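/- All paths are directed Hamiltonian paths of the complete graph $K_n$. An edge-ordered triple $(A,B,C,\preceq)$ consists of three such paths and a linear order $\preceq$ on the edges of $A\cup B\cup C$ for which $A$, $B$ and $C$ are all increasing. Its common edge graph consists of all edges contained in at least two of the paths (and their end-points); each edge is labelled by the set of paths containing it and by the directions in which these traverse it, and the edges are ordered by $\preceq$. Its reduced common edge graph is obtained by collapsing every maximal path, all of whose edges are contained in the same of the three Hamiltonian paths, to a single edge, preserving edge labels and the edge-ordering. Reduced common edge graphs are considered up to isomorphism (preserving labels and edge-ordering). Such a graph is good if each of its components consists of a single edge which is common to precisely two of the three paths. For a reduced common edge graph $\tilde G$ and non-negative integers $\bar c=(c_{AB},c_{AC},c_{BC},c_{ABC})$, let $T_n(\tilde G,\bar c)$ be the number of edge-ordered triples $(A,B,C,\preceq)$ in $K_n$ whose reduced common edge graph is $\tilde G$ and for which $|(A\cap B)\setminus C|=c_{AB}$, $|(A\cap C)\setminus B|=c_{AC}$, $|(B\cap C)\setminus A|=c_{BC}$ and $|A\cap B\cap C|=c_{ABC}$ (sizes of edge sets), and let $$t_n(\tilde G,\bar c)=\frac{T_n(\tilde G,\bar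 c)}{(3n-3-c_{AB}-c_{AC}-c_{BC}-2c_{ABC})!}.$$ Proposition. Let $\tilde G$ be a fixed good reduced common edge graph, and let $c_{AB},c_{AC},c_{BC}$ be fixed non-negative integers. Then $$\lim_{n\to\infty} n^{-3}\,t_n(\tilde G,c_{AB},c_{AC},c_{BC},0)=\frac{e^{-6}}{\left(\sum_\alpha k_\alpha\right)!}\prod_\alpha\left(\binom{c_\alpha-r_\alpha-1}{k_\alpha-r_\alpha-1}2^{-c_\alpha+k_\alpha}\right),$$ where $\alpha$ ranges over $AB$, $AC$, $BC$; $k_\alpha$ is the number of edges of $\tilde G$ whose label states that the edge is common to the two paths in $\alpha$; and $r_\alpha$ is the number of those edges which the two paths in $\alpha$ traverse in opposite directions. Here $\binom{m-1}{l-1}$ stands for the number of ways to place $m$ indistinguishable balls in $l$ bins such that each bin contains at least one ball: it is $1$ if $m=l=0$, and it is $0$ if exactly one of $m,l$ is $0$ or if $m<0$. -/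

import Mathlib

open Filter Topology

/-- The names of the three paths. -/
inductive PathName where
  | A
  | B
  | C
  deriving DecidableEq

/-- A directed Hamiltonian path in the complete graph on `Fin n`, given by its vertex sequence:
`σ i` is the vertex visited at time `i`. -/
abbrev HamPath (n : ℕ) : Type := Equiv.Perm (Fin n)

/-- The path `σ` steps from `u` directly to `v`. -/
def HamPath.Traverses {n : ℕ} (σ : HamPath n) (u v : Fin n) : Prop :=
  (σ.symm u : ℕ) + 1 = (σ.symm v : ℕ)

/-- The (undirected) edges of a directed Hamiltonian path. -/
def HamPath.edges {n : ℕ} (σ : HamPath n) : Set (Sym2 (Fin n)) :=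
  {e | ∃ u v : Fin n, σ.Traverses u v ∧ e = s(u, v)}

/-- An edge-ordered triple `(A, B, C, ⪯)`: three directed Hamiltonian paths of the complete graph
on `Fin n`, with a linear order on the edges of `A ∪ B ∪ C` for which all three paths are
increasing. -/
structure EdgeOrderedTriple (n : ℕ) where
  path : PathName → HamPath n
  order : LinearOrder {e : Sym2 (Fin n) // ∃ p, e ∈ (path p).edges}
  increasing : ∀ (p : PathName) (u v w : Fin n)
    (huv : (path p).Traverses u v) (hvw : (path p).Traverses v w),
    order.lt ⟨s(u, v), p, u, v, huv, rfl⟩ ⟨s(v, w), p, v, w, hvw, rfl⟩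

namespace EdgeOrderedTriple

variable {n : ℕ}

/-- The edge set of one of the three paths. -/
def edges (τ : EdgeOrderedTriple n) (p : PathName) : Set (Sym2 (Fin n)) := (τ.path p).edges

/-- The edge `e` strictly precedes the edge `f` in the edge-ordering. -/
def EdgeLT (τ : EdgeOrderedTriple n) (e f : Sym2 (Fin n)) : Prop :=
  ∃ (he : ∃ p, e ∈ (τ.path p).edges) (hf : ∃ p, f ∈ (τ.path p).edges),
    τ.order.lt ⟨e, he⟩ ⟨f, hf⟩

/-- The edges contained in at least two of the three paths. -/
def commonEdges (τ : EdgeOrderedTriple n) : Set (Sym2 (Fin n)) :=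
  {e | ∃ p q : PathName, p ≠ q ∧ e ∈ τ.edges p ∧ e ∈ τ.edges q}

end EdgeOrderedTriple

/-- The data of a graph whose edges are labelled by the paths containing them and by the directions
in which these traverse them, and whose edges are compared by a relation. `trav p u v` says that
the edge `uv` is contained in the path `p` and that `p` traverses it from `u` to `v`;
`edgeLT` is the (strict) edge-ordering. -/
structure LabelledGraph where
  V : Type
  graph : SimpleGraph V
  trav : PathName → V → V → Prop
  edgeLT : Sym2 V → Sym2 V → Prop

namespace LabelledGraph

/-- The set of paths that contain the edge `e`, according to its label. -/
def label (G : LabelledGraph) (e : Sym2 G.V) : Set PathName :=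
  {p | ∃ u v : G.V, G.trav p u v ∧ e = s(u, v)}

/-- Isomorphism of graphs, preserving edge labels (with directions) and the edge-ordering. -/
def Isomorphic (G H : LabelledGraph) : Prop :=
  ∃ φ : G.graph ≃g H.graph,
    (∀ (p : PathName) (u v : G.V), G.trav p u v ↔ H.trav p (φ u) (φ v)) ∧
    ∀ e ∈ G.graph.edgeSet, ∀ f ∈ G.graph.edgeSet,
      G.edgeLT e f ↔ H.edgeLT (e.map φ) (f.map φ)

/-- A path with at least one edge, all of whose edges are contained in the same of the three
Hamiltonian paths. -/
def IsUnilabelPath (G : LabelledGraph) {u v : G.V} (q : G.graph.Walk u v) : Prop :=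
  q.IsPath ∧ 0 < q.length ∧ ∀ e ∈ q.edges, ∀ f ∈ q.edges, G.label e = G.label f

/-- `v` is an inner vertex of some path whose edges all have the same label. -/
def IsInner (G : LabelledGraph) (v : G.V) : Prop :=
  ∃ u w : G.V, u ≠ w ∧ G.graph.Adj v u ∧ G.graph.Adj v w ∧ G.label s(v, u) = G.label s(v, w)

/-- The graph obtained by collapsing every maximal path whose edges have the same label to a single
edge between its end-points, preserving labels, directions and the edge-ordering. -/
def collapse (G : LabelledGraph) : LabelledGraph where
  V := {v : G.V // ¬ G.IsInner v}
  graph :=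
    SimpleGraph.fromRel fun u v => ∃ q : G.graph.Walk u.1 v.1, G.IsUnilabelPath q
  trav p u v :=
    ∃ q : G.graph.Walk u.1 v.1, G.IsUnilabelPath q ∧ ∀ d ∈ q.darts, G.trav p d.fst d.snd
  edgeLT e f :=
    ∃ (u v u' v' : {v : G.V // ¬ G.IsInner v})
      (q : G.graph.Walk u.1 v.1) (q' : G.graph.Walk u'.1 v'.1),
      e = s(u, v) ∧ f = s(u', v') ∧ G.IsUnilabelPath q ∧ G.IsUnilabelPath q' ∧
      ∀ a ∈ q.edges, ∀ b ∈ q'.edges, G.edgeLT a b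

/-- Every connected component consists of a single edge, common to precisely two paths. -/
def IsGood (G : LabelledGraph) : Prop :=
  ∀ K : G.graph.ConnectedComponent, ∃ u v : G.V,
    G.graph.Adj u v ∧ K.supp = {u, v} ∧ (G.label s(u, v)).ncard = 2

/-- The number of edges labelled as common to the paths `p` and `q`. -/
noncomputable def k (G : LabelledGraph) (p q : PathName) : ℕ :=
  {e | e ∈ G.graph.edgeSet ∧ p ∈ G.label e ∧ q ∈ G.label e}.ncard

/-- The number of edges labelled as common to the paths `p` and `q` and traversed by them in
opposite directions. -/
noncomputable def r (G : LabelledGraph) (p q : PathName) : ℕ :=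
  {e | e ∈ G.graph.edgeSet ∧ ∃ u v : G.V, e = s(u, v) ∧ G.trav p u v ∧ G.trav q v u}.ncard

end LabelledGraph

namespace EdgeOrderedTriple

variable {n : ℕ}

/-- The common edge graph: the edges contained in at least two of the paths and their end-points,
with labels, directions and edge-ordering inherited from the triple. -/
def commonEdgeGraph (τ : EdgeOrderedTriple n) : LabelledGraph where
  V := {v : Fin n // ∃ u : Fin n, s(v, u) ∈ τ.commonEdges}
  graph := SimpleGraph.fromRel fun u v => s(u.1, v.1) ∈ τ.commonEdges
  trav p u v := s(u.1, v.1) ∈ τ.commonEdges ∧ (τ.path p).Traverses u.1 v.1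
  edgeLT e f := τ.EdgeLT (e.map Subtype.val) (f.map Subtype.val)

/-- The reduced common edge graph. -/
def reducedCommonEdgeGraph (τ : EdgeOrderedTriple n) : LabelledGraph :=
  τ.commonEdgeGraph.collapse

end EdgeOrderedTriple

/-- `G` is (up to isomorphism) the reduced common edge graph of some edge-ordered triple. -/
def LabelledGraph.IsReducedCommonEdgeGraph (G : LabelledGraph) : Prop :=
  ∃ (N : ℕ) (τ : EdgeOrderedTriple N), τ.reducedCommonEdgeGraph.Isomorphic G

/-- `T_n(G, c)`: the number of edge-ordered triples on `n` vertices whose reduced common edge graph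
is (isomorphic to) `G` and whose intersections have the prescribed sizes. -/
noncomputable def tripleCount (n : ℕ) (G : LabelledGraph) (cAB cAC cBC cABC : ℕ) : ℕ :=
  Nat.card {τ : EdgeOrderedTriple n //
    τ.reducedCommonEdgeGraph.Isomorphic G ∧
    ((τ.edges .A ∩ τ.edges .B) \ τ.edges .C).ncard = cAB ∧
    ((τ.edges .A ∩ τ.edges .C) \ τ.edges .B).ncard = cAC ∧
    ((τ.edges .B ∩ τ.edges .C) \ τ.edges .A).ncard = cBC ∧
    (τ.edges .A ∩ τ.edges .B ∩ τ.edges .C).ncard = cABC}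

/-- `t_n(G, c) = T_n(G, c) / |A ∪ B ∪ C|!`, where
`|A ∪ B ∪ C| = 3n - 3 - c_AB - c_AC - c_BC - 2 c_ABC` for each triple that is counted. -/
noncomputable def tripleWeight (n : ℕ) (G : LabelledGraph) (cAB cAC cBC cABC : ℕ) : ℝ :=
  (tripleCount n G cAB cAC cBC cABC : ℝ) /
    (Nat.factorial (3 * n - 3 - cAB - cAC - cBC - 2 * cABC) : ℝ)

/-- The binomial coefficient `binom (m - 1) (l - 1)`, read as the number of ways to place `m`
indistinguishable balls in `l` bins with each bin non-empty. In particular it is `1` if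
`m = l = 0` and `0` if exactly one of `m, l` is `0` or if `m` is negative. -/
def ballsInBins (m l : ℤ) : ℕ :=
  if m = 0 ∧ l = 0 then 1
  else if 0 < m ∧ 0 < l then Nat.choose (m - 1).toNat (l - 1).toNat
  else 0

set_option linter.unusedSectionVars false

/-! ### Poisson approximation for random bijections by switchings -/

section RandomBijection

open Finset

variable {P V : Type*} [Fintype P] [Fintype V] [DecidableEq P] [DecidableEq V]

/-- A set of ordered pairs of positions that behaves like "is immediately followed by". -/
structure SuccRel (R : Finset (P × P)) : Prop where
  fst_inj : ∀ e ∈ R, ∀ e' ∈ R, e.1 = e'.1 → e = e'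
  snd_inj : ∀ e ∈ R, ∀ e' ∈ R, e.2 = e'.2 → e = e'
  ne : ∀ e ∈ R, e.1 ≠ e.2
  no_two_cycle : ∀ e ∈ R, ∀ e' ∈ R, e.2 = e'.1 → e.1 ≠ e'.2

/-- The pairs of `R` which `σ` maps to related pairs. -/
def hitSet (R : Finset (P × P)) (H : V → V → Prop) [DecidableRel H] (σ : P ≃ V) :
    Finset (P × P) :=
  R.filter fun e => H (σ e.1) (σ e.2)

/-- The number of hit pairs that involve the position `z`. -/
def hitsAt (R : Finset (P × P)) (H : V → V → Prop) [DecidableRel H] (σ : P ≃ V) (z : P) : ℕ :=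
  ((hitSet R H σ).filter fun e => e.1 = z ∨ e.2 = z).card

variable (R : Finset (P × P)) (H : V → V → Prop) [DecidableRel H]

theorem mem_hitSet (σ : P ≃ V) (e : P × P) :
    e ∈ hitSet R H σ ↔ e ∈ R ∧ H (σ e.1) (σ e.2) := by
  rw [hitSet, mem_filter]

/-- For fixed `j ≠ a`, precomposition with the transposition of `b` and `j` is an involution on the
bijections that keeps the value at `a` and moves the value at `j` to `b`. The term `j = a` vanishes
by irreflexivity. -/
theorem sum_swap_eq (hirr : ∀ v, ¬ H v v) {a b : P} (hab : a ≠ b) (g : (P ≃ V) → P → ℝ) :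
    ∑ σ : P ≃ V, ∑ j, (if H (σ a) (σ j) then g ((Equiv.swap b j).trans σ) j else 0) =
      ∑ σ : P ≃ V, if H (σ a) (σ b) then ∑ j ∈ univ.erase a, g σ j else 0 := by
  rw [Finset.sum_comm]
  have h1 : ∀ σ : P ≃ V, (if H (σ a) (σ b) then ∑ j ∈ univ.erase a, g σ j else 0) =
      ∑ j ∈ univ.erase a, if H (σ a) (σ b) then g σ j else 0 := by
    intro σ; split_ifs <;> simp
  simp_rw [h1]
  rw [Finset.sum_comm (s := univ) (t := univ.erase a), ← Finset.add_sum_erase _ _ (mem_univ a)]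
  simp only [hirr, if_false, Finset.sum_const_zero, zero_add]
  refine Finset.sum_congr rfl fun j hj => ?_
  have hja : j ≠ a := (Finset.mem_erase.1 hj).1
  refine Fintype.sum_equiv (Equiv.mk (fun σ : P ≃ V => (Equiv.swap b j).trans σ)
    (fun σ : P ≃ V => (Equiv.swap b j).trans σ) ?_ ?_) _ _ ?_
  · intro σ; ext x; simp
  · intro σ; ext x; simp
  · intro σ
    simp [Equiv.swap_apply_of_ne_of_ne hab hja.symm]

/-- The switching identity: it trades the event that the pair `(a, b)` is hit for a choice of a
neighbour of `σ a`, at the price of a factor `N - 1`. Every moment estimate below comes from it. -/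
theorem sum_swap_eq_const (hirr : ∀ v, ¬ H v v) {a b : P} (hab : a ≠ b) (g : (P ≃ V) → ℝ) :
    ∑ σ : P ≃ V, ∑ j, (if H (σ a) (σ j) then g ((Equiv.swap b j).trans σ) else 0) =
      ((Fintype.card P : ℝ) - 1) * ∑ σ : P ≃ V, if H (σ a) (σ b) then g σ else 0 := by
  rw [sum_swap_eq H hirr hab fun σ _ => g σ, Finset.mul_sum]
  refine Finset.sum_congr rfl fun σ _ => ?_
  have : 1 ≤ Fintype.card P := Fintype.card_pos_iff.2 ⟨a⟩
  split_ifs <;> simp [Finset.card_erase_of_mem, Nat.cast_sub this]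

variable {R H}

theorem sum_nbr_eq (hsymm : ∀ u v, H u v → H v u) (σ : P ≃ V) (j : P) :
    (univ.filter fun a => H (σ a) (σ j)).card = (univ.filter (H (σ j))).card := by
  refine Finset.card_bij (fun a _ => σ a) ?_ ?_ ?_
  · intro a ha; simpa using hsymm _ _ (by simpa using ha)
  · intro a _ a' _ h; exact σ.injective h
  · intro v hv; exact ⟨σ.symm v, by simpa using hsymm _ _ (by simpa using hv), by simp⟩

theorem sum_nbr_eq' (σ : P ≃ V) (a : P) :
    (univ.filter fun j => H (σ a) (σ j)).card = (univ.filter (H (σ a))).card := by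
  refine Finset.card_bij (fun a _ => σ a) ?_ ?_ ?_
  · intro a ha; simpa using ha
  · intro a _ a' _ h; exact σ.injective h
  · intro v hv; exact ⟨σ.symm v, by simpa using hv, by simp⟩

theorem sum_hitsAt_le (σ : P ≃ V) : ∑ z, hitsAt R H σ z ≤ 2 * (hitSet R H σ).card := by
  simp only [hitsAt, Finset.card_filter]
  rw [Finset.sum_comm, mul_comm, ← smul_eq_mul, ← Finset.sum_const]
  refine Finset.sum_le_sum fun e _ => ?_
  rw [← Finset.card_filter]
  calc (univ.filter fun z => e.1 = z ∨ e.2 = z).card ≤ ({e.1, e.2} : Finset P).card := by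
        refine Finset.card_le_card fun z hz => ?_
        rcases (Finset.mem_filter.1 hz).2 with h | h <;> simp [h]
    _ ≤ 2 := Finset.card_le_two

theorem SuccRel.card_touch (hR : SuccRel R) (z : P) :
    (R.filter fun e => e.1 = z ∨ e.2 = z).card ≤ 2 := by
  rw [Finset.filter_or]
  refine (Finset.card_union_le _ _).trans ?_
  have h1 : (R.filter fun e => e.1 = z).card ≤ 1 := Finset.card_le_one.2 fun x hx y hy => by
    simp only [mem_filter] at hx hy
    exact hR.fst_inj _ hx.1 _ hy.1 (hx.2.trans hy.2.symm)
  have h2 : (R.filter fun e => e.2 = z).card ≤ 1 := Finset.card_le_one.2 fun x hx y hy => by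
    simp only [mem_filter] at hx hy
    exact hR.snd_inj _ hx.1 _ hy.1 (hx.2.trans hy.2.symm)
  omega

theorem hit_swap_iff (σ : P ≃ V) (b j : P) {e : P × P} (hb : ¬ (e.1 = b ∨ e.2 = b))
    (hj : ¬ (e.1 = j ∨ e.2 = j)) :
    e ∈ hitSet R H ((Equiv.swap b j).trans σ) ↔ e ∈ hitSet R H σ := by
  push Not at hb hj
  rw [mem_hitSet, mem_hitSet, Equiv.trans_apply, Equiv.trans_apply,
    Equiv.swap_apply_of_ne_of_ne hb.1 hj.1, Equiv.swap_apply_of_ne_of_ne hb.2 hj.2]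

theorem SuccRel.card_hitSet_swap_le (hR : SuccRel R) (σ : P ≃ V) (b j : P) :
    (hitSet R H ((Equiv.swap b j).trans σ)).card ≤ (hitSet R H σ).card + 4 := by
  have : hitSet R H ((Equiv.swap b j).trans σ) ⊆ hitSet R H σ ∪
      ((R.filter fun e => e.1 = b ∨ e.2 = b) ∪ (R.filter fun e => e.1 = j ∨ e.2 = j)) := by
    intro e he
    by_cases hb : e.1 = b ∨ e.2 = b
    · simp [hb, (Finset.mem_filter.1 he).1]
    by_cases hj : e.1 = j ∨ e.2 = j
    · simp [hj, (Finset.mem_filter.1 he).1]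
    exact Finset.mem_union_left _ ((hit_swap_iff σ b j hb hj).1 he)
  refine (Finset.card_le_card this).trans ((Finset.card_union_le _ _).trans ?_)
  have := Finset.card_union_le (R.filter fun e => e.1 = b ∨ e.2 = b)
    (R.filter fun e => e.1 = j ∨ e.2 = j)
  have h1 := hR.card_touch b
  have h2 := hR.card_touch j
  omega

theorem abs_pow_sub_pow_le_one {t : ℝ} (h0 : 0 ≤ t) (h1 : t ≤ 1) (x y : ℕ) :
    |t ^ x - t ^ y| ≤ 1 := by
  have := pow_nonneg h0 x
  have := pow_nonneg h0 y
  have := pow_le_one₀ h0 h1 (n := x)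
  have := pow_le_one₀ h0 h1 (n := y)
  rw [abs_le]; constructor <;> linarith

/-- The switch makes `e` a hit. Unless some other hit touches one of the two switched positions
before or after, it changes nothing else, so the number of hits grows by exactly one and the
difference vanishes. The right-hand side counts these disturbances; the `- 1` discounts `e` itself.
-/
theorem SuccRel.abs_pow_swap_le (hR : SuccRel R) {t : ℝ} (h0 : 0 ≤ t) (h1 : t ≤ 1) (σ : P ≃ V)
    {e : P × P} (he : e ∈ R) {j : P} (hj : H (σ e.1) (σ j)) (hje : j ≠ e.1) :
    |t ^ ((hitSet R H ((Equiv.swap e.2 j).trans σ)).card - 1) - t ^ (hitSet R H σ).card| ≤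
      (hitsAt R H σ e.2 : ℝ) + hitsAt R H σ j +
        (((hitsAt R H ((Equiv.swap e.2 j).trans σ) e.2 : ℝ) - 1) +
          hitsAt R H ((Equiv.swap e.2 j).trans σ) j) := by
  set σ' := (Equiv.swap e.2 j).trans σ with hσ'
  have he' : e ∈ hitSet R H σ' := by
    simp [hitSet, he, hσ', Equiv.swap_apply_of_ne_of_ne (hR.ne e he) hje.symm, hj]
  have hge : 1 ≤ hitsAt R H σ' e.2 := Finset.card_pos.2 ⟨e, by simp [he']⟩
  have hge' : (1 : ℝ) ≤ hitsAt R H σ' e.2 := by exact_mod_cast hge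
  -- The undisturbed case: `e` is the only hit at the two positions after the switch, and there was
  -- none before.
  by_cases hz : hitsAt R H σ e.2 = 0 ∧ hitsAt R H σ j = 0 ∧ hitsAt R H σ' e.2 = 1 ∧
      hitsAt R H σ' j = 0
  · obtain ⟨z1, z2, z3, z4⟩ := hz
    have key : hitSet R H σ' = insert e (hitSet R H σ) := by
      ext f
      rw [Finset.mem_insert]
      simp only [hitsAt, Finset.card_eq_zero, Finset.filter_eq_empty_iff] at z1 z2 z4
      obtain ⟨f0, hf0⟩ := Finset.card_eq_one.1 z3
      have hef : e = f0 := by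
        have : e ∈ ({f0} : Finset (P × P)) := hf0 ▸ (by simp [he'])
        simpa using this
      constructor
      · intro hf
        by_cases hb : f.1 = e.2 ∨ f.2 = e.2
        · left
          have : f ∈ ({f0} : Finset (P × P)) := hf0 ▸ (by simp [hf, hb])
          rw [hef]; simpa using this
        · right; exact (hit_swap_iff σ e.2 j hb (z4 hf)).1 hf
      · rintro (rfl | hf)
        · exact he'
        · exact (hit_swap_iff σ e.2 j (z1 hf) (z2 hf)).2 hf
    have hne : e ∉ hitSet R H σ := by
      intro hf
      simp only [hitsAt, Finset.card_eq_zero, Finset.filter_eq_empty_iff] at z1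
      exact z1 hf (Or.inr rfl)
    rw [key, Finset.card_insert_of_notMem hne, z1, z2, z3, z4]
    simp
  · refine (abs_pow_sub_pow_le_one h0 h1 _ _).trans ?_
    have : 1 ≤ hitsAt R H σ e.2 + hitsAt R H σ j + ((hitsAt R H σ' e.2 - 1) + hitsAt R H σ' j) := by
      omega
    have h2 : ((hitsAt R H σ' e.2 - 1 : ℕ) : ℝ) = (hitsAt R H σ' e.2 : ℝ) - 1 := by
      push_cast [Nat.cast_sub hge]; ring
    rw [← h2]
    exact_mod_cast this


theorem sum_nbr_le {D : ℕ} (hdeg : ∀ v, (univ.filter (H v)).card ≤ D) (σ : P ≃ V) (a : P) (c : ℝ)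
    (hc : 0 ≤ c) : ∑ j, (if H (σ a) (σ j) then c else 0) ≤ D * c := by
  rw [← Finset.sum_filter, Finset.sum_const, nsmul_eq_mul, sum_nbr_eq']
  gcongr
  exact hdeg _

theorem pair_bound (hirr : ∀ v, ¬ H v v) {D : ℕ} (hdeg : ∀ v, (univ.filter (H v)).card ≤ D)
    {a b : P} (hab : a ≠ b) :
    ((Fintype.card P : ℝ) - 1) * ∑ σ : P ≃ V, (if H (σ a) (σ b) then (1 : ℝ) else 0) ≤
      D * Fintype.card (P ≃ V) := by
  rw [← sum_swap_eq_const H hirr hab fun _ => 1]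
  refine (Finset.sum_le_sum fun σ _ => sum_nbr_le hdeg σ a 1 zero_le_one).trans ?_
  simp [mul_comm]

/-- Given a hit at `(a, b)`, a hit at the following pair `(b, c)` costs another factor `D / (N -
1)`. -/
theorem consecutive_bound (hirr : ∀ v, ¬ H v v) (hsymm : ∀ u v, H u v → H v u) {D : ℕ}
    (hdeg : ∀ v, (univ.filter (H v)).card ≤ D) {a b c : P} (hab : a ≠ b) (hbc : b ≠ c)
    (hac : a ≠ c) :
    ((Fintype.card P : ℝ) - 1) *
        ∑ σ : P ≃ V, (if H (σ b) (σ c) then (if H (σ a) (σ b) then (1 : ℝ) else 0) else 0) ≤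
      D * ∑ σ : P ≃ V, (if H (σ a) (σ b) then (1 : ℝ) else 0) := by
  rw [← sum_swap_eq_const H hirr hbc fun σ => if H (σ a) (σ b) then (1 : ℝ) else 0,
    Finset.mul_sum]
  refine Finset.sum_le_sum fun σ _ => ?_
  refine le_trans (Finset.sum_le_sum fun j _ => ?_) (sum_nbr_le hdeg σ b _ (by split_ifs <;> simp))
  by_cases hj : H (σ b) (σ j)
  · rw [if_pos hj, if_pos hj]
    have hjb : b ≠ j := fun h => hirr _ (h ▸ hj)
    -- Only for `j = a` does the switch affect the pair `(a, b)`; but then `σ a` is adjacent to `σ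
    -- b` by symmetry, so the right-hand side is one anyway.
    by_cases hja : j = a
    · subst hja
      rw [if_pos (hsymm _ _ hj)]
      split_ifs <;> norm_num
    · simp [Equiv.swap_apply_of_ne_of_ne hac (Ne.symm hja),
        Equiv.swap_apply_of_ne_of_ne hbc hjb]
  · simp [hj]

theorem card_hitSet_eq (σ : P ≃ V) :
    ((hitSet R H σ).card : ℝ) = ∑ e ∈ R, if H (σ e.1) (σ e.2) then (1 : ℝ) else 0 := by
  rw [hitSet, Finset.card_filter]; push_cast; rfl

theorem SuccRel.card_le (hR : SuccRel R) : R.card ≤ Fintype.card P := by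
  rw [← Finset.card_univ]
  exact Finset.card_le_card_of_injOn Prod.fst (by simp) fun e he e' he' h =>
    hR.fst_inj e he e' he' h

/-- The first components are distinct, so there are at most `N ≤ 2 (N - 1)` pairs. This absorbs the
factor `N - 1` of the switching identity and is the source of the factors 2 in the moment bounds. -/
theorem SuccRel.card_div_le (hR : SuccRel R) (hN : 2 ≤ Fintype.card P) :
    (R.card : ℝ) ≤ 2 * ((Fintype.card P : ℝ) - 1) := by
  have h1 : (R.card : ℝ) ≤ Fintype.card P := by exact_mod_cast hR.card_le
  have h2 : (2 : ℝ) ≤ Fintype.card P := by exact_mod_cast hN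
  linarith

theorem SuccRel.sum_card_le (hR : SuccRel R) (hirr : ∀ v, ¬ H v v) {D : ℕ}
    (hdeg : ∀ v, (univ.filter (H v)).card ≤ D) (hN : 2 ≤ Fintype.card P) :
    ∑ σ : P ≃ V, ((hitSet R H σ).card : ℝ) ≤ 2 * D * Fintype.card (P ≃ V) := by
  have h2 : (2 : ℝ) ≤ Fintype.card P := by exact_mod_cast hN
  have hpos : 0 < (Fintype.card P : ℝ) - 1 := by linarith
  refine le_of_mul_le_mul_left ?_ hpos
  simp_rw [card_hitSet_eq]
  rw [Finset.sum_comm, Finset.mul_sum]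
  refine (Finset.sum_le_sum fun e he => pair_bound hirr hdeg (hR.ne e he)).trans ?_
  rw [Finset.sum_const, nsmul_eq_mul]
  have := hR.card_div_le hN
  have h3 : 0 ≤ (D : ℝ) * Fintype.card (P ≃ V) := by positivity
  nlinarith

theorem SuccRel.sum_card_sq_le (hR : SuccRel R) (hirr : ∀ v, ¬ H v v) {D : ℕ}
    (hdeg : ∀ v, (univ.filter (H v)).card ≤ D) (hN : 2 ≤ Fintype.card P) :
    ∑ σ : P ≃ V, ((hitSet R H σ).card : ℝ) * (hitSet R H σ).card ≤
      2 * D * (2 * D + 4) * Fintype.card (P ≃ V) := by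
  have h2 : (2 : ℝ) ≤ Fintype.card P := by exact_mod_cast hN
  have hpos : 0 < (Fintype.card P : ℝ) - 1 := by linarith
  refine le_of_mul_le_mul_left ?_ hpos
  have h1 : ∀ σ : P ≃ V, ((hitSet R H σ).card : ℝ) * (hitSet R H σ).card =
      ∑ e ∈ R, if H (σ e.1) (σ e.2) then ((hitSet R H σ).card : ℝ) else 0 := by
    intro σ
    nth_rw 1 [card_hitSet_eq]
    rw [Finset.sum_mul]
    refine Finset.sum_congr rfl fun e _ => ?_
    split_ifs <;> simp
  simp_rw [h1]
  rw [Finset.sum_comm, Finset.mul_sum]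
  have h3 : ∀ e ∈ R, ((Fintype.card P : ℝ) - 1) *
      ∑ σ : P ≃ V, (if H (σ e.1) (σ e.2) then ((hitSet R H σ).card : ℝ) else 0) ≤
      D * ((2 * D + 4) * Fintype.card (P ≃ V)) := by
    intro e he
    rw [← sum_swap_eq_const H hirr (hR.ne e he) fun σ => ((hitSet R H σ).card : ℝ)]
    -- Each of the two switched positions lies in at most two pairs, so a switch creates at most
    -- four new hits.
    calc _ ≤ ∑ σ : P ≃ V, D * (((hitSet R H σ).card : ℝ) + 4) := by
          refine Finset.sum_le_sum fun σ _ => ?_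
          refine le_trans (Finset.sum_le_sum fun j _ => ?_)
            (sum_nbr_le hdeg σ e.1 _ (by positivity))
          split_ifs
          · exact_mod_cast hR.card_hitSet_swap_le σ e.2 j
          · exact le_rfl
      _ ≤ _ := by
          rw [← Finset.mul_sum, Finset.sum_add_distrib]
          have := hR.sum_card_le hirr hdeg hN
          gcongr
          simp only [sum_const, card_univ, nsmul_eq_mul]
          linarith
  refine (Finset.sum_le_sum h3).trans ?_
  rw [Finset.sum_const, nsmul_eq_mul]
  have := hR.card_div_le hN
  have h3 : 0 ≤ (D : ℝ) * ((2 * D + 4) * Fintype.card (P ≃ V)) := by positivity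
  nlinarith

/-- At most one pair ends at `e.2`; all other hits there begin at `e.2`. -/
theorem SuccRel.hitsAt_sub_one_le (hR : SuccRel R) (σ : P ≃ V) (e : P × P) :
    (hitsAt R H σ e.2 : ℝ) - 1 ≤
      ∑ f ∈ R, if f.1 = e.2 then (if H (σ f.1) (σ f.2) then (1 : ℝ) else 0) else 0 := by
  have : hitsAt R H σ e.2 ≤ 1 + ((hitSet R H σ).filter fun f => f.1 = e.2).card := by
    rw [hitsAt, Finset.filter_or, Finset.union_comm]
    refine (Finset.card_union_le _ _).trans (Nat.add_le_add_right ?_ _)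
    refine Finset.card_le_one.2 fun x hx y hy => ?_
    simp only [mem_filter, hitSet] at hx hy
    exact hR.snd_inj _ hx.1.1 _ hy.1.1 (hx.2.trans hy.2.symm)
  have h2 : (((hitSet R H σ).filter fun f => f.1 = e.2).card : ℝ) =
      ∑ f ∈ R, if f.1 = e.2 then (if H (σ f.1) (σ f.2) then (1 : ℝ) else 0) else 0 := by
    rw [hitSet, Finset.filter_filter, Finset.card_filter]
    push_cast
    refine Finset.sum_congr rfl fun f _ => ?_
    by_cases h : f.1 = e.2 <;> simp [h]
  rw [← h2]
  have : (hitsAt R H σ e.2 : ℝ) ≤ 1 + ((hitSet R H σ).filter fun f => f.1 = e.2).card := by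
    exact_mod_cast this
  linarith

/-- At most one pair of `R` begins where `e` ends. So this counts bijections that hit two
consecutive pairs, and each of these hits contributes a factor `D / (N - 1)`. -/
theorem SuccRel.sum_consecutive_le (hR : SuccRel R) (hirr : ∀ v, ¬ H v v)
    (hsymm : ∀ u v, H u v → H v u) {D : ℕ}
    (hdeg : ∀ v, (univ.filter (H v)).card ≤ D) (hN : 2 ≤ Fintype.card P) {e : P × P}
    (he : e ∈ R) :
    ((Fintype.card P : ℝ) - 1) * (((Fintype.card P : ℝ) - 1) * ∑ σ : P ≃ V,
        (if H (σ e.1) (σ e.2) then ((hitsAt R H σ e.2 : ℝ) - 1) else 0)) ≤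
      D * (D * Fintype.card (P ≃ V)) := by
  have h2 : (2 : ℝ) ≤ Fintype.card P := by exact_mod_cast hN
  have hpos : 0 < (Fintype.card P : ℝ) - 1 := by linarith
  have hstep : ∑ σ : P ≃ V, (if H (σ e.1) (σ e.2) then ((hitsAt R H σ e.2 : ℝ) - 1) else 0) ≤
      ∑ f ∈ R, if f.1 = e.2 then ∑ σ : P ≃ V, (if H (σ f.1) (σ f.2) then
        (if H (σ e.1) (σ f.1) then (1 : ℝ) else 0) else 0) else 0 := by
    calc _ ≤ ∑ σ : P ≃ V, ∑ f ∈ R, if f.1 = e.2 then (if H (σ f.1) (σ f.2) then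
        (if H (σ e.1) (σ f.1) then (1 : ℝ) else 0) else 0) else 0 := by
          refine Finset.sum_le_sum fun σ _ => ?_
          split_ifs with h
          · refine (hR.hitsAt_sub_one_le σ e).trans (Finset.sum_le_sum fun f _ => ?_)
            by_cases hf : f.1 = e.2
            · simp [hf, h]
            · simp [hf]
          · exact Finset.sum_nonneg fun f _ => by split_ifs <;> norm_num
      _ = _ := by
          rw [Finset.sum_comm]
          refine Finset.sum_congr rfl fun f _ => ?_
          split_ifs <;> simp
  have hone : ∑ f ∈ R, (if f.1 = e.2 then ∑ σ : P ≃ V, (if H (σ f.1) (σ f.2) then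
        (if H (σ e.1) (σ f.1) then (1 : ℝ) else 0) else 0) else 0) *
          ((Fintype.card P : ℝ) - 1) ≤
      D * ∑ σ : P ≃ V, (if H (σ e.1) (σ e.2) then (1 : ℝ) else 0) := by
    by_cases hf : ∃ f ∈ R, f.1 = e.2
    · obtain ⟨f, hf, hfe⟩ := hf
      rw [Finset.sum_eq_single f]
      · rw [if_pos hfe, mul_comm]
        have := consecutive_bound hirr hsymm hdeg (a := e.1) (b := f.1) (c := f.2)
          (by rw [hfe]; exact hR.ne e he) (hR.ne f hf) (hR.no_two_cycle e he f hf hfe.symm)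
        rwa [← hfe]
      · intro g hg hgf
        rw [if_neg, zero_mul]
        intro h
        exact hgf (hR.fst_inj g hg f hf (h.trans hfe.symm))
      · intro h; exact absurd hf h
    · push Not at hf
      rw [Finset.sum_eq_zero fun f hfR => by rw [if_neg (hf f hfR), zero_mul]]
      positivity
  rw [← Finset.sum_mul] at hone
  have h4 := pair_bound hirr hdeg (hR.ne e he)
  calc _ ≤ ((Fintype.card P : ℝ) - 1) *
        (D * ∑ σ : P ≃ V, (if H (σ e.1) (σ e.2) then (1 : ℝ) else 0)) := by
        refine mul_le_mul_of_nonneg_left (le_trans ?_ hone) hpos.le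
        rw [mul_comm]
        exact mul_le_mul_of_nonneg_right hstep hpos.le
    _ = D * (((Fintype.card P : ℝ) - 1) *
        ∑ σ : P ≃ V, (if H (σ e.1) (σ e.2) then (1 : ℝ) else 0)) := by ring
    _ ≤ _ := by gcongr

theorem SuccRel.sum_hitsAt_snd_le (hR : SuccRel R) (σ : P ≃ V) :
    ∑ e ∈ R, (hitsAt R H σ e.2 : ℝ) ≤ 2 * (hitSet R H σ).card := by
  have h1 : ∑ e ∈ R, (hitsAt R H σ e.2 : ℝ) = ∑ z ∈ R.image Prod.snd, (hitsAt R H σ z : ℝ) := by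
    rw [Finset.sum_image fun e he e' he' h => hR.snd_inj e he e' he' h]
  rw [h1]
  calc _ ≤ ∑ z, (hitsAt R H σ z : ℝ) :=
        Finset.sum_le_sum_of_subset_of_nonneg (Finset.subset_univ _) fun _ _ _ => by positivity
    _ ≤ _ := by exact_mod_cast sum_hitsAt_le σ

/-- The average change of `t ^ (number of hits)` under the transposition that creates a hit. -/
theorem SuccRel.sum_abs_pow_swap_le (hR : SuccRel R) (hirr : ∀ v, ¬ H v v)
    (hsymm : ∀ u v, H u v → H v u) {D : ℕ} (hdeg : ∀ v, (univ.filter (H v)).card ≤ D)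
    (hN : 2 ≤ Fintype.card P) {t : ℝ} (h0 : 0 ≤ t) (h1 : t ≤ 1) :
    ∑ e ∈ R, ∑ σ : P ≃ V, ∑ j, (if H (σ e.1) (σ j) then
      |t ^ ((hitSet R H ((Equiv.swap e.2 j).trans σ)).card - 1) - t ^ (hitSet R H σ).card| else 0) ≤
      (18 * D ^ 2 + 16 * D : ℝ) * Fintype.card (P ≃ V) := by
  have h2 : (2 : ℝ) ≤ Fintype.card P := by exact_mod_cast hN
  have hpos : 0 < (Fintype.card P : ℝ) - 1 := by linarith
  have hS := hR.sum_card_le hirr hdeg hN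
  have hQ := hR.sum_card_sq_le hirr hdeg hN
  calc _ ≤ ∑ e ∈ R, ∑ σ : P ≃ V, ∑ j, ((if H (σ e.1) (σ j) then (hitsAt R H σ e.2 : ℝ) else 0) +
        (if H (σ e.1) (σ j) then (hitsAt R H σ j : ℝ) else 0) +
        (if H (σ e.1) (σ j) then (fun (σ' : P ≃ V) (j : P) => ((hitsAt R H σ' e.2 : ℝ) - 1) +
          hitsAt R H σ' j) ((Equiv.swap e.2 j).trans σ) j else 0)) := by
        refine Finset.sum_le_sum fun e he => Finset.sum_le_sum fun σ _ =>
          Finset.sum_le_sum fun j _ => ?_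
        by_cases hj : H (σ e.1) (σ j)
        · simp only [hj, if_true]
          exact hR.abs_pow_swap_le h0 h1 σ he hj fun h => hirr _ (h ▸ hj)
        · simp [hj]
    _ = (∑ σ : P ≃ V, ∑ e ∈ R, ∑ j, (if H (σ e.1) (σ j) then (hitsAt R H σ e.2 : ℝ) else 0)) +
        (∑ σ : P ≃ V, ∑ j, ∑ e ∈ R, (if H (σ e.1) (σ j) then (hitsAt R H σ j : ℝ) else 0)) +
        ∑ e ∈ R, ∑ σ : P ≃ V, (if H (σ e.1) (σ e.2) then ∑ j ∈ univ.erase e.1,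
          (((hitsAt R H σ e.2 : ℝ) - 1) + hitsAt R H σ j) else 0) := by
        simp_rw [Finset.sum_add_distrib]
        congr 1
        · congr 1
          · rw [Finset.sum_comm]
          · rw [Finset.sum_comm]
            exact Finset.sum_congr rfl fun σ _ => Finset.sum_comm
        · refine Finset.sum_congr rfl fun e he => ?_
          rw [sum_swap_eq H hirr (hR.ne e he) fun (σ' : P ≃ V) (j : P) =>
            ((hitsAt R H σ' e.2 : ℝ) - 1) + hitsAt R H σ' j]
          simp_rw [Finset.sum_add_distrib]
    -- The first two terms bound the hits disturbed before the switch. For those after it, the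
    -- switching identity returns to bijections hitting `e`: the excess at `e.2` is a pair of
    -- consecutive hits, and the hits at `j`, summed over `j`, yield the second moment of the number
    -- of hits.
    _ ≤ (∑ σ : P ≃ V, D * (2 * ((hitSet R H σ).card : ℝ))) +
        (∑ σ : P ≃ V, D * (2 * ((hitSet R H σ).card : ℝ))) +
        (2 * D ^ 2 * Fintype.card (P ≃ V) +
          ∑ σ : P ≃ V, 2 * (((hitSet R H σ).card : ℝ) * (hitSet R H σ).card)) := by
        refine add_le_add (add_le_add ?_ ?_) ?_
        · refine Finset.sum_le_sum fun σ _ => ?_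
          refine (Finset.sum_le_sum fun e _ => sum_nbr_le hdeg σ e.1 _ (by positivity)).trans ?_
          rw [← Finset.mul_sum]
          gcongr
          exact hR.sum_hitsAt_snd_le σ
        · refine Finset.sum_le_sum fun σ _ => ?_
          calc _ ≤ ∑ j, D * (hitsAt R H σ j : ℝ) := by
                refine Finset.sum_le_sum fun j _ => ?_
                rw [← Finset.sum_filter, Finset.sum_const, nsmul_eq_mul]
                gcongr
                refine le_trans ?_ (hdeg (σ j))
                rw [← sum_nbr_eq hsymm σ j]
                refine Finset.card_le_card_of_injOn Prod.fst ?_ ?_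
                · intro e he; simp at he ⊢; exact he.2
                · intro e he e' he' h
                  simp at he he'
                  exact hR.fst_inj e he.1 e' he'.1 h
            _ ≤ _ := by
                rw [← Finset.mul_sum]
                gcongr
                exact_mod_cast sum_hitsAt_le σ
        · have hsplit : ∀ e ∈ R, ∑ σ : P ≃ V, (if H (σ e.1) (σ e.2) then ∑ j ∈ univ.erase e.1,
              (((hitsAt R H σ e.2 : ℝ) - 1) + hitsAt R H σ j) else 0) ≤
              ((Fintype.card P : ℝ) - 1) * ∑ σ : P ≃ V,
                (if H (σ e.1) (σ e.2) then ((hitsAt R H σ e.2 : ℝ) - 1) else 0) +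
              ∑ σ : P ≃ V, (if H (σ e.1) (σ e.2) then 2 * ((hitSet R H σ).card : ℝ) else 0) := by
            intro e he
            rw [Finset.mul_sum, ← Finset.sum_add_distrib]
            refine Finset.sum_le_sum fun σ _ => ?_
            split_ifs
            · rw [Finset.sum_add_distrib]
              gcongr
              · have : 1 ≤ Fintype.card P := by omega
                rw [Finset.sum_const, Finset.card_erase_of_mem (Finset.mem_univ _),
                  Finset.card_univ, nsmul_eq_mul, Nat.cast_sub this, Nat.cast_one]
              · calc _ ≤ ∑ z, (hitsAt R H σ z : ℝ) :=
                      Finset.sum_le_sum_of_subset_of_nonneg (Finset.subset_univ _)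
                        fun _ _ _ => by positivity
                  _ ≤ _ := by exact_mod_cast sum_hitsAt_le σ
            · simp
          refine (Finset.sum_le_sum hsplit).trans ?_
          rw [Finset.sum_add_distrib]
          refine add_le_add ?_ (le_of_eq ?_)
          · refine le_of_mul_le_mul_left ?_ hpos
            rw [Finset.mul_sum]
            refine (Finset.sum_le_sum fun e he =>
              hR.sum_consecutive_le hirr hsymm hdeg hN he).trans ?_
            rw [Finset.sum_const, nsmul_eq_mul]
            have := hR.card_div_le hN
            have h3 : 0 ≤ (D : ℝ) * (D * Fintype.card (P ≃ V)) := by positivity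
            nlinarith
          · rw [Finset.sum_comm]
            refine Finset.sum_congr rfl fun σ _ => ?_
            rw [← Finset.sum_filter, Finset.sum_const, nsmul_eq_mul]
            simp only [hitSet]
            ring
    _ ≤ _ := by
        rw [← Finset.mul_sum, ← Finset.mul_sum, ← Finset.mul_sum]
        have hD : (0 : ℝ) ≤ D := by positivity
        nlinarith

/-- Multiply by the integrating factor `exp (-λt)`: the derivative of the product is at most `ε` in
absolute value, so its values at 0 and 1 differ by at most `ε`. -/
theorem abs_sub_exp_le_of_deriv {φ φ' : ℝ → ℝ} {lam ε : ℝ} (hlam : 0 ≤ lam)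
    (hφ : ∀ t, HasDerivAt φ (φ' t) t) (h1 : φ 1 = 1)
    (hε : ∀ t, 0 ≤ t → t ≤ 1 → |φ' t - lam * φ t| ≤ ε) :
    |φ 0 - Real.exp (-lam)| ≤ ε := by
  have hd : ∀ t, HasDerivAt (fun t => Real.exp (-(lam * t)) * φ t)
      (Real.exp (-(lam * t)) * (φ' t - lam * φ t)) t := by
    intro t
    have h2 : HasDerivAt (fun t => Real.exp (-(lam * t))) (Real.exp (-(lam * t)) * (-lam)) t := by
      refine HasDerivAt.exp ?_
      simpa only [neg_mul, id, mul_one] using (hasDerivAt_id t).const_mul (-lam)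
    refine (h2.mul (hφ t)).congr_deriv ?_
    ring
  have := norm_image_sub_le_of_norm_deriv_le_segment_01' (f := fun t => Real.exp (-(lam * t)) * φ t)
    (C := ε) (fun t _ => (hd t).hasDerivWithinAt) (by
      intro t ht
      rw [Real.norm_eq_abs, abs_mul, abs_of_pos (Real.exp_pos _)]
      have h3 : Real.exp (-(lam * t)) ≤ 1 := by
        rw [Real.exp_le_one_iff]
        have := mul_nonneg hlam ht.1
        linarith
      calc _ ≤ 1 * |φ' t - lam * φ t| := by gcongr
        _ ≤ ε := by rw [one_mul]; exact hε t ht.1 ht.2.le)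
  rw [Real.norm_eq_abs, abs_sub_comm] at this
  simpa [h1] using this

/-- The Poisson approximation for the number of hits of a random bijection. -/
theorem SuccRel.abs_card_no_hit_sub_le (hR : SuccRel R) (hcard : Fintype.card P = Fintype.card V)
    (hirr : ∀ v, ¬ H v v)
    (hsymm : ∀ u v, H u v → H v u) {D : ℕ} (hdeg : ∀ v, (univ.filter (H v)).card ≤ D)
    (hN : 2 ≤ Fintype.card P) {q : ℕ} (hq : Fintype.card P ≤ R.card + q) :
    |((univ.filter fun σ : P ≃ V => hitSet R H σ = ∅).card : ℝ) / Fintype.card (P ≃ V) -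
      Real.exp (-((∑ v, ((univ.filter (H v)).card : ℝ)) / ((Fintype.card P : ℝ) - 1)))| ≤
      (18 * D ^ 2 + 16 * D + D * q : ℝ) / ((Fintype.card P : ℝ) - 1) := by
  have h2 : (2 : ℝ) ≤ Fintype.card P := by exact_mod_cast hN
  have hpos : 0 < (Fintype.card P : ℝ) - 1 := by linarith
  have hF : 0 < (Fintype.card (P ≃ V) : ℝ) := by
    exact_mod_cast Fintype.card_pos_iff.2 ⟨Fintype.equivOfCardEq hcard⟩
  set Δ : ℝ := ∑ v, ((univ.filter (H v)).card : ℝ) with hΔ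
  set F : ℝ := (Fintype.card (P ≃ V) : ℝ) with hFdef
  -- The probability generating function of the number of hits. Its value at 0 is the proportion of
  -- bijections without hits.
  have hd : ∀ t : ℝ, HasDerivAt (fun t : ℝ => (∑ σ : P ≃ V, t ^ (hitSet R H σ).card) / F)
      ((∑ σ : P ≃ V, ((hitSet R H σ).card : ℝ) * t ^ ((hitSet R H σ).card - 1)) / F) t := by
    intro t
    refine HasDerivAt.div_const ?_ _
    exact HasDerivAt.fun_sum fun σ _ => hasDerivAt_pow _ _
  have hone : (fun t : ℝ => (∑ σ : P ≃ V, t ^ (hitSet R H σ).card) / F) 1 = 1 := by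
    show (∑ σ : P ≃ V, (1 : ℝ) ^ (hitSet R H σ).card) / F = 1
    rw [Finset.sum_congr rfl fun σ _ => one_pow _, Finset.sum_const, Finset.card_univ,
      nsmul_eq_mul, mul_one]
    exact div_self hF.ne'
  have main := abs_sub_exp_le_of_deriv
    (lam := Δ / ((Fintype.card P : ℝ) - 1))
    (ε := (18 * D ^ 2 + 16 * D + D * q : ℝ) / ((Fintype.card P : ℝ) - 1))
    (div_nonneg (Finset.sum_nonneg fun _ _ => Nat.cast_nonneg _) hpos.le) hd hone ?_
  · refine le_trans (le_of_eq ?_) main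
    congr 3
    rw [Finset.card_filter, Nat.cast_sum]
    refine Finset.sum_congr rfl fun σ _ => ?_
    by_cases h : hitSet R H σ = ∅
    · rw [if_pos h, h, Finset.card_empty, pow_zero, Nat.cast_one]
    · rw [if_neg h, zero_pow (fun h' => h (Finset.card_eq_zero.1 h')), Nat.cast_zero]
  · intro t h0 h1
    have hX : ∀ σ : P ≃ V, ((hitSet R H σ).card : ℝ) * t ^ ((hitSet R H σ).card - 1) =
        ∑ e ∈ R, if H (σ e.1) (σ e.2) then t ^ ((hitSet R H σ).card - 1) else 0 := by
      intro σ
      nth_rw 1 [card_hitSet_eq]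
      rw [Finset.sum_mul]
      refine Finset.sum_congr rfl fun e _ => ?_
      split_ifs <;> simp
    -- The derivative after switching; `hB` is the same sum with the number of hits before the
    -- switch in the exponent, where the sum over `j` becomes a degree.
    have hA : ((Fintype.card P : ℝ) - 1) *
        ∑ σ : P ≃ V, ((hitSet R H σ).card : ℝ) * t ^ ((hitSet R H σ).card - 1) =
        ∑ e ∈ R, ∑ σ : P ≃ V, ∑ j, (if H (σ e.1) (σ j) then
          t ^ ((hitSet R H ((Equiv.swap e.2 j).trans σ)).card - 1) else 0) := by
      simp_rw [hX]
      rw [Finset.sum_comm, Finset.mul_sum]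
      refine Finset.sum_congr rfl fun e he => ?_
      rw [← sum_swap_eq_const H hirr (hR.ne e he) fun σ => t ^ ((hitSet R H σ).card - 1)]
    have hB : ∑ e ∈ R, ∑ σ : P ≃ V, ∑ j, (if H (σ e.1) (σ j) then
          t ^ (hitSet R H σ).card else 0) =
        ∑ σ : P ≃ V, t ^ (hitSet R H σ).card * ∑ e ∈ R, ((univ.filter (H (σ e.1))).card : ℝ) := by
      rw [Finset.sum_comm]
      refine Finset.sum_congr rfl fun σ _ => ?_
      rw [Finset.mul_sum]
      refine Finset.sum_congr rfl fun e _ => ?_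
      rw [← Finset.sum_filter, Finset.sum_const, nsmul_eq_mul, sum_nbr_eq', mul_comm]
    -- All but at most `q` positions begin a pair of `R`, so the degrees at these positions add up
    -- to nearly the full degree sum.
    have hC : ∀ σ : P ≃ V, |(∑ e ∈ R, ((univ.filter (H (σ e.1))).card : ℝ)) - Δ| ≤ D * q := by
      intro σ
      have e1 : Δ = ∑ a : P, ((univ.filter (H (σ a))).card : ℝ) := by
        rw [hΔ]; exact (Equiv.sum_comp σ fun v => ((univ.filter (H v)).card : ℝ)).symm
      have e2 : ∑ e ∈ R, ((univ.filter (H (σ e.1))).card : ℝ) =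
          ∑ a ∈ R.image Prod.fst, ((univ.filter (H (σ a))).card : ℝ) := by
        rw [Finset.sum_image fun e he e' he' h => hR.fst_inj e he e' he' h]
      rw [e1, e2, ← Finset.sum_add_sum_compl (R.image Prod.fst), sub_add_cancel_left, abs_neg,
        abs_of_nonneg (Finset.sum_nonneg fun _ _ => by positivity)]
      calc _ ≤ ∑ a ∈ (R.image Prod.fst)ᶜ, (D : ℝ) :=
            Finset.sum_le_sum fun a _ => by exact_mod_cast hdeg _
        _ = D * ((R.image Prod.fst)ᶜ.card : ℝ) := by
            rw [Finset.sum_const, nsmul_eq_mul, mul_comm]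
        _ ≤ _ := by
            gcongr
            rw [Finset.card_compl, Finset.card_image_of_injOn
              fun e he e' he' h => hR.fst_inj e he e' he' h]
            omega
    have hD : ((Fintype.card P : ℝ) - 1) *
          (∑ σ : P ≃ V, ((hitSet R H σ).card : ℝ) * t ^ ((hitSet R H σ).card - 1)) -
          Δ * ∑ σ : P ≃ V, t ^ (hitSet R H σ).card =
        (∑ e ∈ R, ∑ σ : P ≃ V, ∑ j, (if H (σ e.1) (σ j) then
          (t ^ ((hitSet R H ((Equiv.swap e.2 j).trans σ)).card - 1) -
            t ^ (hitSet R H σ).card) else 0)) +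
        ∑ σ : P ≃ V, t ^ (hitSet R H σ).card *
          ((∑ e ∈ R, ((univ.filter (H (σ e.1))).card : ℝ)) - Δ) := by
      have : ∀ e ∈ R, ∀ σ : P ≃ V, ∀ j, (if H (σ e.1) (σ j) then
          (t ^ ((hitSet R H ((Equiv.swap e.2 j).trans σ)).card - 1) -
            t ^ (hitSet R H σ).card) else 0) = (if H (σ e.1) (σ j) then
          t ^ ((hitSet R H ((Equiv.swap e.2 j).trans σ)).card - 1) else 0) -
          (if H (σ e.1) (σ j) then t ^ (hitSet R H σ).card else 0) := by
        intro e _ σ j; split_ifs <;> simp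
      rw [Finset.sum_congr rfl fun e he => Finset.sum_congr rfl fun σ _ =>
        Finset.sum_congr rfl fun j _ => this e he σ j]
      simp_rw [Finset.sum_sub_distrib]
      rw [← hA, hB]
      simp_rw [mul_sub, Finset.sum_sub_distrib]
      rw [← Finset.sum_mul]
      ring
    have hE : |((Fintype.card P : ℝ) - 1) *
          (∑ σ : P ≃ V, ((hitSet R H σ).card : ℝ) * t ^ ((hitSet R H σ).card - 1)) -
          Δ * ∑ σ : P ≃ V, t ^ (hitSet R H σ).card| ≤ (18 * D ^ 2 + 16 * D + D * q : ℝ) * F := by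
      rw [hD]
      refine (abs_add_le _ _).trans ?_
      rw [add_mul _ _ F]
      refine add_le_add ?_ ?_
      · refine le_trans ?_ (hR.sum_abs_pow_swap_le hirr hsymm hdeg hN h0 h1)
        refine (Finset.abs_sum_le_sum_abs _ _).trans (Finset.sum_le_sum fun e _ => ?_)
        refine (Finset.abs_sum_le_sum_abs _ _).trans (Finset.sum_le_sum fun σ _ => ?_)
        refine (Finset.abs_sum_le_sum_abs _ _).trans (Finset.sum_le_sum fun j _ => ?_)
        split_ifs <;> simp
      · refine (Finset.abs_sum_le_sum_abs _ _).trans ?_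
        calc _ ≤ ∑ σ : P ≃ V, (D * q : ℝ) := by
              refine Finset.sum_le_sum fun σ _ => ?_
              rw [abs_mul, abs_of_nonneg (pow_nonneg h0 _)]
              calc _ ≤ 1 * (D * q : ℝ) := by
                    gcongr
                    · exact pow_le_one₀ h0 h1
                    · exact hC σ
                _ = _ := one_mul _
          _ = _ := by rw [Finset.sum_const, nsmul_eq_mul, Finset.card_univ, mul_comm]
    set S1 := ∑ σ : P ≃ V, ((hitSet R H σ).card : ℝ) * t ^ ((hitSet R H σ).card - 1)
    set S0 := ∑ σ : P ≃ V, t ^ (hitSet R H σ).card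
    have hG : S1 / F - Δ / ((Fintype.card P : ℝ) - 1) * (S0 / F) =
        (((Fintype.card P : ℝ) - 1) * S1 - Δ * S0) / (((Fintype.card P : ℝ) - 1) * F) := by
      field_simp
    show |S1 / F - Δ / ((Fintype.card P : ℝ) - 1) * (S0 / F)| ≤ _
    rw [hG, abs_div, abs_of_pos (mul_pos hpos hF), div_le_div_iff₀ (mul_pos hpos hF) hpos]
    calc _ ≤ ((18 * D ^ 2 + 16 * D + D * q : ℝ) * F) * ((Fintype.card P : ℝ) - 1) := by gcongr
      _ = _ := by ring

end RandomBijection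

/-! ### Permutations with prescribed values that avoid a graph -/

section PartialPerm

open Finset

/-- The permutations with prescribed values on `I`. -/
def extensions {n : ℕ} (I : Finset (Fin n)) (π : Fin n → Fin n) : Finset (Equiv.Perm (Fin n)) :=
  univ.filter fun σ => ∀ i ∈ I, σ i = π i

theorem mem_extensions {n : ℕ} {I : Finset (Fin n)} {π : Fin n → Fin n} {σ : Equiv.Perm (Fin n)} :
    σ ∈ extensions I π ↔ ∀ i ∈ I, σ i = π i := by
  simp [extensions]

open scoped Classical in
/-- Permutations extending a partial injection correspond to bijections of the complements. -/
noncomputable def extensionsEquiv {n : ℕ} (I : Finset (Fin n)) (π : Fin n → Fin n)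
    (hπ : Set.InjOn π I) :
    {σ : Equiv.Perm (Fin n) // σ ∈ extensions I π} ≃
      (((I : Set (Fin n))ᶜ : Set (Fin n)) ≃ ((π '' (I : Set (Fin n)))ᶜ : Set (Fin n))) :=
  (Equiv.subtypeEquivRight fun σ => by
    rw [mem_extensions]
    exact ⟨fun h x => h x.1 x.2, fun h i hi => h ⟨i, hi⟩⟩).trans
    (Equiv.Set.compl (Equiv.Set.imageOfInjOn π (I : Set (Fin n)) hπ))

theorem extensionsEquiv_apply {n : ℕ} (I : Finset (Fin n)) (π : Fin n → Fin n)
    (hπ : Set.InjOn π I) (σ : {σ : Equiv.Perm (Fin n) // σ ∈ extensions I π})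
    (a : ((I : Set (Fin n))ᶜ : Set (Fin n))) :
    ((extensionsEquiv I π hπ σ a : Fin n)) = σ.1 a := by
  rfl

theorem card_extensions {n : ℕ} (I : Finset (Fin n)) (π : Fin n → Fin n)
    (hπ : Set.InjOn π I) : (extensions I π).card = (n - I.card).factorial := by
  classical
  have h1 := Fintype.card_congr (extensionsEquiv I π hπ)
  rw [Fintype.card_coe] at h1
  rw [h1]
  have h2 : Fintype.card ((I : Set (Fin n))ᶜ : Set (Fin n)) = n - I.card := by
    rw [Fintype.card_compl_set]; simp
  have h3 : Fintype.card ((π '' (I : Set (Fin n)))ᶜ : Set (Fin n)) = n - I.card := by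
    rw [Fintype.card_compl_set, Set.card_image_of_inj_on (fun x hx y hy h => hπ hx hy h)]; simp
  rw [Fintype.card_equiv (Fintype.equivOfCardEq (h2.trans h3.symm)), h2]

theorem card_extensions_le {n : ℕ} (I : Finset (Fin n)) (π : Fin n → Fin n) :
    (extensions I π).card ≤ (n - I.card).factorial := by
  by_cases hπ : Set.InjOn π I
  · exact (card_extensions I π hπ).le
  · rw [Finset.card_eq_zero.2]
    · exact Nat.zero_le _
    · refine Finset.eq_empty_of_forall_notMem fun σ hσ => hπ fun x hx y hy h => σ.injective ?_
      rw [mem_extensions] at hσ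
      rw [hσ x hx, hσ y hy, h]

theorem card_extensions_value_le {n : ℕ} (I : Finset (Fin n)) (π : Fin n → Fin n) {a : Fin n}
    (ha : a ∉ I) (v : Fin n) :
    ((extensions I π).filter fun σ => σ a = v).card ≤ (n - I.card - 1).factorial := by
  classical
  have h := card_extensions_le (insert a I) (Function.update π a v)
  rw [Finset.card_insert_of_notMem ha, ← Nat.sub_sub] at h
  refine (Finset.card_le_card fun σ hσ => ?_).trans h
  rw [Finset.mem_filter, mem_extensions] at hσ
  rw [mem_extensions]
  intro i hi
  rcases Finset.mem_insert.1 hi with rfl | hi'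
  · simp [hσ.2]
  · rw [Function.update_of_ne (by rintro rfl; exact ha hi')]
    exact hσ.1 i hi'

theorem card_extensions_mem_le {n : ℕ} (I : Finset (Fin n)) (π : Fin n → Fin n) {a : Fin n}
    (ha : a ∉ I) (S : Finset (Fin n)) :
    ((extensions I π).filter fun σ => σ a ∈ S).card ≤ S.card * (n - I.card - 1).factorial := by
  classical
  have : ((extensions I π).filter fun σ => σ a ∈ S) ⊆
      S.biUnion fun v => (extensions I π).filter fun σ => σ a = v := by
    intro σ hσ
    simp only [mem_filter, mem_biUnion] at hσ ⊢
    exact ⟨σ a, hσ.2, hσ.1, rfl⟩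
  refine (Finset.card_le_card this).trans (Finset.card_biUnion_le.trans ?_)
  rw [← smul_eq_mul, ← Finset.sum_const]
  exact Finset.sum_le_sum fun v _ => card_extensions_value_le I π ha v

/-- The permutations with prescribed values on `I` for which no two consecutive values are
related, except possibly at two consecutive prescribed positions. -/
def avoiding {m : ℕ} (I : Finset (Fin (m + 1))) (π : Fin (m + 1) → Fin (m + 1))
    (H : Fin (m + 1) → Fin (m + 1) → Prop) [DecidableRel H] : Finset (Equiv.Perm (Fin (m + 1))) :=
  (extensions I π).filter fun σ => ∀ i : Fin m, ¬ (i.castSucc ∈ I ∧ i.succ ∈ I) →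
    ¬ H (σ i.castSucc) (σ i.succ)

theorem avoiding_subset {m : ℕ} (I : Finset (Fin (m + 1))) (π : Fin (m + 1) → Fin (m + 1))
    (H : Fin (m + 1) → Fin (m + 1) → Prop) [DecidableRel H] : avoiding I π H ⊆ extensions I π :=
  Finset.filter_subset _ _

/-- The pairs of consecutive free positions. -/
noncomputable def freePairs {m : ℕ} (I : Finset (Fin (m + 1))) :
    Finset (((I : Set (Fin (m + 1)))ᶜ : Set (Fin (m + 1))) ×
      ((I : Set (Fin (m + 1)))ᶜ : Set (Fin (m + 1)))) := by
  classical
  exact univ.filter fun e => (e.1 : Fin (m + 1)).val + 1 = (e.2 : Fin (m + 1)).val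

theorem succRel_freePairs {m : ℕ} (I : Finset (Fin (m + 1))) : SuccRel (freePairs I) where
  fst_inj e he e' he' h := by
    simp only [freePairs, mem_filter, mem_univ, true_and] at he he'
    refine Prod.ext h (Subtype.ext (Fin.ext ?_))
    rw [← he, ← he', h]
  snd_inj e he e' he' h := by
    simp only [freePairs, mem_filter, mem_univ, true_and] at he he'
    refine Prod.ext (Subtype.ext (Fin.ext ?_)) h
    rw [h] at he
    omega
  ne e he h := by
    simp only [freePairs, mem_filter, mem_univ, true_and] at he
    rw [h] at he
    omega
  no_two_cycle e he e' he' h h' := by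
    simp only [freePairs, mem_filter, mem_univ, true_and] at he he'
    rw [← h, ← h'] at he'
    omega

/-- A free position fails to begin a free pair only if it is the last position or is followed by one
of the prescribed positions. -/
theorem card_le_card_freePairs_add {m : ℕ} (I : Finset (Fin (m + 1))) :
    (m + 1 - I.card) ≤ (freePairs I).card + (I.card + 1) := by
  classical
  have h1 : Iᶜ ⊆ (freePairs I).image (fun e => (e.1 : Fin (m + 1))) ∪
      (I.image (fun x => (⟨x.val - 1, by omega⟩ : Fin (m + 1))) ∪ {Fin.last m}) := by
    intro i hi
    rw [Finset.mem_compl] at hi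
    by_cases hl : i = Fin.last m
    · simp [hl]
    have hlt : i.val + 1 < m + 1 := by
      have := Fin.val_lt_last hl; omega
    by_cases hs : (⟨i.val + 1, hlt⟩ : Fin (m + 1)) ∈ I
    · refine Finset.mem_union_right _ (Finset.mem_union_left _ (Finset.mem_image.2 ⟨_, hs, ?_⟩))
      ext; simp
    · refine Finset.mem_union_left _ (Finset.mem_image.2
        ⟨(⟨i, by simpa using hi⟩, ⟨⟨i.val + 1, hlt⟩, by simpa using hs⟩), ?_, rfl⟩)
      simp [freePairs]
  have h2 := (Finset.card_le_card h1).trans (Finset.card_union_le _ _)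
  have h3 := Finset.card_union_le (I.image (fun x => (⟨x.val - 1, by omega⟩ : Fin (m + 1))))
    {Fin.last m}
  have h4 := Finset.card_image_le (s := freePairs I) (f := fun e => (e.1 : Fin (m + 1)))
  have h5 := Finset.card_image_le (s := I) (f := fun x => (⟨x.val - 1, by omega⟩ : Fin (m + 1)))
  rw [Finset.card_compl, Fintype.card_fin] at h2
  rw [Finset.card_singleton] at h3
  omega

section

variable {m : ℕ} (I : Finset (Fin (m + 1))) (π : Fin (m + 1) → Fin (m + 1))
  {H : Fin (m + 1) → Fin (m + 1) → Prop} [DecidableRel H]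

/-- There are at most `2 |I|` pairs of consecutive positions of which exactly one is prescribed. A
hit at such a pair confines the free value to at most `D` vertices, so these permutations form a
proportion of order `1/m` of all extensions. -/
theorem card_mixed_le {D : ℕ} (hsymm : ∀ u v, H u v → H v u)
    (hdeg : ∀ v, (univ.filter (H v)).card ≤ D) :
    ((extensions I π).filter fun σ => ∃ i : Fin m,
      ((i.castSucc ∈ I ∧ i.succ ∉ I) ∨ (i.castSucc ∉ I ∧ i.succ ∈ I)) ∧
      H (σ i.castSucc) (σ i.succ)).card ≤ 2 * I.card * (D * (m + 1 - I.card - 1).factorial) := by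
  classical
  set U : Finset (Fin m) := univ.filter fun i => i.castSucc ∈ I ∧ i.succ ∉ I with hU
  set W : Finset (Fin m) := univ.filter fun i => i.castSucc ∉ I ∧ i.succ ∈ I with hW
  have hUc : U.card ≤ I.card := Finset.card_le_card_of_injOn Fin.castSucc
    (fun i hi => by simp [hU] at hi; exact hi.1) fun _ _ _ _ h => Fin.castSucc_injective _ h
  have hWc : W.card ≤ I.card := Finset.card_le_card_of_injOn Fin.succ
    (fun i hi => by simp [hW] at hi; exact hi.2) fun _ _ _ _ h => Fin.succ_injective _ h
  have hsub : ((extensions I π).filter fun σ => ∃ i : Fin m,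
      ((i.castSucc ∈ I ∧ i.succ ∉ I) ∨ (i.castSucc ∉ I ∧ i.succ ∈ I)) ∧
      H (σ i.castSucc) (σ i.succ)) ⊆
      (U.biUnion fun i => (extensions I π).filter fun σ =>
        σ i.succ ∈ univ.filter (H (π i.castSucc))) ∪
      (W.biUnion fun i => (extensions I π).filter fun σ =>
        σ i.castSucc ∈ univ.filter (H (π i.succ))) := by
    intro σ hσ
    obtain ⟨hσ, i, hi | hi, hH⟩ := Finset.mem_filter.1 hσ
    · refine Finset.mem_union_left _ (Finset.mem_biUnion.2 ⟨i, by simp [hU, hi], ?_⟩)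
      simp only [mem_filter, mem_univ, true_and]
      refine ⟨hσ, ?_⟩
      rwa [← mem_extensions.1 hσ _ hi.1]
    · refine Finset.mem_union_right _ (Finset.mem_biUnion.2 ⟨i, by simp [hW, hi], ?_⟩)
      simp only [mem_filter, mem_univ, true_and]
      refine ⟨hσ, ?_⟩
      rw [← mem_extensions.1 hσ _ hi.2]
      exact hsymm _ _ hH
  refine (Finset.card_le_card hsub).trans ((Finset.card_union_le _ _).trans ?_)
  have key : ∀ a b : Fin (m + 1), a ∉ I → ((extensions I π).filter fun σ =>
      σ a ∈ univ.filter (H b)).card ≤ D * (m + 1 - I.card - 1).factorial := fun a b ha =>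
    (card_extensions_mem_le I π ha _).trans (Nat.mul_le_mul_right _ (hdeg _))
  have k1 : (U.biUnion fun i => (extensions I π).filter fun σ =>
        σ i.succ ∈ univ.filter (H (π i.castSucc))).card ≤
      I.card * (D * (m + 1 - I.card - 1).factorial) := by
    refine Finset.card_biUnion_le.trans ((Finset.sum_le_sum fun i hi => key _ _ ?_).trans ?_)
    · simp [hU] at hi; exact hi.2
    · rw [Finset.sum_const, smul_eq_mul]; exact Nat.mul_le_mul_right _ hUc
  have k2 : (W.biUnion fun i => (extensions I π).filter fun σ =>
        σ i.castSucc ∈ univ.filter (H (π i.succ))).card ≤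
      I.card * (D * (m + 1 - I.card - 1).factorial) := by
    refine Finset.card_biUnion_le.trans ((Finset.sum_le_sum fun i hi => key _ _ ?_).trans ?_)
    · simp [hW] at hi; exact hi.1
    · rw [Finset.sum_const, smul_eq_mul]; exact Nat.mul_le_mul_right _ hWc
  linarith

/-- The permutations in question for which no two consecutive free values are related. -/
def freeAvoiding (H : Fin (m + 1) → Fin (m + 1) → Prop) [DecidableRel H] :
    Finset (Equiv.Perm (Fin (m + 1))) :=
  (extensions I π).filter fun σ => ∀ i : Fin m, i.castSucc ∉ I → i.succ ∉ I →
    ¬ H (σ i.castSucc) (σ i.succ)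

theorem card_avoiding_le_freeAvoiding : (avoiding I π H).card ≤ (freeAvoiding I π H).card := by
  refine Finset.card_le_card fun σ hσ => ?_
  rw [avoiding, Finset.mem_filter] at hσ
  rw [freeAvoiding, Finset.mem_filter]
  exact ⟨hσ.1, fun i h1 h2 => hσ.2 i fun h => h1 h.1⟩

theorem card_freeAvoiding_le {D : ℕ} (hsymm : ∀ u v, H u v → H v u)
    (hdeg : ∀ v, (univ.filter (H v)).card ≤ D) :
    (freeAvoiding I π H).card ≤ (avoiding I π H).card +
      2 * I.card * (D * (m + 1 - I.card - 1).factorial) := by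
  classical
  refine le_trans ?_ (Nat.add_le_add_left (card_mixed_le I π hsymm hdeg) _)
  refine le_trans (Finset.card_le_card fun σ hσ => ?_) (Finset.card_union_le _ _)
  rw [freeAvoiding, Finset.mem_filter] at hσ
  rw [Finset.mem_union, avoiding, Finset.mem_filter, Finset.mem_filter]
  by_cases h : ∃ i : Fin m,
      ((i.castSucc ∈ I ∧ i.succ ∉ I) ∨ (i.castSucc ∉ I ∧ i.succ ∈ I)) ∧
      H (σ i.castSucc) (σ i.succ)
  · exact Or.inr ⟨hσ.1, h⟩
  · refine Or.inl ⟨hσ.1, fun i hi hH => h ⟨i, ?_, hH⟩⟩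
    have := hσ.2 i
    tauto

open scoped Classical in
-- Deleting the prescribed positions and values turns the count into one for bijections between the
-- complements, to which the Poisson approximation applies.
theorem card_freeAvoiding_eq (hπ : Set.InjOn π I) :
    (freeAvoiding I π H).card = (univ.filter fun τ :
      (((I : Set (Fin (m + 1)))ᶜ : Set (Fin (m + 1))) ≃
        ((π '' (I : Set (Fin (m + 1))))ᶜ : Set (Fin (m + 1)))) =>
      hitSet (freePairs I) (fun u v : ((π '' (I : Set (Fin (m + 1))))ᶜ : Set (Fin (m + 1))) =>
        H u v) τ = ∅).card := by
  classical
  have hiff : ∀ σ : {σ // σ ∈ extensions I π}, (hitSet (freePairs I)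
      (fun u v : ((π '' (I : Set (Fin (m + 1))))ᶜ : Set (Fin (m + 1))) => H u v)
      (extensionsEquiv I π hπ σ) = ∅) ↔ σ.1 ∈ freeAvoiding I π H := by
    intro σ
    rw [freeAvoiding, Finset.mem_filter, hitSet, Finset.filter_eq_empty_iff]
    simp only [extensionsEquiv_apply]
    refine ⟨fun h => ⟨σ.2, fun i h1 h2 => ?_⟩, fun h e he => ?_⟩
    · exact h (x := (⟨i.castSucc, by simpa using h1⟩, ⟨i.succ, by simpa using h2⟩))
        (by simp [freePairs])
    · obtain ⟨⟨a, ha⟩, ⟨b, hb⟩⟩ := e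
      simp only [freePairs, mem_filter, mem_univ, true_and] at he
      have h3 := h.2 ⟨a.val, by omega⟩
      have e1 : (⟨a.val, by omega⟩ : Fin m).castSucc = a := by ext; simp
      have e2 : (⟨a.val, by omega⟩ : Fin m).succ = b := by ext; simp [he]
      rw [e1, e2] at h3
      exact h3 (by simpa using ha) (by simpa using hb)
  refine Finset.card_bij (fun σ hσ => extensionsEquiv I π hπ ⟨σ, (Finset.mem_filter.1 hσ).1⟩)
    ?_ ?_ ?_
  · intro σ hσ
    simp only [mem_filter, mem_univ, true_and]
    exact (hiff _).2 hσ
  · intro σ hσ σ' hσ' h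
    simpa using (extensionsEquiv I π hπ).injective h
  · intro τ hτ
    simp only [mem_filter, mem_univ, true_and] at hτ
    refine ⟨((extensionsEquiv I π hπ).symm τ).1, ?_, by simp⟩
    rw [← hiff]
    simpa using hτ

open scoped Classical in
-- Deleting `b` vertices loses their own degrees, at most `b * D`, and as much again at their
-- neighbours.
theorem abs_degree_sum_compl_sub_le {D b : ℕ} (hI : I.card = b) (hπ : Set.InjOn π I)
    (hsymm : ∀ u v, H u v → H v u) (hdeg : ∀ v, (univ.filter (H v)).card ≤ D) :
    |(∑ v : ((π '' (I : Set (Fin (m + 1))))ᶜ : Set (Fin (m + 1))), ((univ.filter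
      fun w : ((π '' (I : Set (Fin (m + 1))))ᶜ : Set (Fin (m + 1))) => H v w).card : ℝ)) -
      ∑ v, ((univ.filter (H v)).card : ℝ)| ≤ 2 * b * D := by
  classical
  set J : Finset (Fin (m + 1)) := I.image π with hJ
  have hJc : J.card = b := by rw [hJ, Finset.card_image_of_injOn hπ, hI]
  have hmem : ∀ x, x ∈ ((π '' (I : Set (Fin (m + 1))))ᶜ : Set (Fin (m + 1))) ↔ x ∈ Jᶜ := by
    intro x; simp [hJ]
  have e1 : ∑ v : ((π '' (I : Set (Fin (m + 1))))ᶜ : Set (Fin (m + 1))), ((univ.filter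
      fun w : ((π '' (I : Set (Fin (m + 1))))ᶜ : Set (Fin (m + 1))) => H v w).card : ℝ) =
      ∑ v ∈ Jᶜ, (((Jᶜ).filter (H v)).card : ℝ) := by
    rw [Finset.sum_subtype (Jᶜ) (fun x => (hmem x).symm)]
    refine Finset.sum_congr rfl fun v _ => ?_
    congr 1
    refine Finset.card_bij (fun w _ => w.1) ?_ ?_ ?_
    · intro w hw
      simp only [mem_filter, mem_univ, true_and] at hw
      exact Finset.mem_filter.2 ⟨(hmem _).1 w.2, hw⟩
    · intro w _ w' _ h; exact Subtype.ext h
    · intro w hw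
      rw [Finset.mem_filter] at hw
      exact ⟨⟨w, (hmem _).2 hw.1⟩, by simpa using hw.2, rfl⟩
  have e2 : ∑ v, ((univ.filter (H v)).card : ℝ) = ∑ v ∈ Jᶜ, (((Jᶜ).filter (H v)).card : ℝ) +
      ∑ v ∈ Jᶜ, ((J.filter (H v)).card : ℝ) + ∑ v ∈ J, ((univ.filter (H v)).card : ℝ) := by
    rw [← Finset.sum_compl_add_sum J, ← Finset.sum_add_distrib]
    congr 1
    refine Finset.sum_congr rfl fun v _ => ?_
    rw [← Nat.cast_add, ← Finset.card_union_of_disjoint]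
    · rw [← Finset.filter_union]
      congr 2
      rw [Finset.union_comm, Finset.union_compl]
    · exact Finset.disjoint_filter_filter disjoint_compl_left
  have e3 : ∑ v ∈ J, ((univ.filter (H v)).card : ℝ) ≤ b * D := by
    calc _ ≤ ∑ v ∈ J, (D : ℝ) := Finset.sum_le_sum fun v _ => by exact_mod_cast hdeg v
      _ = _ := by rw [Finset.sum_const, hJc, nsmul_eq_mul]
  have e4 : ∑ v ∈ Jᶜ, ((J.filter (H v)).card : ℝ) ≤ b * D := by
    refine le_trans ?_ e3
    have : ∑ v ∈ Jᶜ, (J.filter (H v)).card ≤ ∑ v ∈ J, (univ.filter (H v)).card := by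
      simp only [Finset.card_filter]
      rw [Finset.sum_comm]
      refine Finset.sum_le_sum fun v _ => ?_
      calc _ ≤ ∑ x, (if H x v then 1 else 0) :=
            Finset.sum_le_sum_of_subset (Finset.subset_univ _)
        _ = _ := Finset.sum_congr rfl fun x _ => by
            simp only [show H x v ↔ H v x from ⟨hsymm _ _, hsymm _ _⟩]
    exact_mod_cast this
  have p3 : 0 ≤ ∑ v ∈ J, ((univ.filter (H v)).card : ℝ) :=
    Finset.sum_nonneg fun _ _ => Nat.cast_nonneg _
  have p4 : 0 ≤ ∑ v ∈ Jᶜ, ((J.filter (H v)).card : ℝ) :=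
    Finset.sum_nonneg fun _ _ => Nat.cast_nonneg _
  rw [e1, e2, abs_le]
  constructor <;> linarith

theorem abs_exp_neg_sub_exp_neg_le {x y : ℝ} (hx : 0 ≤ x) (hy : 0 ≤ y) :
    |Real.exp (-x) - Real.exp (-y)| ≤ |x - y| := by
  wlog h : x ≤ y generalizing x y
  · rw [abs_sub_comm, abs_sub_comm x]
    exact this hy hx (le_of_not_ge h)
  have h1 : Real.exp (-y) ≤ Real.exp (-x) := Real.exp_le_exp.2 (by linarith)
  rw [abs_of_nonneg (by linarith), abs_of_nonpos (by linarith)]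
  have h2 := Real.add_one_le_exp (x - y)
  have h3 : Real.exp (-y) = Real.exp (-x) * Real.exp (x - y) := by
    rw [← Real.exp_add]; ring_nf
  have h4 : Real.exp (-x) ≤ 1 := by rw [Real.exp_le_one_iff]; linarith
  have h5 := Real.exp_pos (-x)
  rw [h3]
  nlinarith

end

/-- Among the permutations with `b` prescribed values, the proportion of those which create no
related consecutive values is asymptotically `exp (-h)`, where `h` is the average degree. -/
theorem exists_abs_card_avoiding_sub_le (D b : ℕ) (h K₀ : ℝ) (hh : 0 ≤ h) (hK₀ : 0 ≤ K₀) :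
    ∃ K : ℝ, 0 ≤ K ∧ ∀ (m : ℕ) (I : Finset (Fin (m + 1))) (π : Fin (m + 1) → Fin (m + 1))
      (H : Fin (m + 1) → Fin (m + 1) → Prop) [DecidableRel H], I.card = b → Set.InjOn π I →
      (∀ v, ¬ H v v) → (∀ u v, H u v → H v u) → (∀ v, (univ.filter (H v)).card ≤ D) →
      |(∑ v, ((univ.filter (H v)).card : ℝ)) - h * (m + 1)| ≤ K₀ →
      |((avoiding I π H).card : ℝ) - Real.exp (-h) * (m + 1 - b).factorial| ≤
        K / (m + 1) * (m + 1 - b).factorial := by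
  classical
  set K₁ : ℝ := 18 * D ^ 2 + 16 * D + D * (b + 1) with hK₁
  set K₂ : ℝ := K₀ + 2 * b * D + h * (b + 1) with hK₂
  -- The summands account for small `m`, for the error of the Poisson approximation, for the
  -- deviation of its parameter from `h`, and for the mixed pairs. The factors 2 pass from
  -- denominators `m - b` to `m + 1`.
  refine ⟨2 * (b + 2) + (2 * K₁ + 2 * K₂ + 2 * (2 * b * D)), by positivity, ?_⟩
  intro m I π H _ hI hπ hirr hsymm hdeg hsum
  set F : ℝ := ((m + 1 - b).factorial : ℝ) with hF
  have hFpos : 0 < F := by rw [hF]; exact_mod_cast Nat.factorial_pos _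
  have hm : (0 : ℝ) < m + 1 := by positivity
  -- Here `K / (m + 1) ≥ 1` and the estimate is trivial. Otherwise `m - b ≥ (m + 1) / 2`.
  by_cases hsmall : m + 1 < 2 * (b + 2)
  · have h1 : ((avoiding I π H).card : ℝ) ≤ F := by
      rw [hF, ← hI]
      exact_mod_cast (Finset.card_filter_le _ _).trans (card_extensions_le I π)
    have h2 : 0 ≤ ((avoiding I π H).card : ℝ) := by positivity
    have h3 : Real.exp (-h) ≤ 1 := by rw [Real.exp_le_one_iff]; linarith
    have h4 := Real.exp_pos (-h)
    have h5 : (1 : ℝ) ≤ (2 * (b + 2) + (2 * K₁ + 2 * K₂ + 2 * (2 * b * D))) / (m + 1) := by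
      rw [le_div_iff₀ hm, one_mul]
      have : (m : ℝ) + 1 ≤ 2 * (b + 2) := by exact_mod_cast hsmall.le
      have : 0 ≤ 2 * K₁ + 2 * K₂ + 2 * (2 * b * D) := by positivity
      linarith
    have h6 : |((avoiding I π H).card : ℝ) - Real.exp (-h) * F| ≤ F := by
      rw [abs_le]; constructor <;> nlinarith
    nlinarith
  push Not at hsmall
  have hb : b ≤ m + 1 := by omega
  have hcardP : Fintype.card ((I : Set (Fin (m + 1)))ᶜ : Set (Fin (m + 1))) = m + 1 - b := by
    rw [Fintype.card_compl_set]; simp [hI]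
  have hcardV : Fintype.card ((π '' (I : Set (Fin (m + 1))))ᶜ : Set (Fin (m + 1))) =
      m + 1 - b := by
    rw [Fintype.card_compl_set, Set.card_image_of_inj_on (fun x hx y hy h => hπ hx hy h)]
    simp [hI]
  have hN : 2 ≤ m + 1 - b := by omega
  have hmain := (succRel_freePairs I).abs_card_no_hit_sub_le
    (H := fun u v : ((π '' (I : Set (Fin (m + 1))))ᶜ : Set (Fin (m + 1))) => H u v)
    (hcardP.trans hcardV.symm) (fun v => hirr v) (fun u v => hsymm u v) (D := D) (fun v => by
      refine le_trans (Finset.card_le_card_of_injOn Subtype.val ?_ ?_) (hdeg v)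
      · intro w hw; simpa using hw
      · intro w _ w' _ h; exact Subtype.ext h) (by rw [hcardP]; exact hN) (q := b + 1) (by
      rw [hcardP, ← hI]; exact card_le_card_freePairs_add I)
  rw [← card_freeAvoiding_eq I π hπ, Fintype.card_equiv (Fintype.equivOfCardEq
    (hcardP.trans hcardV.symm)), hcardP] at hmain
  have hcast : ((m + 1 - b : ℕ) : ℝ) = m + 1 - b := by
    rw [Nat.cast_sub hb]; push_cast; ring
  rw [hcast] at hmain
  set N1 : ℝ := (m : ℝ) + 1 - b - 1 with hN1
  have hN1ge : (m + 1 : ℝ) / 2 ≤ N1 := by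
    have : (2 * (b + 2) : ℝ) ≤ m + 1 := by exact_mod_cast hsmall
    rw [hN1]; linarith
  have hN1pos : 0 < N1 := by linarith
  set Δ' : ℝ := ∑ v : ((π '' (I : Set (Fin (m + 1))))ᶜ : Set (Fin (m + 1))), ((univ.filter
      fun w : ((π '' (I : Set (Fin (m + 1))))ᶜ : Set (Fin (m + 1))) => H v w).card : ℝ) with hΔ'
  have hΔdiff := abs_degree_sum_compl_sub_le I π hI hπ hsymm hdeg
  rw [← hΔ'] at hΔdiff
  have hΔ'0 : 0 ≤ Δ' := Finset.sum_nonneg fun _ _ => Nat.cast_nonneg _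
  have hexp : |Real.exp (-(Δ' / N1)) - Real.exp (-h)| ≤ 2 * K₂ / (m + 1) := by
    refine (abs_exp_neg_sub_exp_neg_le (div_nonneg hΔ'0 hN1pos.le) hh).trans ?_
    have e1 : Δ' / N1 - h = (Δ' - h * N1) / N1 := by field_simp
    have e2 : |Δ' - h * N1| ≤ K₂ := by
      rw [abs_le] at hsum hΔdiff ⊢
      have e3 : h * N1 = h * (m + 1) - h * (b + 1) := by rw [hN1]; ring
      have e4 : 0 ≤ h * ((b : ℝ) + 1) := by positivity
      rw [e3]
      constructor <;> linarith
    rw [e1, abs_div, abs_of_pos hN1pos, div_le_div_iff₀ hN1pos hm]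
    have e5 : 0 ≤ K₂ := by positivity
    nlinarith [abs_nonneg (Δ' - h * N1)]
  have hK₁' : (18 * D ^ 2 + 16 * D + D * ((b + 1 : ℕ) : ℝ)) / N1 ≤ 2 * K₁ / (m + 1) := by
    rw [div_le_div_iff₀ hN1pos hm]
    push_cast
    rw [← hK₁]
    have e5 : 0 ≤ K₁ := by positivity
    nlinarith
  have hfree : |((freeAvoiding I π H).card : ℝ) - Real.exp (-h) * F| ≤
      (2 * K₁ / (m + 1) + 2 * K₂ / (m + 1)) * F := by
    have e1 : |((freeAvoiding I π H).card : ℝ) / F - Real.exp (-h)| ≤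
        2 * K₁ / (m + 1) + 2 * K₂ / (m + 1) := by
      refine (abs_sub_le _ (Real.exp (-(Δ' / N1))) _).trans (add_le_add (hmain.trans hK₁') hexp)
    have e2 : ((freeAvoiding I π H).card : ℝ) - Real.exp (-h) * F =
        (((freeAvoiding I π H).card : ℝ) / F - Real.exp (-h)) * F := by
      field_simp
    rw [e2, abs_mul, abs_of_pos hFpos]
    gcongr
  have hmix : ((freeAvoiding I π H).card : ℝ) - (avoiding I π H).card ≤
      2 * (2 * b * D) / (m + 1) * F := by
    have e1 := card_freeAvoiding_le I π hsymm hdeg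
    rw [hI] at e1
    have e2 : F = ((m : ℝ) + 1 - b) * ((m + 1 - b - 1).factorial : ℝ) := by
      rw [hF, ← hcast, ← Nat.cast_mul, Nat.mul_factorial_pred (by omega)]
    have e3 : ((freeAvoiding I π H).card : ℝ) ≤ (avoiding I π H).card +
        2 * b * (D * ((m + 1 - b - 1).factorial : ℝ)) := by exact_mod_cast e1
    have e4 : 2 * b * (D * ((m + 1 - b - 1).factorial : ℝ)) ≤ 2 * (2 * b * D) / (m + 1) * F := by
      rw [e2, div_mul_eq_mul_div, le_div_iff₀ hm]
      have e5 : (m : ℝ) + 1 ≤ 2 * ((m : ℝ) + 1 - b) := by rw [hN1] at hN1ge; linarith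
      have e6 : (0 : ℝ) ≤ 2 * b * (D * ((m + 1 - b - 1).factorial : ℝ)) := by positivity
      calc _ ≤ 2 * b * (D * ((m + 1 - b - 1).factorial : ℝ)) * (2 * ((m : ℝ) + 1 - b)) := by
            gcongr
        _ = _ := by ring
    linarith
  have hle : ((avoiding I π H).card : ℝ) ≤ (freeAvoiding I π H).card := by
    exact_mod_cast card_avoiding_le_freeAvoiding I π
  have hsplit : (2 * ((b : ℝ) + 2) + (2 * K₁ + 2 * K₂ + 2 * (2 * b * D))) / (m + 1) * F =
      2 * ((b : ℝ) + 2) / (m + 1) * F + ((2 * K₁ / (m + 1) + 2 * K₂ / (m + 1)) * F +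
        2 * (2 * b * D) / (m + 1) * F) := by ring
  have hpos : 0 ≤ 2 * ((b : ℝ) + 2) / (m + 1) * F := by positivity
  have hpos2 : 0 ≤ 2 * (2 * (b : ℝ) * D) / (m + 1) * F := by positivity
  rw [hsplit]
  rw [abs_le] at hfree ⊢
  constructor <;> linarith

end PartialPerm

/-! ### Path names, and Hamiltonian paths as vertex sequences -/

instance : Fintype PathName := ⟨{.A, .B, .C}, by intro x; cases x <;> decide⟩

/-- The first of the two paths other than `x`. -/
def PathName.left : PathName → PathName
  | .A => .B
  | .B => .A
  | .C => .A

/-- The second of the two paths other than `x`. -/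
def PathName.right : PathName → PathName
  | .A => .C
  | .B => .C
  | .C => .B

theorem PathName.left_ne (x : PathName) : x.left ≠ x := by cases x <;> decide
theorem PathName.right_ne (x : PathName) : x.right ≠ x := by cases x <;> decide
theorem PathName.left_ne_right (x : PathName) : x.left ≠ x.right := by cases x <;> decide
theorem PathName.eq_left_or_right {x p : PathName} (h : p ≠ x) : p = x.left ∨ p = x.right := by
  revert h; cases x <;> cases p <;> decide

theorem PathName.exists_ne_ne (x y : PathName) : ∃ p : PathName, p ≠ x ∧ p ≠ y := by
  cases x <;> cases y <;> decide

namespace HamPath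

variable {m : ℕ}

/-- The vertex visited at time `i`. -/
def vtx (σ : HamPath (m + 1)) (i : ℕ) : Fin (m + 1) := σ (Fin.ofNat (m + 1) i)

/-- The edge traversed between the times `i` and `i + 1`. -/
def edge (σ : HamPath (m + 1)) (i : ℕ) : Sym2 (Fin (m + 1)) := s(σ.vtx i, σ.vtx (i + 1))

theorem vtx_eq (σ : HamPath (m + 1)) {i : ℕ} (hi : i < m + 1) : σ.vtx i = σ ⟨i, hi⟩ := by
  rw [vtx]; congr 1; ext; simp [Nat.mod_eq_of_lt hi]

theorem vtx_val (σ : HamPath (m + 1)) (i : Fin (m + 1)) : σ.vtx i.val = σ i :=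
  σ.vtx_eq i.2

theorem symm_vtx (σ : HamPath (m + 1)) {i : ℕ} (hi : i ≤ m) : (σ.symm (σ.vtx i) : ℕ) = i := by
  rw [σ.vtx_eq (Nat.lt_succ_of_le hi)]; simp

theorem vtx_symm (σ : HamPath (m + 1)) (v : Fin (m + 1)) : σ.vtx (σ.symm v : ℕ) = v := by
  rw [vtx_val]; simp

theorem vtx_inj (σ : HamPath (m + 1)) {i j : ℕ} (hi : i ≤ m) (hj : j ≤ m)
    (h : σ.vtx i = σ.vtx j) : i = j := by
  rw [← σ.symm_vtx hi, ← σ.symm_vtx hj, h]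

theorem edge_inj (σ : HamPath (m + 1)) {i j : ℕ} (hi : i < m) (hj : j < m)
    (h : σ.edge i = σ.edge j) : i = j := by
  rw [edge, edge, Sym2.eq_iff] at h
  rcases h with ⟨h1, _⟩ | ⟨h1, h2⟩
  · exact σ.vtx_inj hi.le hj.le h1
  · have := σ.vtx_inj hi.le hj h1
    have := σ.vtx_inj hi hj.le h2
    omega

theorem mem_edges_iff (σ : HamPath (m + 1)) (e : Sym2 (Fin (m + 1))) :
    e ∈ σ.edges ↔ ∃ i < m, e = σ.edge i := by
  constructor
  · rintro ⟨u, v, huv, rfl⟩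
    have hv := (σ.symm v).2
    refine ⟨σ.symm u, by rw [Traverses] at huv; omega, ?_⟩
    rw [edge, vtx_symm, show (σ.symm u : ℕ) + 1 = σ.symm v from huv, vtx_symm]
  · rintro ⟨i, hi, rfl⟩
    exact ⟨_, _, by rw [Traverses, symm_vtx _ hi.le, symm_vtx _ hi], rfl⟩

theorem edge_mem_edges (σ : HamPath (m + 1)) {i : ℕ} (hi : i < m) : σ.edge i ∈ σ.edges :=
  (σ.mem_edges_iff _).2 ⟨i, hi, rfl⟩

/-- Adjacency along a Hamiltonian path. -/
def AdjIn (σ : HamPath (m + 1)) (u v : Fin (m + 1)) : Prop := s(u, v) ∈ σ.edges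

theorem adjIn_iff (σ : HamPath (m + 1)) (u v : Fin (m + 1)) :
    σ.AdjIn u v ↔ (σ.symm u : ℕ) + 1 = σ.symm v ∨ (σ.symm v : ℕ) + 1 = σ.symm u := by
  constructor
  · rintro ⟨x, y, hxy, h⟩
    rcases Sym2.eq_iff.1 h with ⟨rfl, rfl⟩ | ⟨rfl, rfl⟩
    · exact Or.inl hxy
    · exact Or.inr hxy
  · rintro (h | h)
    · exact ⟨u, v, h, rfl⟩
    · exact ⟨v, u, h, Sym2.eq_swap⟩

theorem adjIn_irrefl (σ : HamPath (m + 1)) (v : Fin (m + 1)) : ¬ σ.AdjIn v v := by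
  rw [adjIn_iff]; omega

theorem adjIn_symm (σ : HamPath (m + 1)) (u v : Fin (m + 1)) (h : σ.AdjIn u v) : σ.AdjIn v u := by
  rw [AdjIn, Sym2.eq_swap]; exact h

open Finset in
open scoped Classical in
theorem card_adjIn_le (σ : HamPath (m + 1)) (v : Fin (m + 1)) :
    (univ.filter (σ.AdjIn v)).card ≤ 2 := by
  -- At the ends of the path one of these two indices wraps around or is truncated; this only
  -- enlarges the set.
  refine (Finset.card_le_card (t := {σ.vtx (σ.symm v + 1), σ.vtx (σ.symm v - 1)}) ?_).trans
    Finset.card_le_two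
  intro w hw
  rcases (σ.adjIn_iff v w).1 (Finset.mem_filter.1 hw).2 with h | h
  · rw [h, vtx_symm]; simp
  · rw [← h, Nat.add_sub_cancel, vtx_symm]; simp

open Finset in
open scoped Classical in
theorem sum_card_adjIn (σ : HamPath (m + 1)) :
    ∑ v, (univ.filter (σ.AdjIn v)).card = 2 * m := by
  have h1 : ∀ v, (univ.filter (σ.AdjIn v)).card =
      (univ.filter fun w => (σ.symm v : ℕ) + 1 = σ.symm w).card +
      (univ.filter fun w => (σ.symm w : ℕ) + 1 = σ.symm v).card := by
    intro v
    rw [← Finset.card_union_of_disjoint, ← Finset.filter_or]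
    · simp only [adjIn_iff]
    · rw [Finset.disjoint_filter]; intro w _ h1 h2; omega
  have h2 : ∑ v, (univ.filter fun w => (σ.symm w : ℕ) + 1 = σ.symm v).card =
      ∑ v, (univ.filter fun w => (σ.symm v : ℕ) + 1 = σ.symm w).card := by
    simp only [Finset.card_filter]; rw [Finset.sum_comm]
  have h3 : ∑ v, (univ.filter fun w => (σ.symm v : ℕ) + 1 = σ.symm w).card = m := by
    rw [← Equiv.sum_comp σ]
    simp only [Equiv.symm_apply_apply]
    rw [Fin.sum_univ_castSucc]
    have e1 : (univ.filter fun w => (Fin.last m : ℕ) + 1 = σ.symm w).card = 0 := by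
      rw [Finset.card_eq_zero, Finset.filter_eq_empty_iff]
      intro w _ h
      have := (σ.symm w).2
      simp at h; omega
    have e2 : ∀ i : Fin m, (univ.filter fun w => (i.castSucc : ℕ) + 1 = σ.symm w).card = 1 := by
      intro i
      refine Finset.card_eq_one.2 ⟨σ i.succ, ?_⟩
      ext w
      simp only [mem_filter, mem_univ, true_and, mem_singleton]
      constructor
      · intro h
        rw [← σ.apply_symm_apply w]
        congr 1
        ext
        rw [← h]; simp
      · rintro rfl; simp
    rw [e1, Finset.sum_congr rfl fun i _ => e2 i]
    simp
  simp_rw [h1, Finset.sum_add_distrib, h2, h3]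
  ring

end HamPath

/-! ### Runs of common edges -/

variable {m k : ℕ}

/-- Admissible positions of `k` runs: the run `j` is missing from the path `th j` and consists of
`ℓ j` edges, the first of which has the index `s j p` in each of the other two paths `p`. -/
structure RunPositions (m : ℕ) (th : Fin k → PathName) (dir : Fin k → Bool) (ℓ : Fin k → ℕ)
    (s : Fin k → PathName → ℕ) : Prop where
  pos : ∀ j, 1 ≤ ℓ j
  opp : ∀ j, dir j = true → ℓ j = 1
  fits : ∀ j p, p ≠ th j → s j p + ℓ j ≤ m
  sep : ∀ j j', j < j' → ∀ p, p ≠ th j → p ≠ th j' → s j p + ℓ j < s j' p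

/-- The common edges of the three paths are exactly the given runs; the run `j` is traversed in
opposite directions if `dir j = true`. -/
structure HasRuns (σ : PathName → HamPath (m + 1)) (th : Fin k → PathName) (dir : Fin k → Bool)
    (ℓ : Fin k → ℕ) (s : Fin k → PathName → ℕ) : Prop where
  agree : ∀ j r, r ≤ ℓ j → (σ (th j).right).vtx (s j (th j).right + r) =
    (σ (th j).left).vtx (s j (th j).left + (if dir j then ℓ j - r else r))
  exact : ∀ p q, p ≠ q → ∀ i < m, ∀ i' < m, (σ p).edge i = (σ q).edge i' →
    ∃ j, p ≠ th j ∧ q ≠ th j ∧ ∃ r < ℓ j, i = s j p + r ∧ i' = s j q + r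

/-- An opposite run is a single edge, for which reversal of the vertices only swaps its ends; so the
edges of the two paths correspond index by index in either case. -/
theorem edge_eq_of_agree {σ : PathName → HamPath (m + 1)} {th : Fin k → PathName}
    {dir : Fin k → Bool} {ℓ : Fin k → ℕ} {s : Fin k → PathName → ℕ} {j : Fin k}
    (h : ∀ r, r ≤ ℓ j → (σ (th j).right).vtx (s j (th j).right + r) =
      (σ (th j).left).vtx (s j (th j).left + (if dir j then ℓ j - r else r)))
    (hopp : dir j = true → ℓ j = 1) {r : ℕ} (hr : r < ℓ j) {p q : PathName}
    (hp : p ≠ th j) (hq : q ≠ th j) :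
    (σ p).edge (s j p + r) = (σ q).edge (s j q + r) := by
  have key : (σ (th j).right).edge (s j (th j).right + r) =
      (σ (th j).left).edge (s j (th j).left + r) := by
    rw [HamPath.edge, HamPath.edge, add_assoc, add_assoc, h r hr.le, h (r + 1) hr]
    by_cases hd : dir j = true
    · have := hopp hd
      have hr0 : r = 0 := by omega
      subst hr0
      simp [hd, this, Sym2.eq_swap]
    · simp [hd]
  rcases PathName.eq_left_or_right hp with rfl | rfl <;>
    rcases PathName.eq_left_or_right hq with rfl | rfl
  · rfl
  · exact key.symm
  · exact key
  · rfl

/-! ### The vertices prescribed for a path by the preceding paths -/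

section Labelings

variable {th : Fin k → PathName} {dir : Fin k → Bool} {ℓ : Fin k → ℕ} {s : Fin k → PathName → ℕ}

/-- The runs on a path occupy disjoint intervals of vertices, end-points included. -/
theorem RunPositions.unique (P : RunPositions m th dir ℓ s) {j j' : Fin k} {p : PathName}
    (hp : p ≠ th j) (hp' : p ≠ th j') {r r' : ℕ} (hr : r ≤ ℓ j) (hr' : r' ≤ ℓ j')
    (h : s j p + r = s j' p + r') : j = j' ∧ r = r' := by
  rcases lt_trichotomy j j' with hj | rfl | hj
  · have := P.sep j j' hj p hp hp'; omega
  · exact ⟨rfl, by omega⟩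
  · have := P.sep j' j hj p hp' hp; omega

/-- The indices of the vertices of those runs that are prescribed for the path `q` by the
preceding paths. -/
abbrev RunIdx (th : Fin k → PathName) (ℓ : Fin k → ℕ) (q : PathName) : Type :=
  Σ j : {j : Fin k // (th j).right = q}, Fin (ℓ j + 1)

theorem card_runIdx (th : Fin k → PathName) (ℓ : Fin k → ℕ) (q : PathName) :
    Fintype.card (RunIdx th ℓ q) = ∑ j, if (th j).right = q then ℓ j + 1 else 0 := by
  rw [Fintype.card_sigma, ← Finset.sum_filter]
  simp only [Fintype.card_fin]
  rw [Finset.sum_subtype (p := fun j => (th j).right = q)]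
  intro x; simp

/-- The position of a prescribed vertex in the path `q`. -/
def runPos (m : ℕ) (s : Fin k → PathName → ℕ) (q : PathName) (t : RunIdx th ℓ q) : Fin (m + 1) :=
  Fin.ofNat (m + 1) (s t.1 q + t.2)

/-- The prescribed vertex. -/
def runVal (σ : PathName → HamPath (m + 1)) (dir : Fin k → Bool) (s : Fin k → PathName → ℕ)
    (q : PathName) (t : RunIdx th ℓ q) : Fin (m + 1) :=
  (σ (th t.1).left).vtx (s t.1 (th t.1).left + (if dir t.1 then ℓ t.1 - t.2 else t.2))

theorem right_ne_of_eq {x q : PathName} (h : x.right = q) : q ≠ x := h ▸ x.right_ne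

theorem RunPositions.runPos_val (P : RunPositions m th dir ℓ s) {q : PathName}
    (t : RunIdx th ℓ q) : (runPos m s q t : ℕ) = s t.1 q + t.2 := by
  have h1 := P.fits t.1 q (right_ne_of_eq t.1.2)
  have h2 := t.2.2
  simp only [runPos, Fin.val_ofNat]
  exact Nat.mod_eq_of_lt (by omega)

theorem RunPositions.runPos_injective (P : RunPositions m th dir ℓ s) (q : PathName) :
    Function.Injective (runPos m s q : RunIdx th ℓ q → _) := by
  rintro ⟨⟨j, hj⟩, r⟩ ⟨⟨j', hj'⟩, r'⟩ h
  have h1 := P.runPos_val (q := q) ⟨⟨j, hj⟩, r⟩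
  have h2 := P.runPos_val (q := q) ⟨⟨j', hj'⟩, r'⟩
  rw [h, h2] at h1
  obtain ⟨rfl, h3⟩ := P.unique (right_ne_of_eq hj') (right_ne_of_eq hj)
    (Nat.lt_succ_iff.1 r'.2) (Nat.lt_succ_iff.1 r.2) h1
  have : r' = r := Fin.ext h3
  rw [this]

/-- The prescribed positions. -/
def runSet (m : ℕ) (th : Fin k → PathName) (ℓ : Fin k → ℕ) (s : Fin k → PathName → ℕ)
    (q : PathName) : Finset (Fin (m + 1)) :=
  Finset.univ.image (runPos m s q : RunIdx th ℓ q → _)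

/-- The prescribed vertices as a function of the position. -/
noncomputable def runFun (σ : PathName → HamPath (m + 1)) (th : Fin k → PathName)
    (dir : Fin k → Bool) (ℓ : Fin k → ℕ) (s : Fin k → PathName → ℕ)
    (q : PathName) : Fin (m + 1) → Fin (m + 1) :=
  Function.extend (runPos m s q : RunIdx th ℓ q → _) (runVal σ dir s q) id

theorem RunPositions.card_runSet (P : RunPositions m th dir ℓ s) (q : PathName) :
    (runSet m th ℓ s q).card = Fintype.card (RunIdx th ℓ q) := by
  rw [runSet, Finset.card_image_of_injective _ (P.runPos_injective q), Finset.card_univ]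

theorem RunPositions.runFun_runPos (P : RunPositions m th dir ℓ s)
    (σ : PathName → HamPath (m + 1)) {q : PathName} (t : RunIdx th ℓ q) :
    runFun σ th dir ℓ s q (runPos m s q t) = runVal σ dir s q t :=
  (P.runPos_injective q).extend_apply _ _ _

theorem RunPositions.mem_runSet (P : RunPositions m th dir ℓ s) {q : PathName} {i : Fin (m + 1)} :
    i ∈ runSet m th ℓ s q ↔ ∃ j, (th j).right = q ∧ ∃ r ≤ ℓ j, (i : ℕ) = s j q + r := by
  rw [runSet, Finset.mem_image]
  constructor
  · rintro ⟨t, _, rfl⟩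
    exact ⟨t.1, t.1.2, t.2, Nat.lt_succ_iff.1 t.2.2, P.runPos_val t⟩
  · rintro ⟨j, hj, r, hr, h⟩
    exact ⟨⟨⟨j, hj⟩, ⟨r, Nat.lt_succ_of_le hr⟩⟩, Finset.mem_univ _, Fin.ext (by
      rw [P.runPos_val, h])⟩

theorem RunPositions.mem_extensions_iff (P : RunPositions m th dir ℓ s)
    {σ : PathName → HamPath (m + 1)} {q : PathName} {ρ : HamPath (m + 1)} :
    ρ ∈ extensions (runSet m th ℓ s q) (runFun σ th dir ℓ s q) ↔
      ∀ j, (th j).right = q → ∀ r ≤ ℓ j, ρ.vtx (s j q + r) =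
        (σ (th j).left).vtx (s j (th j).left + (if dir j then ℓ j - r else r)) := by
  rw [mem_extensions]
  constructor
  · intro h j hj r hr
    have := h (runPos m s q ⟨⟨j, hj⟩, ⟨r, Nat.lt_succ_of_le hr⟩⟩)
      (Finset.mem_image_of_mem _ (Finset.mem_univ _))
    rw [P.runFun_runPos, ← HamPath.vtx_val, P.runPos_val] at this
    exact this
  · intro h i hi
    obtain ⟨t, _, rfl⟩ := Finset.mem_image.1 hi
    rw [P.runFun_runPos, ← HamPath.vtx_val, P.runPos_val]
    exact h t.1 t.1.2 t.2 (Nat.lt_succ_iff.1 t.2.2)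

/-- `p` precedes `q`. -/
def PathName.Before (p q : PathName) : Prop := (p = .A ∧ q ≠ .A) ∨ (p = .B ∧ q = .C)

theorem PathName.Before.ne {p q : PathName} (h : p.Before q) : p ≠ q := by
  rcases h with ⟨rfl, h⟩ | ⟨rfl, rfl⟩
  · exact h.symm
  · decide

theorem PathName.before_left_right (x : PathName) : x.left.Before x.right := by
  cases x <;> simp [PathName.Before, PathName.left, PathName.right]

/-- The vertices of a run missing from `x` are thus always prescribed for the later of its two
paths, which is `x.right`. -/
theorem PathName.Before.right_eq {p q x : PathName} (h : p.Before q) (hp : p ≠ x) (hq : q ≠ x) :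
    x.right = q := by
  rcases h with ⟨rfl, h⟩ | ⟨rfl, rfl⟩
  · cases x <;> cases q <;> simp_all [PathName.right]
  · cases x <;> simp_all [PathName.right]

/-- The paths `p` and `q` have no common edges other than those of the given runs. -/
def ExactPair (σ : PathName → HamPath (m + 1)) (th : Fin k → PathName) (ℓ : Fin k → ℕ)
    (s : Fin k → PathName → ℕ) (p q : PathName) : Prop :=
  ∀ i < m, ∀ i' < m, (σ p).edge i = (σ q).edge i' →
    ∃ j, p ≠ th j ∧ q ≠ th j ∧ ∃ r < ℓ j, i = s j p + r ∧ i' = s j q + r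

theorem ExactPair.symm {σ : PathName → HamPath (m + 1)} {p q : PathName}
    (h : ExactPair σ th ℓ s p q) : ExactPair σ th ℓ s q p := by
  intro i hi i' hi' he
  obtain ⟨j, h1, h2, r, hr, h3, h4⟩ := h i' hi' i hi he.symm
  exact ⟨j, h2, h1, r, hr, h4, h3⟩

/-- There are at least two private edges between any two runs of a path. -/
def StronglySeparated (th : Fin k → PathName) (ℓ : Fin k → ℕ) (s : Fin k → PathName → ℕ) : Prop :=
  ∀ j j', j < j' → ∀ p, p ≠ th j → p ≠ th j' → s j p + ℓ j + 1 < s j' p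

/-- Adjacency along some path preceding `q`. -/
def AdjBefore (σ : PathName → HamPath (m + 1)) (q : PathName) (u v : Fin (m + 1)) : Prop :=
  ∃ p : PathName, p.Before q ∧ (σ p).AdjIn u v

open scoped Classical in
-- The edges between two consecutive prescribed positions are exactly the edges of runs prescribed
-- for `q`, so having no unintended edge in common with an earlier path is the same as avoiding
-- adjacency elsewhere.
theorem RunPositions.mem_avoiding_iff (P : RunPositions m th dir ℓ s)
    (hs : StronglySeparated th ℓ s) {σ : PathName → HamPath (m + 1)} {q : PathName}
    (hq : σ q ∈ extensions (runSet m th ℓ s q) (runFun σ th dir ℓ s q))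
    (hbef : ∀ p p' : PathName, p.Before q → p'.Before q → p ≠ p' → ExactPair σ th ℓ s p p') :
    σ q ∈ avoiding (runSet m th ℓ s q) (runFun σ th dir ℓ s q) (AdjBefore σ q) ↔
      ∀ p : PathName, p.Before q → ExactPair σ th ℓ s p q := by
  rw [avoiding, Finset.mem_filter]
  have hext := P.mem_extensions_iff.1 hq
  constructor
  · rintro ⟨-, h⟩ p hp i hi i' hi' he
    have h' := h ⟨i', hi'⟩
    have hadj : AdjBefore σ q (σ q (Fin.castSucc ⟨i', hi'⟩)) (σ q (Fin.succ ⟨i', hi'⟩)) := by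
      refine ⟨p, hp, ?_⟩
      rw [HamPath.AdjIn, ← HamPath.vtx_val, ← HamPath.vtx_val]
      simp only [Fin.val_castSucc, Fin.val_succ]
      exact ((σ p).mem_edges_iff _).2 ⟨i, hi, he.symm⟩
    have hI := not_not.1 (mt h' (not_not.2 hadj))
    obtain ⟨⟨j, hj, r, hr, h1⟩, ⟨j', hj', r', hr', h2⟩⟩ := hI.imp P.mem_runSet.1 P.mem_runSet.1
    simp only [Fin.val_castSucc, Fin.val_succ] at h1 h2
    -- Strong separation is used here: with a single private edge between two runs, the end of one
    -- and the start of the next would be consecutive prescribed positions.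
    have hjj : j = j' := by
      rcases lt_trichotomy j j' with hlt | heq | hlt
      · have := hs j j' hlt q (right_ne_of_eq hj) (right_ne_of_eq hj'); omega
      · exact heq
      · have := hs j' j hlt q (right_ne_of_eq hj') (right_ne_of_eq hj); omega
    subst hjj
    have hrl : r < ℓ j := by omega
    have hqj := right_ne_of_eq hj
    have hag : ∀ r, r ≤ ℓ j → (σ (th j).right).vtx (s j (th j).right + r) =
        (σ (th j).left).vtx (s j (th j).left + (if dir j then ℓ j - r else r)) := by
      intro r hr
      have := hext j hj r hr
      rw [hj]; exact this
    -- If `p` is the path missing from run `j`, the edge also lies on the other earlier path.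
    -- Exactness of that pair puts it in a run containing `p`, which has to be run `j`, a
    -- contradiction.
    by_cases hpj : p = th j
    · have hl : (th j).left.Before q := hj ▸ (th j).before_left_right
      have hne : p ≠ (th j).left := by rw [hpj]; exact (th j).left_ne.symm
      have he2 := edge_eq_of_agree hag (P.opp j) hrl hqj (th j).left_ne
      rw [h1, he2] at he
      have hfit := P.fits j _ (th j).left_ne
      obtain ⟨j', h3, h4, r'', hr'', h5, h6⟩ := hbef p _ hp hl hne i hi _ (by omega) he
      obtain ⟨rfl, -⟩ := P.unique (th j).left_ne h4 hrl.le hr''.le h6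
      exact absurd hpj h3
    · refine ⟨j, hpj, hqj, r, hrl, ?_, h1⟩
      rw [h1, edge_eq_of_agree hag (P.opp j) hrl hqj hpj] at he
      have hfit := P.fits j p hpj
      exact (σ p).edge_inj hi (by omega) he
  · intro h
    refine ⟨hq, fun i hi hadj => hi ?_⟩
    obtain ⟨p, hp, hadj⟩ := hadj
    obtain ⟨i₀, hi₀, he⟩ := ((σ p).mem_edges_iff _).1 hadj
    have he' : (σ p).edge i₀ = (σ q).edge i := by
      rw [← he, HamPath.edge, ← HamPath.vtx_val, ← HamPath.vtx_val]
      simp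
    obtain ⟨j, h1, h2, r, hr, h3, h4⟩ := h p hp i₀ hi₀ i i.2 he'
    have hj := hp.right_eq h1 h2
    exact ⟨P.mem_runSet.2 ⟨j, hj, r, hr.le, by simpa using h4⟩,
      P.mem_runSet.2 ⟨j, hj, r + 1, hr, by simp [h4]; ring⟩⟩

end Labelings

/-! ### Counting the labelings path by path -/

section Labelings

open Finset

/-- The function on path names with the given values. -/
def triple {X : Type*} (a b c : X) : PathName → X
  | .A => a
  | .B => b
  | .C => c

variable {m k : ℕ} {th : Fin k → PathName} {dir : Fin k → Bool} {ℓ : Fin k → ℕ}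
  {s : Fin k → PathName → ℕ}

/-- Only the paths before `q` matter. This permits `triple a a a` and `triple a b b`, in which the
entries of paths not yet chosen are mere placeholders. -/
theorem runFun_congr {σ σ' : PathName → HamPath (m + 1)} {q : PathName}
    (h : ∀ p : PathName, p.Before q → σ p = σ' p) :
    runFun σ th dir ℓ s q = runFun σ' th dir ℓ s q := by
  have : (runVal σ dir s q : RunIdx th ℓ q → _) = runVal σ' dir s q := by
    funext t
    have hb := (th t.1).before_left_right
    rw [t.1.2] at hb
    rw [runVal, runVal, h _ hb]
  rw [runFun, runFun, this]

theorem adjBefore_congr {σ σ' : PathName → HamPath (m + 1)} {q : PathName}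
    (h : ∀ p : PathName, p.Before q → σ p = σ' p) : AdjBefore σ q = AdjBefore σ' q := by
  funext u v
  exact propext ⟨fun ⟨p, hp, hv⟩ => ⟨p, hp, h p hp ▸ hv⟩, fun ⟨p, hp, hv⟩ => ⟨p, hp, h p hp ▸ hv⟩⟩

theorem PathName.not_before_A (p : PathName) : ¬ p.Before .A := by
  cases p <;> simp [PathName.Before]
theorem PathName.before_B_iff (p : PathName) : p.Before .B ↔ p = .A := by
  cases p <;> simp [PathName.Before]
theorem PathName.before_C_iff (p : PathName) : p.Before .C ↔ p = .A ∨ p = .B := by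
  cases p <;> simp [PathName.Before]

theorem hasRuns_iff (P : RunPositions m th dir ℓ s) (σ : PathName → HamPath (m + 1)) :
    HasRuns σ th dir ℓ s ↔
      (∀ q, σ q ∈ extensions (runSet m th ℓ s q) (runFun σ th dir ℓ s q)) ∧
      ∀ p q : PathName, p.Before q → ExactPair σ th ℓ s p q := by
  constructor
  · intro h
    refine ⟨fun q => P.mem_extensions_iff.2 fun j hj r hr => ?_, fun p q hpq => h.exact p q hpq.ne⟩
    subst hj; exact h.agree j r hr
  · rintro ⟨h1, h2⟩
    refine ⟨fun j r hr => P.mem_extensions_iff.1 (h1 (th j).right) j rfl r hr, fun p q hpq => ?_⟩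
    rcases (by revert hpq; cases p <;> cases q <;> simp [PathName.Before] :
      p.Before q ∨ q.Before p) with h | h
    · exact h2 p q h
    · exact ExactPair.symm (h2 q p h)

/-- The second path given the first one, without regard to further common edges. -/
noncomputable def extB (th : Fin k → PathName) (dir : Fin k → Bool) (ℓ : Fin k → ℕ)
    (s : Fin k → PathName → ℕ) (a : HamPath (m + 1)) : Finset (HamPath (m + 1)) :=
  extensions (runSet m th ℓ s .B) (runFun (triple a a a) th dir ℓ s .B)

/-- The third path given the first two, without regard to further common edges. -/
noncomputable def extC (th : Fin k → PathName) (dir : Fin k → Bool) (ℓ : Fin k → ℕ)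
    (s : Fin k → PathName → ℕ) (a b : HamPath (m + 1)) : Finset (HamPath (m + 1)) :=
  extensions (runSet m th ℓ s .C) (runFun (triple a b b) th dir ℓ s .C)

open scoped Classical in
/-- The second path given the first one. -/
noncomputable def avoidB (th : Fin k → PathName) (dir : Fin k → Bool) (ℓ : Fin k → ℕ)
    (s : Fin k → PathName → ℕ) (a : HamPath (m + 1)) : Finset (HamPath (m + 1)) :=
  avoiding (runSet m th ℓ s .B) (runFun (triple a a a) th dir ℓ s .B) (AdjBefore (triple a a a) .B)

open scoped Classical in
/-- The third path given the first two. -/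
noncomputable def avoidC (th : Fin k → PathName) (dir : Fin k → Bool) (ℓ : Fin k → ℕ)
    (s : Fin k → PathName → ℕ) (a b : HamPath (m + 1)) : Finset (HamPath (m + 1)) :=
  avoiding (runSet m th ℓ s .C) (runFun (triple a b b) th dir ℓ s .C) (AdjBefore (triple a b b) .C)

theorem runFun_triple_B (a b c : HamPath (m + 1)) :
    runFun (triple a b c) th dir ℓ s .B = runFun (triple a a a) th dir ℓ s .B :=
  runFun_congr fun p hp => by rw [(PathName.before_B_iff p).1 hp]; rfl

theorem runFun_triple_C (a b c : HamPath (m + 1)) :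
    runFun (triple a b c) th dir ℓ s .C = runFun (triple a b b) th dir ℓ s .C :=
  runFun_congr fun p hp => by rcases (PathName.before_C_iff p).1 hp with rfl | rfl <;> rfl

theorem hasRuns_triple_imp (P : RunPositions m th dir ℓ s) {a b c : HamPath (m + 1)}
    (h : HasRuns (triple a b c) th dir ℓ s) : b ∈ extB th dir ℓ s a ∧ c ∈ extC th dir ℓ s a b := by
  have h1 := ((hasRuns_iff P _).1 h).1
  have hB := h1 .B
  have hC := h1 .C
  rw [runFun_triple_B] at hB
  rw [runFun_triple_C] at hC
  exact ⟨hB, hC⟩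

theorem avoidB_subset (a : HamPath (m + 1)) : avoidB th dir ℓ s a ⊆ extB th dir ℓ s a := by
  classical
  unfold avoidB extB
  convert avoiding_subset _ _ _

theorem avoidC_subset (a b : HamPath (m + 1)) :
    avoidC th dir ℓ s a b ⊆ extC th dir ℓ s a b := by
  classical
  unfold avoidC extC
  convert avoiding_subset _ _ _

theorem mem_avoidB_iff (P : RunPositions m th dir ℓ s) (hs : StronglySeparated th ℓ s)
    {a b : HamPath (m + 1)} (c : HamPath (m + 1)) (hb : b ∈ extB th dir ℓ s a) :
    b ∈ avoidB th dir ℓ s a ↔ ExactPair (triple a b c) th ℓ s .A .B := by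
  classical
  have h1 : triple a b c .B ∈ extensions (runSet m th ℓ s .B)
      (runFun (triple a b c) th dir ℓ s .B) := by
    rw [runFun_triple_B]; exact hb
  have h2 := P.mem_avoiding_iff hs h1 (by
    intro p p' hp hp' hne
    rw [PathName.before_B_iff] at hp hp'
    exact absurd (hp.trans hp'.symm) hne)
  rw [runFun_triple_B, adjBefore_congr (σ' := triple a a a) (fun p hp => by
    rw [(PathName.before_B_iff p).1 hp]; rfl)] at h2
  unfold avoidB
  constructor
  · intro h
    refine h2.1 ?_ .A (by simp [PathName.Before])
    convert h
    rfl
  · intro h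
    have := h2.2 fun p hp => by
      rw [(PathName.before_B_iff p).1 hp]; exact h
    convert this
    rfl

/-- The description of the admissible third paths presupposes that the first two have only the
intended common edges; so the conditions are imposed in the order in which the paths are chosen. -/
theorem hasRuns_triple_iff (P : RunPositions m th dir ℓ s) (hs : StronglySeparated th ℓ s)
    (a b c : HamPath (m + 1)) : HasRuns (triple a b c) th dir ℓ s ↔
      b ∈ avoidB th dir ℓ s a ∧ c ∈ avoidC th dir ℓ s a b := by
  classical
  have key : b ∈ avoidB th dir ℓ s a → c ∈ extC th dir ℓ s a b →
      (c ∈ avoidC th dir ℓ s a b ↔ ∀ p : PathName, p.Before .C →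
        ExactPair (triple a b c) th ℓ s p .C) := by
    intro hb hc
    have hbe := (mem_avoidB_iff P hs c (avoidB_subset a hb)).1 hb
    have h1 : triple a b c .C ∈ extensions (runSet m th ℓ s .C)
        (runFun (triple a b c) th dir ℓ s .C) := by
      rw [runFun_triple_C]; exact hc
    have h2 := P.mem_avoiding_iff hs h1 (by
      intro p p' hp hp' hne
      rw [PathName.before_C_iff] at hp hp'
      rcases hp with rfl | rfl <;> rcases hp' with rfl | rfl
      · exact absurd rfl hne
      · exact hbe
      · exact hbe.symm
      · exact absurd rfl hne)
    rw [runFun_triple_C, adjBefore_congr (σ' := triple a b b) (fun p hp => by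
      rcases (PathName.before_C_iff p).1 hp with rfl | rfl <;> rfl)] at h2
    rw [← h2]
    unfold avoidC
    constructor <;> intro h <;> convert h <;> rfl
  constructor
  · intro h
    obtain ⟨hb, hc⟩ := hasRuns_triple_imp P h
    have hb' : b ∈ avoidB th dir ℓ s a :=
      (mem_avoidB_iff P hs c hb).2 (h.exact _ _ (by decide))
    exact ⟨hb', (key hb' hc).2 fun p hp => h.exact p _ hp.ne⟩
  · rintro ⟨hb, hc⟩
    have hbe := avoidB_subset a hb
    have hce : c ∈ extC th dir ℓ s a b := avoidC_subset a b hc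
    have hC := (key hb hce).1 hc
    rw [hasRuns_iff P]
    refine ⟨fun q => ?_, fun p q hpq => ?_⟩
    · cases q
      · rw [mem_extensions]
        intro i hi
        obtain ⟨j, hj, -⟩ := P.mem_runSet.1 hi
        have hA : ∀ x : PathName, x.right ≠ .A := by intro x; cases x <;> decide
        exact absurd hj (hA _)
      · rw [runFun_triple_B]; exact hbe
      · rw [runFun_triple_C]; exact hce
    · cases q
      · exact absurd hpq p.not_before_A
      · rw [(PathName.before_B_iff p).1 hpq]
        exact (mem_avoidB_iff P hs c hbe).1 hb
      · exact hC p hpq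

open scoped Classical in
/-- The triples of paths whose common edges form the given runs. -/
noncomputable def labelings (m : ℕ) (th : Fin k → PathName) (dir : Fin k → Bool) (ℓ : Fin k → ℕ)
    (s : Fin k → PathName → ℕ) : Finset (PathName → HamPath (m + 1)) :=
  univ.filter fun σ => HasRuns σ th dir ℓ s

/-- Functions on path names as triples. -/
def tripleEquiv (X : Type*) : X × X × X ≃ (PathName → X) where
  toFun t := triple t.1 t.2.1 t.2.2
  invFun f := (f .A, f .B, f .C)
  left_inv _ := rfl
  right_inv f := by funext p; cases p <;> rfl

open scoped Classical in
theorem card_labelings :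
    (labelings m th dir ℓ s).card = ∑ a : HamPath (m + 1), ∑ b : HamPath (m + 1),
      (univ.filter fun c => HasRuns (triple a b c) th dir ℓ s).card := by
  rw [labelings, Finset.card_filter, ← Equiv.sum_comp (tripleEquiv (HamPath (m + 1))),
    Fintype.sum_prod_type]
  refine Finset.sum_congr rfl fun a _ => ?_
  rw [Fintype.sum_prod_type]
  refine Finset.sum_congr rfl fun b _ => ?_
  rw [Finset.card_filter]
  rfl

/-- The number of vertices of the runs prescribed for `q`. -/
def runSize (th : Fin k → PathName) (ℓ : Fin k → ℕ) (q : PathName) : ℕ :=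
  ∑ j, if (th j).right = q then ℓ j + 1 else 0

theorem RunPositions.card_runSet' (P : RunPositions m th dir ℓ s) (q : PathName) :
    (runSet m th ℓ s q).card = runSize th ℓ q := by
  rw [P.card_runSet, card_runIdx, runSize]

theorem card_extB_le (P : RunPositions m th dir ℓ s) (a : HamPath (m + 1)) :
    (extB th dir ℓ s a).card ≤ (m + 1 - runSize th ℓ .B).factorial := by
  rw [← P.card_runSet']; exact card_extensions_le _ _

theorem card_extC_le (P : RunPositions m th dir ℓ s) (a b : HamPath (m + 1)) :
    (extC th dir ℓ s a b).card ≤ (m + 1 - runSize th ℓ .C).factorial := by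
  rw [← P.card_runSet']; exact card_extensions_le _ _

/-- The crude bound, needing no strong separation; it serves for the few words whose runs are close
to each other. -/
theorem card_labelings_le (P : RunPositions m th dir ℓ s) :
    (labelings m th dir ℓ s).card ≤ (m + 1).factorial *
      ((m + 1 - runSize th ℓ .B).factorial * (m + 1 - runSize th ℓ .C).factorial) := by
  classical
  rw [card_labelings]
  calc _ ≤ ∑ a : HamPath (m + 1), ∑ b ∈ extB th dir ℓ s a,
        (m + 1 - runSize th ℓ .C).factorial := by
        refine Finset.sum_le_sum fun a _ => ?_
        rw [← Finset.sum_subset (Finset.subset_univ (extB th dir ℓ s a))]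
        · refine Finset.sum_le_sum fun b _ => ?_
          refine (Finset.card_le_card fun c hc => ?_).trans (card_extC_le P a b)
          exact (hasRuns_triple_imp P (Finset.mem_filter.1 hc).2).2
        · intro b _ hb
          rw [Finset.card_eq_zero, Finset.filter_eq_empty_iff]
          exact fun c _ hc => hb (hasRuns_triple_imp P hc).1
    _ ≤ ∑ a : HamPath (m + 1), (m + 1 - runSize th ℓ .B).factorial *
          (m + 1 - runSize th ℓ .C).factorial := by
        refine Finset.sum_le_sum fun a _ => ?_
        rw [Finset.sum_const, smul_eq_mul]
        exact Nat.mul_le_mul_right _ (card_extB_le P a)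
    _ = _ := by
        rw [Finset.sum_const, smul_eq_mul, Finset.card_univ, Fintype.card_perm, Fintype.card_fin]

/-- Two prescribed vertices that are inherited from the same path occupy different positions on it.
Hence for the second path, which inherits only from the first, there are no collisions at all. -/
theorem runVal_eq_imp (P : RunPositions m th dir ℓ s) {σ : PathName → HamPath (m + 1)}
    {q : PathName} {t t' : RunIdx th ℓ q} (h : runVal σ dir s q t = runVal σ dir s q t')
    (hl : (th t.1).left = (th t'.1).left) : t = t' := by
  obtain ⟨⟨j, hj⟩, r⟩ := t
  obtain ⟨⟨j', hj'⟩, r'⟩ := t'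
  simp only [runVal] at h hl
  have hr : (r : ℕ) ≤ ℓ j := Nat.lt_succ_iff.1 r.2
  have hr' : (r' : ℕ) ≤ ℓ j' := Nat.lt_succ_iff.1 r'.2
  have hf := P.fits j _ (th j).left_ne
  have hf' := P.fits j' _ (th j').left_ne
  rw [← hl] at h hf'
  have hb1 : (if dir j then ℓ j - r else (r : ℕ)) ≤ ℓ j := by split_ifs <;> omega
  have hb2 : (if dir j' then ℓ j' - r' else (r' : ℕ)) ≤ ℓ j' := by split_ifs <;> omega
  have h1 := (σ (th j).left).vtx_inj (by omega) (by omega) h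
  obtain ⟨rfl, h2⟩ := P.unique (th j).left_ne (hl ▸ (th j').left_ne) hb1 hb2 h1
  have : r = r' := by
    ext
    split_ifs at h2 <;> omega
  rw [this]

theorem injOn_runFun_iff (P : RunPositions m th dir ℓ s) {σ : PathName → HamPath (m + 1)}
    {q : PathName} : Set.InjOn (runFun σ th dir ℓ s q) (runSet m th ℓ s q) ↔
      Function.Injective (runVal σ dir s q : RunIdx th ℓ q → _) := by
  constructor
  · intro h t t' ht
    apply P.runPos_injective q
    refine h ?_ ?_ ?_
    · exact Finset.mem_coe.2 (Finset.mem_image_of_mem _ (Finset.mem_univ _))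
    · exact Finset.mem_coe.2 (Finset.mem_image_of_mem _ (Finset.mem_univ _))
    · rw [P.runFun_runPos, P.runFun_runPos, ht]
  · intro h i hi i' hi' he
    obtain ⟨t, _, rfl⟩ := Finset.mem_image.1 (Finset.mem_coe.1 hi)
    obtain ⟨t', _, rfl⟩ := Finset.mem_image.1 (Finset.mem_coe.1 hi')
    rw [P.runFun_runPos, P.runFun_runPos] at he
    rw [h he]

/-- For `b < n` this is `n ≤ (b + 1) (n - b)`. For `b ≥ n` both factorials are one by truncated
subtraction. -/
theorem factorial_pred_mul_le (n b : ℕ) :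
    (n - b - 1).factorial * n ≤ (b + 1) * (n - b).factorial := by
  rcases Nat.lt_or_ge b n with h | h
  · obtain ⟨d, rfl⟩ := Nat.exists_eq_add_of_lt h
    have e1 : b + d + 1 - b = d + 1 := by omega
    rw [e1, Nat.factorial_succ]
    simp only [Nat.add_sub_cancel]
    nlinarith [Nat.factorial_pos d, Nat.zero_le (b * d * d.factorial)]
  · have e1 : n - b = 0 := by omega
    rw [e1]; simp; omega

/-- The second paths for which the vertices prescribed for the third path coincide. -/
theorem card_collisions_mul_le (P : RunPositions m th dir ℓ s) (a : HamPath (m + 1)) :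
    ∃ S : Finset (HamPath (m + 1)), (∀ b ∈ extB th dir ℓ s a, b ∉ S →
      Function.Injective (runVal (triple a b b) dir s .C : RunIdx th ℓ .C → _)) ∧
      S.card * (m + 1) ≤ runSize th ℓ .C * runSize th ℓ .C * ((runSize th ℓ .B + 1) *
        (m + 1 - runSize th ℓ .B).factorial) := by
  classical
  -- Only a vertex that the third path inherits from the first and one that it inherits from the
  -- second can coincide. Each such pair forces one value of the second path.
  set Q := (univ : Finset (RunIdx th ℓ .C × RunIdx th ℓ .C)).filter
    fun t => (th t.1.1).left = .A ∧ (th t.2.1).left = .B with hQ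
  set pos : RunIdx th ℓ .C → Fin (m + 1) := fun t => Fin.ofNat (m + 1)
    (s t.1 .B + (if dir t.1 then ℓ t.1 - t.2 else t.2)) with hpos
  refine ⟨Q.biUnion fun t => (extB th dir ℓ s a).filter fun b =>
    b (pos t.2) = runVal (triple a a a) dir s .C t.1, ?_, ?_⟩
  · intro b hb hS t t' h
    have hleft : ∀ x : PathName, x.right = .C → x.left = .A ∨ x.left = .B := by
      intro x; cases x <;> decide
    have main : ∀ t t' : RunIdx th ℓ .C, runVal (triple a b b) dir s .C t =
        runVal (triple a b b) dir s .C t' → (th t.1).left = .A → (th t'.1).left = .B → False := by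
      intro t t' h hA hB
      refine hS (Finset.mem_biUnion.2 ⟨(t, t'), by simp [hQ, hA, hB],
        Finset.mem_filter.2 ⟨hb, ?_⟩⟩)
      have e1 : runVal (triple a a a) dir s .C t = runVal (triple a b b) dir s .C t := by
        simp only [runVal, hA]; rfl
      rw [e1, h]
      simp only [runVal, hB, hpos]
      rfl
    rcases hleft _ t.1.2 with hA | hB <;> rcases hleft _ t'.1.2 with hA' | hB'
    · exact runVal_eq_imp P h (hA.trans hA'.symm)
    · exact (main t t' h hA hB').elim
    · exact (main t' t h.symm hA' hB).elim
    · exact runVal_eq_imp P h (hB.trans hB'.symm)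
  · have h1 : ∀ t ∈ Q, ((extB th dir ℓ s a).filter fun b =>
        b (pos t.2) = runVal (triple a a a) dir s .C t.1).card ≤
        (m + 1 - runSize th ℓ .B - 1).factorial := by
      intro t ht
      rw [← P.card_runSet']
      refine card_extensions_value_le _ _ ?_ _
      -- The forced position is a free one: positions of the second path are prescribed only by runs
      -- missing from the third path, which are disjoint from those missing from the first.
      intro hmem
      obtain ⟨j, hj, r, hr, h⟩ := P.mem_runSet.1 hmem
      have hB := (Finset.mem_filter.1 ht).2.2
      have hne : PathName.B ≠ th t.2.1 := hB ▸ (th t.2.1).left_ne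
      have hb1 : (if dir t.2.1 then ℓ t.2.1 - t.2.2 else (t.2.2 : ℕ)) ≤ ℓ t.2.1 := by
        have := t.2.2.2
        split_ifs <;> omega
      have hf := P.fits t.2.1 .B hne
      have hval : (pos t.2 : ℕ) = s t.2.1 .B + (if dir t.2.1 then ℓ t.2.1 - t.2.2 else t.2.2) := by
        simp only [hpos, Fin.val_ofNat]
        exact Nat.mod_eq_of_lt (by omega)
      rw [hval] at h
      obtain ⟨h2, -⟩ := P.unique hne (right_ne_of_eq hj) hb1 hr h
      have hC := t.2.1.2
      rw [h2, hj] at hC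
      exact absurd hC (by decide)
    have h2 : (Q.biUnion fun t => (extB th dir ℓ s a).filter fun b =>
        b (pos t.2) = runVal (triple a a a) dir s .C t.1).card ≤
        runSize th ℓ .C * runSize th ℓ .C * (m + 1 - runSize th ℓ .B - 1).factorial := by
      refine Finset.card_biUnion_le.trans ((Finset.sum_le_sum h1).trans ?_)
      rw [Finset.sum_const, smul_eq_mul]
      refine Nat.mul_le_mul_right _ ((Finset.card_filter_le _ _).trans ?_)
      rw [Finset.card_univ, Fintype.card_prod, card_runIdx]
      exact le_rfl
    calc _ ≤ runSize th ℓ .C * runSize th ℓ .C * (m + 1 - runSize th ℓ .B - 1).factorial *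
          (m + 1) := Nat.mul_le_mul_right _ h2
      _ ≤ _ := by
          rw [mul_assoc]
          exact Nat.mul_le_mul_left _ (factorial_pred_mul_le _ _)

theorem adjBefore_B (a : HamPath (m + 1)) (σ : PathName → HamPath (m + 1)) (h : σ .A = a) :
    AdjBefore σ .B = a.AdjIn := by
  funext u v
  refine propext ⟨?_, fun hv => ⟨.A, by simp [PathName.Before], by rw [h]; exact hv⟩⟩
  rintro ⟨p, hp, hv⟩
  rw [(PathName.before_B_iff p).1 hp, h] at hv
  exact hv

theorem adjBefore_C (a b : HamPath (m + 1)) :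
    AdjBefore (triple a b b) .C = fun u v => a.AdjIn u v ∨ b.AdjIn u v := by
  funext u v
  refine propext ⟨?_, ?_⟩
  · rintro ⟨p, hp, hv⟩
    rcases (PathName.before_C_iff p).1 hp with rfl | rfl
    · exact Or.inl hv
    · exact Or.inr hv
  · rintro (hv | hv)
    · exact ⟨.A, by simp [PathName.Before], hv⟩
    · exact ⟨.B, by simp [PathName.Before], hv⟩

theorem adjBefore_irrefl (σ : PathName → HamPath (m + 1)) (q : PathName) (v : Fin (m + 1)) :
    ¬ AdjBefore σ q v v := fun ⟨p, _, h⟩ => (σ p).adjIn_irrefl v h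

theorem adjBefore_symm (σ : PathName → HamPath (m + 1)) (q : PathName) (u v : Fin (m + 1))
    (h : AdjBefore σ q u v) : AdjBefore σ q v u := by
  obtain ⟨p, hp, h⟩ := h
  exact ⟨p, hp, (σ p).adjIn_symm _ _ h⟩

open scoped Classical in
-- The degrees in the union of two paths add up to `4m`, less the contribution of the edges in both
-- paths, and these lie in runs prescribed for the second path.
theorem abs_degree_sum_C_sub_le (P : RunPositions m th dir ℓ s) (hs : StronglySeparated th ℓ s)
    {a b : HamPath (m + 1)} (hb : b ∈ avoidB th dir ℓ s a) :
    |(∑ v, ((univ.filter (AdjBefore (triple a b b) .C v)).card : ℝ)) - 4 * (m + 1)| ≤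
      4 + 2 * runSize th ℓ .B := by
  have hbe := (mem_avoidB_iff P hs b (avoidB_subset a hb)).1 hb
  have h1 : ∀ v, (univ.filter (AdjBefore (triple a b b) .C v)).card +
      (univ.filter fun w => a.AdjIn v w ∧ b.AdjIn v w).card =
      (univ.filter (a.AdjIn v)).card + (univ.filter (b.AdjIn v)).card := by
    intro v
    simp only [adjBefore_C]
    rw [Finset.filter_and, Finset.filter_or, Finset.card_union_add_card_inter]
  have h2 : ∑ v, (univ.filter fun w => a.AdjIn v w ∧ b.AdjIn v w).card ≤
      2 * runSize th ℓ .B := by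
    rw [← P.card_runSet', mul_comm, ← smul_eq_mul,
      ← Finset.card_image_of_injective _ b.injective, ← Finset.sum_const]
    rw [← Finset.sum_subset (Finset.subset_univ ((runSet m th ℓ s .B).image b))]
    · refine Finset.sum_le_sum fun v _ => le_trans (Finset.card_le_card ?_) (a.card_adjIn_le v)
      intro w hw
      rw [Finset.mem_filter] at hw ⊢
      exact ⟨hw.1, hw.2.1⟩
    · intro v _ hv
      rw [Finset.card_eq_zero, Finset.filter_eq_empty_iff]
      rintro w - ⟨h3, h4⟩
      obtain ⟨i, hi, hie⟩ := (a.mem_edges_iff _).1 h3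
      obtain ⟨i', hi', hie'⟩ := (b.mem_edges_iff _).1 h4
      obtain ⟨j, hjA, hjB, r, hr, -, h6⟩ := hbe i hi i' hi' (hie.symm.trans hie')
      have hj : (th j).right = .B := PathName.Before.right_eq (p := .A)
        (by simp [PathName.Before]) hjA hjB
      apply hv
      rw [HamPath.edge, Sym2.eq_iff] at hie'
      rcases hie' with ⟨h7, -⟩ | ⟨h7, -⟩
      · rw [h7, b.vtx_eq (by omega)]
        exact Finset.mem_image_of_mem _ (P.mem_runSet.2 ⟨j, hj, r, hr.le, h6⟩)
      · rw [h7, b.vtx_eq (by omega)]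
        exact Finset.mem_image_of_mem _ (P.mem_runSet.2 ⟨j, hj, r + 1, hr, by simp [h6]; ring⟩)
  have h3 : ∑ v, (univ.filter (AdjBefore (triple a b b) .C v)).card +
      ∑ v, (univ.filter fun w => a.AdjIn v w ∧ b.AdjIn v w).card = 2 * m + 2 * m := by
    rw [← Finset.sum_add_distrib, Finset.sum_congr rfl fun v _ => h1 v, Finset.sum_add_distrib,
      a.sum_card_adjIn, b.sum_card_adjIn]
  have h3' : ∑ v, ((univ.filter (AdjBefore (triple a b b) .C v)).card : ℝ) +
      ((∑ v, (univ.filter fun w => a.AdjIn v w ∧ b.AdjIn v w).card : ℕ) : ℝ) =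
        2 * m + 2 * m := by
    exact_mod_cast h3
  have h2' : ((∑ v, (univ.filter fun w => a.AdjIn v w ∧ b.AdjIn v w).card : ℕ) : ℝ) ≤
      2 * runSize th ℓ .B := by exact_mod_cast h2
  have h5 : (0 : ℝ) ≤ ((∑ v, (univ.filter fun w => a.AdjIn v w ∧ b.AdjIn v w).card : ℕ) : ℝ) :=
    Nat.cast_nonneg _
  rw [abs_le]
  constructor <;> linarith

/-- The number of triples with given, strongly separated runs is asymptotically independent of the
positions of the runs. -/
theorem exists_abs_card_labelings_sub_le (th : Fin k → PathName) (dir : Fin k → Bool)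
    (ℓ : Fin k → ℕ) : ∃ K : ℝ, 0 ≤ K ∧ ∀ (m : ℕ) (s : Fin k → PathName → ℕ),
      RunPositions m th dir ℓ s → StronglySeparated th ℓ s →
      |((labelings m th dir ℓ s).card : ℝ) - Real.exp (-6) * ((m + 1).factorial *
        ((m + 1 - runSize th ℓ .B).factorial * (m + 1 - runSize th ℓ .C).factorial))| ≤
      K / (m + 1) * ((m + 1).factorial *
        ((m + 1 - runSize th ℓ .B).factorial * (m + 1 - runSize th ℓ .C).factorial)) := by
  classical
  -- A path has maximal degree 2 and degree sum `2m = 2 (m + 1) - 2`. For the union of two paths the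
  -- maximal degree is 4 and the degree sum is close to `4 (m + 1)`. The constant `K₃` accounts for
  -- the collisions.
  obtain ⟨K₁, hK₁, H₁⟩ := exists_abs_card_avoiding_sub_le 2 (runSize th ℓ .B) 2 2
    (by norm_num) (by norm_num)
  obtain ⟨K₂, hK₂, H₂⟩ := exists_abs_card_avoiding_sub_le 4 (runSize th ℓ .C) 4
    (4 + 2 * runSize th ℓ .B) (by norm_num) (by positivity)
  set K₃ : ℝ := (runSize th ℓ .C * runSize th ℓ .C * (runSize th ℓ .B + 1) : ℝ) with hK₃
  refine ⟨K₁ + K₂ + K₃, by positivity, fun m s P hs => ?_⟩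
  set F₁ : ℝ := ((m + 1 - runSize th ℓ .B).factorial : ℝ) with hF₁
  set F₂ : ℝ := ((m + 1 - runSize th ℓ .C).factorial : ℝ) with hF₂
  have hm : (0 : ℝ) < m + 1 := by positivity
  have hF₁0 : 0 ≤ F₁ := Nat.cast_nonneg _
  have hF₂0 : 0 ≤ F₂ := Nat.cast_nonneg _
  have hB : ∀ a : HamPath (m + 1), |((avoidB th dir ℓ s a).card : ℝ) - Real.exp (-2) * F₁| ≤
      K₁ / (m + 1) * F₁ := by
    intro a
    refine H₁ m _ _ (AdjBefore (triple a a a) .B) (P.card_runSet' _) ?_ (adjBefore_irrefl _ _)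
      (adjBefore_symm _ _) ?_ ?_
    · rw [injOn_runFun_iff P]
      intro t t' h
      refine runVal_eq_imp P h ?_
      have hl : ∀ x : PathName, x.right = .B → x.left = .A := by intro x; cases x <;> decide
      rw [hl _ t.1.2, hl _ t'.1.2]
    · intro v
      simp only [adjBefore_B a (triple a a a) rfl]
      exact a.card_adjIn_le v
    · simp only [adjBefore_B a (triple a a a) rfl]
      rw [← Nat.cast_sum, a.sum_card_adjIn]
      push_cast
      rw [abs_le]; constructor <;> linarith
  have hC : ∀ a : HamPath (m + 1), ∀ b ∈ avoidB th dir ℓ s a,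
      Function.Injective (runVal (triple a b b) dir s .C : RunIdx th ℓ .C → _) →
      |((avoidC th dir ℓ s a b).card : ℝ) - Real.exp (-4) * F₂| ≤ K₂ / (m + 1) * F₂ := by
    intro a b hb hinj
    refine H₂ m _ _ (AdjBefore (triple a b b) .C) (P.card_runSet' _) ((injOn_runFun_iff P).2 hinj)
      (adjBefore_irrefl _ _) (adjBefore_symm _ _) ?_ ?_
    · intro v
      simp only [adjBefore_C]
      rw [Finset.filter_or]
      refine (Finset.card_union_le _ _).trans ?_
      have h1 := a.card_adjIn_le v
      have h2 := b.card_adjIn_le v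
      omega
    · exact abs_degree_sum_C_sub_le P hs hb
  have hC' : ∀ a b : HamPath (m + 1), |((avoidC th dir ℓ s a b).card : ℝ) -
      Real.exp (-4) * F₂| ≤ F₂ := by
    intro a b
    have h1 : ((avoidC th dir ℓ s a b).card : ℝ) ≤ F₂ := by
      rw [hF₂]
      exact_mod_cast (Finset.card_le_card (avoidC_subset a b)).trans (card_extC_le P a b)
    have h2 : Real.exp (-4) ≤ 1 := by rw [Real.exp_le_one_iff]; norm_num
    have h3 := Real.exp_pos (-4)
    have h4 : (0 : ℝ) ≤ (avoidC th dir ℓ s a b).card := Nat.cast_nonneg _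
    rw [abs_le]; constructor <;> nlinarith
  have hinner : ∀ a b : HamPath (m + 1),
      (univ.filter fun c => HasRuns (triple a b c) th dir ℓ s).card =
        if b ∈ avoidB th dir ℓ s a then (avoidC th dir ℓ s a b).card else 0 := by
    intro a b
    split_ifs with hb
    · congr 1
      ext c
      simp [hasRuns_triple_iff P hs, hb]
    · rw [Finset.card_eq_zero, Finset.filter_eq_empty_iff]
      intro c _ h
      exact hb ((hasRuns_triple_iff P hs a b c).1 h).1
  have hrow : ∀ a : HamPath (m + 1), |(∑ b ∈ avoidB th dir ℓ s a,
      ((avoidC th dir ℓ s a b).card : ℝ)) - Real.exp (-6) * (F₁ * F₂)| ≤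
      (K₁ + K₂ + K₃) / (m + 1) * (F₁ * F₂) := by
    intro a
    obtain ⟨S, hS, hScard⟩ := card_collisions_mul_le (dir := dir) P a
    have hSle : (S.card : ℝ) ≤ K₃ / (m + 1) * F₁ := by
      rw [div_mul_eq_mul_div, le_div_iff₀ hm, hK₃, hF₁, mul_assoc _ ((runSize th ℓ .B : ℝ) + 1)]
      exact_mod_cast hScard
    have hcard : ((avoidB th dir ℓ s a).card : ℝ) ≤ F₁ := by
      rw [hF₁]
      exact_mod_cast (Finset.card_le_card (avoidB_subset a)).trans (card_extB_le P a)
    -- The number of third paths is replaced by its approximation first, then the number of second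
    -- paths; the constants combine as `e⁻⁴ e⁻² = e⁻⁶`.
    have e1 : (∑ b ∈ avoidB th dir ℓ s a, ((avoidC th dir ℓ s a b).card : ℝ)) -
        Real.exp (-6) * (F₁ * F₂) =
        (∑ b ∈ avoidB th dir ℓ s a, (((avoidC th dir ℓ s a b).card : ℝ) - Real.exp (-4) * F₂)) +
        Real.exp (-4) * F₂ * (((avoidB th dir ℓ s a).card : ℝ) - Real.exp (-2) * F₁) := by
      rw [Finset.sum_sub_distrib, Finset.sum_const, nsmul_eq_mul,
        show (-6 : ℝ) = -4 + -2 by norm_num, Real.exp_add]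
      ring
    have e2 : |∑ b ∈ avoidB th dir ℓ s a, (((avoidC th dir ℓ s a b).card : ℝ) -
        Real.exp (-4) * F₂)| ≤ F₁ * (K₂ / (m + 1) * F₂) + K₃ / (m + 1) * F₁ * F₂ := by
      refine (Finset.abs_sum_le_sum_abs _ _).trans ?_
      calc _ ≤ ∑ b ∈ avoidB th dir ℓ s a, (K₂ / (m + 1) * F₂ + if b ∈ S then F₂ else 0) := by
            refine Finset.sum_le_sum fun b hb => ?_
            have h0 : 0 ≤ K₂ / (m + 1) * F₂ := by positivity
            split_ifs with hbS
            · have := hC' a b; linarith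
            · rw [add_zero]
              exact hC a b hb (hS b (avoidB_subset a hb) hbS)
        _ ≤ _ := by
            rw [Finset.sum_add_distrib, Finset.sum_const, nsmul_eq_mul, ← Finset.sum_filter,
              Finset.sum_const, nsmul_eq_mul]
            have h5 : (((avoidB th dir ℓ s a).filter fun b => b ∈ S).card : ℝ) ≤ S.card := by
              exact_mod_cast Finset.card_le_card fun b hb => (Finset.mem_filter.1 hb).2
            gcongr
            exact h5.trans hSle
    have e3 : |Real.exp (-4) * F₂ * (((avoidB th dir ℓ s a).card : ℝ) - Real.exp (-2) * F₁)| ≤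
        1 * F₂ * (K₁ / (m + 1) * F₁) := by
      rw [abs_mul, abs_of_nonneg (by positivity)]
      have h2 : Real.exp (-4) ≤ 1 := by rw [Real.exp_le_one_iff]; norm_num
      gcongr
      exact hB a
    rw [e1]
    refine (abs_add_le _ _).trans ((add_le_add e2 e3).trans (le_of_eq ?_))
    ring
  have htot : ((labelings m th dir ℓ s).card : ℝ) =
      ∑ a : HamPath (m + 1), ∑ b ∈ avoidB th dir ℓ s a, ((avoidC th dir ℓ s a b).card : ℝ) := by
    rw [card_labelings]
    push_cast
    refine Finset.sum_congr rfl fun a _ => ?_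
    simp_rw [hinner a]
    push_cast
    rw [← Finset.sum_filter]
    congr 1
    ext b; simp
  have hn : ((m + 1).factorial : ℝ) = (univ : Finset (HamPath (m + 1))).card := by
    rw [Finset.card_univ, Fintype.card_perm, Fintype.card_fin]
  have e1 : ((labelings m th dir ℓ s).card : ℝ) -
      Real.exp (-6) * ((m + 1).factorial * (F₁ * F₂)) = ∑ a : HamPath (m + 1),
        ((∑ b ∈ avoidB th dir ℓ s a, ((avoidC th dir ℓ s a b).card : ℝ)) -
          Real.exp (-6) * (F₁ * F₂)) := by
    rw [Finset.sum_sub_distrib, Finset.sum_const, nsmul_eq_mul, htot, hn]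
    ring
  rw [e1]
  refine (Finset.abs_sum_le_sum_abs _ _).trans ((Finset.sum_le_sum fun a _ => hrow a).trans ?_)
  rw [Finset.sum_const, nsmul_eq_mul, hn]
  exact le_of_eq (by ring)

end Labelings

/-! ### Multinomial coefficients near the diagonal -/

section Multinomial

open Finset

/-- `(|v| + k)! / (k! ∏ v_p!)`. -/
noncomputable def multinom (k : ℕ) (v : PathName → ℕ) : ℝ :=
  ((∑ p, v p + k).factorial : ℝ) / (k.factorial * ∏ p, ((v p).factorial : ℝ))

theorem multinom_pos (k : ℕ) (v : PathName → ℕ) : 0 < multinom k v := by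
  unfold multinom
  have h1 : (0 : ℝ) < ∏ p, ((v p).factorial : ℝ) :=
    Finset.prod_pos fun p _ => by exact_mod_cast Nat.factorial_pos _
  have h2 : (0 : ℝ) < ((∑ p, v p + k).factorial : ℝ) := by exact_mod_cast Nat.factorial_pos _
  positivity

theorem sum_update_succ (v : PathName → ℕ) (p : PathName) :
    ∑ q, Function.update v p (v p + 1) q = ∑ q, v q + 1 := by
  rw [Finset.sum_update_of_mem (mem_univ p), ← Finset.add_sum_erase _ v (mem_univ p),
    Finset.sdiff_singleton_eq_erase]
  ring

theorem multinom_update (k : ℕ) (v : PathName → ℕ) (p : PathName) :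
    multinom k (Function.update v p (v p + 1)) * (v p + 1) = multinom k v * (∑ q, v q + k + 1) := by
  have h2 : ∏ q, ((Function.update v p (v p + 1) q).factorial : ℝ) =
      (v p + 1) * ∏ q, ((v q).factorial : ℝ) := by
    rw [← Finset.mul_prod_erase _ _ (mem_univ p),
      ← Finset.mul_prod_erase _ (fun q => ((v q).factorial : ℝ)) (mem_univ p)]
    rw [Function.update_self, Nat.factorial_succ]
    push_cast
    rw [mul_assoc]
    congr 2
    refine Finset.prod_congr rfl fun q hq => ?_
    rw [Function.update_of_ne (Finset.ne_of_mem_erase hq)]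
  have h3 : (0 : ℝ) < ∏ p, ((v p).factorial : ℝ) :=
    Finset.prod_pos fun p _ => by exact_mod_cast Nat.factorial_pos _
  have h4 : (0 : ℝ) < (k.factorial : ℝ) := by exact_mod_cast Nat.factorial_pos _
  rw [multinom, multinom, h2, sum_update_succ, show ∑ q, v q + 1 + k = (∑ q, v q + k) + 1 by ring,
    Nat.factorial_succ]
  push_cast
  field_simp

/-- `(3n)! / n!³`. -/
noncomputable def central (n : ℕ) : ℝ := multinom 0 fun _ => n

theorem central_pos (n : ℕ) : 0 < central n := multinom_pos _ _

theorem sum_const_pathName (n : ℕ) : ∑ _p : PathName, n = 3 * n := by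
  rw [Finset.sum_const]; rfl

theorem central_eq (n : ℕ) : central n = ((3 * n).factorial : ℝ) / (n.factorial : ℝ) ^ 3 := by
  rw [central, multinom, sum_const_pathName, Finset.prod_const]
  simp only [add_zero, Nat.factorial_zero, Nat.cast_one, one_mul]
  rfl

theorem sum_le_of_le {n : ℕ} {v : PathName → ℕ} (hv : ∀ p, v p ≤ n) : ∑ p, v p ≤ 3 * n := by
  rw [← sum_const_pathName n]; exact Finset.sum_le_sum fun p _ => hv p

/-- Increase the smallest coordinate until the diagonal is reached. If its value is `x`, the
coefficient grows by a factor of at least `(3x+1)/(x+1)`, which is at least `5/2` for `x ≥ 3` and at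
least 1 always. At most nine steps start from a value below 3; the sum of the truncated coordinates
keeps track of them. -/
theorem multinom_mul_pow_le_aux (n : ℕ) : ∀ (d : ℕ) (v : PathName → ℕ), (∀ p, v p ≤ n) →
    3 * n = ∑ p, v p + d →
    multinom 0 v * (5 / 2 : ℝ) ^ (d + ∑ p, min (v p) 3) ≤ (5 / 2 : ℝ) ^ 9 * central n := by
  intro d
  induction d with
  | zero =>
    intro v hv hd
    have hall : ∀ p, v p = n := by
      by_contra hne
      push Not at hne
      obtain ⟨p, hp⟩ := hne
      have : ∑ p, v p < ∑ _p : PathName, n :=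
        Finset.sum_lt_sum (fun q _ => hv q) ⟨p, mem_univ p, lt_of_le_of_ne (hv p) hp⟩
      rw [sum_const_pathName] at this
      omega
    have : v = fun _ => n := funext hall
    subst this
    rw [zero_add, mul_comm]
    have h1 : ∑ p : PathName, min n 3 ≤ 9 := by
      rw [sum_const_pathName]; omega
    have := central_pos n
    refine mul_le_mul_of_nonneg_right (pow_le_pow_right₀ (by norm_num) h1) ?_
    exact this.le
  | succ d ih =>
    intro v hv hd
    obtain ⟨p, -, hp⟩ := Finset.exists_min_image univ v ⟨.A, mem_univ _⟩
    have hpn : v p < n := by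
      by_contra hge
      have h1 : ∑ q : PathName, n ≤ ∑ q, v q :=
        Finset.sum_le_sum fun q _ => (not_lt.1 hge).trans (hp q (mem_univ q))
      rw [sum_const_pathName] at h1
      omega
    have h3 : 3 * v p ≤ ∑ q, v q := by
      rw [← sum_const_pathName]; exact Finset.sum_le_sum fun q _ => hp q (mem_univ q)
    set v' := Function.update v p (v p + 1) with hv'
    have hv'n : ∀ q, v' q ≤ n := by
      intro q
      by_cases hq : q = p
      · subst hq; rw [hv', Function.update_self]; omega
      · rw [hv', Function.update_of_ne hq]; exact hv q
    have hsum : ∑ q, v' q = ∑ q, v q + 1 := sum_update_succ v p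
    have hih := ih v' hv'n (by omega)
    have hmul := multinom_update 0 v p
    rw [← hv'] at hmul
    have hpot : ∑ q, min (v' q) 3 + min (v p) 3 = ∑ q, min (v q) 3 + min (v p + 1) 3 := by
      rw [← Finset.add_sum_erase _ (fun q => min (v' q) 3) (mem_univ p),
        ← Finset.add_sum_erase _ (fun q => min (v q) 3) (mem_univ p)]
      have : ∑ q ∈ univ.erase p, min (v' q) 3 = ∑ q ∈ univ.erase p, min (v q) 3 :=
        Finset.sum_congr rfl fun q hq => by
          rw [hv', Function.update_of_ne (Finset.ne_of_mem_erase hq)]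
      rw [this, hv', Function.update_self]
      ring
    have h3' : (3 : ℝ) * v p ≤ ∑ q, v q := by exact_mod_cast h3
    have hM := multinom_pos 0 v
    have hM' := multinom_pos 0 v'
    have hvp : (0 : ℝ) ≤ v p := Nat.cast_nonneg _
    have hcast : ((∑ q, v q : ℕ) : ℝ) = ∑ q, (v q : ℝ) := by push_cast; rfl
    refine le_trans ?_ hih
    -- A step from a value below 3 moves one unit of the exponent from `d` to the truncated
    -- coordinates; any other step has to pay for it with a factor `5/2`.
    by_cases h : v p < 3
    · have e1 : ∑ q, min (v' q) 3 = ∑ q, min (v q) 3 + 1 := by omega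
      rw [e1, show d + (∑ q, min (v q) 3 + 1) = d + 1 + ∑ q, min (v q) 3 by ring]
      refine mul_le_mul_of_nonneg_right ?_ (by positivity)
      have : multinom 0 v * (v p + 1) ≤ multinom 0 v' * (v p + 1) := by
        rw [hmul]
        push_cast at h3' ⊢
        refine mul_le_mul_of_nonneg_left ?_ hM.le
        linarith
      exact le_of_mul_le_mul_right this (by linarith)
    · have e1 : ∑ q, min (v' q) 3 = ∑ q, min (v q) 3 := by omega
      rw [e1, show d + 1 + ∑ q, min (v q) 3 = (d + ∑ q, min (v q) 3) + 1 by ring, pow_succ',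
        ← mul_assoc]
      refine mul_le_mul_of_nonneg_right ?_ (by positivity)
      have h5 : (3 : ℝ) ≤ v p := by exact_mod_cast not_lt.1 h
      have : multinom 0 v * (5 / 2) * (v p + 1) ≤ multinom 0 v' * (v p + 1) := by
        rw [hmul, mul_assoc]
        push_cast at h3' ⊢
        refine mul_le_mul_of_nonneg_left ?_ hM.le
        linarith
      exact le_of_mul_le_mul_right this (by linarith)

/-- The true decay rate near the diagonal is `1/3`. As a dominating bound, any rate below `1/2`
would serve: words over two letters have to be summable against it. -/
theorem multinom_zero_le (n : ℕ) {v : PathName → ℕ} (hv : ∀ p, v p ≤ n) :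
    multinom 0 v ≤ (5 / 2 : ℝ) ^ 9 * central n * (2 / 5 : ℝ) ^ (3 * n - ∑ p, v p) := by
  have hle := sum_le_of_le hv
  have h := multinom_mul_pow_le_aux n (3 * n - ∑ p, v p) v hv (by omega)
  have h1 : multinom 0 v * (5 / 2 : ℝ) ^ (3 * n - ∑ p, v p) ≤ (5 / 2 : ℝ) ^ 9 * central n := by
    refine le_trans ?_ h
    refine mul_le_mul_of_nonneg_left ?_ (multinom_pos 0 v).le
    exact pow_le_pow_right₀ (by norm_num) (Nat.le_add_right _ _)
  calc multinom 0 v = multinom 0 v * (5 / 2 : ℝ) ^ (3 * n - ∑ p, v p) *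
        (2 / 5 : ℝ) ^ (3 * n - ∑ p, v p) := by
        rw [mul_assoc, ← mul_pow]; norm_num
    _ ≤ _ := mul_le_mul_of_nonneg_right h1 (by positivity)

theorem multinom_eq_mul (k : ℕ) (v : PathName → ℕ) :
    multinom k v = multinom 0 v * ((∑ p, v p + k).descFactorial k : ℝ) / k.factorial := by
  have h := Nat.factorial_mul_descFactorial (n := ∑ p, v p + k) (k := k) (Nat.le_add_left _ _)
  rw [Nat.add_sub_cancel] at h
  rw [multinom, multinom, ← h]
  simp only [add_zero, Nat.factorial_zero, Nat.cast_one, one_mul]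
  have h3 : (0 : ℝ) < ∏ p, ((v p).factorial : ℝ) :=
    Finset.prod_pos fun p _ => by exact_mod_cast Nat.factorial_pos _
  have h4 : (0 : ℝ) < (k.factorial : ℝ) := by exact_mod_cast Nat.factorial_pos _
  push_cast
  field_simp

theorem tendsto_descFactorial_div {a : ℕ → ℕ} {c : ℝ}
    (ha : Tendsto (fun n => (a n : ℝ) / n) atTop (𝓝 c)) (j : ℕ) :
    Tendsto (fun n => ((a n).descFactorial j : ℝ) / (n : ℝ) ^ j) atTop (𝓝 (c ^ j)) := by
  induction j with
  | zero => simp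
  | succ j ih =>
    have h1 : Tendsto (fun n => ((a n - j : ℕ) : ℝ) / n) atTop (𝓝 c) := by
      have h2 : Tendsto (fun n : ℕ => (a n : ℝ) / n - j / n) atTop (𝓝 c) := by
        simpa using ha.sub (tendsto_const_div_atTop_nhds_zero_nat (j : ℝ))
      refine tendsto_of_tendsto_of_tendsto_of_le_of_le h2 ha (fun n => ?_) (fun n => ?_)
      · simp only
        rw [← sub_div]
        refine div_le_div_of_nonneg_right ?_ (Nat.cast_nonneg _)
        have : a n ≤ (a n - j) + j := by omega
        have : (a n : ℝ) ≤ ((a n - j : ℕ) : ℝ) + j := by exact_mod_cast this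
        linarith
      · refine div_le_div_of_nonneg_right ?_ (Nat.cast_nonneg _)
        exact Nat.cast_le.2 (Nat.sub_le _ _)
    refine ((h1.mul ih).congr fun n => ?_).trans (by rw [pow_succ'])
    rw [Nat.descFactorial_succ, pow_succ']
    push_cast
    rw [div_mul_div_comm]

theorem tendsto_sub_div (j : ℕ) : Tendsto (fun n : ℕ => ((n - j : ℕ) : ℝ) / n) atTop (𝓝 1) := by
  have h1 : Tendsto (fun n : ℕ => (1 : ℝ) - j / n) atTop (𝓝 1) := by
    simpa using tendsto_const_nhds.sub (tendsto_const_div_atTop_nhds_zero_nat (j : ℝ))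
  refine h1.congr' ?_
  filter_upwards [eventually_ge_atTop (j + 1)] with n hn
  have : (n : ℝ) ≠ 0 := by
    have : n ≠ 0 := by omega
    exact_mod_cast this
  rw [Nat.cast_sub (by omega)]
  field_simp

theorem tendsto_three_mul_sub_div (j : ℕ) :
    Tendsto (fun n : ℕ => ((3 * n - j : ℕ) : ℝ) / n) atTop (𝓝 3) := by
  have h1 : Tendsto (fun n : ℕ => (3 : ℝ) - j / n) atTop (𝓝 3) := by
    simpa using tendsto_const_nhds.sub (tendsto_const_div_atTop_nhds_zero_nat (j : ℝ))
  refine h1.congr' ?_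
  filter_upwards [eventually_ge_atTop (j + 1)] with n hn
  have : (n : ℝ) ≠ 0 := by
    have : n ≠ 0 := by omega
    exact_mod_cast this
  rw [Nat.cast_sub (by omega)]
  push_cast
  field_simp

theorem sum_sub_offset {n : ℕ} {o : PathName → ℕ} (ho : ∀ p, o p ≤ n) :
    ∑ p, (n - o p) = 3 * n - ∑ p, o p := by
  have h1 : ∑ p, (n - o p) + ∑ p, o p = 3 * n := by
    rw [← Finset.sum_add_distrib, ← sum_const_pathName]
    exact Finset.sum_congr rfl fun p _ => Nat.sub_add_cancel (ho p)
  omega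

theorem le_sum_pathName (o : PathName → ℕ) (p : PathName) : o p ≤ ∑ q, o q :=
  Finset.single_le_sum (f := o) (fun _ _ => Nat.zero_le _) (mem_univ p)

/-- The quotient is the product of the falling factorials of `n` of orders `o p`, divided by the
falling factorial of `3n` of order `∑ o p`. -/
theorem tendsto_multinom_zero_div (o : PathName → ℕ) :
    Tendsto (fun n : ℕ => multinom 0 (fun p => n - o p) / central n) atTop
      (𝓝 ((1 / 3 : ℝ) ^ ∑ p, o p)) := by
  have h1 : Tendsto (fun n : ℕ => (∏ p, ((n.descFactorial (o p) : ℝ) / (n : ℝ) ^ (o p))) /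
      (((3 * n).descFactorial (∑ p, o p) : ℝ) / (n : ℝ) ^ (∑ p, o p))) atTop
      (𝓝 ((∏ p : PathName, (1 : ℝ) ^ (o p)) / 3 ^ ∑ p, o p)) := by
    refine Tendsto.div ?_ ?_ (by positivity)
    · refine tendsto_finsetProd _ fun p _ => tendsto_descFactorial_div ?_ _
      simpa using tendsto_sub_div 0
    · refine tendsto_descFactorial_div ?_ _
      simpa using tendsto_three_mul_sub_div 0
  simp only [one_pow, Finset.prod_const_one] at h1
  rw [one_div_pow]
  refine h1.congr' ?_
  filter_upwards [eventually_ge_atTop (∑ p, o p + 1)] with n hn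
  have ho : ∀ p, o p ≤ n := fun p => (le_sum_pathName o p).trans (by omega)
  have hn0 : (0 : ℝ) < n := by
    have : 0 < n := by omega
    exact_mod_cast this
  rw [Finset.prod_div_distrib, Finset.prod_pow_eq_pow_sum]
  rw [central, multinom, multinom, sum_sub_offset ho, sum_const_pathName]
  simp only [add_zero, Nat.factorial_zero, Nat.cast_one, one_mul]
  have e1 : ((3 * n).factorial : ℝ) =
      ((3 * n - ∑ p, o p).factorial : ℝ) * ((3 * n).descFactorial (∑ p, o p) : ℝ) := by
    exact_mod_cast (Nat.factorial_mul_descFactorial (by omega)).symm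
  have e2 : ∏ _p : PathName, (n.factorial : ℝ) = (∏ p, ((n - o p).factorial : ℝ)) *
      ∏ p, (n.descFactorial (o p) : ℝ) := by
    rw [← Finset.prod_mul_distrib]
    refine Finset.prod_congr rfl fun p _ => ?_
    exact_mod_cast (Nat.factorial_mul_descFactorial (ho p)).symm
  rw [e1, e2]
  have p1 : (0 : ℝ) < ∏ p, ((n - o p).factorial : ℝ) :=
    Finset.prod_pos fun p _ => by exact_mod_cast Nat.factorial_pos _
  have p2 : (0 : ℝ) < ∏ p, (n.descFactorial (o p) : ℝ) :=
    Finset.prod_pos fun p _ => by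
      exact_mod_cast Nat.pos_of_ne_zero fun h => by
        rw [Nat.descFactorial_eq_zero_iff_lt] at h; have := ho p; omega
  have p3 : (0 : ℝ) < ((3 * n).descFactorial (∑ p, o p) : ℝ) := by
    exact_mod_cast Nat.pos_of_ne_zero fun h => by
      rw [Nat.descFactorial_eq_zero_iff_lt] at h; omega
  have p4 : (0 : ℝ) < ((3 * n - ∑ p, o p).factorial : ℝ) := by
    exact_mod_cast Nat.factorial_pos _
  field_simp

/-- `F v` grows like `n ^ K (3n)! / n!³` near the diagonal. -/
structure DiagAsymp (K : ℕ) (L : ℝ) (F : (PathName → ℕ) → ℝ) : Prop where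
  nonneg : ∀ v, 0 ≤ F v
  bound : ∃ C : ℝ, 0 ≤ C ∧ ∀ n : ℕ, 1 ≤ n → ∀ v, (∀ p, v p ≤ n) →
    F v ≤ C * ((n : ℝ) ^ K * central n) * (2 / 5 : ℝ) ^ (3 * n - ∑ p, v p)
  tendsto : ∀ o : PathName → ℕ, Tendsto (fun n : ℕ => F (fun p => n - o p) /
    ((n : ℝ) ^ K * central n)) atTop (𝓝 (L * (1 / 3 : ℝ) ^ ∑ p, o p))

/-- The coefficient is the one for `k = 0` times the binomial coefficient of `|v| + k` over `k`,
which is about `(3n)^k / k!`. -/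
theorem diagAsymp_multinom (k : ℕ) : DiagAsymp k (3 ^ k / k.factorial) (multinom k) where
  nonneg v := (multinom_pos k v).le
  bound := by
    refine ⟨(5 / 2 : ℝ) ^ 9 * (3 + k) ^ k, by positivity, fun n hn v hv => ?_⟩
    rw [multinom_eq_mul]
    have h1 := multinom_zero_le n hv
    have h2 : ((∑ p, v p + k).descFactorial k : ℝ) ≤ (3 + k) ^ k * (n : ℝ) ^ k := by
      have h3 := Nat.descFactorial_le_pow (∑ p, v p + k) k
      have h4 : (∑ p, v p + k) ≤ (3 + k) * n := by
        have := sum_le_of_le hv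
        have h5 : k * 1 ≤ k * n := Nat.mul_le_mul_left k hn
        rw [add_mul]; omega
      have h6 := h3.trans (Nat.pow_le_pow_left h4 k)
      rw [← mul_pow]
      exact_mod_cast h6
    have h3 : (1 : ℝ) ≤ k.factorial := by exact_mod_cast Nat.factorial_pos k
    have hM := multinom_pos 0 v
    calc multinom 0 v * ((∑ p, v p + k).descFactorial k : ℝ) / k.factorial ≤
          multinom 0 v * ((∑ p, v p + k).descFactorial k : ℝ) := div_le_self (by positivity) h3
      _ ≤ ((5 / 2 : ℝ) ^ 9 * central n * (2 / 5 : ℝ) ^ (3 * n - ∑ p, v p)) *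
          ((3 + k) ^ k * (n : ℝ) ^ k) := by
          have := central_pos n
          gcongr
      _ = _ := by ring
  tendsto o := by
    have h1 := tendsto_multinom_zero_div o
    have h2 : Tendsto (fun n : ℕ => ((3 * n - ∑ p, o p + k).descFactorial k : ℝ) / (n : ℝ) ^ k)
        atTop (𝓝 (3 ^ k)) := by
      refine tendsto_descFactorial_div ?_ k
      have h3 := (tendsto_three_mul_sub_div (∑ p, o p)).add
        (tendsto_const_div_atTop_nhds_zero_nat (k : ℝ))
      rw [add_zero] at h3
      refine h3.congr fun n => ?_
      push_cast
      rw [add_div]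
    have h3 := (h2.div_const (k.factorial : ℝ)).mul h1
    refine h3.congr' ?_
    filter_upwards [eventually_ge_atTop (∑ p, o p + 1)] with n hn
    have ho : ∀ p, o p ≤ n := fun p => (le_sum_pathName o p).trans (by omega)
    have hn0 : (0 : ℝ) < n := by
      have : 0 < n := by omega
      exact_mod_cast this
    have := central_pos n
    have h4 : (0 : ℝ) < (k.factorial : ℝ) := by exact_mod_cast Nat.factorial_pos _
    rw [multinom_eq_mul k, sum_sub_offset ho]
    field_simp

open scoped Classical in
/-- Convolution with a summable weight preserves the asymptotic behaviour (dominated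
convergence). -/
theorem DiagAsymp.convolve {K : ℕ} {L : ℝ} {F : (PathName → ℕ) → ℝ} (hF : DiagAsymp K L F)
    {Y : Type*} (wt : Y → PathName → ℕ)
    (hs : Summable fun y => (2 / 5 : ℝ) ^ ∑ p, wt y p) :
    DiagAsymp K (L * ∑' y, (1 / 3 : ℝ) ^ ∑ p, wt y p)
      (fun v => ∑' y, if wt y ≤ v then F (fun p => v p - wt y p) else 0) := by
  obtain ⟨C, hC0, hC⟩ := hF.bound
  -- The exponents of `2/5` add up: lowering `v` by the weight of `y` moves it further from the
  -- diagonal by exactly that weight. So the summable weights also provide the dominating function.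
  have hterm : ∀ n : ℕ, 1 ≤ n → ∀ v : PathName → ℕ, (∀ p, v p ≤ n) → ∀ y,
      (if wt y ≤ v then F (fun p => v p - wt y p) else 0) ≤
        C * ((n : ℝ) ^ K * central n) * (2 / 5 : ℝ) ^ (3 * n - ∑ p, v p) *
          (2 / 5 : ℝ) ^ ∑ p, wt y p := by
    intro n hn v hv y
    have hcen := central_pos n
    split_ifs with h
    · refine (hC n hn _ fun p => (Nat.sub_le _ _).trans (hv p)).trans (le_of_eq ?_)
      rw [mul_assoc _ ((2 / 5 : ℝ) ^ _), ← pow_add]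
      congr 2
      have h1 : ∑ p, (v p - wt y p) + ∑ p, wt y p = ∑ p, v p := by
        rw [← Finset.sum_add_distrib]
        exact Finset.sum_congr rfl fun p _ => Nat.sub_add_cancel (h p)
      have h2 := sum_le_of_le hv
      omega
    · positivity
  have hnn : ∀ v y, 0 ≤ (if wt y ≤ v then F (fun p => v p - wt y p) else 0) := by
    intro v y; split_ifs
    · exact hF.nonneg _
    · exact le_rfl
  refine ⟨fun v => tsum_nonneg (hnn v), ?_, ?_⟩
  · refine ⟨C * ∑' y, (2 / 5 : ℝ) ^ ∑ p, wt y p, mul_nonneg hC0 (tsum_nonneg fun y => by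
      positivity), fun n hn v hv => ?_⟩
    have hsum := hs.mul_left (C * ((n : ℝ) ^ K * central n) * (2 / 5 : ℝ) ^ (3 * n - ∑ p, v p))
    have h1 := Summable.tsum_le_tsum (hterm n hn v hv)
      (Summable.of_nonneg_of_le (hnn v) (hterm n hn v hv) hsum) hsum
    rw [tsum_mul_left] at h1
    refine h1.trans (le_of_eq ?_)
    ring
  · intro o
    have key := tendsto_tsum_of_dominated_convergence (𝓕 := atTop)
      (f := fun (n : ℕ) y => (if wt y ≤ (fun p => n - o p) then
        F (fun p => n - o p - wt y p) else 0) / ((n : ℝ) ^ K * central n))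
      (g := fun y => L * (1 / 3 : ℝ) ^ ∑ p, (o p + wt y p))
      (bound := fun y => C * (2 / 5 : ℝ) ^ ∑ p, wt y p) (hs.mul_left C) ?_ ?_
    · have e1 : ∑' y, L * (1 / 3 : ℝ) ^ ∑ p, (o p + wt y p) =
          L * (∑' y, (1 / 3 : ℝ) ^ ∑ p, wt y p) * (1 / 3 : ℝ) ^ ∑ p, o p := by
        simp_rw [Finset.sum_add_distrib, pow_add]
        rw [tsum_mul_left, tsum_mul_left]
        ring
      rw [e1] at key
      refine key.congr fun n => ?_
      rw [tsum_div_const]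
    · intro y
      refine (hF.tendsto fun p => o p + wt y p).congr' ?_
      filter_upwards [eventually_ge_atTop (∑ p, (o p + wt y p))] with n hn
      have ho : ∀ p, o p + wt y p ≤ n := fun p =>
        (le_sum_pathName (fun p => o p + wt y p) p).trans hn
      have hle : wt y ≤ fun p => n - o p := fun p => by have := ho p; simp only; omega
      rw [if_pos hle]
      simp only [Nat.sub_sub]
    · filter_upwards [eventually_ge_atTop 1] with n hn y
      have hcen := central_pos n
      have hn0 : (0 : ℝ) < n := by exact_mod_cast hn
      rw [Real.norm_eq_abs, abs_of_nonneg (div_nonneg (hnn _ y) (by positivity)),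
        div_le_iff₀ (by positivity)]
      refine (hterm n hn (fun p => n - o p) (fun p => Nat.sub_le _ _) y).trans ?_
      have h1 : (2 / 5 : ℝ) ^ (3 * n - ∑ p, (n - o p)) ≤ 1 := pow_le_one₀ (by norm_num) (by norm_num)
      calc _ ≤ C * ((n : ℝ) ^ K * central n) * 1 * (2 / 5 : ℝ) ^ ∑ p, wt y p := by gcongr
        _ = _ := by ring

end Multinomial

/-! ### Counting tuples of words by their letters -/

section Counting

open Finset

/-- There are `N v` elements of weight `v`. -/
def IsCount {X : Type*} (wt : X → PathName → ℕ) (N : (PathName → ℕ) → ℝ) : Prop :=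
  ∀ v, Finite {x // wt x = v} ∧ (Nat.card {x // wt x = v} : ℝ) = N v

theorem IsCount.of_equiv {X Y : Type*} {wt : X → PathName → ℕ} {wt' : Y → PathName → ℕ}
    {N : (PathName → ℕ) → ℝ} (h : IsCount wt N) (e : Y ≃ X) (he : ∀ y, wt (e y) = wt' y) :
    IsCount wt' N := by
  intro v
  have e' : {y // wt' y = v} ≃ {x // wt x = v} :=
    e.subtypeEquiv fun y => by rw [he]
  obtain ⟨h1, h2⟩ := h v
  exact ⟨Finite.of_equiv _ e'.symm, by rw [Nat.card_congr e', h2]⟩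

/-- The vector of letter counts of a word. -/
def letterCount (l : List PathName) : PathName → ℕ := fun p => l.count p

/-- The unit vector at `p`. -/
def unitVec (p : PathName) : PathName → ℕ := Pi.single p 1

theorem unitVec_self (p : PathName) : unitVec p p = 1 := Pi.single_eq_same p 1

theorem unitVec_of_ne {p q : PathName} (h : q ≠ p) : unitVec p q = 0 := Pi.single_eq_of_ne h 1

theorem sum_unitVec (p : PathName) : ∑ q, unitVec p q = 1 := by simp [unitVec]

theorem letterCount_nil : letterCount [] = 0 := rfl

theorem letterCount_cons (p : PathName) (l : List PathName) :
    letterCount (p :: l) = letterCount l + unitVec p := by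
  funext q
  simp only [letterCount, List.count_cons, Pi.add_apply, unitVec, Pi.single_apply, beq_iff_eq]
  simp only [eq_comm]

theorem sum_letterCount (l : List PathName) : ∑ p, letterCount l p = l.length := by
  induction l with
  | nil => simp [letterCount]
  | cons a l ih =>
    rw [letterCount_cons]
    simp only [Pi.add_apply, Finset.sum_add_distrib, ih, List.length_cons, sum_unitVec]

theorem single_le_iff {v : PathName → ℕ} {p : PathName} : unitVec p ≤ v ↔ 0 < v p := by
  constructor
  · intro h; have := h p; rw [unitVec_self] at this; exact this
  · intro h q
    by_cases hq : q = p
    · subst hq; rw [unitVec_self]; exact h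
    · rw [unitVec_of_ne hq]; exact Nat.zero_le _

theorem sum_sub_single {v : PathName → ℕ} {p : PathName} (h : 0 < v p) :
    ∑ q, (v - unitVec p) q + 1 = ∑ q, v q := by
  have : v = (v - unitVec p) + unitVec p := (tsub_add_cancel_of_le (single_le_iff.2 h)).symm
  conv_rhs => rw [this]
  simp only [Pi.add_apply, Finset.sum_add_distrib, sum_unitVec]

/-- Either the word is empty or its first letter can be removed; the hypothesis on `M` is this
recursion. -/
theorem isCount_list_prod {X : Type*} {wt : X → PathName → ℕ} {N M : (PathName → ℕ) → ℝ}
    (h : IsCount wt N)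
    (hM : ∀ v, M v = N v + ∑ p, if 0 < v p then M (v - unitVec p) else 0) :
    IsCount (fun z : List PathName × X => letterCount z.1 + wt z.2) M := by
  suffices H : ∀ (d : ℕ) (v : PathName → ℕ), ∑ p, v p = d →
      Finite {z : List PathName × X // letterCount z.1 + wt z.2 = v} ∧
        (Nat.card {z : List PathName × X // letterCount z.1 + wt z.2 = v} : ℝ) = M v from
    fun v => H _ v rfl
  intro d
  induction d using Nat.strong_induction_on with
  | _ d ih =>
  intro v hv
  let e : {z : List PathName × X // letterCount z.1 + wt z.2 = v} ≃
      {x // wt x = v} ⊕ Σ p : {p // 0 < v p},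
        {z : List PathName × X // letterCount z.1 + wt z.2 = v - unitVec p.1} :=
    { toFun := fun z => match z with
        | ⟨([], x), hx⟩ => Sum.inl ⟨x, by simpa [letterCount_nil] using hx⟩
        | ⟨(p :: l, x), hx⟩ => Sum.inr ⟨⟨p, by
            rw [← hx]; simp [letterCount_cons, unitVec_self]⟩, ⟨(l, x), by
            simp only [letterCount_cons] at hx
            exact eq_tsub_of_add_eq ((add_right_comm _ _ _).trans hx)⟩⟩
      invFun := fun z => match z with
        | Sum.inl ⟨x, hx⟩ => ⟨([], x), by simpa [letterCount_nil] using hx⟩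
        | Sum.inr ⟨⟨p, hp⟩, ⟨(l, x), hx⟩⟩ => ⟨(p :: l, x), by
            simp only [letterCount_cons] at hx ⊢
            rw [add_right_comm, hx, tsub_add_cancel_of_le (single_le_iff.2 hp)]⟩
      left_inv := by rintro ⟨⟨_ | ⟨p, l⟩, x⟩, hx⟩ <;> rfl
      right_inv := by rintro (⟨x, hx⟩ | ⟨⟨p, hp⟩, ⟨l, x⟩, hx⟩) <;> rfl }
  have hrec : ∀ p : {p // 0 < v p}, _ := fun p =>
    ih (∑ q, (v - unitVec p.1) q) (by have := sum_sub_single p.2; omega) _ rfl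
  have : ∀ p : {p // 0 < v p}, Finite {z : List PathName × X //
      letterCount z.1 + wt z.2 = v - unitVec p.1} := fun p => (hrec p).1
  have := (h v).1
  refine ⟨Finite.of_equiv _ e.symm, ?_⟩
  rw [Nat.card_congr e, Nat.card_sum, Nat.card_sigma, hM v]
  push_cast
  rw [(h v).2]
  congr 1
  rw [← Finset.sum_filter, ← Finset.sum_subtype_eq_sum_filter]
  refine Finset.sum_congr ?_ fun p _ => (hrec p).2
  ext p; simp

theorem multinom_sub_single (k : ℕ) {v : PathName → ℕ} {p : PathName} (h : 0 < v p) :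
    multinom k (v - unitVec p) * (∑ q, v q + k : ℕ) = multinom k v * v p := by
  have h1 := multinom_update k (v - unitVec p) p
  have h2 : (v - unitVec p) p + 1 = v p := by rw [Pi.sub_apply, unitVec_self]; omega
  have h3 : Function.update (v - unitVec p) p (v p) = v := by
    funext q
    by_cases hq : q = p
    · subst hq; simp
    · simp [hq, unitVec_of_ne hq]
  have h4 := sum_sub_single h
  have h5 : ((v - unitVec p) p : ℝ) + 1 = v p := by exact_mod_cast h2
  have h6 : (∑ q, ((v - unitVec p) q : ℝ)) + k + 1 = (∑ q, v q + k : ℕ) := by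
    rw [← h4]; push_cast; ring
  rw [h2, h3, h5] at h1
  rw [h1, ← h6]
  push_cast
  ring

theorem sum_multinom_sub_single (k : ℕ) (v : PathName → ℕ) :
    (∑ p, if 0 < v p then multinom k (v - unitVec p) else 0) * (∑ q, v q + k : ℕ) =
      multinom k v * (∑ q, v q : ℕ) := by
  rw [Finset.sum_mul]
  push_cast
  rw [Finset.mul_sum]
  refine Finset.sum_congr rfl fun p _ => ?_
  split_ifs with h
  · rw [← multinom_sub_single k h]; push_cast; rfl
  · have : v p = 0 := by omega
    simp [this]

theorem multinom_succ_mul (k : ℕ) (v : PathName → ℕ) :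
    multinom k v * (∑ q, v q + (k + 1) : ℕ) = multinom (k + 1) v * (k + 1) := by
  have h3 : (0 : ℝ) < ∏ p, ((v p).factorial : ℝ) :=
    Finset.prod_pos fun p _ => by exact_mod_cast Nat.factorial_pos _
  have h4 : (0 : ℝ) < (k.factorial : ℝ) := by exact_mod_cast Nat.factorial_pos _
  rw [multinom, multinom, ← add_assoc, Nat.factorial_succ (∑ p, v p + k), Nat.factorial_succ k]
  push_cast
  field_simp

/-- The recursion for `k + 2` words according to the first letter, if any, of one of them. After
multiplication by `|v| + k + 1` the two terms on the right become the shares `k + 1` and `|v|` of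
the left-hand side. -/
theorem multinom_succ_eq (k : ℕ) (v : PathName → ℕ) :
    multinom (k + 1) v = multinom k v +
      ∑ p, if 0 < v p then multinom (k + 1) (v - unitVec p) else 0 := by
  have h1 := sum_multinom_sub_single (k + 1) v
  have h2 := multinom_succ_mul k v
  have h3 : (0 : ℝ) < (∑ q, v q + (k + 1) : ℕ) := by
    have : 0 < ∑ q, v q + (k + 1) := by omega
    exact_mod_cast this
  refine mul_right_cancel₀ h3.ne' ?_
  rw [add_mul, h1, h2]
  push_cast
  ring

theorem multinom_zero_eq (v : PathName → ℕ) :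
    multinom 0 v = (if v = 0 then 1 else 0) +
      ∑ p, if 0 < v p then multinom 0 (v - unitVec p) else 0 := by
  by_cases hv : v = 0
  · subst hv; simp [multinom]
  · have h1 := sum_multinom_sub_single 0 v
    have h3 : (0 : ℝ) < (∑ q, v q : ℕ) := by
      have : 0 < ∑ q, v q := by
        obtain ⟨p, hp⟩ := Function.ne_iff.1 hv
        exact lt_of_lt_of_le (Nat.pos_of_ne_zero hp) (le_sum_pathName v p)
      exact_mod_cast this
    rw [if_neg hv, zero_add]
    refine (mul_right_cancel₀ h3.ne' ?_).symm
    simpa using h1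

theorem isCount_tuples (k : ℕ) :
    IsCount (fun g : Fin (k + 1) → List PathName => ∑ j, letterCount (g j)) (multinom k) := by
  induction k with
  | zero =>
    have h0 : IsCount (fun _ : Unit => (0 : PathName → ℕ)) (fun v => if v = 0 then 1 else 0) := by
      intro v
      refine ⟨inferInstance, ?_⟩
      simp only
      split_ifs with h
      · subst h; simp
      · have : IsEmpty {x : Unit // (0 : PathName → ℕ) = v} := ⟨fun x => h x.2.symm⟩
        simp
    refine (isCount_list_prod h0 multinom_zero_eq).of_equiv
      ((Equiv.funUnique (Fin 1) _).trans (Equiv.prodUnique _ Unit).symm) fun g => ?_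
    simp [Equiv.funUnique]
  | succ k ih =>
    refine (isCount_list_prod ih (multinom_succ_eq k)).of_equiv
      (Fin.consEquiv fun _ => List PathName).symm fun g => ?_
    rw [Fin.sum_univ_succ (f := fun j => letterCount (g j))]
    rfl

/-- The terms of a summable family tend to zero, so only finitely many of them can be as large as
those of weight at most `v`. -/
theorem finite_wt_le {Y : Type*} {wt : Y → PathName → ℕ}
    (hs : Summable fun y => (2 / 5 : ℝ) ^ ∑ p, wt y p) (v : PathName → ℕ) :
    Finite {y // wt y ≤ v} := by
  have h1 := hs.tendsto_cofinite_zero.eventually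
    (gt_mem_nhds (show (0 : ℝ) < (2 / 5 : ℝ) ^ ∑ p, v p by positivity))
  rw [Filter.eventually_cofinite] at h1
  refine Set.Finite.to_subtype (h1.subset fun y hy => ?_)
  simp only [Set.mem_ofPred_eq, not_lt]
  exact pow_le_pow_of_le_one (by norm_num) (by norm_num) (Finset.sum_le_sum fun p _ => hy p)

open scoped Classical in
theorem IsCount.convolve {X Y : Type*} {wt : X → PathName → ℕ} {N : (PathName → ℕ) → ℝ}
    (h : IsCount wt N) {wt' : Y → PathName → ℕ}
    (hs : Summable fun y => (2 / 5 : ℝ) ^ ∑ p, wt' y p) :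
    IsCount (fun z : X × Y => wt z.1 + wt' z.2)
      (fun v => ∑' y, if wt' y ≤ v then N (fun p => v p - wt' y p) else 0) := by
  intro v
  let e : {z : X × Y // wt z.1 + wt' z.2 = v} ≃
      Σ y : {y // wt' y ≤ v}, {x // wt x = v - wt' y.1} :=
    { toFun := fun z => ⟨⟨z.1.2, le_add_self.trans_eq z.2⟩, ⟨z.1.1, eq_tsub_of_add_eq z.2⟩⟩
      invFun := fun z => ⟨(z.2.1, z.1.1), by
        simp only; rw [z.2.2, tsub_add_cancel_of_le z.1.2]⟩
      left_inv := fun z => rfl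
      right_inv := fun z => rfl }
  have := finite_wt_le hs v
  have : ∀ y : {y // wt' y ≤ v}, Finite {x // wt x = v - wt' y.1} := fun y => (h _).1
  refine ⟨Finite.of_equiv _ e.symm, ?_⟩
  have := Fintype.ofFinite {y // wt' y ≤ v}
  rw [Nat.card_congr e, Nat.card_sigma]
  push_cast
  rw [← tsum_fintype (L := SummationFilter.unconditional _)]
  have h1 := tsum_subtype {y | wt' y ≤ v} (fun y => N (fun p => v p - wt' y p))
  refine Eq.trans ?_ (h1.trans (tsum_congr fun y => ?_))
  · exact tsum_congr fun y => (h _).2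
  · rw [Set.indicator_apply]; rfl

end Counting

/-! ### Summability of the weights -/

section Summability

open Finset

theorem hasSum_pow_sum_fin {a : ℝ} (h0 : 0 ≤ a) (h1 : a < 1) (d : ℕ) :
    HasSum (fun f : Fin d → ℕ => a ^ ∑ i, f i) (((1 - a)⁻¹) ^ d) := by
  induction d with
  | zero =>
    simp
  | succ d ih =>
    have hg := hasSum_geometric_of_lt_one h0 h1
    have hs : Summable fun z : ℕ × (Fin d → ℕ) => a ^ z.1 * a ^ ∑ i, z.2 i :=
      Summable.mul_of_nonneg (f := fun n : ℕ => a ^ n)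
        (g := fun f : Fin d → ℕ => a ^ ∑ i, f i) hg.summable ih.summable
        (fun n => pow_nonneg h0 n) (fun f => pow_nonneg h0 _)
    have hm := hg.mul ih hs
    rw [← pow_succ'] at hm
    let E : ℕ × (Fin d → ℕ) ≃ (Fin (d + 1) → ℕ) := Fin.consEquiv fun _ => ℕ
    refine E.hasSum_iff.1 ?_
    have e : ((fun f : Fin (d + 1) → ℕ => a ^ ∑ i, f i) ∘ E) =
        fun z => a ^ z.1 * a ^ ∑ i, z.2 i := by
      funext z
      simp [E, Fin.sum_univ_succ, pow_add, Fin.consEquiv]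
    rw [e]
    exact hm

theorem hasSum_pow_sum {ι : Type*} [Fintype ι] {a : ℝ} (h0 : 0 ≤ a) (h1 : a < 1) :
    HasSum (fun f : ι → ℕ => a ^ ∑ i, f i) (((1 - a)⁻¹) ^ Fintype.card ι) := by
  have e := Fintype.equivFin ι
  rw [← (e.arrowCongr (Equiv.refl ℕ)).symm.hasSum_iff]
  convert hasSum_pow_sum_fin h0 h1 (Fintype.card ι) using 1
  funext f
  simp only [Function.comp_apply]
  congr 1
  exact Fintype.sum_equiv e _ _ fun i => by simp [Equiv.arrowCongr]

theorem hasSum_pow_sum_sigma {k : ℕ} (d : Fin k → ℕ) {a : ℝ} (h0 : 0 ≤ a) (h1 : a < 1) :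
    HasSum (fun y : (j : Fin k) → Fin (d j) → ℕ => a ^ ∑ j, ∑ i, y j i)
      (((1 - a)⁻¹) ^ ∑ j, d j) := by
  rw [← (Equiv.piCurry fun (j : Fin k) (_ : Fin (d j)) => ℕ).hasSum_iff]
  convert hasSum_pow_sum (ι := Σ j : Fin k, Fin (d j)) h0 h1 using 1
  · funext f
    simp only [Function.comp_apply]
    rw [Fintype.sum_sigma]
    rfl
  · rw [Fintype.card_sigma]
    simp

/-- Grouped by length, the words contribute the powers of `∑ a, w a`. -/
theorem summable_prod_map {α : Type*} [Fintype α] (w : α → ℝ) (hw : ∀ a, 0 ≤ w a)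
    (h1 : ∑ a, w a < 1) : Summable fun l : List α => (l.map w).prod := by
  rw [← List.equivSigmaTuple.symm.summable_iff]
  have e : ((fun l : List α => (l.map w).prod) ∘ List.equivSigmaTuple.symm) =
      fun x : Σ n, Fin n → α => ∏ i, w (x.2 i) := by
    funext x
    simp only [Function.comp_apply, List.equivSigmaTuple, Equiv.coe_fn_symm_mk, List.map_ofFn,
      List.prod_ofFn]
  rw [e, summable_sigma_of_nonneg fun x => Finset.prod_nonneg fun i _ => hw _]
  refine ⟨fun n => Summable.of_finite, ?_⟩
  refine (summable_geometric_of_lt_one (Finset.sum_nonneg fun a _ => hw a) h1).congr fun n => ?_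
  rw [tsum_fintype, Fintype.sum_pow]

/-- With weight `2/5` for each of the three letters the series over all words would diverge. Here
`p` occurs at most once, so its weight may be lowered to `1/10` at the cost of a factor at most 4,
and then the weights add up to `9/10`. -/
theorem summable_pow_length_of_count_le (p : PathName) :
    Summable fun l : {l : List PathName // l.count p ≤ 1} =>
      (2 / 5 : ℝ) ^ ∑ q, letterCount l.1 q := by
  let w : PathName → ℝ := fun q => if q = p then 1 / 10 else 2 / 5
  have hw : ∀ q, 0 ≤ w q := fun q => by simp only [w]; split_ifs <;> norm_num
  have hw1 : ∑ q, w q < 1 := by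
    have : (univ : Finset PathName) = {.A, .B, .C} := rfl
    rw [this]
    cases p <;> simp [w] <;> norm_num
  have hs := (summable_prod_map w hw hw1).mul_left 4
  refine Summable.of_nonneg_of_le (fun _ => by positivity) (fun l => ?_)
    (hs.comp_injective Subtype.val_injective)
  have key : ∀ l : List PathName, (2 / 5 : ℝ) ^ l.length = 4 ^ l.count p * (l.map w).prod := by
    intro l
    induction l with
    | nil => simp
    | cons a l ih =>
      rw [List.length_cons, pow_succ, ih, List.map_cons, List.prod_cons, List.count_cons]
      by_cases h : a = p
      · simp [w, h, pow_succ]; ring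
      · simp [w, h]; ring
  rw [sum_letterCount, key]
  have h2 : 0 ≤ (l.1.map w).prod := List.prod_nonneg fun x hx => by
    obtain ⟨q, -, rfl⟩ := List.mem_map.1 hx
    exact hw q
  have h3 : (4 : ℝ) ^ l.1.count p ≤ 4 ^ 1 := pow_le_pow_right₀ (by norm_num) l.2
  simp only [Function.comp_apply]
  rw [pow_one] at h3
  exact mul_le_mul_of_nonneg_right h3 h2

end Summability

/-! ### Words with runs and their asymptotic number -/

section WordData

open Finset

/-- The data of a word with `k` runs of lengths `ℓ`: the private letters in the `k + 1` gaps between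
the runs, and the numbers of private letters of the missing path between consecutive common letters
of a run. -/
abbrev WordData {k : ℕ} (ℓ : Fin k → ℕ) : Type :=
  (Fin (k + 1) → List PathName) × ((j : Fin k) → Fin (ℓ j - 1) → ℕ)

/-- The letter counts of a run of length `L` missing the path `x`, with `c` private letters
inside. -/
def blockCount (x : PathName) (L c : ℕ) : PathName → ℕ := fun p => if p = x then c else L

/-- The numbers of private letters inside the runs. -/
def innerCount {k : ℕ} (th : Fin k → PathName) {ℓ : Fin k → ℕ}
    (y : (j : Fin k) → Fin (ℓ j - 1) → ℕ) : PathName → ℕ :=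
  ∑ j, blockCount (th j) 0 (∑ i, y j i)

/-- The letter counts of a word. -/
def WordData.total {k : ℕ} (th : Fin k → PathName) {ℓ : Fin k → ℕ} (D : WordData ℓ) :
    PathName → ℕ :=
  ∑ j, letterCount (D.1 j) + ∑ j, blockCount (th j) (ℓ j) (∑ i, D.2 j i)

theorem sum_blockCount_zero (x : PathName) (c : ℕ) : ∑ p, blockCount x 0 c p = c := by
  simp [blockCount]

theorem sum_innerCount {k : ℕ} (th : Fin k → PathName) {ℓ : Fin k → ℕ}
    (y : (j : Fin k) → Fin (ℓ j - 1) → ℕ) : ∑ p, innerCount th y p = ∑ j, ∑ i, y j i := by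
  simp only [innerCount, Finset.sum_apply]
  rw [Finset.sum_comm]
  exact Finset.sum_congr rfl fun j _ => sum_blockCount_zero _ _

/-- The private letter counts of a word. -/
def WordData.freeCount {k : ℕ} (th : Fin k → PathName) {ℓ : Fin k → ℕ} (D : WordData ℓ) :
    PathName → ℕ :=
  ∑ j, letterCount (D.1 j) + innerCount th D.2

/-- The contribution of the common letters to the letter counts of a word, plus one. -/
def commonOffset {k : ℕ} (th : Fin k → PathName) (ℓ : Fin k → ℕ) : PathName → ℕ :=
  fun p => 1 + ∑ j, if p = th j then 0 else ℓ j

theorem WordData.total_add_one {k : ℕ} (th : Fin k → PathName) {ℓ : Fin k → ℕ} (D : WordData ℓ)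
    (p : PathName) : D.total th p + 1 = D.freeCount th p + commonOffset th ℓ p := by
  have h : ∑ j, blockCount (th j) (ℓ j) (∑ i, D.2 j i) p =
      ∑ j, blockCount (th j) 0 (∑ i, D.2 j i) p + ∑ j, if p = th j then 0 else ℓ j := by
    rw [← Finset.sum_add_distrib]
    refine Finset.sum_congr rfl fun j _ => ?_
    unfold blockCount
    split_ifs <;> simp
  simp only [WordData.total, WordData.freeCount, innerCount, commonOffset, Pi.add_apply,
    Finset.sum_apply]
  rw [h]
  ring

theorem sum_commonOffset {k : ℕ} (th : Fin k → PathName) (ℓ : Fin k → ℕ) :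
    ∑ p, commonOffset th ℓ p = 3 + 2 * ∑ j, ℓ j := by
  simp only [commonOffset, Finset.sum_add_distrib]
  rw [Finset.sum_comm, Finset.mul_sum]
  congr 1
  refine Finset.sum_congr rfl fun j _ => ?_
  have : (univ : Finset PathName) = {.A, .B, .C} := rfl
  rw [this]
  cases th j <;> simp <;> omega

theorem hasSum_innerCount {k : ℕ} (th : Fin k → PathName) (ℓ : Fin k → ℕ) {a : ℝ} (h0 : 0 ≤ a)
    (h1 : a < 1) :
    HasSum (fun y : (j : Fin k) → Fin (ℓ j - 1) → ℕ => a ^ ∑ p, innerCount th y p)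
      (((1 - a)⁻¹) ^ ∑ j, (ℓ j - 1)) := by
  simp only [sum_innerCount]
  exact hasSum_pow_sum_sigma (fun j => ℓ j - 1) h0 h1

/-- The gaps are counted by `multinom k`. The slots inside the runs enter by convolution, and each
of them contributes a geometric series with sum `3/2`. -/
theorem exists_isCount_wordData {k : ℕ} (th : Fin k → PathName) (ℓ : Fin k → ℕ) :
    ∃ F, DiagAsymp k (3 ^ k / k.factorial * (3 / 2) ^ ∑ j, (ℓ j - 1)) F ∧
      IsCount (fun D : WordData ℓ => D.freeCount th) F := by
  have hs := (hasSum_innerCount th ℓ (a := 2 / 5) (by norm_num) (by norm_num)).summable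
  have h1 := (diagAsymp_multinom k).convolve (innerCount th) hs
  have h2 := (isCount_tuples k).convolve hs
  rw [(hasSum_innerCount th ℓ (a := 1 / 3) (by norm_num) (by norm_num)).tsum_eq,
    show (1 - 1 / 3 : ℝ)⁻¹ = 3 / 2 by norm_num] at h1
  exact ⟨_, h1, h2⟩

/-- A gap in which `p` occurs at most once has a summable weight and is moved to the convolution.
The other gaps are one fewer than usual, so the order of growth falls from `n^(k+1)` to `n^k`. -/
theorem exists_isCount_short {k : ℕ} (th : Fin (k + 1) → PathName) (ℓ : Fin (k + 1) → ℕ)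
    (j : Fin (k + 2)) (p : PathName) :
    ∃ L F, DiagAsymp k L F ∧
      IsCount (fun D : {D : WordData ℓ // (D.1 j).count p ≤ 1} => D.1.freeCount th) F := by
  have hs1 := (hasSum_innerCount th ℓ (a := 2 / 5) (by norm_num) (by norm_num)).summable
  have hs2 := summable_pow_length_of_count_le p
  let wt : ((j : Fin (k + 1)) → Fin (ℓ j - 1) → ℕ) × {l : List PathName // l.count p ≤ 1} →
    PathName → ℕ := fun z => innerCount th z.1 + letterCount z.2.1
  have hs : Summable fun z => (2 / 5 : ℝ) ^ ∑ p, wt z p := by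
    refine (Summable.mul_of_nonneg hs1 hs2 (fun _ => pow_nonneg (by norm_num) _)
      (fun _ => pow_nonneg (by norm_num) _)).congr fun z => ?_
    rw [← pow_add]
    simp only [wt, Pi.add_apply, Finset.sum_add_distrib]
  refine ⟨_, _, (diagAsymp_multinom k).convolve wt hs, ((isCount_tuples k).convolve hs).of_equiv
    (?_ : {D : WordData ℓ // (D.1 j).count p ≤ 1} ≃ _) ?_⟩
  · exact
      { toFun := fun D => (fun i => D.1.1 (j.succAbove i), (D.1.2, ⟨D.1.1 j, D.2⟩))
        invFun := fun z => ⟨(Fin.insertNth (α := fun _ => List PathName) j z.2.2.1 z.1, z.2.1), by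
          simpa using z.2.2.2⟩
        left_inv := fun D => by
          refine Subtype.ext (Prod.ext ?_ rfl)
          exact Fin.insertNth_self_removeNth j D.1.1
        right_inv := fun z => by
          refine Prod.ext ?_ (Prod.ext rfl (Subtype.ext ?_))
          · funext i; simp
          · simp }
  · intro D
    simp only [WordData.freeCount, Equiv.coe_fn_mk, wt]
    rw [Fin.sum_univ_succAbove (fun i => letterCount (D.1.1 i)) j]
    abel

/-- The words all of whose paths have `n - 1` letters. -/
def wordsOf {k : ℕ} (th : Fin k → PathName) (ℓ : Fin k → ℕ) (n : ℕ) : Set (WordData ℓ) :=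
  {D | ∀ p, D.total th p + 1 = n}

/-- Each gap after a run contains at least two letters of each path. -/
def WordData.Spread {k : ℕ} {ℓ : Fin k → ℕ} (D : WordData ℓ) : Prop :=
  ∀ (j : Fin k) p, 2 ≤ (D.1 j.succ).count p

theorem mem_wordsOf_iff {k : ℕ} (th : Fin k → PathName) (ℓ : Fin k → ℕ) {n : ℕ}
    (hn : ∑ p, commonOffset th ℓ p ≤ n) (D : WordData ℓ) :
    D ∈ wordsOf th ℓ n ↔ D.freeCount th = fun p => n - commonOffset th ℓ p := by
  have ho : ∀ p, commonOffset th ℓ p ≤ n := fun p => (le_sum_pathName _ p).trans hn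
  have : D ∈ wordsOf th ℓ n ↔ ∀ p, D.total th p + 1 = n := Iff.rfl
  rw [this, funext_iff]
  refine forall_congr' fun p => ?_
  have h1 := D.total_add_one th p
  have h2 := ho p
  omega

theorem wordsOf_subset {k : ℕ} (th : Fin k → PathName) (ℓ : Fin k → ℕ) (n : ℕ) :
    wordsOf th ℓ n ⊆ {D | D.freeCount th = fun p => n - commonOffset th ℓ p} := by
  intro D hD
  have h : ∀ p, D.total th p + 1 = n := hD
  funext p
  have h1 := D.total_add_one th p
  have h2 := h p
  omega

theorem finite_wordsOf {k : ℕ} (th : Fin k → PathName) (ℓ : Fin k → ℕ) (n : ℕ) :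
    (wordsOf th ℓ n).Finite := by
  obtain ⟨F, -, hF⟩ := exists_isCount_wordData th ℓ
  have h : {D : WordData ℓ | D.freeCount th = fun p => n - commonOffset th ℓ p}.Finite :=
    Set.finite_coe_iff.1 (hF fun p => n - commonOffset th ℓ p).1
  exact h.subset (wordsOf_subset th ℓ n)

theorem tendsto_ncard_wordsOf {k : ℕ} (th : Fin k → PathName) (ℓ : Fin k → ℕ) :
    Tendsto (fun n : ℕ => ((wordsOf th ℓ n).ncard : ℝ) / ((n : ℝ) ^ k * central n)) atTop
      (𝓝 (3 ^ k / k.factorial * (3 / 2) ^ (∑ j, (ℓ j - 1)) * (1 / 3) ^ (3 + 2 * ∑ j, ℓ j))) := by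
  obtain ⟨F, h1, hF⟩ := exists_isCount_wordData th ℓ
  rw [← sum_commonOffset th]
  refine (h1.tendsto (commonOffset th ℓ)).congr' ?_
  filter_upwards [eventually_ge_atTop (∑ p, commonOffset th ℓ p)] with n hn
  congr 1
  rw [← (hF _).2, ← Nat.card_coe_set_eq]
  exact congrArg _ (Nat.card_congr (Equiv.subtypeEquivRight fun D =>
    (mem_wordsOf_iff th ℓ hn D).symm))

/-- A union bound over the finitely many gaps and letters that can violate the condition; each
violation costs a power of `n`. -/
theorem tendsto_ncard_not_spread {k : ℕ} (th : Fin k → PathName) (ℓ : Fin k → ℕ) :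
    Tendsto (fun n : ℕ => ({D ∈ wordsOf th ℓ n | ¬ D.Spread}.ncard : ℝ) /
      ((n : ℝ) ^ k * central n)) atTop (𝓝 0) := by
  rcases k with _ | k
  · have : ∀ n, {D ∈ wordsOf th ℓ n | ¬ D.Spread} = ∅ := by
      intro n
      ext D
      simp only [Set.mem_sep_iff, Set.mem_empty_iff_false, iff_false, not_and, not_not]
      exact fun _ j => j.elim0
    simp [this]
  · choose L F hF hcount using exists_isCount_short th ℓ
    have hlim : Tendsto (fun n : ℕ => ∑ j : Fin (k + 1), ∑ p,
        F j.succ p (fun p => n - commonOffset th ℓ p) / ((n : ℝ) ^ (k + 1) * central n))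
        atTop (𝓝 (∑ j : Fin (k + 1), ∑ p : PathName, 0)) := by
      refine tendsto_finsetSum _ fun j _ => tendsto_finsetSum _ fun p _ => ?_
      have h1 := ((hF j.succ p).tendsto (commonOffset th ℓ)).mul
        (tendsto_const_div_atTop_nhds_zero_nat (1 : ℝ))
      rw [mul_zero] at h1
      refine h1.congr fun n => ?_
      rw [div_mul_div_comm, mul_one, pow_succ]
      congr 1
      ring
    simp only [Finset.sum_const_zero] at hlim
    refine squeeze_zero (fun n => ?_) (fun n => ?_) hlim
    · have := central_pos n
      positivity
    · have hc := central_pos n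
      rw [← Finset.sum_congr rfl fun j _ => Finset.sum_div _ _ _, ← Finset.sum_div]
      refine div_le_div_of_nonneg_right ?_ (by positivity)
      let S : Fin (k + 1) → PathName → Set (WordData ℓ) := fun j p =>
        {D | D ∈ wordsOf th ℓ n ∧ (D.1 j.succ).count p ≤ 1}
      have hsub : {D ∈ wordsOf th ℓ n | ¬ D.Spread} ⊆ ⋃ j ∈ (univ : Finset (Fin (k + 1))),
          ⋃ p ∈ (univ : Finset PathName), S j p := by
        rintro D ⟨hD, hns⟩
        unfold WordData.Spread at hns
        push Not at hns
        obtain ⟨j, p, hjp⟩ := hns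
        simp only [Set.mem_iUnion]
        exact ⟨j, mem_univ _, p, mem_univ _, hD, by omega⟩
      have hSfin : ∀ j p, (S j p).Finite := fun j p =>
        (finite_wordsOf th ℓ n).subset fun D hD => hD.1
      have hfin : (⋃ j ∈ (univ : Finset (Fin (k + 1))),
          ⋃ p ∈ (univ : Finset PathName), S j p).Finite :=
        Finset.finite_toSet _ |>.biUnion fun j _ => (Finset.finite_toSet _).biUnion fun p _ =>
          hSfin j p
      have h1 := (Set.ncard_le_ncard hsub hfin).trans
        ((Finset.set_ncard_biUnion_le _ _).trans
          (Finset.sum_le_sum fun j _ => Finset.set_ncard_biUnion_le _ _))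
      have h2 : ∀ j p, ((S j p).ncard : ℝ) ≤ F j.succ p (fun p => n - commonOffset th ℓ p) := by
        intro j p
        obtain ⟨hfi, hc⟩ := hcount j.succ p (fun p => n - commonOffset th ℓ p)
        rw [← hc, ← Nat.card_coe_set_eq]
        refine Nat.cast_le.2 (Nat.card_le_card_of_injective (α := S j p)
          (fun D => ⟨⟨D.1, D.2.2⟩, wordsOf_subset th ℓ n D.2.1⟩) ?_)
        intro D D' h
        exact Subtype.ext (congrArg (fun z => z.1.1) h)
      calc _ ≤ ((∑ j : Fin (k + 1), ∑ p, (S j p).ncard : ℕ) : ℝ) := Nat.cast_le.2 h1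
        _ ≤ _ := by
          push_cast
          exact Finset.sum_le_sum fun j _ => Finset.sum_le_sum fun p _ => h2 j p

end WordData

/-! ### Reading a word letter by letter -/

section Words

open Finset

/-- The letter shared by the two paths other than `x`. -/
def com (x : PathName) : Finset PathName := univ.erase x

theorem mem_com {x p : PathName} : p ∈ com x ↔ p ≠ x := by simp [com]

theorem com_ne_singleton (x p : PathName) : com x ≠ {p} := by
  cases x <;> cases p <;> decide

theorem com_injective : Function.Injective com := by
  intro x y h
  by_contra hne
  have : x ∈ com y := mem_com.2 hne
  rw [← h] at this
  exact mem_com.1 this rfl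

/-- The positions after reading a letter. -/
def bump (v : PathName → ℕ) (a : Finset PathName) : PathName → ℕ :=
  fun p => v p + if p ∈ a then 1 else 0

theorem le_bump (v : PathName → ℕ) (a : Finset PathName) : v ≤ bump v a :=
  fun _ => Nat.le_add_right _ _

theorem bump_singleton (v : PathName → ℕ) (p : PathName) : bump v {p} = v + unitVec p := by
  funext q
  by_cases h : q = p
  · subst h; simp [bump, unitVec_self]
  · simp [bump, h, unitVec_of_ne h]

/-- A word read from the positions `v` by admissible steps until all positions are `m`. -/
def IsWord (Step : (PathName → ℕ) → Finset PathName → Prop) (m : ℕ) :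
    (PathName → ℕ) → List (Finset PathName) → Prop
  | v, [] => ∀ p, v p = m
  | v, a :: w => Step v a ∧ IsWord Step m (bump v a) w

/-- The letter `a` may be read at the positions `v`, if the common edges are those of the runs. -/
def LetterStep (m : ℕ) {k : ℕ} (th : Fin k → PathName) (ℓ : Fin k → ℕ) (s : Fin k → PathName → ℕ)
    (v : PathName → ℕ) (a : Finset PathName) : Prop :=
  (∃ p, a = {p} ∧ v p < m ∧ ∀ j, p ≠ th j → ¬ (s j p ≤ v p ∧ v p < s j p + ℓ j)) ∨
  ∃ j, ∃ r < ℓ j, a = com (th j) ∧ ∀ p, p ≠ th j → v p = s j p + r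

/-- Beyond `v`, the admissible steps are those prescribed by the runs. -/
def StepsFrom (Step : (PathName → ℕ) → Finset PathName → Prop) (m : ℕ) {k : ℕ}
    (th : Fin k → PathName) (ℓ : Fin k → ℕ) (s : Fin k → PathName → ℕ) (v : PathName → ℕ) : Prop :=
  ∀ u, v ≤ u → ∀ a, Step u a ↔ LetterStep m th ℓ s u a

theorem StepsFrom.mono {Step : (PathName → ℕ) → Finset PathName → Prop} {m k : ℕ}
    {th : Fin k → PathName} {ℓ : Fin k → ℕ} {s : Fin k → PathName → ℕ} {v v' : PathName → ℕ}
    (h : StepsFrom Step m th ℓ s v) (hv : v ≤ v') : StepsFrom Step m th ℓ s v' :=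
  fun u hu => h u (hv.trans hu)

/-- Beyond its end on both of its paths, the first run no longer restricts or permits any step. This
makes induction on the number of runs possible. -/
theorem StepsFrom.tail {Step : (PathName → ℕ) → Finset PathName → Prop} {m k : ℕ}
    {th : Fin (k + 1) → PathName} {ℓ : Fin (k + 1) → ℕ} {s : Fin (k + 1) → PathName → ℕ}
    {v v' : PathName → ℕ} (h : StepsFrom Step m th ℓ s v) (hv : v ≤ v')
    (h0 : ∀ p, p ≠ th 0 → s 0 p + ℓ 0 ≤ v' p) :
    StepsFrom Step m (fun j => th j.succ) (fun j => ℓ j.succ) (fun j => s j.succ) v' := by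
  intro u hu a
  rw [h u (hv.trans hu)]
  constructor
  · rintro (⟨p, hp, hm, hj⟩ | ⟨j, r, hr, ha, hj⟩)
    · exact Or.inl ⟨p, hp, hm, fun j => hj j.succ⟩
    · refine Or.inr ?_
      rcases Fin.eq_zero_or_eq_succ j with rfl | ⟨j, rfl⟩
      · exfalso
        have h1 := h0 _ (PathName.left_ne (th 0))
        have h2 := hj _ (PathName.left_ne (th 0))
        have h3 : v' (th 0).left ≤ u (th 0).left := hu (th 0).left
        omega
      · exact ⟨j, r, hr, ha, hj⟩
  · rintro (⟨p, hp, hm, hj⟩ | ⟨j, r, hr, ha, hj⟩)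
    · refine Or.inl ⟨p, hp, hm, fun j => ?_⟩
      rcases Fin.eq_zero_or_eq_succ j with rfl | ⟨j, rfl⟩
      · intro hp0
        have h1 := h0 _ hp0
        have h2 : v' p ≤ u p := hu p
        omega
      · exact hj j
    · exact Or.inr ⟨j.succ, r, hr, ha, hj⟩

/-- The letters of a run after its first one: `c` private letters before each common letter. -/
def innerWord (x : PathName) : List ℕ → List (Finset PathName)
  | [] => []
  | c :: L => List.replicate c {x} ++ com x :: innerWord x L

namespace WordData

/-- The word without its first gap and its first run. -/
def tail {k : ℕ} {ℓ : Fin (k + 1) → ℕ} (D : WordData ℓ) : WordData fun j => ℓ j.succ :=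
  (fun j => D.1 j.succ, fun j => D.2 j.succ)

/-- The positions after the first gap and the first run. -/
def afterRun {k : ℕ} {ℓ : Fin (k + 1) → ℕ} (v : PathName → ℕ) (th : Fin (k + 1) → PathName)
    (D : WordData ℓ) : PathName → ℕ :=
  v + letterCount (D.1 0) + blockCount (th 0) (ℓ 0) (∑ i, D.2 0 i)

/-- The word. -/
def flat : {k : ℕ} → (th : Fin k → PathName) → {ℓ : Fin k → ℕ} → WordData ℓ →
    List (Finset PathName)
  | 0, _, _, D => (D.1 0).map fun p => {p}
  | _ + 1, th, _, D => (D.1 0).map (fun p => {p}) ++ com (th 0) ::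
      (innerWord (th 0) (List.ofFn (D.2 0)) ++ flat (fun j => th j.succ) D.tail)

/-- The positions at the starts of the runs. -/
def start : {k : ℕ} → (v : PathName → ℕ) → (th : Fin k → PathName) → {ℓ : Fin k → ℕ} →
    WordData ℓ → Fin k → PathName → ℕ
  | 0, _, _, _, _ => fun j => j.elim0
  | _ + 1, v, th, _, D => Fin.cons (v + letterCount (D.1 0))
      (start (D.afterRun v th) (fun j => th j.succ) D.tail)

theorem start_zero {k : ℕ} {ℓ : Fin (k + 1) → ℕ} (v : PathName → ℕ) (th : Fin (k + 1) → PathName)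
    (D : WordData ℓ) : D.start v th 0 = v + letterCount (D.1 0) := rfl

theorem start_succ {k : ℕ} {ℓ : Fin (k + 1) → ℕ} (v : PathName → ℕ) (th : Fin (k + 1) → PathName)
    (D : WordData ℓ) (j : Fin k) :
    D.start v th j.succ = D.tail.start (D.afterRun v th) (fun j => th j.succ) j := rfl

theorem add_total {k : ℕ} {ℓ : Fin (k + 1) → ℕ} (v : PathName → ℕ) (th : Fin (k + 1) → PathName)
    (D : WordData ℓ) :
    v + D.total th = D.afterRun v th + D.tail.total fun j => th j.succ := by
  simp only [total, afterRun, tail]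
  rw [Fin.sum_univ_succ (fun j => letterCount (D.1 j)),
    Fin.sum_univ_succ (fun j => blockCount (th j) (ℓ j) (∑ i, D.2 j i))]
  abel

theorem le_start {k : ℕ} : ∀ (v : PathName → ℕ) (th : Fin k → PathName) {ℓ : Fin k → ℕ}
    (D : WordData ℓ) (j : Fin k), v ≤ D.start v th j := by
  induction k with
  | zero => exact fun _ _ _ _ j => j.elim0
  | succ k ih =>
    intro v th ℓ D j
    rcases Fin.eq_zero_or_eq_succ j with rfl | ⟨j, rfl⟩
    · rw [start_zero]; exact le_self_add
    · rw [start_succ]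
      refine le_trans ?_ (ih _ _ _ _)
      rw [afterRun, add_assoc]
      exact le_self_add

theorem start_add_le {k : ℕ} : ∀ (v : PathName → ℕ) (th : Fin k → PathName) {ℓ : Fin k → ℕ}
    (D : WordData ℓ) (j : Fin k) (p : PathName), p ≠ th j →
    D.start v th j p + ℓ j ≤ v p + D.total th p := by
  induction k with
  | zero => exact fun _ _ _ _ j => j.elim0
  | succ k ih =>
    intro v th ℓ D j p hp
    have h1 := congrFun (D.add_total v th) p
    simp only [Pi.add_apply] at h1
    rw [h1]
    rcases Fin.eq_zero_or_eq_succ j with rfl | ⟨j, rfl⟩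
    · simp only [start_zero, afterRun, Pi.add_apply, blockCount, if_neg hp]
      omega
    · rw [start_succ]
      exact ih _ _ D.tail j p hp

theorem start_add_count_le {k : ℕ} : ∀ (v : PathName → ℕ) (th : Fin k → PathName) {ℓ : Fin k → ℕ}
    (D : WordData ℓ) (j j' : Fin k) (p : PathName), j < j' → p ≠ th j →
    D.start v th j p + ℓ j + (D.1 j.succ).count p ≤ D.start v th j' p := by
  induction k with
  | zero => exact fun _ _ _ _ j => j.elim0
  | succ k ih =>
    intro v th ℓ D j j' p hj hp
    rcases Fin.eq_zero_or_eq_succ j' with rfl | ⟨j', rfl⟩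
    · exact absurd hj (Fin.not_lt_zero j)
    rcases Fin.eq_zero_or_eq_succ j with rfl | ⟨j, rfl⟩
    · rw [start_succ]
      have h0 : ∀ (k : ℕ) (v : PathName → ℕ) (th : Fin k → PathName) (ℓ : Fin k → ℕ)
          (D : WordData ℓ) (j : Fin k), v p + (D.1 0).count p ≤ D.start v th j p := by
        intro k v th ℓ D j
        rcases k with _ | k
        · exact j.elim0
        rcases Fin.eq_zero_or_eq_succ j with rfl | ⟨j, rfl⟩
        · exact le_rfl
        · rw [start_succ]
          refine le_trans ?_ (le_start _ _ _ _ p)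
          rw [afterRun]
          exact Nat.le_add_right _ _
      refine le_trans ?_ (h0 _ _ _ _ _ _)
      simp only [start_zero, afterRun, Pi.add_apply, blockCount, if_neg hp]
      exact le_rfl
    · rw [start_succ, start_succ]
      exact ih _ _ D.tail j j' p (Fin.succ_lt_succ_iff.1 hj) hp

theorem stronglySeparated_start {k : ℕ} (v : PathName → ℕ) (th : Fin k → PathName) {ℓ : Fin k → ℕ}
    (D : WordData ℓ) (hD : D.Spread) : StronglySeparated th ℓ (D.start v th) := by
  intro j j' hj p hp _
  have h1 := start_add_count_le v th D j j' p hj hp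
  have h2 := hD j p
  omega

end WordData

section Reading

variable {Step : (PathName → ℕ) → Finset PathName → Prop} {m : ℕ}

theorem isWord_map_append (g : List PathName) : ∀ {v : PathName → ℕ} {w : List (Finset PathName)},
    (∀ u p, v ≤ u → u + unitVec p ≤ v + letterCount g → Step u {p}) →
    IsWord Step m (v + letterCount g) w →
    IsWord Step m v (g.map (fun p => {p}) ++ w) := by
  induction g with
  | nil => intro v w _ h; simpa [letterCount_nil] using h
  | cons p g ih =>
    intro v w hs h
    have e : v + letterCount (p :: g) = v + unitVec p + letterCount g := by
      rw [letterCount_cons]; abel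
    refine ⟨hs v p le_rfl ?_, ?_⟩
    · rw [e]; exact le_self_add
    · rw [bump_singleton]
      refine ih (fun u q hu hq => hs u q (le_self_add.trans hu) (by rw [e]; exact hq)) ?_
      rw [← e]; exact h

theorem letterCount_replicate (c : ℕ) (x : PathName) :
    letterCount (List.replicate c x) = blockCount x 0 c := by
  funext p
  by_cases h : p = x
  · subst h; simp [letterCount, blockCount]
  · simp [letterCount, blockCount, List.count_replicate, h, Ne.symm h]

theorem isWord_innerWord_append (x : PathName) {X N : ℕ} {S : PathName → ℕ} (L : List ℕ) :
    ∀ {u : PathName → ℕ} {r : ℕ} {w : List (Finset PathName)},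
    (∀ u', u ≤ u' → u' x < X → Step u' {x}) →
    (∀ u', u ≤ u' → ∀ r < N, (∀ p, p ≠ x → u' p = S p + r) → Step u' (com x)) →
    (∀ p, p ≠ x → u p = S p + r) → r + L.length ≤ N → u x + L.sum ≤ X →
    IsWord Step m (u + blockCount x L.length L.sum) w →
    IsWord Step m u (innerWord x L ++ w) := by
  induction L with
  | nil =>
    intro u r w _ _ _ _ _ h
    have : u + blockCount x (List.length ([] : List ℕ)) (List.sum []) = u := by
      funext p; simp [blockCount]
    rwa [this] at h
  | cons c L ih =>
    intro u r w hx hc hu hN hX h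
    rw [List.length_cons] at hN
    rw [List.sum_cons] at hX
    have e : List.replicate c ({x} : Finset PathName) =
        (List.replicate c x).map fun p => {p} := by rw [List.map_replicate]
    rw [innerWord, e, List.append_assoc]
    have hval : ∀ p, (u + letterCount (List.replicate c x)) p =
        u p + if p = x then c else 0 := by
      intro p; rw [letterCount_replicate]; rfl
    refine isWord_map_append _ (fun u' p hu' hp => ?_) ?_
    · have h1 : (u' + unitVec p) p ≤ (u + letterCount (List.replicate c x)) p := hp p
      rw [hval, Pi.add_apply, unitVec_self] at h1
      have h2 : u p ≤ u' p := hu' p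
      by_cases hpx : p = x
      · subst hpx
        rw [if_pos rfl] at h1
        exact hx u' hu' (by omega)
      · rw [if_neg hpx] at h1; omega
    · refine ⟨hc _ le_self_add r (by omega) fun p hp => ?_, ?_⟩
      · rw [hval, if_neg hp, hu p hp, add_zero]
      · refine ih (r := r + 1) (fun u' hu' => hx u' (le_self_add.trans ((le_bump _ _).trans hu')))
          (fun u' hu' => hc u' (le_self_add.trans ((le_bump _ _).trans hu'))) (fun p hp => ?_)
          (by omega) ?_ ?_
        · rw [bump, hval, if_neg hp, if_pos (mem_com.2 hp), hu p hp]; omega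
        · rw [bump, hval, if_pos rfl, if_neg (by simp [mem_com])]; omega
        · convert h using 1
          funext p
          rw [Pi.add_apply, bump, hval, Pi.add_apply]
          by_cases hp : p = x
          · simp [hp, mem_com, blockCount]; ring
          · simp [hp, mem_com, blockCount]; ring

theorem WordData.isWord_flat {k : ℕ} : ∀ {v : PathName → ℕ} {th : Fin k → PathName}
    {ℓ : Fin k → ℕ} {D : WordData ℓ}, (∀ j, 1 ≤ ℓ j) → (∀ p, v p + D.total th p = m) →
    StepsFrom Step m th ℓ (D.start v th) v → IsWord Step m v (D.flat th) := by
  induction k with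
  | zero =>
    intro v th ℓ D _ hm hs
    have h1 : ∀ p, (v + letterCount (D.1 0)) p = m := fun p => by
      rw [← hm p]; simp [WordData.total]
    have := isWord_map_append (Step := Step) (m := m) (D.1 0) (v := v) (w := [])
      (fun u p hu hp => ?_) h1
    · simpa [WordData.flat] using this
    · refine (hs u hu _).2 (Or.inl ⟨p, rfl, ?_, fun j => j.elim0⟩)
      have h2 := hp p
      rw [h1, Pi.add_apply, unitVec_self] at h2
      exact h2
  | succ k ih =>
    intro v th ℓ D hℓ hm hs
    have htot : ∀ p, D.afterRun v th p + D.tail.total (fun j => th j.succ) p = m := by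
      intro p
      have h1 := congrFun (D.add_total v th) p
      simp only [Pi.add_apply] at h1
      rw [← h1]; exact hm p
    have hle : v ≤ D.afterRun v th := by
      rw [WordData.afterRun, add_assoc]; exact le_self_add
    have hafter : ∀ p, p ≠ th 0 → D.afterRun v th p = D.start v th 0 p + ℓ 0 := by
      intro p hp
      simp [WordData.afterRun, WordData.start_zero, blockCount, hp]
    have hafter0 : D.afterRun v th (th 0) = D.start v th 0 (th 0) + ∑ i, D.2 0 i := by
      simp [WordData.afterRun, WordData.start_zero, blockCount]
    have htail : StepsFrom Step m (fun j => th j.succ) (fun j => ℓ j.succ)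
        (D.tail.start (D.afterRun v th) fun j => th j.succ) (D.afterRun v th) :=
      hs.tail (s := D.start v th) hle fun p hp => (hafter p hp).ge
    have hlater : ∀ (j : Fin k) p, D.afterRun v th p ≤ D.start v th j.succ p := fun j p =>
      WordData.le_start _ _ D.tail j p
    have hstart : ∀ p, D.start v th 0 p ≤ D.afterRun v th p := fun p => by
      rw [WordData.start_zero, WordData.afterRun]; exact Nat.le_add_right _ _
    have hw := ih (fun j => hℓ j.succ) htot htail
    have h0 := hℓ 0
    rw [WordData.flat]
    refine isWord_map_append _ (fun u p hu hp => (hs u hu _).2 (Or.inl ⟨p, rfl, ?_, ?_⟩)) ?_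
    · have h2 : (u + unitVec p) p ≤ (v + letterCount (D.1 0)) p := hp p
      rw [← WordData.start_zero v th D, Pi.add_apply, unitVec_self] at h2
      have h3 := hstart p
      have h4 := htot p
      omega
    · have h2 : (u + unitVec p) p ≤ (v + letterCount (D.1 0)) p := hp p
      rw [← WordData.start_zero v th D, Pi.add_apply, unitVec_self] at h2
      intro j hj
      rcases Fin.eq_zero_or_eq_succ j with rfl | ⟨j, rfl⟩
      · omega
      · have h3 := hstart p
        have h4 := hlater j p
        omega
    · rw [← WordData.start_zero v th D]
      have hv0 : v ≤ D.start v th 0 := WordData.le_start _ _ _ _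
      refine ⟨(hs _ hv0 _).2 (Or.inr ⟨0, 0, h0, rfl, fun p _ => rfl⟩), ?_⟩
      refine isWord_innerWord_append (th 0) (X := D.afterRun v th (th 0)) (N := ℓ 0)
        (S := D.start v th 0) (r := 1) (List.ofFn (D.2 0)) (fun u hu hX => ?_)
        (fun u hu r hr hp => ?_) (fun p hp => ?_) ?_ ?_ ?_
      · refine (hs u (hv0.trans ((le_bump _ _).trans hu)) _).2 (Or.inl ⟨th 0, rfl, ?_, ?_⟩)
        · have := htot (th 0); omega
        · intro j hj
          rcases Fin.eq_zero_or_eq_succ j with rfl | ⟨j, rfl⟩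
          · exact absurd rfl hj
          · have := hlater j (th 0); omega
      · exact (hs u (hv0.trans ((le_bump _ _).trans hu)) _).2 (Or.inr ⟨0, r, hr, rfl, hp⟩)
      · rw [bump, if_pos (mem_com.2 hp)]
      · rw [List.length_ofFn]; omega
      · rw [bump, if_neg (by simp [mem_com]), List.sum_ofFn, hafter0]; omega
      · convert hw using 1
        funext p
        rw [Pi.add_apply, bump, List.length_ofFn, List.sum_ofFn]
        by_cases hp : p = th 0
        · rw [hp, if_neg (by simp [mem_com]), hafter0]
          simp [blockCount]
        · rw [if_pos (mem_com.2 hp), hafter p hp]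
          simp only [blockCount, if_neg hp]
          omega

end Reading

end Words

section Peeling

open Finset

variable {Step : (PathName → ℕ) → Finset PathName → Prop} {m : ℕ}

theorem IsWord.exists_map {th : Fin 0 → PathName} {ℓ : Fin 0 → ℕ} {s : Fin 0 → PathName → ℕ}
    (w : List (Finset PathName)) : ∀ {v : PathName → ℕ}, StepsFrom Step m th ℓ s v →
    IsWord Step m v w →
    ∃ g : List PathName, w = g.map (fun p => {p}) ∧ ∀ p, (v + letterCount g) p = m := by
  induction w with
  | nil =>
    intro v _ h
    have h1 : ∀ p, v p = m := h
    exact ⟨[], rfl, by simpa [letterCount_nil] using h1⟩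
  | cons a w ih =>
    rintro v hs ⟨h1, h2⟩
    rcases (hs v le_rfl a).1 h1 with ⟨p, rfl, -, -⟩ | ⟨j, -⟩
    · obtain ⟨g, hg, hm⟩ := ih (hs.mono (le_bump _ _)) h2
      refine ⟨p :: g, by rw [hg]; rfl, fun q => ?_⟩
      rw [← hm q, letterCount_cons, bump_singleton]
      simp only [Pi.add_apply]
      ring
    · exact j.elim0

theorem IsWord.exists_gap {k : ℕ} {th : Fin (k + 1) → PathName} {ℓ : Fin (k + 1) → ℕ}
    {s : Fin (k + 1) → PathName → ℕ} (hℓ : ∀ j, 1 ≤ ℓ j)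
    (hfit : ∀ j p, p ≠ th j → s j p + ℓ j ≤ m)
    (hsep : ∀ j j', j < j' → ∀ p, p ≠ th j → p ≠ th j' → s j p + ℓ j < s j' p)
    (w : List (Finset PathName)) : ∀ {v : PathName → ℕ}, StepsFrom Step m th ℓ s v →
    (∀ j p, p ≠ th j → v p ≤ s j p) → IsWord Step m v w →
    ∃ (g : List PathName) (w' : List (Finset PathName)),
      w = g.map (fun p => {p}) ++ com (th 0) :: w' ∧
      (∀ p, p ≠ th 0 → (v + letterCount g) p = s 0 p) ∧
      (∀ j p, p ≠ th j → (v + letterCount g) p ≤ s j p) ∧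
      IsWord Step m (bump (v + letterCount g) (com (th 0))) w' := by
  induction w with
  | nil =>
    intro v _ hv h
    have h1 := hfit 0 _ (PathName.left_ne (th 0))
    have h2 := hv 0 _ (PathName.left_ne (th 0))
    have h3 := hℓ 0
    have h4 : v _ = m := h (th 0).left
    omega
  | cons a w ih =>
    rintro v hs hv ⟨h1, h2⟩
    rcases (hs v le_rfl a).1 h1 with ⟨p, rfl, -, hp⟩ | ⟨j, r, hr, rfl, hj⟩
    · obtain ⟨g, w', hg, hg1, hg2, hg3⟩ := ih (hs.mono (le_bump _ _)) (fun j q hq => by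
        have h3 := hv j q hq
        have h4 := hℓ j
        rw [bump]
        split_ifs with hqp
        · rw [Finset.mem_singleton] at hqp
          subst hqp
          have h5 := hp j hq
          omega
        · exact h3) h2
      have e : v + letterCount (p :: g) = bump v {p} + letterCount g := by
        rw [letterCount_cons, bump_singleton]; abel
      refine ⟨p :: g, w', by rw [hg]; rfl, ?_, ?_, ?_⟩ <;> rw [e]
      exacts [hg1, hg2, hg3]
    · have hr0 : r = 0 := by
        have h3 := hj _ (PathName.left_ne (th j))
        have h4 := hv j _ (PathName.left_ne (th j))
        omega
      subst hr0
      have hj0 : j = 0 := by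
        by_contra hne
        obtain ⟨p, hp1, hp2⟩ := PathName.exists_ne_ne (th 0) (th j)
        have h3 := hsep 0 j (Fin.pos_iff_ne_zero.2 hne) p hp1 hp2
        have h4 := hj p hp2
        have h5 := hv 0 p hp1
        omega
      subst hj0
      exact ⟨[], w, rfl, fun p hp => by simpa [letterCount_nil] using hj p hp,
        fun j p hp => by simpa [letterCount_nil] using hv j p hp,
        by simpa [letterCount_nil] using h2⟩

theorem IsWord.exists_inner {k : ℕ} {th : Fin (k + 1) → PathName} {ℓ : Fin (k + 1) → ℕ}
    {s : Fin (k + 1) → PathName → ℕ} (hℓ : ∀ j, 1 ≤ ℓ j)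
    (hfit : ∀ j p, p ≠ th j → s j p + ℓ j ≤ m)
    (hsep : ∀ j j', j < j' → ∀ p, p ≠ th j → p ≠ th j' → s j p + ℓ j < s j' p)
    (w : List (Finset PathName)) : ∀ {u : PathName → ℕ} {r : ℕ}, StepsFrom Step m th ℓ s u →
    r ≤ ℓ 0 → (∀ p, p ≠ th 0 → u p = s 0 p + r) →
    (∀ (j : Fin k) p, p ≠ th j.succ → u p ≤ s j.succ p) → IsWord Step m u w →
    ∃ (L : List ℕ) (w' : List (Finset PathName)),
      r + L.length = ℓ 0 ∧ w = innerWord (th 0) L ++ w' ∧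
      (∀ (j : Fin k) p, p ≠ th j.succ → (u + blockCount (th 0) L.length L.sum) p ≤ s j.succ p) ∧
      IsWord Step m (u + blockCount (th 0) L.length L.sum) w' := by
  induction w with
  | nil =>
    intro u r _ hr hu hv h
    have h1 := hfit 0 _ (PathName.left_ne (th 0))
    have h2 := hu _ (PathName.left_ne (th 0))
    have h4 : u _ = m := h (th 0).left
    have e : u + blockCount (th 0) (List.length ([] : List ℕ)) (List.sum []) = u := by
      funext p; simp [blockCount]
    refine ⟨[], [], by simp only [List.length_nil]; omega, rfl, ?_, ?_⟩ <;> rw [e]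
    exacts [hv, h]
  | cons a w ih =>
    rintro u r hs hr hu hv hw
    have e0 : u + blockCount (th 0) (List.length ([] : List ℕ)) (List.sum []) = u := by
      funext p; simp [blockCount]
    by_cases hrl : r = ℓ 0
    · refine ⟨[], a :: w, by simpa using hrl, rfl, ?_, ?_⟩ <;> rw [e0]
      exacts [hv, hw]
    obtain ⟨h1, h2⟩ := hw
    rcases (hs u le_rfl a).1 h1 with ⟨p, rfl, -, hp⟩ | ⟨j, r', hr', rfl, hj⟩
    · have hpx : p = th 0 := by
        by_contra hne
        have h3 := hp 0 hne
        have h4 := hu p hne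
        omega
      subst hpx
      have hb : ∀ q, q ≠ th 0 → bump u {th 0} q = u q := fun q hq => by
        rw [bump, if_neg (by simpa using hq), add_zero]
      obtain ⟨L, w', hL, hw', hL1, hL2⟩ := ih (r := r) (hs.mono (le_bump _ _)) hr
        (fun q hq => by rw [hb q hq]; exact hu q hq) (fun j q hq => by
          by_cases hqx : q = th 0
          · subst hqx
            have h3 := hp j.succ hq
            have h4 := hv j _ hq
            have h5 := hℓ j.succ
            rw [bump, if_pos (Finset.mem_singleton_self _)]
            omega
          · rw [hb q hqx]; exact hv j q hq) h2
      rcases L with _ | ⟨c, L⟩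
      · simp only [List.length_nil] at hL; omega
      have e : u + blockCount (th 0) ((c + 1) :: L).length ((c + 1) :: L).sum =
          bump u {th 0} + blockCount (th 0) (c :: L).length (c :: L).sum := by
        funext q
        by_cases hq : q = th 0
        · subst hq; simp [bump, blockCount]; ring
        · rw [Pi.add_apply, Pi.add_apply, hb q hq]; simp [blockCount, hq]
      refine ⟨(c + 1) :: L, w', by simpa using hL, ?_, ?_, ?_⟩
      · rw [hw']; simp [innerWord, List.replicate_succ]
      · rw [e]; exact hL1
      · rw [e]; exact hL2
    · rcases Fin.eq_zero_or_eq_succ j with rfl | ⟨j, rfl⟩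
      · have hrr : r' = r := by
          have h3 := hj _ (PathName.left_ne (th 0))
          have h4 := hu _ (PathName.left_ne (th 0))
          omega
        subst hrr
        have hb : ∀ q, q ≠ th 0 → bump u (com (th 0)) q = u q + 1 := fun q hq => by
          rw [bump, if_pos (mem_com.2 hq)]
        obtain ⟨L, w', hL, hw', hL1, hL2⟩ := ih (r := r' + 1) (hs.mono (le_bump _ _)) (by omega)
          (fun q hq => by rw [hb q hq, hu q hq]; ring) (fun j q hq => by
            by_cases hqx : q = th 0
            · subst hqx
              rw [bump, if_neg (by simp [mem_com]), add_zero]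
              exact hv j _ hq
            · rw [hb q hqx, hu q hqx]
              have := hsep 0 j.succ (Fin.succ_pos j) q hqx hq
              omega) h2
        have e : u + blockCount (th 0) (0 :: L).length (0 :: L).sum =
            bump u (com (th 0)) + blockCount (th 0) L.length L.sum := by
          funext q
          by_cases hq : q = th 0
          · subst hq; simp [bump, blockCount, mem_com]
          · rw [Pi.add_apply, Pi.add_apply, hb q hq]; simp [blockCount, hq]; ring
        refine ⟨0 :: L, w', by simp only [List.length_cons]; omega, ?_, ?_, ?_⟩
        · rw [hw']; simp [innerWord]
        · rw [e]; exact hL1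
        · rw [e]; exact hL2
      · exfalso
        obtain ⟨p, hp1, hp2⟩ := PathName.exists_ne_ne (th 0) (th j.succ)
        have h3 := hsep 0 j.succ (Fin.succ_pos j) p hp1 hp2
        have h4 := hj p hp2
        have h5 := hu p hp1
        omega

theorem IsWord.exists_flat {k : ℕ} : ∀ {th : Fin k → PathName} {ℓ : Fin k → ℕ}
    {s : Fin k → PathName → ℕ}, (∀ j, 1 ≤ ℓ j) →
    (∀ j p, p ≠ th j → s j p + ℓ j ≤ m) →
    (∀ j j', j < j' → ∀ p, p ≠ th j → p ≠ th j' → s j p + ℓ j < s j' p) →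
    ∀ {w : List (Finset PathName)} {v : PathName → ℕ}, StepsFrom Step m th ℓ s v →
    (∀ j p, p ≠ th j → v p ≤ s j p) → IsWord Step m v w →
    ∃ D : WordData ℓ, w = D.flat th ∧ (∀ j p, p ≠ th j → D.start v th j p = s j p) ∧
      ∀ p, v p + D.total th p = m := by
  induction k with
  | zero =>
    intro th ℓ s _ _ _ w v hs _ hw
    obtain ⟨g, hg, hm⟩ := hw.exists_map w hs
    refine ⟨(fun _ => g, fun j => j.elim0), hg, fun j => j.elim0, fun p => ?_⟩
    rw [← hm p]
    simp [WordData.total]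
  | succ k ih =>
    intro th ℓ s hℓ hfit hsep w v hs hv hw
    obtain ⟨g, w₁, hg, hg1, hg2, hg3⟩ := hw.exists_gap hℓ hfit hsep w hs hv
    have hvg : v ≤ bump (v + letterCount g) (com (th 0)) := le_self_add.trans (le_bump _ _)
    have hb : ∀ q, q ≠ th 0 → bump (v + letterCount g) (com (th 0)) q = s 0 q + 1 :=
      fun q hq => by rw [bump, if_pos (mem_com.2 hq), hg1 q hq]
    have hb0 : bump (v + letterCount g) (com (th 0)) (th 0) = (v + letterCount g) (th 0) := by
      rw [bump, if_neg (by simp [mem_com]), add_zero]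
    obtain ⟨L, w₂, hL, hw₂, hL1, hL2⟩ := hg3.exists_inner hℓ hfit hsep w₁ (r := 1) (hs.mono hvg)
      (hℓ 0) hb (fun j q hq => by
        by_cases hqx : q = th 0
        · subst hqx; rw [hb0]; exact hg2 _ _ hq
        · rw [hb q hqx]
          have := hsep 0 j.succ (Fin.succ_pos j) q hqx hq
          have := hℓ 0
          omega)
    set u := bump (v + letterCount g) (com (th 0)) + blockCount (th 0) L.length L.sum with hu
    have hvu : v ≤ u := hvg.trans le_self_add
    obtain ⟨D, hD, hD1, hD2⟩ := ih (fun j => hℓ j.succ) (fun j => hfit j.succ)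
      (fun j j' hj => hsep j.succ j'.succ (Fin.succ_lt_succ_iff.2 hj))
      (hs.tail hvu fun p hp => by
        rw [hu, Pi.add_apply, hb p hp]; simp [blockCount, hp]; omega) hL1 hL2
    have hlen : L.length = ℓ 0 - 1 := by omega
    obtain ⟨y, hy⟩ : ∃ y : Fin (ℓ 0 - 1) → ℕ, List.ofFn y = L := by
      rw [← hlen]; exact ⟨L.get, List.ofFn_get L⟩
    let E : WordData ℓ := (Fin.cons g D.1, Fin.cons y D.2)
    have hE : E.tail = D := rfl
    have hafter : E.afterRun v th = u := by
      funext q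
      have hsum : ∑ i, y i = L.sum := by rw [← hy, List.sum_ofFn]
      have e1 : E.afterRun v th q = (v + letterCount g) q + blockCount (th 0) (ℓ 0) (∑ i, y i) q :=
        rfl
      rw [e1, hu, Pi.add_apply _ (blockCount _ _ _), hsum]
      by_cases hq : q = th 0
      · subst hq; rw [hb0]; simp [blockCount]
      · rw [hb q hq, hg1 q hq]; simp only [blockCount, if_neg hq]; omega
    refine ⟨E, ?_, fun j p hp => ?_, fun p => ?_⟩
    · rw [hg, hw₂, hD, ← hy]; rfl
    · rcases Fin.eq_zero_or_eq_succ j with rfl | ⟨j, rfl⟩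
      · exact hg1 p hp
      · rw [WordData.start_succ, hafter]; exact hD1 j p hp
    · have h1 := congrFun (E.add_total v th) p
      rw [hafter] at h1
      exact h1.trans (hD2 p)

theorem map_singleton_append_inj {x : PathName} (g : List PathName) :
    ∀ {g' : List PathName} {w w' : List (Finset PathName)},
    g.map (fun p => ({p} : Finset PathName)) ++ com x :: w =
      g'.map (fun p => {p}) ++ com x :: w' → g = g' ∧ w = w' := by
  induction g with
  | nil =>
    intro g' w w' h
    rcases g' with _ | ⟨p, g'⟩
    · simpa using h
    · exact absurd (List.cons.inj h).1 (com_ne_singleton _ _)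
  | cons q g ih =>
    intro g' w w' h
    rcases g' with _ | ⟨p, g'⟩
    · exact absurd (List.cons.inj h).1.symm (com_ne_singleton _ _)
    · obtain ⟨h1, h2⟩ := List.cons.inj h
      obtain ⟨rfl, h4⟩ := ih h2
      exact ⟨by rw [Finset.singleton_injective h1], h4⟩

theorem innerWord_append_inj {x : PathName} (L : List ℕ) :
    ∀ {L' : List ℕ} {w w' : List (Finset PathName)}, L.length = L'.length →
    innerWord x L ++ w = innerWord x L' ++ w' → L = L' ∧ w = w' := by
  induction L with
  | nil =>
    intro L' w w' hl h
    rcases L' with _ | ⟨c, L'⟩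
    · exact ⟨rfl, h⟩
    · simp at hl
  | cons c L ih =>
    intro L' w w' hl h
    rcases L' with _ | ⟨c', L'⟩
    · simp at hl
    · have e : ∀ c, List.replicate c ({x} : Finset PathName) =
          (List.replicate c x).map fun p => {p} := fun c => by rw [List.map_replicate]
      rw [innerWord, innerWord, e, e, List.append_assoc, List.append_assoc] at h
      obtain ⟨h1, h2⟩ := map_singleton_append_inj _ h
      obtain ⟨h3, h4⟩ := ih (by simpa using hl) h2
      have h5 := congrArg List.length h1
      simp only [List.length_replicate] at h5
      exact ⟨by rw [h5, h3], h4⟩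

theorem WordData.flat_injective {k : ℕ} : ∀ (th : Fin k → PathName) {ℓ : Fin k → ℕ},
    Function.Injective fun D : WordData ℓ => D.flat th := by
  induction k with
  | zero =>
    intro th ℓ D D' h
    have h1 := List.map_injective_iff.2 (Finset.singleton_injective (α := PathName)) h
    refine Prod.ext (funext fun j => ?_) (funext fun j => j.elim0)
    obtain rfl : j = 0 := Fin.fin_one_eq_zero j
    exact h1
  | succ k ih =>
    intro th ℓ D D' h
    obtain ⟨h1, h2⟩ := map_singleton_append_inj _ h
    obtain ⟨h3, h4⟩ := innerWord_append_inj _ (by simp) h2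
    have h5 := ih _ h4
    refine Prod.ext (funext fun j => ?_) (funext fun j => ?_)
    · rcases Fin.eq_zero_or_eq_succ j with rfl | ⟨j, rfl⟩
      · exact h1
      · exact congrFun (congrArg Prod.fst h5) j
    · rcases Fin.eq_zero_or_eq_succ j with rfl | ⟨j, rfl⟩
      · exact List.ofFn_injective h3
      · exact congrFun (congrArg Prod.snd h5) j

end Peeling

section EdgeWords

open Finset

variable {m : ℕ}

/-- The letter `a` labels the edges of the paths at the positions `v`. -/
def EdgeStep (σ : PathName → HamPath (m + 1)) (v : PathName → ℕ) (a : Finset PathName) : Prop :=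
  a.Nonempty ∧ ∃ e, ∀ p, (p ∈ a → v p < m ∧ e = (σ p).edge (v p)) ∧ (p ∉ a → e ∉ (σ p).edges)

theorem PathName.eq_or_eq_of_ne {p q x y : PathName} (hpq : p ≠ q) (hp : p ≠ x) (hq : q ≠ x)
    (hy : y ≠ x) : y = p ∨ y = q := by
  revert hpq hp hq hy; cases x <;> cases y <;> cases p <;> cases q <;> decide

theorem HasRuns.stepsFrom {k : ℕ} {σ : PathName → HamPath (m + 1)} {th : Fin k → PathName}
    {dir : Fin k → Bool} {ℓ : Fin k → ℕ} {s : Fin k → PathName → ℕ} (h : HasRuns σ th dir ℓ s)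
    (P : RunPositions m th dir ℓ s) (v : PathName → ℕ) :
    StepsFrom (EdgeStep σ) m th ℓ s v := by
  intro u _ a
  constructor
  · rintro ⟨⟨p, hp⟩, e, he⟩
    obtain ⟨hpm, hpe⟩ := (he p).1 hp
    by_cases hq : ∃ q ∈ a, q ≠ p
    · obtain ⟨q, hqa, hqp⟩ := hq
      obtain ⟨hqm, hqe⟩ := (he q).1 hqa
      obtain ⟨j, h1, h2, r, hr, h3, h4⟩ := h.exact p q hqp.symm _ hpm _ hqm (hpe.symm.trans hqe)
      have hth : th j ∉ a := by
        intro ht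
        obtain ⟨htm, hte⟩ := (he (th j)).1 ht
        obtain ⟨j', h1', h2', r', hr', h3', -⟩ := h.exact p (th j) h1 _ hpm _ htm
          (hpe.symm.trans hte)
        obtain ⟨rfl, -⟩ := P.unique h1 h1' hr.le hr'.le (h3.symm.trans h3')
        exact h2' rfl
      refine Or.inr ⟨j, r, hr, ?_, ?_⟩
      · ext x
        rw [mem_com]
        constructor
        · rintro hx rfl; exact hth hx
        · intro hx
          rcases PathName.eq_or_eq_of_ne hqp.symm h1 h2 hx with rfl | rfl <;> assumption
      · intro x hx
        rcases PathName.eq_or_eq_of_ne hqp.symm h1 h2 hx with rfl | rfl <;> assumption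
    · push Not at hq
      refine Or.inl ⟨p, ?_, hpm, ?_⟩
      · ext x
        rw [Finset.mem_singleton]
        exact ⟨fun hx => hq x hx, fun hx => hx ▸ hp⟩
      · rintro j hj ⟨h1, h2⟩
        obtain ⟨q, hqp, hqj⟩ := PathName.exists_ne_ne p (th j)
        have h3 := edge_eq_of_agree (h.agree j) (P.opp j) (r := u p - s j p) (by omega) hj hqj
        rw [Nat.add_sub_cancel' h1, ← hpe] at h3
        have h4 := P.fits j q hqj
        refine (he q).2 (fun hqa => hqp (hq q hqa)) ?_
        rw [h3]
        exact HamPath.edge_mem_edges _ (by omega)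
  · rintro (⟨p, rfl, hpm, hp⟩ | ⟨j, r, hr, rfl, hj⟩)
    · refine ⟨Finset.singleton_nonempty p, (σ p).edge (u p), fun q => ⟨fun hq => ?_, fun hq hqe => ?_⟩⟩
      · rw [Finset.mem_singleton] at hq
        subst hq
        exact ⟨hpm, rfl⟩
      · rw [Finset.mem_singleton] at hq
        obtain ⟨i, hi, hie⟩ := ((σ q).mem_edges_iff _).1 hqe
        obtain ⟨j, h1, h2, r, hr, h3, -⟩ := h.exact p q (Ne.symm hq) _ hpm _ hi hie
        exact hp j h1 ⟨by omega, by omega⟩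
    · have hl := PathName.left_ne (th j)
      have hfit := fun p hp => P.fits j p hp
      refine ⟨⟨_, mem_com.2 hl⟩, (σ (th j).left).edge (s j (th j).left + r),
        fun q => ⟨fun hq => ?_, fun hq hqe => ?_⟩⟩
      · rw [mem_com] at hq
        have := hfit q hq
        exact ⟨by rw [hj q hq]; omega, by
          rw [hj q hq]; exact edge_eq_of_agree (h.agree j) (P.opp j) hr hl hq⟩
      · rw [mem_com, not_not] at hq
        subst hq
        obtain ⟨i, hi, hie⟩ := ((σ _).mem_edges_iff _).1 hqe
        have h0 := hfit _ hl
        obtain ⟨j', h1, h2, r', hr', h3, -⟩ := h.exact _ _ hl _ (by omega) _ hi hie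
        obtain ⟨rfl, -⟩ := P.unique hl h1 hr.le hr'.le h3
        exact h2 rfl

open scoped Classical in
/-- The set of paths containing an edge. -/
noncomputable def edgeLabel (σ : PathName → HamPath (m + 1)) (e : Sym2 (Fin (m + 1))) :
    Finset PathName :=
  univ.filter fun p => e ∈ (σ p).edges

theorem mem_edgeLabel {σ : PathName → HamPath (m + 1)} {e : Sym2 (Fin (m + 1))} {p : PathName} :
    p ∈ edgeLabel σ e ↔ e ∈ (σ p).edges := by
  simp [edgeLabel]

/-- The edge at the positions `v` with label `a`. -/
def pickEdge (σ : PathName → HamPath (m + 1)) (v : PathName → ℕ) (a : Finset PathName) :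
    Sym2 (Fin (m + 1)) :=
  if .A ∈ a then (σ .A).edge (v .A) else if .B ∈ a then (σ .B).edge (v .B) else (σ .C).edge (v .C)

theorem pickEdge_eq {σ : PathName → HamPath (m + 1)} {v : PathName → ℕ} {a : Finset PathName}
    (ha : a.Nonempty) {e : Sym2 (Fin (m + 1))} (he : ∀ p ∈ a, e = (σ p).edge (v p)) :
    pickEdge σ v a = e := by
  unfold pickEdge
  split_ifs with h1 h2
  · exact (he _ h1).symm
  · exact (he _ h2).symm
  · obtain ⟨p, hp⟩ := ha
    cases p
    · exact absurd hp h1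
    · exact absurd hp h2
    · exact (he _ hp).symm

/-- The edges spelled by a word. -/
def edgesOfWord (σ : PathName → HamPath (m + 1)) : (PathName → ℕ) → List (Finset PathName) →
    List (Sym2 (Fin (m + 1)))
  | _, [] => []
  | v, a :: w => pickEdge σ v a :: edgesOfWord σ (bump v a) w

open scoped Classical in
/-- The list contains the edges of the paths from the positions `v` on, those of each path in the
order in which it traverses them. -/
def IsEdgeList (σ : PathName → HamPath (m + 1)) (v : PathName → ℕ)
    (l : List (Sym2 (Fin (m + 1)))) : Prop :=
  (∀ e ∈ l, ∃ p, e ∈ (σ p).edges) ∧ ∀ p, v p ≤ m ∧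
    l.filter (fun e => e ∈ (σ p).edges) = (List.range' (v p) (m - v p)).map (σ p).edge

theorem range'_eq_cons {v m : ℕ} (h : v < m) :
    List.range' v (m - v) = v :: List.range' (v + 1) (m - (v + 1)) := by
  rw [show m - v = (m - (v + 1)) + 1 by omega, List.range'_succ]

theorem isEdgeList_cons_iff {σ : PathName → HamPath (m + 1)} {v : PathName → ℕ}
    {e : Sym2 (Fin (m + 1))} {l : List (Sym2 (Fin (m + 1)))} :
    IsEdgeList σ v (e :: l) ↔ (edgeLabel σ e).Nonempty ∧
      (∀ p ∈ edgeLabel σ e, v p < m ∧ e = (σ p).edge (v p)) ∧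
      IsEdgeList σ (bump v (edgeLabel σ e)) l := by
  classical
  constructor
  · rintro ⟨h1, h2⟩
    obtain ⟨q, hq⟩ := h1 e List.mem_cons_self
    have key : ∀ p ∈ edgeLabel σ e, v p < m ∧ e = (σ p).edge (v p) ∧
        l.filter (fun e => e ∈ (σ p).edges) =
          (List.range' (v p + 1) (m - (v p + 1))).map (σ p).edge := by
      intro p hp
      obtain ⟨h3, h4⟩ := h2 p
      rw [List.filter_cons_of_pos (by simpa using mem_edgeLabel.1 hp)] at h4
      have hlt : v p < m := by
        rcases h3.lt_or_eq with h5 | h5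
        · exact h5
        · rw [h5, Nat.sub_self] at h4; simp at h4
      rw [range'_eq_cons hlt, List.map_cons] at h4
      obtain ⟨h5, h6⟩ := List.cons.inj h4
      exact ⟨hlt, h5, h6⟩
    refine ⟨⟨q, mem_edgeLabel.2 hq⟩, fun p hp => ⟨(key p hp).1, (key p hp).2.1⟩,
      fun f hf => h1 f (List.mem_cons_of_mem _ hf), fun p => ?_⟩
    by_cases hp : p ∈ edgeLabel σ e
    · obtain ⟨h3, h4, h5⟩ := key p hp
      rw [bump, if_pos hp]
      exact ⟨h3, h5⟩
    · rw [bump, if_neg hp, add_zero]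
      have h3 := h2 p
      rw [List.filter_cons_of_neg (by simpa using fun h => hp (mem_edgeLabel.2 h))] at h3
      exact h3
  · rintro ⟨⟨q, hq⟩, h1, h2, h3⟩
    refine ⟨fun f hf => ?_, fun p => ?_⟩
    · rcases List.mem_cons.1 hf with rfl | hf
      · exact ⟨q, mem_edgeLabel.1 hq⟩
      · exact h2 f hf
    · have h4 := h3 p
      by_cases hp : p ∈ edgeLabel σ e
      · obtain ⟨h5, h6⟩ := h1 p hp
        rw [bump, if_pos hp] at h4
        rw [List.filter_cons_of_pos (by simpa using mem_edgeLabel.1 hp), range'_eq_cons h5,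
          List.map_cons, ← h6, h4.2]
        exact ⟨h5.le, rfl⟩
      · rw [bump, if_neg hp, add_zero] at h4
        rw [List.filter_cons_of_neg (by simpa using fun h => hp (mem_edgeLabel.2 h))]
        exact h4

theorem IsEdgeList.isWord {σ : PathName → HamPath (m + 1)} (l : List (Sym2 (Fin (m + 1)))) :
    ∀ {v : PathName → ℕ}, IsEdgeList σ v l →
    IsWord (EdgeStep σ) m v (l.map (edgeLabel σ)) ∧ edgesOfWord σ v (l.map (edgeLabel σ)) = l := by
  induction l with
  | nil =>
    rintro v ⟨-, h⟩
    refine ⟨fun p => ?_, rfl⟩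
    obtain ⟨h1, h2⟩ := h p
    have := congrArg List.length h2
    simp at this
    omega
  | cons e l ih =>
    intro v h
    obtain ⟨h1, h2, h3⟩ := isEdgeList_cons_iff.1 h
    obtain ⟨h4, h5⟩ := ih h3
    refine ⟨⟨⟨h1, e, fun p => ⟨h2 p, fun hp he => hp (mem_edgeLabel.2 he)⟩⟩, h4⟩, ?_⟩
    rw [List.map_cons, edgesOfWord, h5, pickEdge_eq h1 fun p hp => (h2 p hp).2]

theorem IsWord.isEdgeList {σ : PathName → HamPath (m + 1)} (w : List (Finset PathName)) :
    ∀ {v : PathName → ℕ}, IsWord (EdgeStep σ) m v w →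
    IsEdgeList σ v (edgesOfWord σ v w) ∧ (edgesOfWord σ v w).map (edgeLabel σ) = w := by
  induction w with
  | nil =>
    intro v h
    refine ⟨⟨by simp [edgesOfWord], fun p => ?_⟩, rfl⟩
    have : v p = m := h p
    simp [edgesOfWord, this]
  | cons a w ih =>
    rintro v ⟨⟨ha, e, he⟩, h2⟩
    have hpick := pickEdge_eq ha fun p hp => ((he p).1 hp).2
    have hlab : edgeLabel σ e = a := by
      ext p
      rw [mem_edgeLabel]
      constructor
      · intro h; by_contra hp; exact (he p).2 hp h
      · intro hp
        obtain ⟨h3, h4⟩ := (he p).1 hp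
        rw [h4]; exact HamPath.edge_mem_edges _ h3
    obtain ⟨h3, h4⟩ := ih h2
    rw [edgesOfWord, hpick]
    refine ⟨isEdgeList_cons_iff.2 ?_, ?_⟩
    · rw [hlab]
      exact ⟨ha, fun p hp => (he p).1 hp, h3⟩
    · rw [List.map_cons, hlab, h4]

theorem IsEdgeList.mem_iff {σ : PathName → HamPath (m + 1)} {l : List (Sym2 (Fin (m + 1)))}
    (h : IsEdgeList σ 0 l) (e : Sym2 (Fin (m + 1))) : e ∈ l ↔ ∃ p, e ∈ (σ p).edges := by
  classical
  refine ⟨h.1 e, ?_⟩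
  rintro ⟨p, hp⟩
  obtain ⟨i, hi, rfl⟩ := ((σ p).mem_edges_iff e).1 hp
  have h1 : (σ p).edge i ∈ l.filter (fun e => e ∈ (σ p).edges) := by
    rw [(h.2 p).2]
    exact List.mem_map_of_mem (by simp; omega)
  exact (List.mem_filter.1 h1).1

theorem IsEdgeList.nodup {σ : PathName → HamPath (m + 1)} {l : List (Sym2 (Fin (m + 1)))}
    (h : IsEdgeList σ 0 l) : l.Nodup := by
  classical
  rw [List.nodup_iff_count_le_one]
  intro e
  by_cases he : e ∈ l
  · obtain ⟨p, hp⟩ := h.1 e he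
    rw [← List.count_filter (p := fun e => decide (e ∈ (σ p).edges)) (by simpa using hp),
      (h.2 p).2]
    refine List.nodup_iff_count_le_one.1 (List.Nodup.map_on ?_ List.nodup_range') e
    intro i hi j hj hij
    simp at hi hj
    exact (σ p).edge_inj hi hj hij
  · rw [List.count_eq_zero_of_not_mem he]; exact zero_le_one

end EdgeWords

section Orders

open Finset

variable {m : ℕ}

namespace EdgeOrderedTriple

theorem not_edgeLT_self {n : ℕ} (τ : EdgeOrderedTriple n) (e : Sym2 (Fin n)) : ¬ τ.EdgeLT e e := by
  rintro ⟨he, hf, h⟩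
  exact @lt_irrefl _ τ.order.toPreorder _ h

theorem EdgeLT.trans {n : ℕ} {τ : EdgeOrderedTriple n} {e f g : Sym2 (Fin n)} (h : τ.EdgeLT e f)
    (h' : τ.EdgeLT f g) : τ.EdgeLT e g := by
  obtain ⟨he, hf, h⟩ := h
  obtain ⟨hf', hg, h'⟩ := h'
  exact ⟨he, hg, @lt_trans _ τ.order.toPreorder _ _ _ h h'⟩

theorem EdgeLT.asymm {n : ℕ} {τ : EdgeOrderedTriple n} {e f : Sym2 (Fin n)} (h : τ.EdgeLT e f) :
    ¬ τ.EdgeLT f e :=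
  fun h' => τ.not_edgeLT_self e (h.trans h')

theorem edgeLT_edge (τ : EdgeOrderedTriple (m + 1)) (p : PathName) {i j : ℕ} (hij : i < j)
    (hj : j < m) : τ.EdgeLT ((τ.path p).edge i) ((τ.path p).edge j) := by
  induction j, hij using Nat.le_induction with
  | base =>
    have h1 : (τ.path p).Traverses ((τ.path p).vtx i) ((τ.path p).vtx (i + 1)) := by
      rw [HamPath.Traverses, HamPath.symm_vtx _ (by omega), HamPath.symm_vtx _ (by omega)]
    have h2 : (τ.path p).Traverses ((τ.path p).vtx (i + 1)) ((τ.path p).vtx (i + 1 + 1)) := by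
      rw [HamPath.Traverses, HamPath.symm_vtx _ (by omega), HamPath.symm_vtx _ (by omega)]
    exact ⟨_, _, τ.increasing p _ _ _ h1 h2⟩
  | succ j hij ih =>
    refine (ih (by omega)).trans ?_
    have h1 : (τ.path p).Traverses ((τ.path p).vtx j) ((τ.path p).vtx (j + 1)) := by
      rw [HamPath.Traverses, HamPath.symm_vtx _ (by omega), HamPath.symm_vtx _ (by omega)]
    have h2 : (τ.path p).Traverses ((τ.path p).vtx (j + 1)) ((τ.path p).vtx (j + 1 + 1)) := by
      rw [HamPath.Traverses, HamPath.symm_vtx _ (by omega), HamPath.symm_vtx _ (by omega)]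
    exact ⟨_, _, τ.increasing p _ _ _ h1 h2⟩

theorem edge_lt_iff (τ : EdgeOrderedTriple (m + 1)) (p : PathName) {i j : ℕ} (hi : i < m)
    (hj : j < m) : τ.EdgeLT ((τ.path p).edge i) ((τ.path p).edge j) ↔ i < j := by
  refine ⟨fun h => ?_, fun h => τ.edgeLT_edge p h hj⟩
  by_contra hle
  rcases (not_lt.1 hle).eq_or_lt with rfl | h1
  · exact τ.not_edgeLT_self _ h
  · exact h.asymm (τ.edgeLT_edge p h1 hi)

/-- The list of all edges in increasing order. -/
def IsSorted {n : ℕ} (τ : EdgeOrderedTriple n) (l : List (Sym2 (Fin n))) : Prop :=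
  l.Pairwise τ.EdgeLT ∧ ∀ e, e ∈ l ↔ ∃ p, e ∈ (τ.path p).edges

theorem _root_.exists_pairwise_lt_list (α : Type*) [LinearOrder α] [Fintype α] :
    ∃ l : List α, l.Pairwise (· < ·) ∧ ∀ a, a ∈ l :=
  ⟨univ.sort, ((univ.pairwise_sort (· ≤ ·)).and (univ.sort_nodup (· ≤ ·))).imp
    fun h => lt_of_le_of_ne h.1 h.2, fun a => by simp⟩

theorem exists_isSorted {n : ℕ} (τ : EdgeOrderedTriple n) : ∃ l, τ.IsSorted l := by
  classical
  obtain ⟨l, h1, h2⟩ := @exists_pairwise_lt_list _ τ.order inferInstance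
  refine ⟨l.map Subtype.val, ?_, fun e => ?_⟩
  · rw [List.pairwise_map]
    exact h1.imp fun {a b} h => ⟨a.2, b.2, h⟩
  · rw [List.mem_map]
    exact ⟨fun ⟨a, _, ha⟩ => ha ▸ a.2, fun h => ⟨⟨e, h⟩, h2 _, rfl⟩⟩

theorem eq_of_pairwise_edgeLT {n : ℕ} {τ : EdgeOrderedTriple n} {l l' : List (Sym2 (Fin n))}
    (h : l.Pairwise τ.EdgeLT) (h' : l'.Pairwise τ.EdgeLT) (hm : ∀ e, e ∈ l ↔ e ∈ l') : l = l' := by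
  have hn : ∀ {l : List (Sym2 (Fin n))}, l.Pairwise τ.EdgeLT → l.Nodup := fun h =>
    List.Pairwise.imp (fun {a b} (hab : τ.EdgeLT a b) (hne : a = b) =>
      τ.not_edgeLT_self a (by rw [← hne] at hab; exact hab)) h
  exact ((List.perm_ext_iff_of_nodup (hn h) (hn h')).2 hm).eq_of_pairwise
    (fun a b _ _ h1 h2 => absurd h2 h1.asymm) h h'

theorem IsSorted.isEdgeList {τ : EdgeOrderedTriple (m + 1)} {l : List (Sym2 (Fin (m + 1)))}
    (h : τ.IsSorted l) : IsEdgeList τ.path 0 l := by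
  classical
  refine ⟨fun e he => (h.2 e).1 he, fun p => ⟨Nat.zero_le _, ?_⟩⟩
  refine eq_of_pairwise_edgeLT (τ := τ) (h.1.filter _) ?_ fun e => ?_
  · rw [List.pairwise_map]
    refine List.Pairwise.imp_of_mem ?_ List.pairwise_lt_range'
    intro i j _ hj hij
    simp at hj
    exact τ.edgeLT_edge p hij hj
  · rw [List.mem_filter, h.2 e, List.mem_map, decide_eq_true_eq]
    constructor
    · rintro ⟨-, he⟩
      obtain ⟨i, hi, rfl⟩ := ((τ.path p).mem_edges_iff e).1 he
      exact ⟨i, by simp; omega, rfl⟩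
    · rintro ⟨i, hi, rfl⟩
      simp at hi
      have := (τ.path p).edge_mem_edges hi
      exact ⟨⟨p, this⟩, this⟩

theorem IsSorted.ext {n : ℕ} {τ τ' : EdgeOrderedTriple n} {l : List (Sym2 (Fin n))}
    (h : τ.IsSorted l) (h' : τ'.IsSorted l) (hp : τ.path = τ'.path) : τ = τ' := by
  have key : ∀ e ∈ l, ∀ f ∈ l, e ≠ f →
      (τ.EdgeLT e f ↔ τ'.EdgeLT e f) ∧ (τ.EdgeLT f e ↔ τ'.EdgeLT f e) := by
    have : Std.Symm fun e f => (τ.EdgeLT e f ↔ τ'.EdgeLT e f) ∧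
        (τ.EdgeLT f e ↔ τ'.EdgeLT f e) := ⟨fun _ _ h => ⟨h.2, h.1⟩⟩
    have h1 : l.Pairwise fun e f => (τ.EdgeLT e f ↔ τ'.EdgeLT e f) ∧
        (τ.EdgeLT f e ↔ τ'.EdgeLT f e) :=
      (h.1.and h'.1).imp fun h => ⟨iff_of_true h.1 h.2, iff_of_false h.1.asymm h.2.asymm⟩
    intro e he f hf hne
    exact h1.forall he hf hne
  obtain ⟨path, order, inc⟩ := τ
  obtain ⟨path', order', inc'⟩ := τ'
  obtain rfl : path = path' := hp
  have ho : order = order' := by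
    refine LinearOrder.ext_lt fun x y => ?_
    by_cases hxy : x = y
    · subst hxy
      exact iff_of_false (fun h => (@lt_irrefl _ order.toPreorder x) h)
        (fun h => (@lt_irrefl _ order'.toPreorder x) h)
    · have h1 := (key x.1 ((h.2 _).2 x.2) y.1 ((h.2 _).2 y.2)
        (fun h => hxy (Subtype.ext h))).1
      constructor
      · intro hlt
        obtain ⟨_, _, h2⟩ := h1.1 ⟨x.2, y.2, hlt⟩
        exact h2
      · intro hlt
        obtain ⟨_, _, h2⟩ := h1.2 ⟨x.2, y.2, hlt⟩
        exact h2
  subst ho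
  rfl

end EdgeOrderedTriple

theorem List.Nodup.pairwise_idxOf {α : Type*} [DecidableEq α] {l : List α} (h : l.Nodup) :
    l.Pairwise fun a b => l.idxOf a < l.idxOf b := by
  rw [List.pairwise_iff_getElem]
  intro i j hi hj hij
  rw [h.idxOf_getElem i hi, h.idxOf_getElem j hj]
  exact hij

theorem IsEdgeList.exists_isSorted {σ : PathName → HamPath (m + 1)}
    {l : List (Sym2 (Fin (m + 1)))} (h : IsEdgeList σ 0 l) :
    ∃ τ : EdgeOrderedTriple (m + 1), τ.path = σ ∧ τ.IsSorted l := by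
  classical
  let f : {e : Sym2 (Fin (m + 1)) // ∃ p, e ∈ (σ p).edges} → ℕ := fun e => l.idxOf e.1
  have hf : Function.Injective f := fun x y hxy =>
    Subtype.ext ((List.idxOf_inj ((h.mem_iff _).2 x.2)).1 hxy)
  have hidx := h.nodup.pairwise_idxOf
  have hlt : ∀ p i, i + 1 < m → l.idxOf ((σ p).edge i) < l.idxOf ((σ p).edge (i + 1)) := by
    intro p i hi
    have h1 := hidx.filter (fun e => decide (e ∈ (σ p).edges))
    rw [(h.2 p).2, List.pairwise_map, List.pairwise_iff_getElem] at h1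
    have h2 := h1 i (i + 1) (by simp; omega) (by simp; omega) (by omega)
    simpa using h2
  let τ : EdgeOrderedTriple (m + 1) :=
    { path := σ
      order := LinearOrder.lift' f hf
      increasing := by
        intro p u v w huv hvw
        change l.idxOf s(u, v) < l.idxOf s(v, w)
        have hw := ((σ p).symm w).2
        have h1 : (σ p).vtx ((σ p).symm u) = u := (σ p).vtx_symm u
        have h2 : (σ p).vtx ((σ p).symm u + 1) = v := by
          rw [show ((σ p).symm u : ℕ) + 1 = (σ p).symm v from huv]; exact (σ p).vtx_symm v
        have h3 : (σ p).vtx ((σ p).symm u + 1 + 1) = w := by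
          rw [show ((σ p).symm u : ℕ) + 1 = (σ p).symm v from huv,
            show ((σ p).symm v : ℕ) + 1 = (σ p).symm w from hvw]
          exact (σ p).vtx_symm w
        have h4 := hlt p ((σ p).symm u) (by
          rw [HamPath.Traverses] at huv hvw; omega)
        rwa [HamPath.edge, HamPath.edge, h1, h2, h3] at h4 }
  refine ⟨τ, rfl, ?_, h.mem_iff⟩
  refine hidx.imp_of_mem fun {a b} ha hb hab => ⟨(h.mem_iff a).1 ha, (h.mem_iff b).1 hb, hab⟩

/-- The word spelled by the labels of the edges in increasing order. -/
noncomputable def EdgeOrderedTriple.word (τ : EdgeOrderedTriple (m + 1)) : List (Finset PathName) :=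
  τ.exists_isSorted.choose.map (edgeLabel τ.path)

theorem EdgeOrderedTriple.isWord_word (τ : EdgeOrderedTriple (m + 1)) :
    IsWord (EdgeStep τ.path) m 0 τ.word :=
  (IsEdgeList.isWord _ τ.exists_isSorted.choose_spec.isEdgeList).1

theorem EdgeOrderedTriple.eq_of_word_eq {τ τ' : EdgeOrderedTriple (m + 1)}
    (hp : τ.path = τ'.path) (hw : τ.word = τ'.word) : τ = τ' := by
  have h1 := (IsEdgeList.isWord _ τ.exists_isSorted.choose_spec.isEdgeList).2
  have h2 := (IsEdgeList.isWord _ τ'.exists_isSorted.choose_spec.isEdgeList).2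
  refine τ.exists_isSorted.choose_spec.ext ?_ hp
  rw [word, word] at hw
  rw [← h1, hw, hp, h2]
  exact τ'.exists_isSorted.choose_spec

theorem IsWord.exists_triple {σ : PathName → HamPath (m + 1)} {w : List (Finset PathName)}
    (h : IsWord (EdgeStep σ) m 0 w) :
    ∃ τ : EdgeOrderedTriple (m + 1), τ.path = σ ∧ τ.word = w := by
  obtain ⟨h1, h2⟩ := h.isEdgeList w
  obtain ⟨τ, rfl, hs⟩ := h1.exists_isSorted
  refine ⟨τ, rfl, ?_⟩
  have hs' := τ.exists_isSorted.choose_spec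
  rw [EdgeOrderedTriple.word, EdgeOrderedTriple.eq_of_pairwise_edgeLT hs'.1 hs.1 fun e => by
    rw [hs.2, hs'.2], h2]

end Orders

section RunTriples

open Finset

variable {m k : ℕ} {th : Fin k → PathName} {dir : Fin k → Bool} {ℓ : Fin k → ℕ}

theorem RunPositions.congr {s s' : Fin k → PathName → ℕ} (P : RunPositions m th dir ℓ s)
    (h : ∀ j p, p ≠ th j → s' j p = s j p) : RunPositions m th dir ℓ s' where
  pos := P.pos
  opp := P.opp
  fits j p hp := by rw [h j p hp]; exact P.fits j p hp
  sep j j' hj p hp hp' := by rw [h j p hp, h j' p hp']; exact P.sep j j' hj p hp hp'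

theorem HasRuns.congr {σ : PathName → HamPath (m + 1)} {s s' : Fin k → PathName → ℕ}
    (H : HasRuns σ th dir ℓ s) (h : ∀ j p, p ≠ th j → s' j p = s j p) :
    HasRuns σ th dir ℓ s' where
  agree j r hr := by
    rw [h j _ (th j).left_ne, h j _ (th j).right_ne]; exact H.agree j r hr
  exact p q hpq i hi i' hi' he := by
    obtain ⟨j, h1, h2, r, hr, h3, h4⟩ := H.exact p q hpq i hi i' hi' he
    exact ⟨j, h1, h2, r, hr, by rw [h j p h1, h3], by rw [h j q h2, h4]⟩

/-- The triple has runs of the given types and lengths. -/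
def EdgeOrderedTriple.HasRunLengths (τ : EdgeOrderedTriple (m + 1)) (th : Fin k → PathName)
    (dir : Fin k → Bool) (ℓ : Fin k → ℕ) : Prop :=
  ∃ s, RunPositions m th dir ℓ s ∧ HasRuns τ.path th dir ℓ s

theorem mem_labelings {s : Fin k → PathName → ℕ} {σ : PathName → HamPath (m + 1)} :
    σ ∈ labelings m th dir ℓ s ↔ HasRuns σ th dir ℓ s := by
  simp [labelings]

theorem runPositions_start (hpos : ∀ j, 1 ≤ ℓ j) (hopp : ∀ j, dir j = true → ℓ j = 1)
    {D : WordData ℓ} (hD : D ∈ wordsOf th ℓ (m + 1)) (hs : D.Spread) :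
    RunPositions m th dir ℓ (D.start 0 th) where
  pos := hpos
  opp := hopp
  fits j p hp := by
    have h1 := D.start_add_le 0 th j p hp
    have h2 : D.total th p + 1 = m + 1 := hD p
    rw [Pi.zero_apply] at h1
    omega
  sep j j' hj p hp hp' := by
    have := WordData.stronglySeparated_start 0 th D hs j j' hj p hp hp'
    omega

variable (m th dir ℓ) in
/-- The words and labelings that describe the triples with runs of the given types and lengths. -/
def runData : Set (WordData ℓ × (PathName → HamPath (m + 1))) :=
  {z | z.1 ∈ wordsOf th ℓ (m + 1) ∧ RunPositions m th dir ℓ (z.1.start 0 th) ∧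
    HasRuns z.2 th dir ℓ (z.1.start 0 th)}

theorem isWord_of_mem_runData {z : WordData ℓ × (PathName → HamPath (m + 1))}
    (hz : z ∈ runData m th dir ℓ) : IsWord (EdgeStep z.2) m 0 (z.1.flat th) := by
  obtain ⟨h1, P, H⟩ := hz
  refine WordData.isWord_flat P.pos (fun p => ?_) (H.stepsFrom P 0)
  have h2 : z.1.total th p + 1 = m + 1 := h1 p
  rw [Pi.zero_apply]; omega

theorem card_hasRunLengths_eq_ncard :
    Nat.card {τ : EdgeOrderedTriple (m + 1) // τ.HasRunLengths th dir ℓ} =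
      (runData m th dir ℓ).ncard := by
  rw [← Nat.card_coe_set_eq]
  have hex : ∀ z : runData m th dir ℓ, ∃ τ : EdgeOrderedTriple (m + 1),
      τ.path = z.1.2 ∧ τ.word = z.1.1.flat th := fun z => (isWord_of_mem_runData z.2).exists_triple
  choose f hf1 hf2 using hex
  symm
  refine Nat.card_congr (Equiv.ofBijective (fun z => ⟨f z, _, z.2.2.1, by
    rw [hf1]; exact z.2.2.2⟩) ⟨fun z z' h => ?_, fun ⟨τ, s, P, H⟩ => ?_⟩)
  · have h1 : f z = f z' := congrArg Subtype.val h
    refine Subtype.ext (Prod.ext (WordData.flat_injective th ?_) ?_)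
    · simp only; rw [← hf2, ← hf2, h1]
    · rw [← hf1, ← hf1, h1]
  · obtain ⟨D, h1, h2, h3⟩ := τ.isWord_word.exists_flat P.pos P.fits P.sep (H.stepsFrom P 0)
      (fun _ _ _ => Nat.zero_le _)
    have h3' : D ∈ wordsOf th ℓ (m + 1) := fun p => by
      have := h3 p; rw [Pi.zero_apply] at this; omega
    refine ⟨⟨(D, τ.path), h3', P.congr h2, H.congr h2⟩, Subtype.ext ?_⟩
    exact EdgeOrderedTriple.eq_of_word_eq (hf1 _) ((hf2 _).trans h1.symm)

open scoped Classical in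
theorem card_hasRunLengths (m : ℕ) (th : Fin k → PathName) (dir : Fin k → Bool) (ℓ : Fin k → ℕ) :
    Nat.card {τ : EdgeOrderedTriple (m + 1) // τ.HasRunLengths th dir ℓ} =
      ∑ D ∈ (finite_wordsOf th ℓ (m + 1)).toFinset,
        if RunPositions m th dir ℓ (D.start 0 th) then (labelings m th dir ℓ (D.start 0 th)).card
        else 0 := by
  rw [card_hasRunLengths_eq_ncard]
  have h : runData m th dir ℓ = ((((finite_wordsOf th ℓ (m + 1)).toFinset.filter fun D =>
      RunPositions m th dir ℓ (D.start 0 th)).biUnion fun D =>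
        (labelings m th dir ℓ (D.start 0 th)).map ⟨fun σ => (D, σ), fun _ _ h =>
          (Prod.ext_iff.1 h).2⟩ : Finset _) : Set _) := by
    ext ⟨D, σ⟩
    simp only [runData, Set.mem_ofPred_eq, Finset.coe_biUnion, Set.mem_iUnion, Finset.coe_map,
      Set.mem_image, Finset.mem_coe, Finset.mem_filter, Set.Finite.mem_toFinset, mem_labelings, exists_prop]
    constructor
    · rintro ⟨h1, h2, h3⟩
      exact ⟨D, ⟨h1, h2⟩, σ, h3, rfl⟩
    · rintro ⟨D', ⟨h1, h2⟩, σ', h3, h4⟩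
      obtain ⟨rfl, rfl⟩ := Prod.mk.inj h4
      exact ⟨h1, h2, h3⟩
  rw [h, Set.ncard_coe_finset, Finset.card_biUnion]
  · rw [Finset.sum_filter]
    refine Finset.sum_congr rfl fun D _ => ?_
    split_ifs
    · rw [Finset.card_map]
    · rfl
  · intro D _ D' _ hne
    rw [Function.onFun, Finset.disjoint_left]
    rintro z hz hz'
    obtain ⟨σ, -, rfl⟩ := Finset.mem_map.1 hz
    obtain ⟨σ', -, h⟩ := Finset.mem_map.1 hz'
    exact hne (Prod.ext_iff.1 h).1.symm

end RunTriples

section Limit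

open Finset

variable {k : ℕ}

/-- The number of triples of paths containing prescribed runs. -/
def labelingBound (th : Fin k → PathName) (ℓ : Fin k → ℕ) (m : ℕ) : ℝ :=
  (m + 1).factorial *
    ((m + 1 - runSize th ℓ .B).factorial * (m + 1 - runSize th ℓ .C).factorial)

theorem labelingBound_pos (th : Fin k → PathName) (ℓ : Fin k → ℕ) (m : ℕ) :
    0 < labelingBound th ℓ m := by
  unfold labelingBound
  have h := fun n : ℕ => (Nat.cast_pos (α := ℝ)).2 (Nat.factorial_pos n)
  exact mul_pos (h _) (mul_pos (h _) (h _))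

theorem exists_abs_card_hasRunLengths_sub_le (th : Fin k → PathName) (dir : Fin k → Bool)
    (ℓ : Fin k → ℕ) (hpos : ∀ j, 1 ≤ ℓ j) (hopp : ∀ j, dir j = true → ℓ j = 1) :
    ∃ K : ℝ, 0 ≤ K ∧ ∀ m : ℕ,
      |(Nat.card {τ : EdgeOrderedTriple (m + 1) // τ.HasRunLengths th dir ℓ} : ℝ) -
        Real.exp (-6) * labelingBound th ℓ m * (wordsOf th ℓ (m + 1)).ncard| ≤
      labelingBound th ℓ m * (K / (m + 1) * (wordsOf th ℓ (m + 1)).ncard +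
        ({D ∈ wordsOf th ℓ (m + 1) | ¬ D.Spread}.ncard : ℝ)) := by
  classical
  obtain ⟨K, hK, H⟩ := exists_abs_card_labelings_sub_le th dir ℓ
  refine ⟨K, hK, fun m => ?_⟩
  have hΛ := labelingBound_pos th ℓ m
  set W := (finite_wordsOf th ℓ (m + 1)).toFinset with hW
  have hcard : ((wordsOf th ℓ (m + 1)).ncard : ℝ) = ∑ D ∈ W, (1 : ℝ) := by
    rw [Set.ncard_eq_toFinset_card _ (finite_wordsOf th ℓ (m + 1)), Finset.sum_const, nsmul_eq_mul,
      mul_one]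
  have hns : ({D ∈ wordsOf th ℓ (m + 1) | ¬ D.Spread}.ncard : ℝ) =
      ∑ D ∈ W, if D.Spread then (0 : ℝ) else 1 := by
    have : {D ∈ wordsOf th ℓ (m + 1) | ¬ D.Spread} = ((W.filter fun D => ¬ D.Spread : Finset _) :
        Set (WordData ℓ)) := by
      ext D; simp [hW]
    rw [this, Set.ncard_coe_finset, Finset.card_filter]
    push_cast
    exact Finset.sum_congr rfl fun D _ => by split_ifs <;> simp_all
  rw [card_hasRunLengths, hcard, hns, Nat.cast_sum, Finset.mul_sum, ← Finset.sum_sub_distrib]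
  refine (Finset.abs_sum_le_sum_abs _ _).trans ?_
  rw [Finset.mul_sum, ← Finset.sum_add_distrib, Finset.mul_sum]
  refine Finset.sum_le_sum fun D hD => ?_
  have hD' : D ∈ wordsOf th ℓ (m + 1) := by simpa [hW] using hD
  by_cases hs : D.Spread
  · have P := runPositions_start (dir := dir) hpos hopp hD' hs
    rw [if_pos P, if_pos hs]
    have := H m _ P (WordData.stronglySeparated_start 0 th D hs)
    rw [mul_one, mul_one, add_zero, mul_comm (labelingBound _ _ _)]
    exact this
  · rw [if_neg hs]
    have he : Real.exp (-6) ≤ 1 := Real.exp_le_one_iff.2 (by norm_num)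
    have he0 := Real.exp_pos (-6)
    have hle : ((if RunPositions m th dir ℓ (D.start 0 th) then
        (labelings m th dir ℓ (D.start 0 th)).card else 0 : ℕ) : ℝ) ≤ labelingBound th ℓ m := by
      split_ifs with P
      · have := card_labelings_le P
        unfold labelingBound
        exact_mod_cast this
      · simpa using hΛ.le
    have h0 : (0 : ℝ) ≤ ((if RunPositions m th dir ℓ (D.start 0 th) then
        (labelings m th dir ℓ (D.start 0 th)).card else 0 : ℕ) : ℝ) := Nat.cast_nonneg _
    have h1 : Real.exp (-6) * labelingBound th ℓ m ≤ labelingBound th ℓ m :=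
      mul_le_of_le_one_left hΛ.le he
    have h2 : 0 ≤ Real.exp (-6) * labelingBound th ℓ m := by positivity
    have h3 : 0 ≤ K / ((m : ℝ) + 1) := by positivity
    rw [mul_one, mul_one]
    refine (abs_sub_le_of_nonneg_of_le h0 hle h2 h1).trans ?_
    nlinarith

theorem runSize_add (th : Fin k → PathName) (ℓ : Fin k → ℕ) :
    runSize th ℓ .B + runSize th ℓ .C = ∑ j, ℓ j + k := by
  rw [runSize, runSize, ← Finset.sum_add_distrib]
  have : ∑ j, ℓ j + k = ∑ j, (ℓ j + 1) := by
    rw [Finset.sum_add_distrib]; simp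
  rw [this]
  refine Finset.sum_congr rfl fun j _ => ?_
  cases th j <;> simp [PathName.right]

theorem tendsto_labelingBound (th : Fin k → PathName) (ℓ : Fin k → ℕ) :
    Tendsto (fun m : ℕ => ((m + 1 : ℕ) : ℝ) ^ (-3 : ℤ) * (labelingBound th ℓ m *
      (((m + 1 : ℕ) : ℝ) ^ k * central (m + 1))) / (3 * (m + 1) - 3 - ∑ j, ℓ j).factorial) atTop
      (𝓝 (3 ^ (3 + ∑ j, ℓ j))) := by
  set c := ∑ j, ℓ j with hc
  set b := runSize th ℓ .B with hb
  set b' := runSize th ℓ .C with hb'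
  have hbb : b + b' = c + k := runSize_add th ℓ
  have h1 : Tendsto (fun n : ℕ => ((3 * n).descFactorial (3 + c) : ℝ) / (n : ℝ) ^ (3 + c)) atTop
      (𝓝 (3 ^ (3 + c))) :=
    tendsto_descFactorial_div (by simpa using tendsto_three_mul_sub_div 0) _
  have h2 : ∀ b, Tendsto (fun n : ℕ => (n.descFactorial b : ℝ) / (n : ℝ) ^ b) atTop (𝓝 1) := by
    intro b
    simpa using tendsto_descFactorial_div (a := fun n => n) (c := 1)
      (by simpa using tendsto_sub_div 0) b
  have h3 := (h1.div ((h2 b).mul (h2 b')) (by norm_num)).comp (tendsto_add_atTop_nat 1)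
  rw [mul_one, div_one] at h3
  refine h3.congr' ?_
  filter_upwards [eventually_ge_atTop (3 + c + b + b')] with m hm
  simp only [Function.comp_apply, Pi.div_apply]
  set n := m + 1 with hn
  have hn0 : (n : ℝ) ≠ 0 := by rw [hn]; positivity
  have e1 : ((3 * n).factorial : ℝ) = ((3 * n - 3 - c).factorial : ℝ) *
      ((3 * n).descFactorial (3 + c) : ℝ) := by
    rw [Nat.sub_sub]
    exact_mod_cast (Nat.factorial_mul_descFactorial (by omega)).symm
  have e2 : ∀ b ≤ n, (n.factorial : ℝ) = ((n - b).factorial : ℝ) * (n.descFactorial b : ℝ) :=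
    fun b hb => by exact_mod_cast (Nat.factorial_mul_descFactorial hb).symm
  have e3 := e2 b (by omega)
  have e4 := e2 b' (by omega)
  have hf := fun n : ℕ => ((Nat.cast_pos (α := ℝ)).2 (Nat.factorial_pos n)).ne'
  have hd : ∀ b ≤ n, (n.descFactorial b : ℝ) ≠ 0 := fun b hb => by
    have : n.descFactorial b ≠ 0 := fun h => by rw [Nat.descFactorial_eq_zero_iff_lt] at h; omega
    exact_mod_cast this
  have hd1 := hd b (by omega)
  have hd2 := hd b' (by omega)
  have f1 := hf n
  have f2 := hf (n - b)
  have f3 := hf (n - b')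
  have f4 := hf (3 * n - 3 - c)
  rw [labelingBound, central_eq, ← hb, ← hb', ← hn, e1]
  have e5 : (n.factorial : ℝ) ^ 3 = n.factorial * (((n - b).factorial * n.descFactorial b) *
      ((n - b').factorial * n.descFactorial b')) := by
    rw [← e3, ← e4]; ring
  have e6 : (n : ℝ) ^ (-3 : ℤ) = ((n : ℝ) ^ 3)⁻¹ := by
    rw [zpow_neg]; rfl
  have e7 : (n : ℝ) ^ b * (n : ℝ) ^ b' = (n : ℝ) ^ c * (n : ℝ) ^ k := by
    rw [← pow_add, hbb, pow_add]
  rw [e5, e6]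
  field_simp
  rw [pow_add]
  linear_combination ((n : ℝ) ^ 3 * ((3 * n).descFactorial (3 + c) : ℝ)) * e7

theorem tendsto_card_hasRunLengths (th : Fin k → PathName) (dir : Fin k → Bool)
    (ℓ : Fin k → ℕ) (hpos : ∀ j, 1 ≤ ℓ j) (hopp : ∀ j, dir j = true → ℓ j = 1) :
    Tendsto (fun m : ℕ => ((m + 1 : ℕ) : ℝ) ^ (-3 : ℤ) *
      ((Nat.card {τ : EdgeOrderedTriple (m + 1) // τ.HasRunLengths th dir ℓ} : ℝ) /
        (3 * (m + 1) - 3 - ∑ j, ℓ j).factorial)) atTop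
      (𝓝 (Real.exp (-6) / k.factorial * 2 ^ (-((∑ j, ℓ j : ℕ) : ℤ) + k))) := by
  obtain ⟨K, hK, H⟩ := exists_abs_card_hasRunLengths_sub_le th dir ℓ hpos hopp
  set c := ∑ j, ℓ j with hc
  set w : ℝ := 3 ^ k / k.factorial * (3 / 2) ^ (∑ j, (ℓ j - 1)) * (1 / 3) ^ (3 + 2 * c) with hw
  have hW := (tendsto_ncard_wordsOf th ℓ).comp (tendsto_add_atTop_nat 1)
  have hNS := (tendsto_ncard_not_spread th ℓ).comp (tendsto_add_atTop_nat 1)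
  rw [← hc, ← hw] at hW
  have hKn : Tendsto (fun m : ℕ => K / ((m : ℝ) + 1)) atTop (𝓝 0) := by
    have := (tendsto_const_div_atTop_nhds_zero_nat K).comp (tendsto_add_atTop_nat 1)
    refine this.congr fun m => ?_
    simp
  have hmain : Tendsto (fun m : ℕ =>
      (Nat.card {τ : EdgeOrderedTriple (m + 1) // τ.HasRunLengths th dir ℓ} : ℝ) /
        (labelingBound th ℓ m * (((m + 1 : ℕ) : ℝ) ^ k * central (m + 1)))) atTop
      (𝓝 (Real.exp (-6) * w)) := by
    have hlim := (hW.const_mul (Real.exp (-6)))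
    have herr := (hKn.mul hW).add hNS
    rw [zero_mul, zero_add] at herr
    have hdiff : Tendsto (fun m : ℕ =>
        (Nat.card {τ : EdgeOrderedTriple (m + 1) // τ.HasRunLengths th dir ℓ} : ℝ) /
        (labelingBound th ℓ m * (((m + 1 : ℕ) : ℝ) ^ k * central (m + 1))) -
        Real.exp (-6) * (((wordsOf th ℓ (m + 1)).ncard : ℝ) /
          (((m + 1 : ℕ) : ℝ) ^ k * central (m + 1)))) atTop (𝓝 0) := by
      refine squeeze_zero_norm (fun m => ?_) herr
      have hΛ := labelingBound_pos th ℓ m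
      have hcen := central_pos (m + 1)
      have hnk : (0 : ℝ) < ((m + 1 : ℕ) : ℝ) ^ k * central (m + 1) := by positivity
      have e : (Nat.card {τ : EdgeOrderedTriple (m + 1) // τ.HasRunLengths th dir ℓ} : ℝ) /
          (labelingBound th ℓ m * (((m + 1 : ℕ) : ℝ) ^ k * central (m + 1))) -
          Real.exp (-6) * (((wordsOf th ℓ (m + 1)).ncard : ℝ) /
          (((m + 1 : ℕ) : ℝ) ^ k * central (m + 1))) =
          ((Nat.card {τ : EdgeOrderedTriple (m + 1) // τ.HasRunLengths th dir ℓ} : ℝ) -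
            Real.exp (-6) * labelingBound th ℓ m * (wordsOf th ℓ (m + 1)).ncard) /
            (labelingBound th ℓ m * (((m + 1 : ℕ) : ℝ) ^ k * central (m + 1))) := by
        field_simp
      rw [e, Real.norm_eq_abs, abs_div, abs_of_pos (mul_pos hΛ hnk), div_le_iff₀ (mul_pos hΛ hnk)]
      refine (H m).trans (le_of_eq ?_)
      simp only [Function.comp_apply]
      field_simp
    have := hdiff.add hlim
    rw [zero_add] at this
    refine this.congr fun m => ?_
    simp only [Function.comp_apply]
    ring
  have hfin := hmain.mul (tendsto_labelingBound th ℓ)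
  rw [← hc] at hfin
  have hk : ∑ j, (ℓ j - 1) + k = c := by
    have : ∑ j, (ℓ j - 1) + k = ∑ j, ((ℓ j - 1) + 1) := by
      rw [Finset.sum_add_distrib]; simp
    rw [this]
    exact Finset.sum_congr rfl fun j _ => Nat.sub_add_cancel (hpos j)
  have hval : Real.exp (-6) * w * 3 ^ (3 + c) =
      Real.exp (-6) / k.factorial * 2 ^ (-(c : ℤ) + k) := by
    have hz : (2 : ℝ) ^ (-(c : ℤ) + k) = (1 / 2) ^ (∑ j, (ℓ j - 1)) := by
      rw [← hk]
      push_cast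
      rw [show -((∑ j, ((ℓ j - 1 : ℕ) : ℤ)) + (k : ℤ)) + k = -((∑ j, (ℓ j - 1) : ℕ) : ℤ) by
        push_cast; ring, zpow_neg, zpow_natCast, one_div, inv_pow]
    have h3 : (3 : ℝ) ^ k * 3 ^ (∑ j, (ℓ j - 1)) = 3 ^ c := by rw [← pow_add, add_comm, hk]
    have hf : (k.factorial : ℝ) ≠ 0 := ((Nat.cast_pos (α := ℝ)).2 (Nat.factorial_pos k)).ne'
    rw [hz, hw, div_pow, one_div_pow, one_div_pow]
    field_simp
    rw [mul_assoc, ← mul_assoc ((3 : ℝ) ^ k), h3, ← pow_add]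
    congr 1
    ring
  rw [← hval]
  refine hfin.congr fun m => ?_
  have hΛ := labelingBound_pos th ℓ m
  have hcen := central_pos (m + 1)
  have hn : (0 : ℝ) < ((m + 1 : ℕ) : ℝ) := by positivity
  field_simp

end Limit

section RunDecomposition

open Finset

variable {m : ℕ}

namespace HamPath

/-- If the edges of a segment of a path belong to another path, then the latter traverses the
segment in one direction. -/
theorem traverses_segment (π ρ : HamPath (m + 1)) (a L : ℕ) (hL : a + L ≤ m)
    (h : ∀ r < L, π.edge (a + r) ∈ ρ.edges) :
    (∀ r < L, ρ.Traverses (π.vtx (a + r)) (π.vtx (a + r + 1))) ∨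
      (∀ r < L, ρ.Traverses (π.vtx (a + r + 1)) (π.vtx (a + r))) := by
  induction L with
  | zero => exact Or.inl fun r hr => absurd hr (Nat.not_lt_zero r)
  | succ L ih =>
    have hlast := (ρ.adjIn_iff _ _).1 (h L (Nat.lt_succ_self L))
    rcases Nat.eq_zero_or_pos L with rfl | hpos
    · rcases hlast with h1 | h1
      · exact Or.inl fun r hr => by obtain rfl : r = 0 := by omega
                                    exact h1
      · exact Or.inr fun r hr => by obtain rfl : r = 0 := by omega
                                    exact h1
    have hne : ρ.symm (π.vtx (a + (L - 1))) ≠ ρ.symm (π.vtx (a + L + 1)) := fun he => by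
      have := π.vtx_inj (by omega) (by omega) (ρ.symm.injective he)
      omega
    have hne' : (ρ.symm (π.vtx (a + (L - 1))) : ℕ) ≠ ρ.symm (π.vtx (a + L + 1)) :=
      fun he => hne (Fin.ext he)
    have e : a + (L - 1) + 1 = a + L := by omega
    rcases ih (by omega) fun r hr => h r (by omega) with h1 | h1
    · refine Or.inl fun r hr => ?_
      rcases Nat.lt_succ_iff_lt_or_eq.1 hr with hr | rfl
      · exact h1 r hr
      · have h2 := h1 (r - 1) (by omega)
        rw [e, Traverses] at h2
        rcases hlast with h3 | h3
        · exact h3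
        · exact absurd (by omega) hne'
    · refine Or.inr fun r hr => ?_
      rcases Nat.lt_succ_iff_lt_or_eq.1 hr with hr | rfl
      · exact h1 r hr
      · have h2 := h1 (r - 1) (by omega)
        rw [e, Traverses] at h2
        rcases hlast with h3 | h3
        · exact absurd (by omega) hne'
        · exact h3

theorem mem_edge {π : HamPath (m + 1)} {i : ℕ} {v : Fin (m + 1)} :
    v ∈ π.edge i ↔ v = π.vtx i ∨ v = π.vtx (i + 1) := Sym2.mem_iff

theorem edge_adjacent (π : HamPath (m + 1)) {i i' : ℕ} (hi : i < m) (hi' : i' < m) (h : i < i')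
    {v : Fin (m + 1)} (hv : v ∈ π.edge i) (hv' : v ∈ π.edge i') : i' = i + 1 := by
  rcases mem_edge.1 hv with rfl | rfl <;> rcases mem_edge.1 hv' with h1 | h1 <;>
    · have := π.vtx_inj (by omega) (by omega) h1
      omega

end HamPath

/-- The edge `e` belongs to at least two paths. -/
def IsCommon (σ : PathName → HamPath (m + 1)) (e : Sym2 (Fin (m + 1))) : Prop :=
  ∃ p q, p ≠ q ∧ e ∈ (σ p).edges ∧ e ∈ (σ q).edges

variable {τ : EdgeOrderedTriple (m + 1)}

/-- No edge belongs to all three paths, and common edges that share a vertex belong to the same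
paths. -/
structure EdgeOrderedTriple.IsTame (τ : EdgeOrderedTriple (m + 1)) : Prop where
  label_eq_com : ∀ e, IsCommon τ.path e → ∃ x, edgeLabel τ.path e = com x
  label_eq : ∀ e f, IsCommon τ.path e → IsCommon τ.path f → (∃ v, v ∈ e ∧ v ∈ f) →
    edgeLabel τ.path e = edgeLabel τ.path f

theorem mem_edges_of_label {σ : PathName → HamPath (m + 1)} {e : Sym2 (Fin (m + 1))} {x p : PathName}
    (h : edgeLabel σ e = com x) (hp : p ≠ x) : e ∈ (σ p).edges :=
  mem_edgeLabel.1 (by rw [h]; exact mem_com.2 hp)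

theorem EdgeOrderedTriple.IsTame.exists_run (ht : τ.IsTame) {e : Sym2 (Fin (m + 1))}
    (he : IsCommon τ.path e) {x : PathName} (hx : edgeLabel τ.path e = com x) :
    ∃ (d : Bool) (L : ℕ) (s : PathName → ℕ), 1 ≤ L ∧ (d = true → L = 1) ∧
      (∀ p, p ≠ x → s p + L ≤ m ∧ (τ.path p).edge (s p) = e) ∧
      (∀ r ≤ L, (τ.path x.right).vtx (s x.right + r) =
        (τ.path x.left).vtx (s x.left + if d then L - r else r)) ∧
      ¬ (s x.left + L < m ∧ IsCommon τ.path ((τ.path x.left).edge (s x.left + L))) := by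
  classical
  set π := τ.path x.left with hπ
  set ρ := τ.path x.right with hρ
  obtain ⟨i, hi, hei⟩ := (π.mem_edges_iff e).1 (mem_edges_of_label hx x.left_ne)
  have hex : ∃ r, ¬ (i + r < m ∧ IsCommon τ.path (π.edge (i + r))) := ⟨m, by omega⟩
  obtain ⟨L, hLP, hLmin⟩ : ∃ L, ¬ (i + L < m ∧ IsCommon τ.path (π.edge (i + L))) ∧
      ∀ r < L, i + r < m ∧ IsCommon τ.path (π.edge (i + r)) :=
    ⟨Nat.find hex, Nat.find_spec hex, fun r hr => not_not.1 (Nat.find_min hex hr)⟩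
  have hL1 : 1 ≤ L := by
    by_contra h
    obtain rfl : L = 0 := by omega
    exact hLP ⟨hi, by rw [add_zero, ← hei]; exact he⟩
  have hLm : i + L ≤ m := by have := (hLmin (L - 1) (by omega)).1; omega
  have hlab : ∀ r < L, edgeLabel τ.path (π.edge (i + r)) = com x := by
    intro r
    induction r with
    | zero => intro _; rw [add_zero, ← hei, hx]
    | succ r ih =>
      intro hr
      rw [← ih (by omega)]
      refine ht.label_eq _ _ (hLmin _ hr).2 (hLmin r (by omega)).2 ⟨π.vtx (i + r + 1), ?_, ?_⟩
      · exact HamPath.mem_edge.2 (Or.inl rfl)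
      · exact HamPath.mem_edge.2 (Or.inr rfl)
  have key : ∀ p, p ≠ x → p ≠ x.left → p = x.right := fun p h1 h2 =>
    (PathName.eq_left_or_right h1).resolve_left h2
  have hrl : x.right ≠ x.left := x.left_ne_right.symm
  rcases π.traverses_segment ρ i L hLm
    (fun r hr => mem_edges_of_label (hlab r hr) x.right_ne) with hf | hb
  · have hpos : ∀ r ≤ L, (ρ.symm (π.vtx (i + r)) : ℕ) = ρ.symm (π.vtx i) + r := by
      intro r
      induction r with
      | zero => intro _; simp
      | succ r ih =>
        intro hr
        have h1 := hf r (by omega)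
        rw [HamPath.Traverses, ih (by omega)] at h1
        rw [← add_assoc, ← h1]; ring
    have hvtx : ∀ r ≤ L, ρ.vtx (ρ.symm (π.vtx i) + r) = π.vtx (i + r) := by
      intro r hr; rw [← hpos r hr, ρ.vtx_symm]
    refine ⟨false, L, fun p => if p = x.left then i else ρ.symm (π.vtx i), hL1, by simp,
      fun p hp => ?_, ?_, ?_⟩
    · by_cases hpl : p = x.left
      · beta_reduce; rw [if_pos hpl, hpl]; exact ⟨hLm, hei.symm⟩
      · beta_reduce; rw [if_neg hpl, key p hp hpl]
        refine ⟨?_, ?_⟩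
        · rw [← hpos L le_rfl]
          exact Nat.lt_succ_iff.1 (ρ.symm _).2
        · rw [hei, HamPath.edge, HamPath.edge, ← hρ, ρ.vtx_symm, hvtx 1 hL1]
    · intro r hr
      beta_reduce; rw [if_neg hrl, if_pos rfl]
      simpa using hvtx r hr
    · beta_reduce; rw [if_pos rfl]; exact hLP
  · have hL : L = 1 := by
      by_contra hne
      have h0 := hb 0 (by omega)
      have h1 := hb 1 (by omega)
      rw [add_zero, HamPath.Traverses] at h0
      rw [HamPath.Traverses] at h1
      have hv : ∀ v, ρ.vtx (ρ.symm v : ℕ) = v := ρ.vtx_symm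
      have e0 : π.edge i = ρ.edge (ρ.symm (π.vtx (i + 1))) := by
        rw [HamPath.edge, HamPath.edge, h0, hv, hv, Sym2.eq_swap]
      have e1 : π.edge (i + 1) = ρ.edge (ρ.symm (π.vtx (i + 1 + 1))) := by
        rw [HamPath.edge, HamPath.edge, h1, hv, hv, Sym2.eq_swap]
      have hlt := (ρ.symm (π.vtx i)).2
      have l1 := τ.edgeLT_edge x.left (i := i) (j := i + 1) (by omega) (by omega)
      have l2 := τ.edgeLT_edge x.right (i := ρ.symm (π.vtx (i + 1 + 1)))
        (j := ρ.symm (π.vtx (i + 1))) (by omega) (by omega)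
      rw [← hπ, e0, e1] at l1
      exact l1.asymm l2
    subst hL
    have h0 := hb 0 (by omega)
    rw [add_zero, HamPath.Traverses] at h0
    refine ⟨true, 1, fun p => if p = x.left then i else ρ.symm (π.vtx (i + 1)), le_rfl,
      fun _ => rfl, fun p hp => ?_, ?_, ?_⟩
    · by_cases hpl : p = x.left
      · beta_reduce; rw [if_pos hpl, hpl]; exact ⟨hLm, hei.symm⟩
      · beta_reduce; rw [if_neg hpl, key p hp hpl]
        refine ⟨?_, ?_⟩
        · rw [h0]; exact Nat.lt_succ_iff.1 (ρ.symm _).2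
        · rw [hei, HamPath.edge, HamPath.edge, ← hρ, h0, ρ.vtx_symm, ρ.vtx_symm, Sym2.eq_swap]
    · intro r hr
      beta_reduce; rw [if_neg hrl, if_pos rfl, if_pos rfl]
      rcases Nat.le_one_iff_eq_zero_or_eq_one.1 hr with rfl | rfl
      · rw [add_zero, Nat.sub_zero, ρ.vtx_symm]
      · rw [h0, ρ.vtx_symm]; rfl
    · beta_reduce; rw [if_pos rfl]; exact hLP

/-- A common edge not preceded by an adjacent common edge. -/
def EdgeOrderedTriple.IsRunStart (τ : EdgeOrderedTriple (m + 1)) (e : Sym2 (Fin (m + 1))) : Prop :=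
  IsCommon τ.path e ∧ ∀ f, IsCommon τ.path f → τ.EdgeLT f e → ¬ ∃ v, v ∈ f ∧ v ∈ e

theorem EdgeOrderedTriple.IsTame.exists_hasRunLengths (ht : τ.IsTame) :
    ∃ (k : ℕ) (th : Fin k → PathName) (dir : Fin k → Bool) (ℓ : Fin k → ℕ),
      τ.HasRunLengths th dir ℓ := by
  classical
  obtain ⟨l, hl, hmem⟩ := τ.exists_isSorted
  set S := l.filter τ.IsRunStart with hS
  have hpw : S.Pairwise τ.EdgeLT := hl.filter _
  have hSmem : ∀ e, e ∈ S ↔ τ.IsRunStart e := by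
    intro e
    rw [hS, List.mem_filter, decide_eq_true_eq, hmem]
    exact ⟨fun h => h.2, fun h => ⟨by obtain ⟨p, q, -, hp, -⟩ := h.1; exact ⟨p, hp⟩, h⟩⟩
  have hst : ∀ j : Fin S.length, τ.IsRunStart (S.get j) := fun j => (hSmem _).1 (S.get_mem j)
  choose th hth using fun j => ht.label_eq_com _ (hst j).1
  choose dir ℓ s h1 h2 h3 h4 h5 using fun j => ht.exists_run (hst j).1 (hth j)
  have hopp : ∀ j r, r < ℓ j → ∀ {p q}, p ≠ th j → q ≠ th j →
      (τ.path p).edge (s j p + r) = (τ.path q).edge (s j q + r) :=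
    fun j r hr p q hp hq => edge_eq_of_agree (h4 j) (h2 j) hr hp hq
  have hcom : ∀ j r, r < ℓ j → ∀ {p}, p ≠ th j →
      IsCommon τ.path ((τ.path p).edge (s j p + r)) := by
    intro j r hr p hp
    have hl := (h3 j _ (th j).left_ne).1
    have hr' := (h3 j _ (th j).right_ne).1
    refine ⟨(th j).left, (th j).right, (th j).left_ne_right, ?_, ?_⟩
    · rw [hopp j r hr hp (th j).left_ne]; exact HamPath.edge_mem_edges _ (by omega)
    · rw [hopp j r hr hp (th j).right_ne]; exact HamPath.edge_mem_edges _ (by omega)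
  have hlt : ∀ j j', j < j' → ∀ p, p ≠ th j → p ≠ th j' → s j p < s j' p := by
    intro j j' hj p hp hp'
    have := hpw.rel_get_of_lt hj
    rw [← (h3 j p hp).2, ← (h3 j' p hp').2] at this
    have hf := (h3 j p hp).1
    have hf' := (h3 j' p hp').1
    have := h1 j
    have := h1 j'
    exact (τ.edge_lt_iff p (by omega) (by omega)).1 ‹_›
  refine ⟨S.length, th, dir, ℓ, s, ⟨h1, h2, fun j p hp => (h3 j p hp).1, ?_⟩, h4, ?_⟩
  · intro j j' hj p hp hp'
    by_contra hle
    have h6 := hlt j j' hj p hp hp'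
    have h7 := (h3 j' p hp').1
    have h8 := h1 j'
    have e : s j' p - 1 = s j p + (s j' p - 1 - s j p) := by omega
    refine (hst j').2 ((τ.path p).edge (s j' p - 1)) ?_ ?_ ⟨(τ.path p).vtx (s j' p), ?_, ?_⟩
    · rw [e]; exact hcom j _ (by omega) hp
    · rw [← (h3 j' p hp').2]; exact τ.edgeLT_edge p (by omega) (by omega)
    · exact HamPath.mem_edge.2 (Or.inr (by congr 1; omega))
    · rw [← (h3 j' p hp').2]; exact HamPath.mem_edge.2 (Or.inl rfl)
  · intro p q hpq i
    induction i using Nat.strong_induction_on with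
    | _ i ih =>
    intro hi i' hi' he
    have hec : IsCommon τ.path ((τ.path p).edge i) :=
      ⟨p, q, hpq, HamPath.edge_mem_edges _ hi, he ▸ HamPath.edge_mem_edges _ hi'⟩
    have hpl : p ∈ edgeLabel τ.path ((τ.path p).edge i) :=
      mem_edgeLabel.2 (HamPath.edge_mem_edges _ hi)
    have hql : q ∈ edgeLabel τ.path ((τ.path p).edge i) :=
      mem_edgeLabel.2 (he ▸ HamPath.edge_mem_edges _ hi')
    by_cases hstart : τ.IsRunStart ((τ.path p).edge i)
    · obtain ⟨j, hj⟩ := List.get_of_mem ((hSmem _).2 hstart)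
      have hlab := hth j
      rw [hj] at hlab
      have hp : p ≠ th j := mem_com.1 (hlab ▸ hpl)
      have hq : q ≠ th j := mem_com.1 (hlab ▸ hql)
      have hfp := h3 j p hp
      have hfq := h3 j q hq
      have := h1 j
      refine ⟨j, hp, hq, 0, h1 j, ?_, ?_⟩
      · exact (τ.path p).edge_inj hi (by omega) (by rw [add_zero, hfp.2, hj])
      · exact (τ.path q).edge_inj hi' (by omega) (by rw [add_zero, hfq.2, hj, he])
    · have : ∃ f, IsCommon τ.path f ∧ τ.EdgeLT f ((τ.path p).edge i) ∧
          ∃ v, v ∈ f ∧ v ∈ (τ.path p).edge i := by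
        by_contra hno
        push Not at hno
        exact hstart ⟨hec, fun f hf hlt ⟨v, hv, hv'⟩ => hno f hf hlt v hv hv'⟩
      obtain ⟨f, hf, hfe, v, hv, hv'⟩ := this
      have hlab := ht.label_eq f _ hf hec ⟨v, hv, hv'⟩
      obtain ⟨a, ha, rfl⟩ := ((τ.path p).mem_edges_iff f).1 (mem_edgeLabel.1 (hlab ▸ hpl))
      obtain ⟨b, hb, hab⟩ := ((τ.path q).mem_edges_iff _).1 (mem_edgeLabel.1 (hlab ▸ hql))
      have hai : a < i := (τ.edge_lt_iff p ha hi).1 hfe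
      have hbi : b < i' := (τ.edge_lt_iff q hb hi').1 (by rw [← hab, ← he]; exact hfe)
      obtain rfl := (τ.path p).edge_adjacent ha hi hai hv hv'
      obtain rfl := (τ.path q).edge_adjacent hb hi' hbi (hab ▸ hv) (he ▸ hv')
      obtain ⟨j, hp, hq, r, hr, rfl, rfl⟩ := ih a hai ha b hb hab
      refine ⟨j, hp, hq, r + 1, ?_, by ring, by ring⟩
      by_contra hge
      have hrl : r + 1 = ℓ j := by omega
      refine h5 j ?_
      rw [← hrl, ← add_assoc]
      rcases PathName.eq_or_eq_of_ne hpq hp hq (th j).left_ne with h | h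
      · rw [h]; exact ⟨hi, hec⟩
      · rw [h]; exact ⟨hi', he ▸ hec⟩

end RunDecomposition

section RunLengths

open Finset

variable {m k : ℕ} {th : Fin k → PathName} {dir : Fin k → Bool} {ℓ : Fin k → ℕ}
  {s : Fin k → PathName → ℕ} {σ : PathName → HamPath (m + 1)}

theorem HasRuns.edge_eq (H : HasRuns σ th dir ℓ s) (P : RunPositions m th dir ℓ s) {j : Fin k}
    {r : ℕ} (hr : r < ℓ j) {p q : PathName} (hp : p ≠ th j) (hq : q ≠ th j) :
    (σ p).edge (s j p + r) = (σ q).edge (s j q + r) :=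
  edge_eq_of_agree (H.agree j) (P.opp j) hr hp hq

theorem HasRuns.edgeLabel_eq (H : HasRuns σ th dir ℓ s) (P : RunPositions m th dir ℓ s) {j : Fin k}
    {r : ℕ} (hr : r < ℓ j) {p : PathName} (hp : p ≠ th j) :
    edgeLabel σ ((σ p).edge (s j p + r)) = com (th j) := by
  ext q
  rw [mem_edgeLabel, mem_com]
  constructor
  · rintro hq rfl
    obtain ⟨i, hi, hie⟩ := ((σ _).mem_edges_iff _).1 hq
    have h0 := P.fits j p hp
    obtain ⟨j', h1, h2, r', hr', h3, -⟩ := H.exact _ _ hp _ (by omega) _ hi hie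
    obtain ⟨rfl, -⟩ := P.unique hp h1 hr.le hr'.le h3
    exact h2 rfl
  · intro hq
    have h0 := P.fits j q hq
    rw [H.edge_eq P hr hp hq]
    exact HamPath.edge_mem_edges _ (by omega)

theorem isCommon_iff_edgeLabel {e : Sym2 (Fin (m + 1))} :
    IsCommon σ e ↔ ∃ p q, p ≠ q ∧ p ∈ edgeLabel σ e ∧ q ∈ edgeLabel σ e := by
  simp only [IsCommon, mem_edgeLabel]

theorem isCommon_of_edgeLabel_eq {e : Sym2 (Fin (m + 1))} {x : PathName}
    (h : edgeLabel σ e = com x) : IsCommon σ e :=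
  isCommon_iff_edgeLabel.2 ⟨x.left, x.right, x.left_ne_right, h ▸ mem_com.2 x.left_ne,
    h ▸ mem_com.2 x.right_ne⟩

theorem HasRuns.exists_of_isCommon (H : HasRuns σ th dir ℓ s) (P : RunPositions m th dir ℓ s)
    {e : Sym2 (Fin (m + 1))} (he : IsCommon σ e) :
    ∃ j, ∃ r < ℓ j, ∀ p, p ≠ th j → e = (σ p).edge (s j p + r) := by
  obtain ⟨p, q, hpq, hp, hq⟩ := he
  obtain ⟨i, hi, rfl⟩ := ((σ p).mem_edges_iff e).1 hp
  obtain ⟨i', hi', hie⟩ := ((σ q).mem_edges_iff _).1 hq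
  obtain ⟨j, h1, h2, r, hr, rfl, -⟩ := H.exact p q hpq i hi i' hi' hie
  exact ⟨j, r, hr, fun q hq => H.edge_eq P hr h1 hq⟩

theorem HasRuns.isCommon_edge_iff (H : HasRuns σ th dir ℓ s) (P : RunPositions m th dir ℓ s)
    {p : PathName} {i : ℕ} :
    (i < m ∧ IsCommon σ ((σ p).edge i)) ↔ ∃ j, p ≠ th j ∧ s j p ≤ i ∧ i < s j p + ℓ j := by
  constructor
  · rintro ⟨hi, hc⟩
    obtain ⟨j, r, hr, h⟩ := H.exists_of_isCommon P hc
    have hp : p ≠ th j := by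
      have h1 := H.edgeLabel_eq P hr (th j).left_ne
      rw [← h _ (th j).left_ne] at h1
      have : p ∈ edgeLabel σ ((σ p).edge i) := mem_edgeLabel.2 (HamPath.edge_mem_edges _ hi)
      rw [h1] at this
      exact mem_com.1 this
    have h0 := P.fits j p hp
    have := (σ p).edge_inj hi (by omega) (h p hp)
    exact ⟨j, hp, by omega, by omega⟩
  · rintro ⟨j, hp, h1, h2⟩
    have h0 := P.fits j p hp
    obtain ⟨r, rfl⟩ := Nat.exists_eq_add_of_le h1
    exact ⟨by omega, isCommon_of_edgeLabel_eq (H.edgeLabel_eq P (by omega) hp)⟩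

theorem RunPositions.start_le {ℓ' : Fin k → ℕ} {s' : Fin k → PathName → ℕ}
    (P : RunPositions m th dir ℓ s) (P' : RunPositions m th dir ℓ' s')
    (h : ∀ p i, (∃ j, p ≠ th j ∧ s j p ≤ i ∧ i < s j p + ℓ j) →
      ∃ j, p ≠ th j ∧ s' j p ≤ i ∧ i < s' j p + ℓ' j) {j : Fin k}
    (ih : ∀ j' < j, ∀ p, p ≠ th j' → s j' p = s' j' p ∧ ℓ j' = ℓ' j') {p : PathName}
    (hp : p ≠ th j) : s' j p ≤ s j p := by
  obtain ⟨j', h1, h2, h3⟩ := h p (s j p) ⟨j, hp, le_rfl, by have := P.pos j; omega⟩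
  rcases lt_trichotomy j' j with hj | rfl | hj
  · obtain ⟨h4, h5⟩ := ih j' hj p h1
    have := P.sep j' j hj p h1 hp
    omega
  · exact h2
  · have := P'.sep j j' hj p hp h1
    omega

theorem RunPositions.length_le {ℓ' : Fin k → ℕ} {s' : Fin k → PathName → ℕ}
    (P' : RunPositions m th dir ℓ' s')
    (h : ∀ p i, (∃ j, p ≠ th j ∧ s j p ≤ i ∧ i < s j p + ℓ j) →
      ∃ j, p ≠ th j ∧ s' j p ≤ i ∧ i < s' j p + ℓ' j) {j : Fin k} {p : PathName}
    (hp : p ≠ th j) (hs : s j p = s' j p) : ℓ j ≤ ℓ' j := by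
  by_contra hlt
  obtain ⟨j', h1, h2, h3⟩ := h p (s' j p + ℓ' j) ⟨j, hp, by omega, by omega⟩
  rcases lt_trichotomy j' j with hj | rfl | hj
  · have := P'.sep j' j hj p h1 hp
    omega
  · omega
  · have := P'.sep j j' hj p hp h1
    omega

theorem EdgeOrderedTriple.HasRunLengths.unique {τ : EdgeOrderedTriple (m + 1)} {ℓ' : Fin k → ℕ}
    (h : τ.HasRunLengths th dir ℓ) (h' : τ.HasRunLengths th dir ℓ') : ℓ = ℓ' := by
  obtain ⟨s, P, H⟩ := h
  obtain ⟨s', P', H'⟩ := h'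
  have h1 : ∀ p i, (∃ j, p ≠ th j ∧ s j p ≤ i ∧ i < s j p + ℓ j) ↔
      ∃ j, p ≠ th j ∧ s' j p ≤ i ∧ i < s' j p + ℓ' j := fun p i => by
    rw [← H.isCommon_edge_iff P, ← H'.isCommon_edge_iff P']
  have key : ∀ (n : ℕ) (j : Fin k), (j : ℕ) = n → ∀ p, p ≠ th j → s j p = s' j p ∧ ℓ j = ℓ' j := by
    intro n
    induction n using Nat.strong_induction_on with
    | _ n ih =>
    intro j hj p hp
    have ih' : ∀ j' < j, ∀ p, p ≠ th j' → s j' p = s' j' p ∧ ℓ j' = ℓ' j' :=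
      fun j' hj' => ih j' (hj ▸ hj') j' rfl
    have e := le_antisymm
      (P'.start_le P (fun p i => (h1 p i).2) (fun j' hj' p hp =>
        ⟨(ih' j' hj' p hp).1.symm, (ih' j' hj' p hp).2.symm⟩) hp)
      (P.start_le P' (fun p i => (h1 p i).1) ih' hp)
    exact ⟨e, le_antisymm (P'.length_le (fun p i => (h1 p i).1) hp e)
      (P.length_le (fun p i => (h1 p i).2) hp e.symm)⟩
  funext j
  exact (key j j rfl _ (th j).left_ne).2

theorem HasRuns.ncard_edgeLabel_eq (H : HasRuns σ th dir ℓ s) (P : RunPositions m th dir ℓ s)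
    (x : PathName) :
    {e | edgeLabel σ e = com x}.ncard = ∑ j, if th j = x then ℓ j else 0 := by
  classical
  rw [← Nat.card_coe_set_eq]
  let f : (Σ j : {j : Fin k // th j = x}, Fin (ℓ j)) → {e | edgeLabel σ e = com x} := fun z =>
    ⟨(σ x.left).edge (s z.1 x.left + z.2), by
      have := H.edgeLabel_eq P z.2.2 (p := x.left) (by rw [z.1.2]; exact x.left_ne)
      rw [z.1.2] at this
      exact this⟩
  have hne : ∀ j, th j = x → x.left ≠ th j := fun j hj => hj ▸ x.left_ne
  have hf : Function.Bijective f := by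
    constructor
    · rintro ⟨⟨j, hj⟩, r⟩ ⟨⟨j', hj'⟩, r'⟩ h
      have h1 := congrArg Subtype.val h
      have h2 := P.fits j _ (hne j hj)
      have h3 := P.fits j' _ (hne j' hj')
      have hr := r.2
      have hr' := r'.2
      simp only at hr hr'
      have h4 := (σ x.left).edge_inj (by simp only; omega) (by simp only; omega) h1
      obtain ⟨rfl, h5⟩ := P.unique (hne j hj) (hne j' hj') hr.le hr'.le h4
      obtain rfl := Fin.ext h5
      rfl
    · rintro ⟨e, he⟩
      obtain ⟨j, r, hr, h⟩ := H.exists_of_isCommon P (isCommon_of_edgeLabel_eq he)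
      have h1 := H.edgeLabel_eq P hr (th j).left_ne
      rw [← h _ (th j).left_ne] at h1
      have hj : th j = x := com_injective (h1.symm.trans he)
      exact ⟨⟨⟨j, hj⟩, ⟨r, hr⟩⟩, Subtype.ext (h _ (hne j hj)).symm⟩
  rw [← Nat.card_congr (Equiv.ofBijective f hf), Nat.card_eq_fintype_card, Fintype.card_sigma]
  simp only [Fintype.card_fin]
  rw [← Finset.sum_filter, ← Finset.sum_subtype_eq_sum_filter]
  exact Finset.sum_congr (by ext; simp) fun _ _ => rfl

theorem mem_inter_diff_iff {τ : EdgeOrderedTriple (m + 1)} {x : PathName}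
    {e : Sym2 (Fin (m + 1))} : e ∈ (τ.edges x.left ∩ τ.edges x.right) \ τ.edges x ↔
      edgeLabel τ.path e = com x := by
  have h1 : ∀ p, e ∈ τ.edges p ↔ p ∈ edgeLabel τ.path e := fun p => mem_edgeLabel.symm
  rw [Set.mem_sdiff, Set.mem_inter_iff, h1, h1, h1]
  constructor
  · rintro ⟨⟨h2, h3⟩, h4⟩
    ext p
    rw [mem_com]
    refine ⟨fun hp => by rintro rfl; exact h4 hp, fun hp => ?_⟩
    rcases PathName.eq_left_or_right hp with rfl | rfl <;> assumption
  · intro h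
    rw [h]
    exact ⟨⟨mem_com.2 x.left_ne, mem_com.2 x.right_ne⟩, fun h => mem_com.1 h rfl⟩

theorem EdgeOrderedTriple.HasRunLengths.ncard_inter_diff {τ : EdgeOrderedTriple (m + 1)}
    (h : τ.HasRunLengths th dir ℓ) (x : PathName) :
    ((τ.edges x.left ∩ τ.edges x.right) \ τ.edges x).ncard = ∑ j, if th j = x then ℓ j else 0 := by
  obtain ⟨s, P, H⟩ := h
  rw [← H.ncard_edgeLabel_eq P x]
  congr 1
  ext e
  exact mem_inter_diff_iff

theorem EdgeOrderedTriple.HasRunLengths.ncard_inter_inter {τ : EdgeOrderedTriple (m + 1)}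
    (h : τ.HasRunLengths th dir ℓ) :
    (τ.edges .A ∩ τ.edges .B ∩ τ.edges .C).ncard = 0 := by
  obtain ⟨s, P, H⟩ := h
  rw [Set.ncard_eq_zero]
  ext e
  simp only [Set.mem_empty_iff_false, iff_false]
  rintro ⟨⟨hA, hB⟩, hC⟩
  obtain ⟨j, r, hr, h⟩ := H.exists_of_isCommon P ⟨.A, .B, by decide, hA, hB⟩
  have h1 := H.edgeLabel_eq P hr (th j).left_ne
  rw [← h _ (th j).left_ne] at h1
  have h2 : th j ∈ edgeLabel τ.path e := by
    rw [mem_edgeLabel]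
    cases th j <;> assumption
  rw [h1] at h2
  exact mem_com.1 h2 rfl

end RunLengths

section CommonEdgeGraph

open Finset

variable {m : ℕ}

namespace EdgeOrderedTriple

theorem commonEdgeGraph_adj {τ : EdgeOrderedTriple (m + 1)} {u v : τ.commonEdgeGraph.V} :
    τ.commonEdgeGraph.graph.Adj u v ↔ IsCommon τ.path s(u.1, v.1) := by
  have h : τ.commonEdgeGraph.graph.Adj u v ↔
      u ≠ v ∧ (IsCommon τ.path s(u.1, v.1) ∨ IsCommon τ.path s(v.1, u.1)) := Iff.rfl
  rw [h, Sym2.eq_swap (a := v.1), or_self]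
  refine ⟨fun h => h.2, fun h => ⟨?_, h⟩⟩
  rintro rfl
  obtain ⟨p, -, -, hp, -⟩ := h
  exact (τ.path p).adjIn_irrefl _ hp

theorem commonEdgeGraph_trav {τ : EdgeOrderedTriple (m + 1)} {u v : τ.commonEdgeGraph.V}
    {p : PathName} : τ.commonEdgeGraph.trav p u v ↔
      IsCommon τ.path s(u.1, v.1) ∧ (τ.path p).Traverses u.1 v.1 := Iff.rfl

theorem commonEdgeGraph_edgeLT {τ : EdgeOrderedTriple (m + 1)} {e f : Sym2 τ.commonEdgeGraph.V} :
    τ.commonEdgeGraph.edgeLT e f ↔ τ.EdgeLT (e.map Subtype.val) (f.map Subtype.val) := Iff.rfl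

theorem commonEdgeGraph_label {τ : EdgeOrderedTriple (m + 1)} {u v : τ.commonEdgeGraph.V}
    (h : IsCommon τ.path s(u.1, v.1)) :
    τ.commonEdgeGraph.label s(u, v) = (edgeLabel τ.path s(u.1, v.1) : Set PathName) := by
  ext p
  rw [Finset.mem_coe, mem_edgeLabel]
  constructor
  · rintro ⟨u', v', ⟨-, ht⟩, he⟩
    rcases Sym2.eq_iff.1 he with ⟨rfl, rfl⟩ | ⟨rfl, rfl⟩
    · exact ⟨_, _, ht, rfl⟩
    · exact ⟨_, _, ht, Sym2.eq_swap⟩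
  · rintro ⟨x, y, ht, he⟩
    rcases Sym2.eq_iff.1 he with ⟨rfl, rfl⟩ | ⟨rfl, rfl⟩
    · exact ⟨u, v, ⟨h, ht⟩, rfl⟩
    · exact ⟨v, u, ⟨by rw [Sym2.eq_swap]; exact h, ht⟩, Sym2.eq_swap⟩

theorem exists_walk_along (τ : EdgeOrderedTriple (m + 1)) (p : PathName) (d : ℕ) :
    ∀ (a : ℕ), a + d ≤ m → (∀ r < d, IsCommon τ.path ((τ.path p).edge (a + r))) →
    ∀ u v : τ.commonEdgeGraph.V, u.1 = (τ.path p).vtx a → v.1 = (τ.path p).vtx (a + d) →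
    ∃ q : τ.commonEdgeGraph.graph.Walk u v, q.IsPath ∧ q.length = d ∧
      (∀ x ∈ q.support, ∃ r ≤ d, x.1 = (τ.path p).vtx (a + r)) ∧
      ∀ t ∈ q.darts, ∃ r < d, t.fst.1 = (τ.path p).vtx (a + r) ∧
        t.snd.1 = (τ.path p).vtx (a + r + 1) := by
  induction d with
  | zero =>
    intro a _ _ u v hu hv
    obtain rfl : u = v := Subtype.ext (hu.trans hv.symm)
    exact ⟨.nil, .nil, rfl, by simpa using hu, by simp⟩
  | succ d ih =>
    intro a had h u v hu hv
    have h0 := h 0 (Nat.succ_pos d)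
    rw [add_zero] at h0
    have hcw : IsCommon τ.path s((τ.path p).vtx (a + 1), (τ.path p).vtx a) := by
      rw [Sym2.eq_swap]; exact h0
    let w : τ.commonEdgeGraph.V := ⟨(τ.path p).vtx (a + 1), _, hcw⟩
    have huw : τ.commonEdgeGraph.graph.Adj u w := by
      rw [commonEdgeGraph_adj, hu]; exact h0
    obtain ⟨q, h1, h2, h3, h4⟩ := ih (a + 1) (by omega)
      (fun r hr => by rw [add_right_comm, add_assoc]; exact h (r + 1) (by omega)) w v rfl
      (by rw [hv]; congr 1; ring)
    refine ⟨.cons huw q, ?_, ?_, ?_, ?_⟩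
    · rw [SimpleGraph.Walk.cons_isPath_iff]
      refine ⟨h1, fun hmem => ?_⟩
      obtain ⟨r, hr, hx⟩ := h3 u hmem
      rw [hu] at hx
      have := (τ.path p).vtx_inj (by omega) (by omega) hx
      omega
    · rw [SimpleGraph.Walk.length_cons, h2]
    · intro x hx
      rw [SimpleGraph.Walk.support_cons, List.mem_cons] at hx
      rcases hx with rfl | hx
      · exact ⟨0, Nat.zero_le _, hu⟩
      · obtain ⟨r, hr, hx⟩ := h3 x hx
        exact ⟨r + 1, by omega, by rw [hx]; congr 1; ring⟩
    · intro t ht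
      rw [SimpleGraph.Walk.darts_cons, List.mem_cons] at ht
      rcases ht with rfl | ht
      · exact ⟨0, Nat.succ_pos d, hu, rfl⟩
      · obtain ⟨r, hr, hx, hy⟩ := h4 t ht
        exact ⟨r + 1, by omega, by rw [hx]; congr 1; ring, by rw [hy]; congr 1; ring⟩

end EdgeOrderedTriple

end CommonEdgeGraph

section Model

variable {m k : ℕ} {th : Fin k → PathName} {dir : Fin k → Bool} {ℓ : Fin k → ℕ}
  {s : Fin k → PathName → ℕ}

/-- The path `p` traverses a run missing from `x` starting at its end `b`; `d` tells whether its
two paths traverse the run in opposite directions. -/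
def StartsAt (x : PathName) (d : Bool) (p : PathName) (b : Bool) : Prop :=
  (p = x.left ∧ b = false) ∨ (p = x.right ∧ b = d)

/-- The graph with one component for each run. -/
def modelGraph (th : Fin k → PathName) (dir : Fin k → Bool) : LabelledGraph where
  V := Fin k × Bool
  graph :=
    { Adj := fun a b => a.1 = b.1 ∧ a.2 ≠ b.2
      symm := ⟨fun _ _ h => ⟨h.1.symm, h.2.symm⟩⟩
      loopless := ⟨fun _ h => h.2 rfl⟩ }
  trav p a b := (a.1 = b.1 ∧ a.2 ≠ b.2) ∧ StartsAt (th a.1) (dir a.1) p a.2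
  edgeLT e f := ∃ j j', j < j' ∧ e = s((j, false), (j, true)) ∧ f = s((j', false), (j', true))

variable {τ : EdgeOrderedTriple (m + 1)}

/-- The vertices of the runs. -/
def runVtx (τ : EdgeOrderedTriple (m + 1)) (th : Fin k → PathName) (s : Fin k → PathName → ℕ)
    (j : Fin k) (r : ℕ) : Fin (m + 1) :=
  (τ.path (th j).left).vtx (s j (th j).left + r)

theorem HasRuns.runVtx_eq (H : HasRuns τ.path th dir ℓ s) {j : Fin k} {r : ℕ} (hr : r ≤ ℓ j)
    {p : PathName} (hp : p ≠ th j) : ∃ r' ≤ ℓ j, runVtx τ th s j r = (τ.path p).vtx (s j p + r') := by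
  rcases PathName.eq_left_or_right hp with rfl | rfl
  · exact ⟨r, hr, rfl⟩
  · refine ⟨if dir j then ℓ j - r else r, by split_ifs <;> omega, ?_⟩
    have h := H.agree j (if dir j then ℓ j - r else r) (by split_ifs <;> omega)
    rw [h, runVtx]
    congr 2
    split_ifs <;> omega

theorem HasRuns.runVtx_inj (H : HasRuns τ.path th dir ℓ s) (P : RunPositions m th dir ℓ s)
    {j j' : Fin k} {r r' : ℕ} (hr : r ≤ ℓ j) (hr' : r' ≤ ℓ j')
    (h : runVtx τ th s j r = runVtx τ th s j' r') : j = j' ∧ r = r' := by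
  obtain ⟨p, hp, hp'⟩ := PathName.exists_ne_ne (th j) (th j')
  obtain ⟨a, ha, h1⟩ := H.runVtx_eq hr hp
  obtain ⟨a', ha', h2⟩ := H.runVtx_eq hr' hp'
  have f1 := P.fits j p hp
  have f2 := P.fits j' p hp'
  have h3 := (τ.path p).vtx_inj (by omega) (by omega) (h1.symm.trans (h.trans h2))
  obtain ⟨rfl, -⟩ := P.unique hp hp' ha ha' h3
  have f3 := P.fits j _ (th j).left_ne
  have := (τ.path (th j).left).vtx_inj (by omega) (by omega) h
  exact ⟨rfl, by omega⟩

theorem HasRuns.isCommon_runVtx (H : HasRuns τ.path th dir ℓ s) (P : RunPositions m th dir ℓ s)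
    {j : Fin k} {r : ℕ} (hr : r < ℓ j) :
    IsCommon τ.path s(runVtx τ th s j r, runVtx τ th s j (r + 1)) :=
  isCommon_of_edgeLabel_eq (H.edgeLabel_eq P hr (th j).left_ne)

theorem HasRuns.exists_runVtx (H : HasRuns τ.path th dir ℓ s) (P : RunPositions m th dir ℓ s)
    {u v : Fin (m + 1)} (h : IsCommon τ.path s(u, v)) : ∃ j, ∃ r < ℓ j,
      (u = runVtx τ th s j r ∧ v = runVtx τ th s j (r + 1)) ∨
        (u = runVtx τ th s j (r + 1) ∧ v = runVtx τ th s j r) := by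
  obtain ⟨j, r, hr, he⟩ := H.exists_of_isCommon P h
  exact ⟨j, r, hr, Sym2.eq_iff.1 (he _ (th j).left_ne)⟩

theorem HasRuns.exists_runVtx_of_left (H : HasRuns τ.path th dir ℓ s)
    (P : RunPositions m th dir ℓ s) {j : Fin k} {r : ℕ} (hr : r ≤ ℓ j) {v : Fin (m + 1)}
    (h : IsCommon τ.path s(runVtx τ th s j r, v)) :
    (r < ℓ j ∧ v = runVtx τ th s j (r + 1)) ∨
      ∃ r', r = r' + 1 ∧ v = runVtx τ th s j r' := by
  obtain ⟨j', r', hr', ⟨h1, h2⟩ | ⟨h1, h2⟩⟩ := H.exists_runVtx P h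
  · obtain ⟨rfl, rfl⟩ := H.runVtx_inj P hr hr'.le h1
    exact Or.inl ⟨hr', h2⟩
  · obtain ⟨rfl, rfl⟩ := H.runVtx_inj P hr hr' h1
    exact Or.inr ⟨r', rfl, h2⟩

theorem HasRuns.traverses_runVtx_iff (H : HasRuns τ.path th dir ℓ s)
    (P : RunPositions m th dir ℓ s) {j : Fin k} {r : ℕ} (hr : r < ℓ j) (p : PathName) (b : Bool) :
    (τ.path p).Traverses (runVtx τ th s j (if b then r + 1 else r))
      (runVtx τ th s j (if b then r else r + 1)) ↔ StartsAt (th j) (dir j) p b := by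
  have fl := P.fits j _ (th j).left_ne
  have fr := P.fits j _ (th j).right_ne
  by_cases hp : p = th j
  · refine iff_of_false (fun h => ?_) ?_
    · have h1 : s(runVtx τ th s j r, runVtx τ th s j (r + 1)) ∈ (τ.path p).edges := by
        refine ⟨_, _, h, ?_⟩
        cases b
        · rfl
        · exact Sym2.eq_swap
      have h2 : p ∈ edgeLabel τ.path s(runVtx τ th s j r, runVtx τ th s j (r + 1)) :=
        mem_edgeLabel.2 h1
      have h3 := H.edgeLabel_eq P hr (th j).left_ne
      rw [HamPath.edge] at h3
      rw [runVtx, runVtx, ← add_assoc, h3] at h2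
      exact mem_com.1 h2 hp
    · rintro (⟨h, -⟩ | ⟨h, -⟩)
      · exact (th j).left_ne (h.symm.trans hp)
      · exact (th j).right_ne (h.symm.trans hp)
  · rcases PathName.eq_left_or_right hp with rfl | rfl
    · have e : StartsAt (th j) (dir j) (th j).left b ↔ b = false := by
        simp [StartsAt, (th j).left_ne_right]
      rw [e, HamPath.Traverses, runVtx, runVtx,
        HamPath.symm_vtx _ (by split_ifs <;> omega), HamPath.symm_vtx _ (by split_ifs <;> omega)]
      cases b <;> simp <;> omega
    · have e : StartsAt (th j) (dir j) (th j).right b ↔ b = dir j := by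
        simp [StartsAt, (th j).left_ne_right.symm]
      have hv : ∀ r ≤ ℓ j, runVtx τ th s j r = (τ.path (th j).right).vtx
          (s j (th j).right + if dir j then ℓ j - r else r) := by
        intro r hr
        rw [H.agree j _ (by split_ifs <;> omega), runVtx]
        congr 2
        split_ifs <;> omega
      rw [e, HamPath.Traverses, hv _ (by split_ifs <;> omega), hv _ (by split_ifs <;> omega),
        HamPath.symm_vtx _ (by split_ifs <;> omega), HamPath.symm_vtx _ (by split_ifs <;> omega)]
      have hd := P.opp j
      cases b <;> cases hdj : dir j <;> simp [hdj] at hd ⊢ <;> omega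

end Model

section Reduced

variable {m k : ℕ} {th : Fin k → PathName} {dir : Fin k → Bool} {ℓ : Fin k → ℕ}
  {s : Fin k → PathName → ℕ} {τ : EdgeOrderedTriple (m + 1)}

theorem HasRuns.exists_isCommon_left (H : HasRuns τ.path th dir ℓ s)
    (P : RunPositions m th dir ℓ s) {j : Fin k} {r : ℕ} (hr : r ≤ ℓ j) :
    ∃ u, IsCommon τ.path s(runVtx τ th s j r, u) := by
  rcases hr.lt_or_eq with h | h
  · exact ⟨_, H.isCommon_runVtx P h⟩
  · obtain ⟨r', rfl⟩ : ∃ r', r = r' + 1 := ⟨r - 1, by have := P.pos j; omega⟩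
    exact ⟨_, by rw [Sym2.eq_swap]; exact H.isCommon_runVtx P (by omega)⟩

/-- The vertices of the runs as vertices of the common edge graph. -/
def HasRuns.vertex (H : HasRuns τ.path th dir ℓ s) (P : RunPositions m th dir ℓ s) (j : Fin k)
    (r : ℕ) (hr : r ≤ ℓ j) : τ.commonEdgeGraph.V :=
  ⟨runVtx τ th s j r, H.exists_isCommon_left P hr⟩

theorem HasRuns.exists_eq_vertex (H : HasRuns τ.path th dir ℓ s) (P : RunPositions m th dir ℓ s)
    (v : τ.commonEdgeGraph.V) : ∃ j, ∃ r ≤ ℓ j, v.1 = runVtx τ th s j r := by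
  obtain ⟨u, hu⟩ := v.2
  obtain ⟨j, r, hr, ⟨h, -⟩ | ⟨h, -⟩⟩ := H.exists_runVtx P hu
  · exact ⟨j, r, hr.le, h⟩
  · exact ⟨j, r + 1, hr, h⟩

theorem HasRuns.label_eq (H : HasRuns τ.path th dir ℓ s) (P : RunPositions m th dir ℓ s)
    {j : Fin k} {r : ℕ} (hr : r < ℓ j) {u v : τ.commonEdgeGraph.V}
    (hu : u.1 = runVtx τ th s j r) (hv : v.1 = runVtx τ th s j (r + 1)) :
    τ.commonEdgeGraph.label s(u, v) = (com (th j) : Set PathName) := by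
  rw [EdgeOrderedTriple.commonEdgeGraph_label (by rw [hu, hv]; exact H.isCommon_runVtx P hr),
    hu, hv]
  congr 1
  exact H.edgeLabel_eq P hr (th j).left_ne

theorem HasRuns.isInner_iff (H : HasRuns τ.path th dir ℓ s) (P : RunPositions m th dir ℓ s)
    {j : Fin k} {r : ℕ} (hr : r ≤ ℓ j) {v : τ.commonEdgeGraph.V}
    (hv : v.1 = runVtx τ th s j r) :
    τ.commonEdgeGraph.IsInner v ↔ 0 < r ∧ r < ℓ j := by
  constructor
  · rintro ⟨u, w, huw, hu, hw, -⟩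
    rw [EdgeOrderedTriple.commonEdgeGraph_adj, hv] at hu hw
    by_contra hne
    refine huw (Subtype.ext ?_)
    rcases H.exists_runVtx_of_left P hr hu with ⟨h1, h2⟩ | ⟨r1, h1, h2⟩ <;>
      rcases H.exists_runVtx_of_left P hr hw with ⟨h3, h4⟩ | ⟨r3, h3, h4⟩
    · rw [h2, h4]
    · omega
    · omega
    · obtain rfl : r1 = r3 := by omega
      rw [h2, h4]
  · rintro ⟨h0, h1⟩
    obtain ⟨r, rfl⟩ : ∃ r', r = r' + 1 := ⟨r - 1, by omega⟩
    have c1 := H.isCommon_runVtx P h1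
    have c2 := H.isCommon_runVtx P (show r < ℓ j by omega)
    refine ⟨H.vertex P j (r + 1 + 1) (by omega), H.vertex P j r (by omega), fun h => ?_, ?_, ?_, ?_⟩
    · have := (H.runVtx_inj P (by omega) (by omega) (congrArg Subtype.val h)).2
      omega
    · rw [EdgeOrderedTriple.commonEdgeGraph_adj, hv]; exact c1
    · rw [EdgeOrderedTriple.commonEdgeGraph_adj, hv, Sym2.eq_swap]; exact c2
    · rw [H.label_eq P h1 hv rfl, Sym2.eq_swap (a := v),
        H.label_eq P (show r < ℓ j by omega) (u := H.vertex P j r (by omega)) rfl hv]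

theorem HasRuns.walk_stays (H : HasRuns τ.path th dir ℓ s) (P : RunPositions m th dir ℓ s)
    {j : Fin k} {u v : τ.commonEdgeGraph.V} (q : τ.commonEdgeGraph.graph.Walk u v) :
    ∀ {r : ℕ}, r ≤ ℓ j → u.1 = runVtx τ th s j r → ∃ r' ≤ ℓ j, v.1 = runVtx τ th s j r' := by
  induction q with
  | nil => exact fun hr hu => ⟨_, hr, hu⟩
  | cons h q ih =>
    intro r hr hu
    rw [EdgeOrderedTriple.commonEdgeGraph_adj, hu] at h
    rcases H.exists_runVtx_of_left P hr h with ⟨h1, h2⟩ | ⟨r', rfl, h2⟩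
    · exact ih h1 h2
    · exact ih (by omega) h2

theorem HasRuns.exists_run_walk (H : HasRuns τ.path th dir ℓ s) (P : RunPositions m th dir ℓ s)
    (j : Fin k) : ∃ q : τ.commonEdgeGraph.graph.Walk (H.vertex P j 0 (Nat.zero_le _))
      (H.vertex P j (ℓ j) le_rfl), τ.commonEdgeGraph.IsUnilabelPath q ∧
      ∀ t ∈ q.darts, ∃ r < ℓ j, t.fst.1 = runVtx τ th s j r ∧
        t.snd.1 = runVtx τ th s j (r + 1) := by
  have hl := (th j).left_ne
  obtain ⟨q, h1, h2, -, h4⟩ := τ.exists_walk_along (th j).left (ℓ j) (s j (th j).left)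
    (P.fits j _ hl) (fun r hr => isCommon_of_edgeLabel_eq (H.edgeLabel_eq P hr hl))
    (H.vertex P j 0 (Nat.zero_le _)) (H.vertex P j (ℓ j) le_rfl) rfl rfl
  refine ⟨q, ⟨h1, by rw [h2]; exact P.pos j, ?_⟩, h4⟩
  have hlab : ∀ e ∈ q.edges, τ.commonEdgeGraph.label e = (com (th j) : Set PathName) := by
    intro e he
    obtain ⟨t, ht, rfl⟩ := List.mem_map.1 he
    obtain ⟨r, hr, hx, hy⟩ := h4 t ht
    exact H.label_eq P hr hx hy
  intro e he f hf
  rw [hlab e he, hlab f hf]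

theorem HasRuns.exists_first_dart (H : HasRuns τ.path th dir ℓ s) (P : RunPositions m th dir ℓ s)
    {j : Fin k} {b : Bool} {u v : τ.commonEdgeGraph.V} (q : τ.commonEdgeGraph.graph.Walk u v)
    (hq : 0 < q.length) (hu : u.1 = runVtx τ th s j (if b then ℓ j else 0)) :
    ∃ t ∈ q.darts, ∃ r < ℓ j, (b = false → r = 0) ∧
      t.fst.1 = runVtx τ th s j (if b then r + 1 else r) ∧
      t.snd.1 = runVtx τ th s j (if b then r else r + 1) := by
  have hpos := P.pos j
  cases q with
  | nil => simp at hq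
  | @cons _ w _ h q =>
    refine ⟨⟨(u, w), h⟩, List.mem_cons_self .., ?_⟩
    rw [EdgeOrderedTriple.commonEdgeGraph_adj, hu] at h
    rcases H.exists_runVtx_of_left P (by split_ifs <;> omega) h with ⟨h1, h2⟩ | ⟨r', h1, h2⟩
    · cases b
      · exact ⟨0, by omega, fun _ => rfl, hu, h2⟩
      · simp at h1
    · cases b
      · simp at h1
      · simp only [if_true] at h1
        exact ⟨r', by omega, by simp, by rw [hu]; simp [h1], h2⟩

/-- The ends of the runs as vertices of the reduced graph. -/
def HasRuns.endVertex (H : HasRuns τ.path th dir ℓ s) (P : RunPositions m th dir ℓ s)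
    (a : Fin k × Bool) : {v : τ.commonEdgeGraph.V // ¬ τ.commonEdgeGraph.IsInner v} :=
  ⟨H.vertex P a.1 (if a.2 then ℓ a.1 else 0) (by split_ifs <;> omega), by
    rw [H.isInner_iff P (j := a.1) (r := if a.2 then ℓ a.1 else 0) (by split_ifs <;> omega) rfl]
    split_ifs <;> omega⟩

theorem HasRuns.endVertex_bijective (H : HasRuns τ.path th dir ℓ s)
    (P : RunPositions m th dir ℓ s) : Function.Bijective (H.endVertex P) := by
  constructor
  · rintro ⟨j, b⟩ ⟨j', b'⟩ h
    have h1 : runVtx τ th s j (if b then ℓ j else 0) = runVtx τ th s j' (if b' then ℓ j' else 0) :=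
      congrArg (fun v => v.1.1) h
    obtain ⟨rfl, h2⟩ := H.runVtx_inj P (by split_ifs <;> omega) (by split_ifs <;> omega) h1
    have := P.pos j
    cases b <;> cases b' <;> simp at h2 ⊢ <;> omega
  · rintro ⟨v, hv⟩
    obtain ⟨j, r, hr, h⟩ := H.exists_eq_vertex P v
    rw [H.isInner_iff P hr h] at hv
    have hpos := P.pos j
    rcases Nat.eq_zero_or_pos r with rfl | h0
    · exact ⟨(j, false), Subtype.ext (Subtype.ext h.symm)⟩
    · obtain rfl : r = ℓ j := by omega
      exact ⟨(j, true), Subtype.ext (Subtype.ext h.symm)⟩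

theorem HasRuns.eq_of_walk (H : HasRuns τ.path th dir ℓ s) (P : RunPositions m th dir ℓ s)
    {a b : Fin k × Bool} (q : τ.commonEdgeGraph.graph.Walk (H.endVertex P a).1
      (H.endVertex P b).1) (hq : τ.commonEdgeGraph.IsUnilabelPath q) : a.1 = b.1 ∧ a.2 ≠ b.2 := by
  obtain ⟨r', hr', h⟩ := H.walk_stays P q (j := a.1) (r := if a.2 then ℓ a.1 else 0)
    (by split_ifs <;> omega) rfl
  have h1 := (H.runVtx_inj P (j := b.1) (r := if b.2 then ℓ b.1 else 0)
    (by split_ifs <;> omega) hr' h).1.symm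
  refine ⟨h1, fun h2 => ?_⟩
  obtain rfl : a = b := Prod.ext h1 h2
  exact hq.2.1.ne' (SimpleGraph.Walk.length_eq_zero_iff.2 (SimpleGraph.Walk.isPath_iff_nil.1 hq.1))

theorem HasRuns.reduced_adj_iff (H : HasRuns τ.path th dir ℓ s) (P : RunPositions m th dir ℓ s)
    (a b : Fin k × Bool) :
    τ.reducedCommonEdgeGraph.graph.Adj (H.endVertex P a) (H.endVertex P b) ↔
      (modelGraph th dir).graph.Adj a b := by
  have h : τ.reducedCommonEdgeGraph.graph.Adj (H.endVertex P a) (H.endVertex P b) ↔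
      H.endVertex P a ≠ H.endVertex P b ∧
      ((∃ q : τ.commonEdgeGraph.graph.Walk (H.endVertex P a).1 (H.endVertex P b).1,
        τ.commonEdgeGraph.IsUnilabelPath q) ∨
      (∃ q : τ.commonEdgeGraph.graph.Walk (H.endVertex P b).1 (H.endVertex P a).1,
        τ.commonEdgeGraph.IsUnilabelPath q)) := Iff.rfl
  rw [h]
  constructor
  · rintro ⟨-, ⟨q, hq⟩ | ⟨q, hq⟩⟩
    · exact H.eq_of_walk P q hq
    · have := H.eq_of_walk P q hq
      exact ⟨this.1.symm, this.2.symm⟩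
  · rintro ⟨h1, h2⟩
    refine ⟨fun h => h2 (congrArg Prod.snd ((H.endVertex_bijective P).1 h)), ?_⟩
    obtain ⟨j, c⟩ := a
    obtain ⟨j', c'⟩ := b
    simp only at h1 h2
    subst h1
    obtain ⟨q, hq, -⟩ := H.exists_run_walk P j
    cases c <;> cases c' <;> simp at h2
    · exact Or.inl ⟨q, hq⟩
    · exact Or.inr ⟨q, hq⟩

theorem LabelledGraph.IsUnilabelPath.reverse {G : LabelledGraph} {u v : G.V} {q : G.graph.Walk u v}
    (h : G.IsUnilabelPath q) : G.IsUnilabelPath q.reverse := by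
  refine ⟨h.1.reverse, by rw [SimpleGraph.Walk.length_reverse]; exact h.2.1, fun e he f hf => ?_⟩
  rw [SimpleGraph.Walk.edges_reverse, List.mem_reverse] at he hf
  exact h.2.2 e he f hf

theorem HasRuns.reduced_trav_iff (H : HasRuns τ.path th dir ℓ s) (P : RunPositions m th dir ℓ s)
    (p : PathName) (a b : Fin k × Bool) :
    τ.reducedCommonEdgeGraph.trav p (H.endVertex P a) (H.endVertex P b) ↔
      (modelGraph th dir).trav p a b := by
  constructor
  · rintro ⟨q, hq, hd⟩
    refine ⟨H.eq_of_walk P q hq, ?_⟩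
    obtain ⟨t, ht, r, hr, -, h1, h2⟩ := H.exists_first_dart P (j := a.1) (b := a.2) q hq.2.1 rfl
    have h3 := (EdgeOrderedTriple.commonEdgeGraph_trav.1 (hd t ht)).2
    rw [h1, h2] at h3
    exact (H.traverses_runVtx_iff P hr p a.2).1 h3
  · rintro ⟨⟨h1, h2⟩, h3⟩
    obtain ⟨j, c⟩ := a
    obtain ⟨j', c'⟩ := b
    simp only at h1 h2 h3
    subst h1
    obtain ⟨q, hq, hd⟩ := H.exists_run_walk P j
    cases c <;> cases c' <;> simp at h2
    · refine ⟨q, hq, fun t ht => ?_⟩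
      obtain ⟨r, hr, hx, hy⟩ := hd t ht
      rw [EdgeOrderedTriple.commonEdgeGraph_trav, hx, hy]
      exact ⟨H.isCommon_runVtx P hr, (H.traverses_runVtx_iff P hr p false).2 h3⟩
    · refine ⟨q.reverse, hq.reverse, fun t ht => ?_⟩
      obtain ⟨r, hr, hx, hy⟩ := hd t.symm (SimpleGraph.Walk.mem_darts_reverse.1 ht)
      rw [EdgeOrderedTriple.commonEdgeGraph_trav,
        show t.fst.1 = runVtx τ th s j (r + 1) from hy, show t.snd.1 = runVtx τ th s j r from hx]
      exact ⟨by rw [Sym2.eq_swap]; exact H.isCommon_runVtx P hr,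
        (H.traverses_runVtx_iff P hr p true).2 h3⟩

theorem HasRuns.first_edge_mem (H : HasRuns τ.path th dir ℓ s) (P : RunPositions m th dir ℓ s)
    {j : Fin k} {u v : τ.commonEdgeGraph.V} (q : τ.commonEdgeGraph.graph.Walk u v)
    (hq : 0 < q.length) (h : u.1 = runVtx τ th s j 0 ∨ v.1 = runVtx τ th s j 0) :
    ∃ e ∈ q.edges, e.map Subtype.val = s(runVtx τ th s j 0, runVtx τ th s j 1) := by
  have key : ∀ {u v : τ.commonEdgeGraph.V} (q : τ.commonEdgeGraph.graph.Walk u v),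
      0 < q.length → u.1 = runVtx τ th s j 0 →
      ∃ e ∈ q.edges, e.map Subtype.val = s(runVtx τ th s j 0, runVtx τ th s j 1) := by
    intro u v q hq hu
    obtain ⟨t, ht, r, hr, hr0, h1, h2⟩ := H.exists_first_dart P (j := j) (b := false) q hq hu
    obtain rfl := hr0 rfl
    refine ⟨t.edge, List.mem_map_of_mem ht, ?_⟩
    exact (Sym2.eq_iff.2 (Or.inl ⟨h1, h2⟩) : s(t.fst.1, t.snd.1) = _)
  rcases h with h | h
  · exact key q hq h
  · obtain ⟨e, he, h1⟩ := key q.reverse (by rwa [SimpleGraph.Walk.length_reverse]) h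
    rw [SimpleGraph.Walk.edges_reverse, List.mem_reverse] at he
    exact ⟨e, he, h1⟩

theorem HasRuns.edgeLT_runVtx_iff (H : HasRuns τ.path th dir ℓ s) (P : RunPositions m th dir ℓ s)
    {j j' : Fin k} {r r' : ℕ} (hr : r < ℓ j) (hr' : r' < ℓ j') {p : PathName} (hp : p ≠ th j)
    (hp' : p ≠ th j') : τ.EdgeLT s(runVtx τ th s j r, runVtx τ th s j (r + 1))
      s(runVtx τ th s j' r', runVtx τ th s j' (r' + 1)) ↔ s j p + r < s j' p + r' := by
  have h1 := H.edge_eq P hr (th j).left_ne hp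
  have h2 := H.edge_eq P hr' (th j').left_ne hp'
  have f1 := P.fits j p hp
  have f2 := P.fits j' p hp'
  rw [← τ.edge_lt_iff p (by omega) (by omega), ← h1, ← h2]
  rfl

theorem HasRuns.reduced_edgeLT_iff (H : HasRuns τ.path th dir ℓ s) (P : RunPositions m th dir ℓ s)
    (j j' : Fin k) :
    τ.reducedCommonEdgeGraph.edgeLT s(H.endVertex P (j, false), H.endVertex P (j, true))
      s(H.endVertex P (j', false), H.endVertex P (j', true)) ↔ j < j' := by
  obtain ⟨p, hp, hp'⟩ := PathName.exists_ne_ne (th j) (th j')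
  have l1 := P.pos j
  have l2 := P.pos j'
  constructor
  · rintro ⟨u, v, u', v', q, q', he, hf, hq, hq', hlt⟩
    have key : ∀ {j : Fin k} {u v : {v : τ.commonEdgeGraph.V // ¬ τ.commonEdgeGraph.IsInner v}},
        s(H.endVertex P (j, false), H.endVertex P (j, true)) = s(u, v) →
        u.1.1 = runVtx τ th s j 0 ∨ v.1.1 = runVtx τ th s j 0 := by
      intro j u v h
      rcases Sym2.eq_iff.1 h with ⟨rfl, -⟩ | ⟨rfl, -⟩
      · exact Or.inl rfl
      · exact Or.inr rfl
    obtain ⟨e, he, h1⟩ := H.first_edge_mem P q hq.2.1 (key he)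
    obtain ⟨f, hf, h2⟩ := H.first_edge_mem P q' hq'.2.1 (key hf)
    have h3 := EdgeOrderedTriple.commonEdgeGraph_edgeLT.1 (hlt e he f hf)
    rw [h1, h2, H.edgeLT_runVtx_iff P (r := 0) (r' := 0) (by omega) (by omega) hp hp'] at h3
    rcases lt_trichotomy j j' with h | rfl | h
    · exact h
    · omega
    · have := P.sep j' j h p hp' hp; omega
  · intro hj
    obtain ⟨q, hq, hd⟩ := H.exists_run_walk P j
    obtain ⟨q', hq', hd'⟩ := H.exists_run_walk P j'
    refine ⟨_, _, _, _, q, q', rfl, rfl, hq, hq', fun e he f hf => ?_⟩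
    obtain ⟨t, ht, rfl⟩ := List.mem_map.1 he
    obtain ⟨t', ht', rfl⟩ := List.mem_map.1 hf
    obtain ⟨r, hr, hx, hy⟩ := hd t ht
    obtain ⟨r', hr', hx', hy'⟩ := hd' t' ht'
    have h1 : τ.EdgeLT s(t.fst.1, t.snd.1) s(t'.fst.1, t'.snd.1) := by
      rw [hx, hy, hx', hy', H.edgeLT_runVtx_iff P hr hr' hp hp']
      have := P.sep j j' hj p hp hp'
      omega
    exact h1

theorem modelGraph_mem_edgeSet {e : Sym2 (Fin k × Bool)}
    (h : e ∈ (modelGraph th dir).graph.edgeSet) : ∃ j, e = s((j, false), (j, true)) := by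
  induction e with
  | _ a b =>
  obtain ⟨h1, h2⟩ : a.1 = b.1 ∧ a.2 ≠ b.2 := h
  obtain ⟨j, c⟩ := a
  obtain ⟨j', c'⟩ := b
  simp only at h1 h2
  subst h1
  refine ⟨j, ?_⟩
  cases c <;> cases c' <;> simp at h2
  · rfl
  · exact Sym2.eq_swap

theorem modelGraph_edgeLT_iff {j j' : Fin k} :
    (modelGraph th dir).edgeLT s((j, false), (j, true)) s((j', false), (j', true)) ↔ j < j' := by
  constructor
  · rintro ⟨a, b, hab, h1, h2⟩
    rcases Sym2.eq_iff.1 h1 with ⟨h3, -⟩ | ⟨h3, -⟩ <;> rcases Sym2.eq_iff.1 h2 with ⟨h4, -⟩ | ⟨h4, -⟩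
    · obtain ⟨rfl, -⟩ := Prod.mk.inj h3
      obtain ⟨rfl, -⟩ := Prod.mk.inj h4
      exact hab
    all_goals first
      | exact absurd (Prod.mk.inj h3).2 (by decide)
      | exact absurd (Prod.mk.inj h4).2 (by decide)
  · exact fun h => ⟨j, j', h, rfl, rfl⟩

theorem HasRuns.modelGraph_isomorphic (H : HasRuns τ.path th dir ℓ s)
    (P : RunPositions m th dir ℓ s) :
    (modelGraph th dir).Isomorphic τ.reducedCommonEdgeGraph := by
  refine ⟨⟨Equiv.ofBijective _ (H.endVertex_bijective P), fun {a b} => H.reduced_adj_iff P a b⟩,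
    fun p a b => (H.reduced_trav_iff P p a b).symm, fun e he f hf => ?_⟩
  obtain ⟨j, rfl⟩ := modelGraph_mem_edgeSet he
  obtain ⟨j', rfl⟩ := modelGraph_mem_edgeSet hf
  exact modelGraph_edgeLT_iff.trans (H.reduced_edgeLT_iff P j j').symm

end Reduced

section Good

open Finset

namespace LabelledGraph

variable {G : LabelledGraph}

theorem IsGood.eq_of_adj (h : G.IsGood) {u v w : G.V} (hv : G.graph.Adj u v)
    (hw : G.graph.Adj u w) : v = w := by
  obtain ⟨x, y, -, hs, -⟩ := h (G.graph.connectedComponentMk u)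
  have key : ∀ z, G.graph.Reachable z u → z = x ∨ z = y := fun z hz => by
    have : z ∈ (G.graph.connectedComponentMk u).supp := SimpleGraph.ConnectedComponent.sound hz
    rw [hs] at this
    exact this
  have h1 := hv.ne
  have h2 := hw.ne
  rcases key u (SimpleGraph.Reachable.refl _) with h3 | h3 <;>
    rcases key v hv.symm.reachable with h4 | h4 <;>
    rcases key w hw.symm.reachable with h5 | h5 <;>
    grind

theorem IsGood.ncard_label (h : G.IsGood) {u v : G.V} (hv : G.graph.Adj u v) :
    (G.label s(u, v)).ncard = 2 := by
  obtain ⟨x, y, hxy, hs, hl⟩ := h (G.graph.connectedComponentMk u)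
  have hu : u ∈ (G.graph.connectedComponentMk u).supp := rfl
  rw [hs] at hu
  rcases hu with rfl | rfl
  · rw [h.eq_of_adj hv hxy, hl]
  · rw [h.eq_of_adj hv hxy.symm, Sym2.eq_swap, hl]

end LabelledGraph

variable {m : ℕ}

theorem IsCommon.exists_path {σ : PathName → HamPath (m + 1)} {e f : Sym2 (Fin (m + 1))}
    (he : IsCommon σ e) (hf : IsCommon σ f) : ∃ p, e ∈ (σ p).edges ∧ f ∈ (σ p).edges := by
  obtain ⟨p, q, hpq, hp, hq⟩ := he
  obtain ⟨p', q', hpq', hp', hq'⟩ := hf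
  by_cases h1 : p = p'
  · exact ⟨p, hp, h1 ▸ hp'⟩
  by_cases h2 : p = q'
  · exact ⟨p, hp, h2 ▸ hq'⟩
  rcases PathName.eq_or_eq_of_ne hpq' (x := p) (Ne.symm h1) (Ne.symm h2) hpq.symm with h3 | h3
  · exact ⟨q, hq, by rw [h3]; exact hp'⟩
  · exact ⟨q, hq, by rw [h3]; exact hq'⟩

theorem HamPath.eq_of_three (π : HamPath (m + 1)) {e f g : Sym2 (Fin (m + 1))} {v : Fin (m + 1)}
    (he : e ∈ π.edges) (hf : f ∈ π.edges) (hg : g ∈ π.edges) (hve : v ∈ e) (hvf : v ∈ f)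
    (hvg : v ∈ g) (hef : e ≠ f) : g = e ∨ g = f := by
  obtain ⟨i, hi, rfl⟩ := (π.mem_edges_iff e).1 he
  obtain ⟨j, hj, rfl⟩ := (π.mem_edges_iff f).1 hf
  obtain ⟨l, hl, rfl⟩ := (π.mem_edges_iff g).1 hg
  have key : ∀ {i}, i < m → v ∈ π.edge i → i = (π.symm v : ℕ) ∨ i + 1 = (π.symm v : ℕ) := by
    intro i hi h
    rcases HamPath.mem_edge.1 h with rfl | rfl
    · exact Or.inl (π.symm_vtx hi.le).symm
    · exact Or.inr (π.symm_vtx hi).symm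
  have hij : i ≠ j := fun h => hef (by rw [h])
  have h1 := key hi hve
  have h2 := key hj hvf
  have h3 := key hl hvg
  rcases (show l = i ∨ l = j by omega) with h | h
  · exact Or.inl (by rw [h])
  · exact Or.inr (by rw [h])

variable {τ : EdgeOrderedTriple (m + 1)}

namespace EdgeOrderedTriple

theorem edgeLabel_of_isInner {v : τ.commonEdgeGraph.V} (h : τ.commonEdgeGraph.IsInner v)
    {p : PathName} {c i : ℕ} (hc : c ≤ m) (hv : v.1 = (τ.path p).vtx c) (hi : i < m)
    (hvi : v.1 ∈ (τ.path p).edge i) (hcom : IsCommon τ.path ((τ.path p).edge i)) :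
    1 ≤ c ∧ c < m ∧
      edgeLabel τ.path ((τ.path p).edge (c - 1)) = edgeLabel τ.path ((τ.path p).edge i) ∧
      edgeLabel τ.path ((τ.path p).edge c) = edgeLabel τ.path ((τ.path p).edge i) := by
  obtain ⟨u, w, huw, hu, hw, hl⟩ := h
  rw [commonEdgeGraph_adj] at hu hw
  rw [commonEdgeGraph_label hu, commonEdgeGraph_label hw, Finset.coe_inj] at hl
  have hne : s(v.1, u.1) ≠ s(v.1, w.1) := fun h => huw (Subtype.ext (Sym2.congr_right.1 h))
  have hmu : v.1 ∈ s(v.1, u.1) := Sym2.mem_mk_left _ _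
  have hmw : v.1 ∈ s(v.1, w.1) := Sym2.mem_mk_left _ _
  obtain ⟨q, hq, hqi⟩ := hu.exists_path hcom
  have hq' : s(v.1, w.1) ∈ (τ.path q).edges := mem_edgeLabel.1 (hl ▸ mem_edgeLabel.2 hq)
  have hlu : edgeLabel τ.path s(v.1, u.1) = edgeLabel τ.path ((τ.path p).edge i) := by
    rcases (τ.path q).eq_of_three hq hq' hqi hmu hmw hvi hne with h | h
    · rw [h]
    · rw [h, hl]
  have hlw := hl ▸ hlu
  have hp : p ∈ edgeLabel τ.path ((τ.path p).edge i) :=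
    mem_edgeLabel.2 (HamPath.edge_mem_edges _ hi)
  obtain ⟨a, ha, hea⟩ := ((τ.path p).mem_edges_iff _).1 (mem_edgeLabel.1 (hlu ▸ hp))
  obtain ⟨b, hb, heb⟩ := ((τ.path p).mem_edges_iff _).1 (mem_edgeLabel.1 (hlw ▸ hp))
  rw [hea] at hlu hmu hne
  rw [heb] at hlw hmw hne
  have hab : a ≠ b := fun h => hne (by rw [h])
  have key : ∀ {i}, i < m → v.1 ∈ (τ.path p).edge i → c = i ∨ c = i + 1 := by
    intro i hi h
    rw [hv] at h
    rcases HamPath.mem_edge.1 h with h | h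
    · exact Or.inl ((τ.path p).vtx_inj hc hi.le h)
    · exact Or.inr ((τ.path p).vtx_inj hc hi h)
  rcases key ha hmu with rfl | rfl <;> rcases key hb hmw with h | h
  · exact absurd h hab
  · subst h
    exact ⟨by omega, ha, hlw, hlu⟩
  · subst h
    exact ⟨by omega, hb, hlu, hlw⟩
  · omega

theorem exists_maximal_interval {Q : ℕ → Prop} {i : ℕ} (hi : Q i) (hm : ∀ r, Q r → r < m) :
    ∃ a b, a ≤ i ∧ i < b ∧ b ≤ m ∧ (∀ r, a ≤ r → r < b → Q r) ∧ (1 ≤ a → ¬ Q (a - 1)) ∧ ¬ Q b := by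
  classical
  have h1 : ∃ b, i ≤ b ∧ ¬ Q b := ⟨max i m, le_max_left _ _, fun h => by
    have := hm _ h
    have := le_max_right i m
    omega⟩
  have h2 : ∃ a, a ≤ i ∧ ∀ r, a ≤ r → r ≤ i → Q r :=
    ⟨i, le_rfl, fun r hr hr' => by obtain rfl : r = i := by omega
                                   exact hi⟩
  obtain ⟨hb, hb'⟩ := Nat.find_spec h1
  obtain ⟨ha, ha'⟩ := Nat.find_spec h2
  have hib : i < Nat.find h1 := lt_of_le_of_ne hb fun h => hb' (h ▸ hi)
  have hlt : ∀ r, i ≤ r → r < Nat.find h1 → Q r := fun r hr hr' =>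
    not_not.1 fun h => Nat.find_min h1 hr' ⟨hr, h⟩
  refine ⟨Nat.find h2, Nat.find h1, ha, hib, ?_, fun r hr hr' => ?_, fun h h' => ?_, hb'⟩
  · have := hm _ (hlt (Nat.find h1 - 1) (by omega) (by omega))
    omega
  · rcases le_total r i with h | h
    · exact ha' r hr h
    · exact hlt r h hr'
  · refine Nat.find_min h2 (show Nat.find h2 - 1 < Nat.find h2 by omega)
      ⟨by omega, fun r hr hr' => ?_⟩
    rcases hr.eq_or_lt with rfl | hr
    · exact h'
    · exact ha' r (by omega) hr'

/-- A common edge lies in a maximal segment of equally labelled edges, which is collapsed to an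
edge of the reduced common edge graph. -/
theorem exists_reduced_adj {p : PathName} {i : ℕ} (hi : i < m)
    (hcom : IsCommon τ.path ((τ.path p).edge i)) :
    ∃ a b, a ≤ i ∧ i < b ∧ b ≤ m ∧
      (∀ r, a ≤ r → r < b →
        edgeLabel τ.path ((τ.path p).edge r) = edgeLabel τ.path ((τ.path p).edge i)) ∧
      ∃ u v : τ.reducedCommonEdgeGraph.V, u.1.1 = (τ.path p).vtx a ∧ v.1.1 = (τ.path p).vtx b ∧
        τ.reducedCommonEdgeGraph.graph.Adj u v ∧
        (edgeLabel τ.path ((τ.path p).edge i) : Set PathName) ⊆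
          τ.reducedCommonEdgeGraph.label s(u, v) := by
  set S := edgeLabel τ.path ((τ.path p).edge i) with hS
  obtain ⟨a, b, hai, hib, hbm, hQ, hQa, hQb⟩ := exists_maximal_interval (m := m)
    (Q := fun r => r < m ∧ edgeLabel τ.path ((τ.path p).edge r) = S) ⟨hi, rfl⟩ fun r h => h.1
  have hlab : ∀ r, a ≤ r → r < b → edgeLabel τ.path ((τ.path p).edge r) = S :=
    fun r h h' => (hQ r h h').2
  have hc : ∀ r, a ≤ r → r < b → IsCommon τ.path ((τ.path p).edge r) := fun r h h' => by
    rw [isCommon_iff_edgeLabel, hlab r h h', hS, ← isCommon_iff_edgeLabel]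
    exact hcom
  let u : τ.commonEdgeGraph.V := ⟨(τ.path p).vtx a, (τ.path p).vtx (a + 1), hc a le_rfl (by omega)⟩
  let v : τ.commonEdgeGraph.V := ⟨(τ.path p).vtx b, (τ.path p).vtx (b - 1), by
    have := hc (b - 1) (by omega) (by omega)
    rw [HamPath.edge, Sym2.eq_swap, show b - 1 + 1 = b by omega] at this
    exact this⟩
  have hu : ¬ τ.commonEdgeGraph.IsInner u := fun h => by
    obtain ⟨h1, -, h2, -⟩ := edgeLabel_of_isInner h (p := p) (c := a) (i := a) (by omega) rfl
      (by omega) (HamPath.mem_edge.2 (Or.inl rfl)) (hc a le_rfl (by omega))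
    exact hQa h1 ⟨by omega, h2.trans (hlab a le_rfl (by omega))⟩
  have hv : ¬ τ.commonEdgeGraph.IsInner v := fun h => by
    obtain ⟨-, h1, -, h2⟩ := edgeLabel_of_isInner h (p := p) (c := b) (i := b - 1) (by omega) rfl
      (by omega) (HamPath.mem_edge.2 (Or.inr (by rw [show b - 1 + 1 = b by omega])))
      (hc (b - 1) (by omega) (by omega))
    exact hQb ⟨h1, h2.trans (hlab (b - 1) (by omega) (by omega))⟩
  obtain ⟨q, hq1, hq2, -, hq4⟩ := τ.exists_walk_along p (b - a) a (by omega)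
    (fun r hr => hc (a + r) (by omega) (by omega)) u v rfl
    (by rw [show a + (b - a) = b by omega])
  have hql : ∀ e ∈ q.edges, τ.commonEdgeGraph.label e = (S : Set PathName) := by
    intro e he
    obtain ⟨t, ht, rfl⟩ := List.mem_map.1 he
    obtain ⟨r, hr, hx, hy⟩ := hq4 t ht
    have h1 := hc (a + r) (by omega) (by omega)
    refine (commonEdgeGraph_label (u := t.fst) (v := t.snd) (by rw [hx, hy]; exact h1)).trans ?_
    rw [hx, hy, Finset.coe_inj]
    exact hlab _ (by omega) (by omega)
  have hq : τ.commonEdgeGraph.IsUnilabelPath q :=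
    ⟨hq1, by omega, fun e he f hf => by rw [hql e he, hql f hf]⟩
  have huv : (⟨u, hu⟩ : τ.reducedCommonEdgeGraph.V) ≠ ⟨v, hv⟩ := fun h => by
    have h1 : (τ.path p).vtx a = (τ.path p).vtx b :=
      congrArg (fun z : τ.reducedCommonEdgeGraph.V => z.1.1) h
    have := (τ.path p).vtx_inj (by omega) (by omega) h1
    omega
  refine ⟨a, b, hai, hib, hbm, hlab, ⟨u, hu⟩, ⟨v, hv⟩, rfl, rfl, ⟨huv, Or.inl ⟨q, hq⟩⟩, ?_⟩
  intro p' hp'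
  rcases (τ.path p).traverses_segment (τ.path p') a (b - a) (by omega) fun r hr =>
    mem_edgeLabel.1 (by rw [hlab _ (by omega) (by omega)]; exact hp') with h | h
  · refine ⟨⟨u, hu⟩, ⟨v, hv⟩, ⟨q, hq, fun t ht => ?_⟩, rfl⟩
    obtain ⟨r, hr, hx, hy⟩ := hq4 t ht
    rw [commonEdgeGraph_trav, hx, hy]
    exact ⟨hc _ (by omega) (by omega), h r hr⟩
  · refine ⟨⟨v, hv⟩, ⟨u, hu⟩, ⟨q.reverse, hq.reverse, fun t ht => ?_⟩, Sym2.eq_swap⟩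
    obtain ⟨r, hr, hx, hy⟩ := hq4 t.symm (SimpleGraph.Walk.mem_darts_reverse.1 ht)
    rw [commonEdgeGraph_trav, show t.fst.1 = (τ.path p).vtx (a + r + 1) from hy,
      show t.snd.1 = (τ.path p).vtx (a + r) from hx]
    exact ⟨by rw [Sym2.eq_swap]; exact hc _ (by omega) (by omega), h r hr⟩

theorem isTame_of_isGood (h : τ.reducedCommonEdgeGraph.IsGood) : τ.IsTame := by
  constructor
  · intro e he
    obtain ⟨p, q, hpq, hp, hq⟩ := id he
    obtain ⟨i, hi, rfl⟩ := ((τ.path p).mem_edges_iff e).1 hp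
    obtain ⟨a, b, -, -, -, -, u, v, -, -, hadj, hsub⟩ := exists_reduced_adj hi he
    have h1 := Set.ncard_le_ncard hsub (Set.toFinite _)
    rw [h.ncard_label hadj, Set.ncard_coe_finset] at h1
    have h2 : ∃ x, x ∉ edgeLabel τ.path ((τ.path p).edge i) := by
      by_contra hno
      push Not at hno
      rw [Finset.eq_univ_iff_forall.2 hno] at h1
      exact absurd h1 (by decide)
    obtain ⟨x, hx⟩ := h2
    refine ⟨x, ?_⟩
    have hpx : p ≠ x := fun h => hx (h ▸ mem_edgeLabel.2 hp)
    have hqx : q ≠ x := fun h => hx (h ▸ mem_edgeLabel.2 hq)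
    ext y
    rw [mem_com]
    refine ⟨fun hy hyx => hx (hyx ▸ hy), fun hy => ?_⟩
    rcases PathName.eq_or_eq_of_ne hpq hpx hqx hy with rfl | rfl
    · exact mem_edgeLabel.2 hp
    · exact mem_edgeLabel.2 hq
  · have key : ∀ (p : PathName) (i : ℕ), i + 1 < m → IsCommon τ.path ((τ.path p).edge i) →
        IsCommon τ.path ((τ.path p).edge (i + 1)) →
        edgeLabel τ.path ((τ.path p).edge i) = edgeLabel τ.path ((τ.path p).edge (i + 1)) := by
      intro p i hi h1 h2
      by_contra hne
      obtain ⟨a, b, ha, hb, hbm, hlab, u, v, hu, hv, hadj, -⟩ := exists_reduced_adj (by omega) h1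
      obtain ⟨a', b', ha', hb', hbm', hlab', u', v', hu', hv', hadj', -⟩ :=
        exists_reduced_adj (by omega) h2
      obtain rfl : b = i + 1 := by
        by_contra hb1
        exact hne (hlab (i + 1) (by omega) (by omega)).symm
      obtain rfl : a' = i + 1 := by
        by_contra ha1
        exact hne (hlab' i (by omega) (by omega))
      obtain rfl : v = u' := Subtype.ext (Subtype.ext (hv.trans hu'.symm))
      obtain rfl := h.eq_of_adj hadj.symm hadj'
      have := (τ.path p).vtx_inj (by omega) (by omega) (hu.symm.trans hv')
      omega
    intro e f he hf ⟨v, hve, hvf⟩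
    obtain ⟨p, hp, hp'⟩ := he.exists_path hf
    obtain ⟨i, hi, rfl⟩ := ((τ.path p).mem_edges_iff e).1 hp
    obtain ⟨j, hj, rfl⟩ := ((τ.path p).mem_edges_iff f).1 hp'
    rcases lt_trichotomy i j with hij | rfl | hij
    · obtain rfl := (τ.path p).edge_adjacent hi hj hij hve hvf
      exact key p i hj he hf
    · rfl
    · obtain rfl := (τ.path p).edge_adjacent hj hi hij hvf hve
      exact (key p j hi hf he).symm

end EdgeOrderedTriple

end Good

section Isomorphism

namespace LabelledGraph

variable {G H K : LabelledGraph}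

theorem Isomorphic.symm (h : G.Isomorphic H) : H.Isomorphic G := by
  obtain ⟨φ, ht, hl⟩ := h
  refine ⟨φ.symm, fun p u v => ?_, fun e he f hf => ?_⟩
  · rw [ht, φ.apply_symm_apply, φ.apply_symm_apply]
  · have key : ∀ e : Sym2 H.V, (e.map φ.symm).map φ = e := fun e => by
      rw [Sym2.map_map, show (φ ∘ φ.symm : H.V → H.V) = id from funext φ.apply_symm_apply,
        Sym2.map_id, id]
    have hmem : ∀ e ∈ H.graph.edgeSet, e.map φ.symm ∈ G.graph.edgeSet := by
      intro e he
      induction e with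
      | _ a b => exact φ.symm.map_adj_iff.2 he
    rw [hl _ (hmem e he) _ (hmem f hf), key, key]

theorem Isomorphic.trans (h : G.Isomorphic H) (h' : H.Isomorphic K) : G.Isomorphic K := by
  obtain ⟨φ, ht, hl⟩ := h
  obtain ⟨ψ, ht', hl'⟩ := h'
  refine ⟨φ.trans ψ, fun p u v => (ht p u v).trans (ht' _ _ _), fun e he f hf => ?_⟩
  have hmem : ∀ e ∈ G.graph.edgeSet, e.map φ ∈ H.graph.edgeSet := by
    intro e he
    induction e with
    | _ a b => exact φ.map_adj_iff.2 he
  rw [hl e he f hf, hl' _ (hmem e he) _ (hmem f hf), Sym2.map_map, Sym2.map_map]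
  rfl

variable {φ : G.graph ≃g H.graph}

theorem label_map (ht : ∀ p u v, G.trav p u v ↔ H.trav p (φ u) (φ v)) (e : Sym2 G.V) :
    H.label (e.map φ) = G.label e := by
  ext p
  constructor
  · rintro ⟨u, v, huv, he⟩
    refine ⟨φ.symm u, φ.symm v, ?_, ?_⟩
    · rwa [ht, φ.apply_symm_apply, φ.apply_symm_apply]
    · refine Sym2.map.injective φ.injective ?_
      rw [he, Sym2.map_mk, φ.apply_symm_apply, φ.apply_symm_apply]
  · rintro ⟨u, v, huv, rfl⟩
    exact ⟨φ u, φ v, (ht p u v).1 huv, rfl⟩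

/-- The paths `p` and `q` traverse `e` in opposite directions. -/
def Opposite (G : LabelledGraph) (p q : PathName) (e : Sym2 G.V) : Prop :=
  ∃ u v : G.V, e = s(u, v) ∧ G.trav p u v ∧ G.trav q v u

theorem opposite_map (ht : ∀ p u v, G.trav p u v ↔ H.trav p (φ u) (φ v)) (p q : PathName)
    (e : Sym2 G.V) : H.Opposite p q (e.map φ) ↔ G.Opposite p q e := by
  constructor
  · rintro ⟨u, v, he, h1, h2⟩
    refine ⟨φ.symm u, φ.symm v, ?_, ?_, ?_⟩
    · refine Sym2.map.injective φ.injective ?_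
      rw [he, Sym2.map_mk, φ.apply_symm_apply, φ.apply_symm_apply]
    · rwa [ht, φ.apply_symm_apply, φ.apply_symm_apply]
    · rwa [ht, φ.apply_symm_apply, φ.apply_symm_apply]
  · rintro ⟨u, v, rfl, h1, h2⟩
    exact ⟨φ u, φ v, rfl, (ht p u v).1 h1, (ht q v u).1 h2⟩

theorem map_mem_edgeSet_iff (e : Sym2 G.V) : e.map φ ∈ H.graph.edgeSet ↔ e ∈ G.graph.edgeSet := by
  induction e with
  | _ a b => exact φ.map_adj_iff

theorem ncard_map (φ : G.graph ≃g H.graph) {P : Sym2 G.V → Prop} {Q : Sym2 H.V → Prop}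
    (h : ∀ e, Q (e.map φ) ↔ P e) : {e | P e}.ncard = {e | Q e}.ncard := by
  rw [← Set.ncard_image_of_injective {e | P e} (Sym2.map.injective φ.injective)]
  congr 1
  ext e
  constructor
  · rintro ⟨e, he, rfl⟩
    exact (h e).2 he
  · intro he
    have : (e.map φ.symm).map φ = e := by
      rw [Sym2.map_map, show (φ ∘ φ.symm : H.V → H.V) = id from funext φ.apply_symm_apply,
        Sym2.map_id, id]
    exact ⟨e.map φ.symm, (h _).1 (by rw [this]; exact he), this⟩

theorem Isomorphic.k_eq (h : G.Isomorphic H) (p q : PathName) : G.k p q = H.k p q := by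
  obtain ⟨φ, ht, -⟩ := h
  exact ncard_map φ fun e => by rw [map_mem_edgeSet_iff, label_map ht]

theorem Isomorphic.r_eq (h : G.Isomorphic H) (p q : PathName) : G.r p q = H.r p q := by
  obtain ⟨φ, ht, -⟩ := h
  exact ncard_map φ fun e => and_congr (map_mem_edgeSet_iff e) (opposite_map ht p q e)

theorem Isomorphic.isGood (h : G.Isomorphic H) (hH : H.IsGood) : G.IsGood := by
  obtain ⟨φ, ht, -⟩ := h
  intro K
  induction K using SimpleGraph.ConnectedComponent.ind with
  | _ w =>
  obtain ⟨x, y, hxy, hs, hl⟩ := hH (H.graph.connectedComponentMk (φ w))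
  refine ⟨φ.symm x, φ.symm y, φ.symm.map_adj_iff.2 hxy, ?_, ?_⟩
  · ext z
    have h1 : φ z ∈ (H.graph.connectedComponentMk (φ w)).supp ↔
        z ∈ (G.graph.connectedComponentMk w).supp := by
      rw [SimpleGraph.ConnectedComponent.mem_supp_iff, SimpleGraph.ConnectedComponent.mem_supp_iff,
        SimpleGraph.ConnectedComponent.eq, SimpleGraph.ConnectedComponent.eq,
        SimpleGraph.Iso.reachable_iff]
    rw [← h1, hs]
    exact or_congr φ.toEquiv.eq_symm_apply.symm φ.toEquiv.eq_symm_apply.symm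
  · rw [← label_map ht, Sym2.map_mk, φ.apply_symm_apply, φ.apply_symm_apply, hl]

end LabelledGraph

variable {k : ℕ} {th : Fin k → PathName} {dir : Fin k → Bool}

/-- The edge of the model graph that belongs to a run. -/
def runEdge (th : Fin k → PathName) (dir : Fin k → Bool) (j : Fin k) :
    Sym2 (modelGraph th dir).V :=
  (s((j, false), (j, true)) : Sym2 (Fin k × Bool))

theorem runEdge_injective : Function.Injective (runEdge th dir) := by
  intro j j' h
  rcases Sym2.eq_iff.1 h with ⟨h1, -⟩ | ⟨h1, -⟩
  · exact congrArg Prod.fst h1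
  · exact congrArg Prod.fst h1

theorem runEdge_mem_edgeSet (j : Fin k) : runEdge th dir j ∈ (modelGraph th dir).graph.edgeSet :=
  show (modelGraph th dir).graph.Adj (j, false) (j, true) from ⟨rfl, Bool.false_ne_true⟩

theorem exists_runEdge {e : Sym2 (modelGraph th dir).V}
    (h : e ∈ (modelGraph th dir).graph.edgeSet) : ∃ j, e = runEdge th dir j :=
  modelGraph_mem_edgeSet h

theorem edgeLT_runEdge {j j' : Fin k} :
    (modelGraph th dir).edgeLT (runEdge th dir j) (runEdge th dir j') ↔ j < j' :=
  modelGraph_edgeLT_iff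

theorem runEdge_eq {j : Fin k} {u v : (modelGraph th dir).V} (h : runEdge th dir j = s(u, v)) :
    ∃ b : Bool, u = (j, b) ∧ v = (j, !b) := by
  rcases Sym2.eq_iff.1 h with ⟨h1, h2⟩ | ⟨h1, h2⟩
  · exact ⟨false, h1.symm, h2.symm⟩
  · exact ⟨true, h2.symm, h1.symm⟩

theorem modelGraph_trav_iff {j : Fin k} {b : Bool} {p : PathName} :
    (modelGraph th dir).trav p (j, b) (j, !b) ↔ StartsAt (th j) (dir j) p b :=
  ⟨fun h => h.2, fun h => ⟨⟨rfl, (Bool.not_ne_self b).symm⟩, h⟩⟩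

theorem runEdge_eq_mk (j : Fin k) (b : Bool) :
    runEdge th dir j = (s((j, b), (j, !b)) : Sym2 (Fin k × Bool)) := by
  cases b
  · rfl
  · exact Sym2.eq_swap

theorem mem_label_runEdge {j : Fin k} {p : PathName} :
    p ∈ (modelGraph th dir).label (runEdge th dir j) ↔ p ≠ th j := by
  constructor
  · rintro ⟨u, v, ht, he⟩
    obtain ⟨b, rfl, rfl⟩ := runEdge_eq he
    rcases modelGraph_trav_iff.1 ht with ⟨h, -⟩ | ⟨h, -⟩
    · exact h ▸ (th j).left_ne
    · exact h ▸ (th j).right_ne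
  · intro hp
    rcases PathName.eq_left_or_right hp with h | h
    · exact ⟨_, _, modelGraph_trav_iff.2 (Or.inl ⟨h, rfl⟩), runEdge_eq_mk j false⟩
    · exact ⟨_, _, modelGraph_trav_iff.2 (Or.inr ⟨h, rfl⟩), runEdge_eq_mk j (dir j)⟩

theorem opposite_runEdge {j : Fin k} {x : PathName} :
    (modelGraph th dir).Opposite x.left x.right (runEdge th dir j) ↔
      th j = x ∧ dir j = true := by
  constructor
  · rintro ⟨u, v, he, h1, h2⟩
    have hl : x.left ≠ th j := mem_label_runEdge.1 ⟨u, v, h1, he⟩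
    have hr : x.right ≠ th j := mem_label_runEdge.1 ⟨v, u, h2, he.trans Sym2.eq_swap⟩
    have hx : th j = x := by
      by_contra hne
      rcases PathName.eq_left_or_right hne with h | h
      · exact hl h.symm
      · exact hr h.symm
    refine ⟨hx, ?_⟩
    obtain ⟨b, rfl, rfl⟩ := runEdge_eq he
    have h3 := modelGraph_trav_iff.1 h1
    have h4 : StartsAt (th j) (dir j) x.right (!b) := h2.2
    rw [hx] at h3 h4
    rcases h3 with ⟨-, h3⟩ | ⟨h3, -⟩
    · rcases h4 with ⟨h4, -⟩ | ⟨-, h4⟩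
      · exact absurd h4 x.left_ne_right.symm
      · rw [← h4, h3]; rfl
    · exact absurd h3 x.left_ne_right
  · rintro ⟨rfl, hd⟩
    refine ⟨(j, false), (j, true), rfl, modelGraph_trav_iff.2 (Or.inl ⟨rfl, rfl⟩), ?_⟩
    exact modelGraph_trav_iff.2 (Or.inr ⟨rfl, hd.symm⟩)

theorem modelGraph_k (x : PathName) :
    (modelGraph th dir).k x.left x.right = {j | th j = x}.ncard := by
  rw [← Set.ncard_image_of_injective _ (runEdge_injective (th := th) (dir := dir))]
  refine congrArg Set.ncard (Set.ext fun e => ?_)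
  constructor
  · rintro ⟨he, hl, hr⟩
    obtain ⟨j, rfl⟩ := exists_runEdge he
    refine ⟨j, ?_, rfl⟩
    by_contra hne
    rcases PathName.eq_left_or_right hne with h | h
    · exact mem_label_runEdge.1 hl h.symm
    · exact mem_label_runEdge.1 hr h.symm
  · rintro ⟨j, rfl, rfl⟩
    exact ⟨runEdge_mem_edgeSet j, mem_label_runEdge.2 (th j).left_ne,
      mem_label_runEdge.2 (th j).right_ne⟩

theorem modelGraph_r (x : PathName) :
    (modelGraph th dir).r x.left x.right = {j | th j = x ∧ dir j = true}.ncard := by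
  rw [← Set.ncard_image_of_injective _ (runEdge_injective (th := th) (dir := dir))]
  refine congrArg Set.ncard (Set.ext fun e => ?_)
  constructor
  · rintro ⟨he, ho⟩
    obtain ⟨j, rfl⟩ := exists_runEdge he
    exact ⟨j, opposite_runEdge.1 ho, rfl⟩
  · rintro ⟨j, hj, rfl⟩
    exact ⟨runEdge_mem_edgeSet j, opposite_runEdge.2 hj⟩

theorem eq_of_modelGraph_isomorphic {k' : ℕ} {th' : Fin k' → PathName} {dir' : Fin k' → Bool}
    (h : (modelGraph th dir).Isomorphic (modelGraph th' dir')) :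
    ∃ hk : k' = k, th = th' ∘ Fin.cast hk.symm ∧ dir = dir' ∘ Fin.cast hk.symm := by
  obtain ⟨φ, ht, hl⟩ := h
  obtain rfl : k' = k := by
    have e : Fin k × Bool ≃ Fin k' × Bool := φ.toEquiv
    have := Fintype.card_congr e
    simp only [Fintype.card_prod, Fintype.card_fin, Fintype.card_bool] at this
    omega
  refine ⟨rfl, ?_⟩
  choose f hf using fun j => exists_runEdge
    ((LabelledGraph.map_mem_edgeSet_iff (φ := φ) (runEdge th dir j)).2 (runEdge_mem_edgeSet j))
  have hmono : StrictMono f := fun j j' hj => by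
    rw [← edgeLT_runEdge (th := th') (dir := dir'), ← hf, ← hf,
      ← hl _ (runEdge_mem_edgeSet j) _ (runEdge_mem_edgeSet j')]
    exact edgeLT_runEdge.2 hj
  have hid : ∀ j, f j = j := fun j => le_antisymm hmono.apply_le hmono.le_apply
  have hth : ∀ j, th j = th' j := fun j => by
    by_contra hne
    have h1 : th' j ∈ (modelGraph th dir).label (runEdge th dir j) :=
      mem_label_runEdge.2 (Ne.symm hne)
    rw [← LabelledGraph.label_map ht, hf, hid] at h1
    exact mem_label_runEdge.1 h1 rfl
  refine ⟨funext hth, funext fun j => ?_⟩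
  have h1 := LabelledGraph.opposite_map ht (th j).left (th j).right (runEdge th dir j)
  rw [hf, hid, opposite_runEdge, opposite_runEdge] at h1
  have h2 : dir' j = true ↔ dir j = true :=
    ⟨fun h => (h1.1 ⟨(hth j).symm, h⟩).2, fun h => (h1.2 ⟨rfl, h⟩).2⟩
  exact Bool.eq_iff_iff.2 h2.symm

theorem isomorphic_iff_exists_hasRunLengths {m : ℕ} {G : LabelledGraph} (hG : G.IsGood)
    (hth : (modelGraph th dir).Isomorphic G) (τ : EdgeOrderedTriple (m + 1)) :
    τ.reducedCommonEdgeGraph.Isomorphic G ↔ ∃ ℓ, τ.HasRunLengths th dir ℓ := by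
  constructor
  · intro h
    obtain ⟨k', th', dir', ℓ, s, P, H⟩ :=
      (EdgeOrderedTriple.isTame_of_isGood (h.isGood hG)).exists_hasRunLengths
    obtain ⟨rfl, rfl, rfl⟩ :=
      eq_of_modelGraph_isomorphic (hth.trans (((H.modelGraph_isomorphic P).trans h).symm))
    exact ⟨ℓ, s, P, H⟩
  · rintro ⟨ℓ, s, P, H⟩
    exact (H.modelGraph_isomorphic P).symm.trans hth

theorem LabelledGraph.IsReducedCommonEdgeGraph.exists_modelGraph {G : LabelledGraph}
    (h : G.IsReducedCommonEdgeGraph) (hG : G.IsGood) :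
    ∃ (k : ℕ) (th : Fin k → PathName) (dir : Fin k → Bool), (modelGraph th dir).Isomorphic G := by
  obtain ⟨N, τ, hτ⟩ := h
  cases N with
  | zero =>
    refine ⟨0, Fin.elim0, Fin.elim0, ?_⟩
    have h1 : IsEmpty τ.reducedCommonEdgeGraph.V := ⟨fun v => v.1.1.elim0⟩
    have h2 : IsEmpty (modelGraph (k := 0) Fin.elim0 Fin.elim0).V := ⟨fun v => v.1.elim0⟩
    refine LabelledGraph.Isomorphic.trans ⟨⟨Equiv.equivOfIsEmpty _ _, fun {a} => h2.elim a⟩,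
      fun p u => h2.elim u, fun e => ?_⟩ hτ
    induction e with
    | _ a b => exact h2.elim a
  | succ m =>
    obtain ⟨k, th, dir, ℓ, s, P, H⟩ :=
      (EdgeOrderedTriple.isTame_of_isGood (hτ.isGood hG)).exists_hasRunLengths
    exact ⟨k, th, dir, (H.modelGraph_isomorphic P).trans hτ⟩

end Isomorphism

section Compositions

open Finset

theorem card_fun_sum_eq (κ : Type) [Fintype κ] (n : ℕ) :
    Nat.card {h : κ → ℕ // ∑ j, h j = n} = (Fintype.card κ).multichoose n := by
  classical
  rw [← Sym.card_sym_eq_multichoose, ← Nat.card_eq_fintype_card]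
  exact Nat.card_congr (Sym.equivNatSumOfFintype κ n).symm

theorem ballsInBins_of_lt {a l : ℕ} {d : ℕ} (h : a < l + d) :
    ballsInBins ((a : ℤ) - d) l = 0 := by
  unfold ballsInBins
  split_ifs with h1 h2
  · omega
  · exact Nat.choose_eq_zero_of_lt (by omega)
  · rfl

theorem ballsInBins_add (n l : ℕ) : ballsInBins ((l + n : ℕ) : ℤ) l = l.multichoose n := by
  unfold ballsInBins
  rcases l with _ | l
  · rcases n with _ | n
    · simp
    · rw [Nat.multichoose_zero_succ, if_neg (by omega), if_neg (by omega)]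
  · rw [if_neg (by omega), if_pos (by omega), Nat.multichoose_eq,
      show (((l + 1 + n : ℕ) : ℤ) - 1).toNat = l + n by omega,
      show (((l + 1 : ℕ) : ℤ) - 1).toNat = l by omega, show l + 1 + n - 1 = l + n by omega]
    exact Nat.choose_symm_add

/-- The positive functions with a given sum, equal to one on a given set. -/
theorem card_compositions {ι : Type} [Fintype ι] (D : ι → Prop) (c : ℕ) :
    Nat.card {g : ι → ℕ // (∀ j, 1 ≤ g j) ∧ (∀ j, D j → g j = 1) ∧ ∑ j, g j = c} =
      ballsInBins ((c : ℤ) - {j | D j}.ncard) (((Fintype.card ι : ℕ) : ℤ) - {j | D j}.ncard) := by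
  classical
  set d := {j | D j}.ncard with hd
  have hdc : Fintype.card {j // D j} = d := by
    rw [← Nat.card_eq_fintype_card]; exact Nat.card_coe_set_eq _
  set l := Fintype.card {j // ¬ D j} with hl
  have hdl : Fintype.card ι = d + l := by
    have := Fintype.card_subtype_compl D
    have := Fintype.card_subtype_le D
    omega
  have hsum : ∀ h : {j // ¬ D j} → ℕ,
      ∑ j, (if hj : D j then 1 else h ⟨j, hj⟩ + 1) = ∑ j, h j + (l + d) := by
    intro h
    rw [← Fintype.sum_subtype_add_sum_subtype D,
      Finset.sum_congr rfl fun (j : {j // D j}) _ => dif_pos j.2,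
      Finset.sum_congr rfl fun (j : {j // ¬ D j}) _ => dif_neg j.2, Finset.sum_add_distrib]
    simp only [Finset.sum_const, Finset.card_univ, hdc, ← hl, smul_eq_mul, mul_one]
    ring
  have e : {g : ι → ℕ // (∀ j, 1 ≤ g j) ∧ (∀ j, D j → g j = 1) ∧ ∑ j, g j = c} ≃
      {h : {j // ¬ D j} → ℕ // ∑ j, h j + (l + d) = c} :=
    { toFun := fun g => ⟨fun j => g.1 j.1 - 1, by
        rw [← hsum]
        refine Eq.trans ?_ g.2.2.2
        refine Finset.sum_congr rfl fun j _ => ?_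
        have := g.2.1 j
        split_ifs with hj
        · exact (g.2.2.1 j hj).symm
        · exact Nat.sub_add_cancel this⟩
      invFun := fun h => ⟨fun j => if hj : D j then 1 else h.1 ⟨j, hj⟩ + 1,
        fun j => by beta_reduce; split_ifs <;> omega, fun j hj => dif_pos hj,
        (hsum h.1).trans h.2⟩
      left_inv := fun g => by
        refine Subtype.ext (funext fun j => ?_)
        have := g.2.1 j
        by_cases hj : D j
        · exact (dif_pos hj).trans (g.2.2.1 j hj).symm
        · refine (dif_neg hj).trans ?_
          show g.1 j - 1 + 1 = _
          omega
      right_inv := fun h => by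
        refine Subtype.ext (funext fun j => ?_)
        show (if hj : D j.1 then 1 else h.1 ⟨j.1, hj⟩ + 1) - 1 = _
        rw [dif_neg j.2, Nat.add_sub_cancel] }
  rw [Nat.card_congr e, hdl, show (((d + l : ℕ) : ℤ) - d) = l by push_cast; ring]
  rcases lt_or_ge c (l + d) with h | h
  · rw [ballsInBins_of_lt h, Nat.card_eq_zero]
    exact Or.inl ⟨fun g => by have := g.2; omega⟩
  · obtain ⟨n, rfl⟩ := Nat.exists_eq_add_of_le h
    rw [show (((l + d + n : ℕ) : ℤ) - d) = ((l + n : ℕ) : ℤ) by push_cast; ring, ballsInBins_add,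
      hl, ← card_fun_sum_eq]
    exact Nat.card_congr (Equiv.subtypeEquivRight fun h => by omega)

variable {k : ℕ}

/-- The possible lengths of the runs. -/
def RunLengths (th : Fin k → PathName) (dir : Fin k → Bool) (c : PathName → ℕ) : Type :=
  {ℓ : Fin k → ℕ // (∀ j, 1 ≤ ℓ j) ∧ (∀ j, dir j = true → ℓ j = 1) ∧
    ∀ x, (∑ j, if th j = x then ℓ j else 0) = c x}

instance (th : Fin k → PathName) (dir : Fin k → Bool) (c : PathName → ℕ) :
    Finite (RunLengths th dir c) := by
  refine Set.Finite.to_subtype ((Set.finite_Iic fun j => c (th j)).subset ?_)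
  rintro ℓ ⟨-, -, h⟩ j
  refine le_trans ?_ (h (th j)).le
  refine le_trans (by simp) (Finset.single_le_sum (fun _ _ => Nat.zero_le _) (Finset.mem_univ j))

theorem sum_ite_fiber (th : Fin k → PathName) (x : PathName) (f : Fin k → ℕ) :
    (∑ j, if th j = x then f j else 0) = ∑ j : {j // th j = x}, f j.1 := by
  rw [← Finset.sum_filter]
  exact Finset.sum_subtype _ (by simp) f

theorem card_runLengths (th : Fin k → PathName) (dir : Fin k → Bool) (c : PathName → ℕ) :
    Nat.card (RunLengths th dir c) = ∏ x, ballsInBins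
      ((c x : ℤ) - {j | th j = x ∧ dir j = true}.ncard)
      (({j | th j = x}.ncard : ℤ) - {j | th j = x ∧ dir j = true}.ncard) := by
  have e : RunLengths th dir c ≃ ∀ x, {g : {j // th j = x} → ℕ // (∀ j, 1 ≤ g j) ∧
      (∀ j, dir j.1 = true → g j = 1) ∧ ∑ j, g j = c x} :=
    { toFun := fun ℓ x => ⟨fun j => ℓ.1 j.1, fun j => ℓ.2.1 j.1, fun j => ℓ.2.2.1 j.1, by
        rw [← ℓ.2.2.2 x, sum_ite_fiber]⟩
      invFun := fun g => ⟨fun j => (g (th j)).1 ⟨j, rfl⟩, fun j => (g (th j)).2.1 _,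
        fun j hj => (g (th j)).2.2.1 _ hj, fun x => by
          rw [sum_ite_fiber, ← (g x).2.2.2]
          refine Finset.sum_congr rfl ?_
          rintro ⟨j, rfl⟩ _
          rfl⟩
      left_inv := fun ℓ => rfl
      right_inv := fun g => by
        funext x
        refine Subtype.ext (funext ?_)
        rintro ⟨j, rfl⟩
        rfl }
  rw [Nat.card_congr e, Nat.card_pi]
  refine Finset.prod_congr rfl fun x _ => ?_
  rw [card_compositions (fun j : {j // th j = x} => dir j.1 = true)]
  have h1 : {j : {j // th j = x} | dir j.1 = true}.ncard =
      {j | th j = x ∧ dir j = true}.ncard := by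
    rw [← Set.ncard_image_of_injective _ Subtype.val_injective]
    congr 1
    ext j
    simp [and_comm]
  have h2 : Fintype.card {j // th j = x} = {j | th j = x}.ncard := by
    rw [← Nat.card_eq_fintype_card]; exact Nat.card_coe_set_eq _
  rw [h1, h2]

end Compositions

section Limit

open Finset

theorem PathName.sum_univ {M : Type*} [AddCommMonoid M] (f : PathName → M) :
    ∑ x, f x = f .C + f .B + f .A := by
  rw [show (univ : Finset PathName) = {.C, .B, .A} by decide, Finset.sum_insert (by decide),
    Finset.sum_insert (by decide), Finset.sum_singleton, add_assoc]

theorem PathName.prod_univ {M : Type*} [CommMonoid M] (f : PathName → M) :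
    ∏ x, f x = f .C * f .B * f .A := by
  rw [show (univ : Finset PathName) = {.C, .B, .A} by decide, Finset.prod_insert (by decide),
    Finset.prod_insert (by decide), Finset.prod_singleton, mul_assoc]

instance (n : ℕ) : Finite (EdgeOrderedTriple n) := by
  classical
  choose l hl using fun τ : EdgeOrderedTriple n => τ.exists_isSorted
  have hnd : ∀ τ, (l τ).Nodup := fun τ => (hl τ).1.imp fun {a b} h hab => by
    subst hab
    exact τ.not_edgeLT_self _ h
  refine Finite.of_injective
    (β := (PathName → HamPath n) × {l : List (Sym2 (Fin n)) // l.Nodup})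
    (fun τ => (τ.path, ⟨l τ, hnd τ⟩)) fun τ τ' h => ?_
  obtain ⟨h1, h2⟩ := Prod.mk.inj h
  exact (hl τ).ext (by rw [Subtype.mk.inj h2]; exact hl τ') h1

/-- The numbers of edges common to two paths, indexed by the third path. -/
def pairCounts (cAB cAC cBC : ℕ) : PathName → ℕ
  | .A => cBC
  | .B => cAC
  | .C => cAB

variable {k : ℕ} {th : Fin k → PathName} {dir : Fin k → Bool}

theorem sum_runLengths {c : PathName → ℕ} (ℓ : RunLengths th dir c) :
    ∑ j, ℓ.1 j = ∑ x, c x := by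
  rw [← Finset.sum_congr rfl fun x _ => ℓ.2.2.2 x, Finset.sum_comm]
  refine Finset.sum_congr rfl fun j _ => ?_
  rw [Finset.sum_ite_eq]; simp

theorem sum_ncard_fiber (th : Fin k → PathName) : ∑ x, {j | th j = x}.ncard = k := by
  have h : ∀ x, {j | th j = x}.ncard = ∑ j, if th j = x then 1 else 0 := fun x => by
    rw [Set.ncard_eq_toFinset_card', Finset.sum_boole]; simp
  rw [Finset.sum_congr rfl fun x _ => h x, Finset.sum_comm]
  simp

theorem tripleCount_eq_sum {m : ℕ} {G : LabelledGraph} (hG : G.IsGood)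
    (hth : (modelGraph th dir).Isomorphic G) (cAB cAC cBC : ℕ)
    [Fintype (RunLengths th dir (pairCounts cAB cAC cBC))] :
    tripleCount (m + 1) G cAB cAC cBC 0 = ∑ ℓ : RunLengths th dir (pairCounts cAB cAC cBC),
      Nat.card {τ : EdgeOrderedTriple (m + 1) // τ.HasRunLengths th dir ℓ.1} := by
  have hmem : ∀ z : Σ ℓ : RunLengths th dir (pairCounts cAB cAC cBC),
      {τ : EdgeOrderedTriple (m + 1) // τ.HasRunLengths th dir ℓ.1},
      z.2.1.reducedCommonEdgeGraph.Isomorphic G ∧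
      ((z.2.1.edges .A ∩ z.2.1.edges .B) \ z.2.1.edges .C).ncard = cAB ∧
      ((z.2.1.edges .A ∩ z.2.1.edges .C) \ z.2.1.edges .B).ncard = cAC ∧
      ((z.2.1.edges .B ∩ z.2.1.edges .C) \ z.2.1.edges .A).ncard = cBC ∧
      (z.2.1.edges .A ∩ z.2.1.edges .B ∩ z.2.1.edges .C).ncard = 0 := by
    rintro ⟨ℓ, τ, h⟩
    exact ⟨(isomorphic_iff_exists_hasRunLengths hG hth τ).2 ⟨_, h⟩,
      (h.ncard_inter_diff .C).trans (ℓ.2.2.2 .C), (h.ncard_inter_diff .B).trans (ℓ.2.2.2 .B),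
      (h.ncard_inter_diff .A).trans (ℓ.2.2.2 .A), h.ncard_inter_inter⟩
  rw [← Nat.card_sigma, tripleCount]
  refine (Nat.card_congr (Equiv.ofBijective (fun z => ⟨z.2.1, hmem z⟩) ⟨?_, ?_⟩)).symm
  · rintro ⟨ℓ, τ, h⟩ ⟨ℓ', τ', h'⟩ he
    obtain rfl : τ = τ' := congrArg Subtype.val he
    obtain rfl : ℓ = ℓ' := Subtype.ext (h.unique h')
    rfl
  · rintro ⟨τ, h, h1, h2, h3, h4⟩
    obtain ⟨ℓ, hℓ⟩ := (isomorphic_iff_exists_hasRunLengths hG hth τ).1 h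
    have hc : ∀ x, (∑ j, if th j = x then ℓ j else 0) = pairCounts cAB cAC cBC x := fun x => by
      rw [← hℓ.ncard_inter_diff x]
      cases x
      · exact h3
      · exact h2
      · exact h1
    obtain ⟨s, P, H⟩ := id hℓ
    exact ⟨⟨⟨ℓ, P.pos, P.opp, hc⟩, τ, hℓ⟩, rfl⟩

theorem tendsto_tripleWeight {G : LabelledGraph} (hG : G.IsGood)
    (hth : (modelGraph th dir).Isomorphic G) (cAB cAC cBC : ℕ) :
    Tendsto (fun n : ℕ => (n : ℝ) ^ (-3 : ℤ) * tripleWeight n G cAB cAC cBC 0) atTop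
      (𝓝 (Nat.card (RunLengths th dir (pairCounts cAB cAC cBC)) *
        (Real.exp (-6) / k.factorial * 2 ^ (-((cAB + cAC + cBC : ℕ) : ℤ) + k)))) := by
  have := Fintype.ofFinite (RunLengths th dir (pairCounts cAB cAC cBC))
  have hs : ∀ ℓ : RunLengths th dir (pairCounts cAB cAC cBC), ∑ j, ℓ.1 j = cAB + cAC + cBC :=
    fun ℓ => (sum_runLengths ℓ).trans (PathName.sum_univ _)
  rw [← tendsto_add_atTop_iff_nat 1]
  have h := tendsto_finsetSum (univ : Finset (RunLengths th dir (pairCounts cAB cAC cBC)))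
    fun ℓ _ => tendsto_card_hasRunLengths th dir ℓ.1 ℓ.2.1 ℓ.2.2.1
  simp only [hs, Finset.sum_const, nsmul_eq_mul, Finset.card_univ,
    ← Nat.card_eq_fintype_card] at h
  refine h.congr fun m => ?_
  rw [tripleWeight, tripleCount_eq_sum hG hth, Nat.cast_sum, Finset.sum_div, Finset.mul_sum]
  refine Finset.sum_congr rfl fun ℓ _ => ?_
  rw [show 3 * (m + 1) - 3 - cAB - cAC - cBC - 2 * 0 = 3 * (m + 1) - 3 - (cAB + cAC + cBC) by omega]

end Limit

theorem mainTheorem7 (G : LabelledGraph) (hG : G.IsReducedCommonEdgeGraph) (hgood : G.IsGood)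
    (cAB cAC cBC : ℕ) :
    Tendsto (fun n : ℕ => (n : ℝ) ^ (-3 : ℤ) * tripleWeight n G cAB cAC cBC 0) atTop
      (𝓝 (Real.exp (-6) / (Nat.factorial (G.k .A .B + G.k .A .C + G.k .B .C) : ℝ) *
        (((ballsInBins ((cAB : ℤ) - G.r .A .B) ((G.k .A .B : ℤ) - G.r .A .B) : ℝ) *
            (2 : ℝ) ^ (-(cAB : ℤ) + (G.k .A .B : ℤ))) *
         ((ballsInBins ((cAC : ℤ) - G.r .A .C) ((G.k .A .C : ℤ) - G.r .A .C) : ℝ) *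
            (2 : ℝ) ^ (-(cAC : ℤ) + (G.k .A .C : ℤ))) *
         ((ballsInBins ((cBC : ℤ) - G.r .B .C) ((G.k .B .C : ℤ) - G.r .B .C) : ℝ) *
            (2 : ℝ) ^ (-(cBC : ℤ) + (G.k .B .C : ℤ)))))) := by
  obtain ⟨k, th, dir, hth⟩ := hG.exists_modelGraph hgood
  have hk : ∀ x : PathName, G.k x.left x.right = {j | th j = x}.ncard := fun x => by
    rw [← hth.k_eq, modelGraph_k]
  have hr : ∀ x : PathName, G.r x.left x.right = {j | th j = x ∧ dir j = true}.ncard := fun x => by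
    rw [← hth.r_eq, modelGraph_r]
  have hsum : G.k .A .B + G.k .A .C + G.k .B .C = k := by
    rw [← sum_ncard_fiber th, PathName.sum_univ, ← hk, ← hk, ← hk]
    rfl
  have hcard := card_runLengths th dir (pairCounts cAB cAC cBC)
  simp only [← hk, ← hr, PathName.prod_univ, PathName.left, PathName.right, pairCounts] at hcard
  have h2 : (2 : ℝ) ^ (-((cAB + cAC + cBC : ℕ) : ℤ) + k) =
      2 ^ (-(cAB : ℤ) + (G.k .A .B : ℤ)) * 2 ^ (-(cAC : ℤ) + (G.k .A .C : ℤ)) *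
        2 ^ (-(cBC : ℤ) + (G.k .B .C : ℤ)) := by
    rw [← zpow_add₀ two_ne_zero, ← zpow_add₀ two_ne_zero, ← hsum]
    congr 1
    push_cast
    ring
  have h := tendsto_tripleWeight hgood hth cAB cAC cBC
  rw [hcard, h2, ← hsum] at h
  push_cast at h
  convert h using 2
  ring
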